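/- **Theorem (Hydrodynamic limit).** Fix $\gamma\in(1,2)$, $0<\alpha\le\beta<1$, $\kappa>0$, $\theta\le 0$ and $T>0$. Let $p(z)=c_\gamma\mathbf 1_{\{z\ne0\}}|z|^{-(1+\gamma)}$, $z\in\mathbb Z$, where $c_\gamma$ is the constant such that $\sum_z p(z)=1$. For $N\ge2$ let $\Lambda_N=\{1,\dots,N-1\}$, $\Omega_N=\{0,1\}^{\Lambda_N}$ and, for $f:\Omega_N\to\mathbb R$, $$L_Nf(\eta)=\tfrac12\sum_{x,y\in\Lambda_N}p(x-y)[f(\sigma^{x,y}\eta)-f(\eta)]+\kappa N^{-\theta}\sum_{x\in\Lambda_N}\Big(\sum_{y\le0}p(x-y)c_x(\eta;\alpha)+\sum_{y\ge N}p(x-y)c_x(\eta;\beta)\Big)[f(\sigma^x\eta)-f(\eta)],$$ where $\sigma^{x,y}\eta$ is $\eta$ with the values at $x,y$ exchanged, $\sigma^x\eta$ is $\eta$ with the value at $x$ replaced by $1-\eta_x$, and $c_x(\eta;r)=\eta_x(1-r)+(1-\eta_x)r$. Let $\Theta(N)=N^{\gamma+\theta}$, and for a probability measure $\mu_N$ on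 $\Omega_N$ let $\mathbb P_{\mu_N}$ be the law on the Skorohod space $\mathcal D([0,T],\Omega_N)$ of the Markov process $(\eta^N_t)_{t\in[0,T]}$ with generator $\Theta(N)L_N$ and initial law $\mu_N$. For $u\in(0,1)$ put $V_1(u)=c_\gamma\gamma^{-1}(u^{-\gamma}+(1-u)^{-\gamma})$, $V_0(u)=c_\gamma\gamma^{-1}(\alpha u^{-\gamma}+\beta(1-u)^{-\gamma})$ and, for $G\in C_c^\infty((0,1))$, $$\mathbb LG(u)=c_\gamma\lim_{\varepsilon\downarrow0}\int_0^1\mathbf 1_{\{|u-v|\ge\varepsilon\}}\frac{G(v)-G(u)}{|u-v|^{1+\gamma}}\,dv .$$ Let $C_c^{1,\infty}([0,T]\times(0,1))$ be the set of functions $G$ on $[0,T]\times(0,1)$ such that $G$, $\partial_tG$ and $\partial_u^nG$ ($n\ge1$) exist and are continuous and $G$ vanishes outside $[0,T]\times K$ for some compact $K\subset(0,1)$. Let $\langle\cdot,\cdot\rangle$ be the inner product of $L^2([0,1])$. Let $g:[0,1]\to[0,1]$ be measurable, and for a measurable $\rho:[0,T]\times[0,1]\to[0,1]$ consider the conditions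 1. $\displaystyle\int_0^T\int_0^1\Big\{\frac{(\alpha-\rho_t(u))^2}{u^\gamma}+\frac{(\beta-\rho_t(u))^2}{(1-u)^\gamma}\Big\}du\,dt<\infty$; 2. $\displaystyle\int_0^T\Big(\|\rho_t\|_{L^2([0,1])}^2+\frac{c_\gamma}{2}\iint_{[0,1]^2}\frac{(\rho_t(u)-\rho_t(v))^2}{|u-v|^{1+\gamma}}\,du\,dv\Big)dt<\infty$. *Reaction equation.* $\rho$ is a weak solution of $\partial_t\rho=-\kappa V_1\rho+\kappa V_0$ with $\rho_t(0)=\alpha$, $\rho_t(1)=\beta$, $\rho_0=g$ if (1) holds and, for all $t\in[0,T]$ and $G\in C_c^{1,\infty}([0,T]\times(0,1))$, $$\langle\rho_t,G_t\rangle-\langle g,G_0\rangle-\int_0^t\langle\rho_s,\partial_sG_s\rangle ds+\kappa\int_0^t\langle\rho_s,V_1G_s\rangle ds-\kappa\int_0^t\langle G_s,V_0\rangle ds=0 .$$ *Regional fractional reaction–diffusion equation.* $\rho$ is a weak solution of $\partial_t\rho=(\mathbb L-\kappa V_1)\rho+\kappa V_0$ with $\rho_t(0)=\alpha$, $\rho_t(1)=\beta$,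 $\rho_0=g$ if (1) and (2) hold and, for all $t\in[0,T]$ and $G\in C_c^{1,\infty}([0,T]\times(0,1))$, $$\langle\rho_t,G_t\rangle-\langle g,G_0\rangle-\int_0^t\langle\rho_s,(\partial_s+\mathbb L-\kappa V_1)G_s\rangle ds-\kappa\int_0^t\langle G_s,V_0\rangle ds=0 .$$ Let $(\mu_N)$ be probability measures on $\Omega_N$ associated to $g$, i.e. for every continuous $G:[0,1]\to\mathbb R$ and every $\delta>0$, $$\lim_{N\to\infty}\mu_N\Big(\Big|\frac1N\sum_{x\in\Lambda_N}G(\tfrac xN)\eta_x-\int_0^1G(u)g(u)\,du\Big|>\delta\Big)=0 .$$ Then the reaction equation (if $\theta<0$), respectively the regional fractional reaction–diffusion equation (if $\theta=0$), has a weak solution $\rho$; it is unique in the sense that any other weak solution $\rho'$ satisfies, for every $t\in[0,T]$, $\rho'_t(u)=\rho_t(u)$ for almost every $u\in[0,1]$; and for every $t\in[0,T]$, every continuous $G:[0,1]\to\mathbb R$ and every $\delta>0$, $$\lim_{N\to\infty}\mathbb P_{\mu_N}\Big(\Big|\frac1N\sum_{x\in\Lambda_N}G(\tfrac xN)\,\eta^N_{t,x}-\int_0^1G(u)\rho_t(u)\,du\Big|>\delta\Big)=0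 ,$$ where $\eta^N_{t,x}$ is the value of $\eta^N_t$ at the site $x$. -/

import Mathlib

open Set Filter Topology MeasureTheory
open scoped ENNReal ContDiff

noncomputable section

namespace LongJumpExclusion

/-! ### The microscopic model -/

/-- The normalizing constant `c_γ` of the jump law. -/
def cGamma (γ : ℝ) : ℝ :=
  (∑' z : ℤ, if z = 0 then (0 : ℝ) else 1 / |(z : ℝ)| ^ (γ + 1))⁻¹

/-- The jump law `p(z) = c_γ 1_{z ≠ 0} |z|^{-(γ+1)}`. -/
def jump (γ : ℝ) (z : ℤ) : ℝ :=
  if z = 0 then 0 else cGamma γ / |(z : ℝ)| ^ (γ + 1)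

/-- The bulk `Λ_N = {1, …, N-1}`. -/
abbrev Site (N : ℕ) : Type := ↥(Finset.Icc (1 : ℤ) ((N : ℤ) - 1))

/-- The configuration space `Ω_N = {0,1}^{Λ_N}` (`true` means occupied). -/
abbrev Config (N : ℕ) : Type := Site N → Bool

/-- The occupation number `η_x ∈ {0,1}` as a real number. -/
def occ {N : ℕ} (η : Config N) (x : Site N) : ℝ := if η x then 1 else 0

/-- `σ^{x,y} η`: the occupation values at `x` and `y` are exchanged. -/
def exchange {N : ℕ} (x y : Site N) (η : Config N) : Config N :=
  fun z => if z = x then η y else if z = y then η x else η z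

/-- `σ^x η`: the occupation value at `x` is flipped. -/
def flipSite {N : ℕ} (x : Site N) (η : Config N) : Config N :=
  fun z => if z = x then !(η x) else η z

/-- The rate `c_x(η; r) = η_x (1 - r) + (1 - η_x) r` for a reservoir of constant density `r`. -/
def flipRate {N : ℕ} (r : ℝ) (x : Site N) (η : Config N) : ℝ :=
  occ η x * (1 - r) + (1 - occ η x) * r

/-- The bulk generator `L_N^0`. -/
def genBulk (γ : ℝ) (N : ℕ) (f : Config N → ℝ) (η : Config N) : ℝ :=
  (1 / 2) * ∑ x : Site N, ∑ y : Site N,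
    jump γ ((x : ℤ) - (y : ℤ)) * (f (exchange x y η) - f η)

/-- The generator `L_N^ℓ` of the left reservoirs, which occupy all the sites `y ≤ 0`. -/
def genLeft (γ α : ℝ) (N : ℕ) (f : Config N → ℝ) (η : Config N) : ℝ :=
  ∑ x : Site N, ∑' y : Set.Iic (0 : ℤ),
    jump γ ((x : ℤ) - (y : ℤ)) * flipRate α x η * (f (flipSite x η) - f η)

/-- The generator `L_N^r` of the right reservoirs, which occupy all the sites `y ≥ N`. -/
def genRight (γ β : ℝ) (N : ℕ) (f : Config N → ℝ) (η : Config N) : ℝ :=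
  ∑ x : Site N, ∑' y : Set.Ici (N : ℤ),
    jump γ ((x : ℤ) - (y : ℤ)) * flipRate β x η * (f (flipSite x η) - f η)

/-- The full generator `L_N = L_N^0 + κ N^{-θ} L_N^ℓ + κ N^{-θ} L_N^r`. -/
def gen (γ α β κ θ : ℝ) (N : ℕ) (f : Config N → ℝ) (η : Config N) : ℝ :=
  genBulk γ N f η + κ * (N : ℝ) ^ (-θ) * genLeft γ α N f η
    + κ * (N : ℝ) ^ (-θ) * genRight γ β N f η

/-- The time scale `Θ(N) = N^{γ+θ}`. -/
def timeScale (γ θ : ℝ) (N : ℕ) : ℝ := (N : ℝ) ^ (γ + θ)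

/-- The space `D([0,T], Ω_N)` of right-continuous paths with left limits. -/
def SkorohodPath (T : ℝ) (N : ℕ) : Type :=
  {w : Set.Icc (0 : ℝ) T → Config N //
    ∀ t, ContinuousWithinAt w (Set.Ici t) t ∧ ∃ l, Tendsto w (𝓝[<] t) (𝓝 l)}

/-- The position at time `t` of the path `w`. -/
def SkorohodPath.at {T : ℝ} {N : ℕ} (w : SkorohodPath T N) (t : Set.Icc (0 : ℝ) T) : Config N := w.1 t

/-- The σ-algebra on `D([0,T], Ω_N)` generated by the coordinates (this is also the Borel
σ-algebra of the Skorohod topology). -/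
instance SkorohodPath.instMeasurableSpace (T : ℝ) (N : ℕ) : MeasurableSpace (SkorohodPath T N) :=
  ⨆ t : Set.Icc (0 : ℝ) T, MeasurableSpace.comap (fun w : SkorohodPath T N => w.at t) inferInstance

/-- The natural filtration of the coordinate process. -/
def SkorohodPath.filtration (T : ℝ) (N : ℕ) :
    Filtration (Set.Icc (0 : ℝ) T) (SkorohodPath.instMeasurableSpace T N) where
  seq t := ⨆ s : Set.Icc (0 : ℝ) T, ⨆ _ : s ≤ t,
    MeasurableSpace.comap (fun w : SkorohodPath T N => w.at s) inferInstance
  mono' _ _ hst := iSup_mono fun _ => iSup_mono' fun h => ⟨h.trans hst, le_rfl⟩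
  le' _ := iSup_mono fun _ => iSup_le fun _ => le_rfl

/-- `P` is the law `ℙ_{μ_N}` on `D([0,T], Ω_N)` of the Markov process `η^N_t = η(t Θ(N))` with
generator `Θ(N) L_N` and initial law `μ`: it is the solution of the martingale problem for
`(Θ(N) L_N, μ)`. The integral is over `s ∈ [0,t]`, with respect to Lebesgue measure on `[0,T]`. -/
structure IsProcessLaw (γ α β κ θ T : ℝ) (N : ℕ) (μ : Measure (Config N))
    (P : Measure (SkorohodPath T N)) : Prop where
  isProbabilityMeasure : IsProbabilityMeasure P
  initial : ∀ t : Set.Icc (0 : ℝ) T, (t : ℝ) = 0 → P.map (fun w => w.at t) = μ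
  martingale : ∀ f : Config N → ℝ,
    Martingale
      (fun (t : Set.Icc (0 : ℝ) T) (w : SkorohodPath T N) =>
        f (w.at t) - ∫ s in Set.Iic t, timeScale γ θ N * gen γ α β κ θ N f (w.at s)
          ∂(Measure.comap Subtype.val (volume : Measure ℝ)))
      (SkorohodPath.filtration T N) P

/-- `(1/N) ∑_{x ∈ Λ_N} G(x/N) η_x`. -/
def empirical {N : ℕ} (G : ℝ → ℝ) (η : Config N) : ℝ :=
  (1 / (N : ℝ)) * ∑ x : Site N, G (((x : ℤ) : ℝ) / (N : ℝ)) * occ η x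

/-- The sequence `μ_N` is associated to the profile `g`. -/
def AssociatedTo (μ : ∀ N : ℕ, Measure (Config N)) (g : ℝ → ℝ) : Prop :=
  ∀ G : ℝ → ℝ, ContinuousOn G (Set.Icc 0 1) → ∀ δ : ℝ, 0 < δ →
    Tendsto
      (fun N : ℕ => μ N {η | δ < |empirical G η - ∫ u in (0 : ℝ)..1, G u * g u|})
      atTop (𝓝 0)

/-- Under `P_N`, at each time `t ∈ [0,T]`, the empirical density converges in probability to
`ρ_t(u) du`. -/
def ConvergesTo (T : ℝ) (P : ∀ N : ℕ, Measure (SkorohodPath T N)) (ρ : ℝ → ℝ → ℝ) : Prop :=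
  ∀ t : Set.Icc (0 : ℝ) T, ∀ G : ℝ → ℝ, ContinuousOn G (Set.Icc 0 1) → ∀ δ : ℝ, 0 < δ →
    Tendsto
      (fun N : ℕ => P N {w | δ < |empirical G (w.at t) - ∫ u in (0 : ℝ)..1, G u * ρ t u|})
      atTop (𝓝 0)

/-! ### The hydrodynamic equations -/

/-- `r^-(u) = c_γ γ^{-1} u^{-γ}`. -/
def rMinus (γ u : ℝ) : ℝ := cGamma γ * γ⁻¹ * u ^ (-γ)

/-- `r^+(u) = c_γ γ^{-1} (1-u)^{-γ}`. -/
def rPlus (γ u : ℝ) : ℝ := cGamma γ * γ⁻¹ * (1 - u) ^ (-γ)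

/-- `V_1 = r^- + r^+`. -/
def V₁ (γ u : ℝ) : ℝ := rMinus γ u + rPlus γ u

/-- `V_0 = α r^- + β r^+`. -/
def V₀ (γ α β u : ℝ) : ℝ := α * rMinus γ u + β * rPlus γ u

/-- The regional fractional Laplacian on `(0,1)`, as a principal value. -/
def regionalLaplacian (γ : ℝ) (G : ℝ → ℝ) (u : ℝ) : ℝ :=
  cGamma γ * limUnder (𝓝[>] (0 : ℝ)) (fun ε : ℝ =>
    ∫ v in {v : ℝ | v ∈ Set.Icc (0 : ℝ) 1 ∧ ε ≤ |u - v|}, (G v - G u) / |u - v| ^ (1 + γ))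

/-- The time derivative on `[0,T]` (one-sided at the end points). -/
def timeDeriv (T : ℝ) (G : ℝ → ℝ → ℝ) (t u : ℝ) : ℝ :=
  derivWithin (fun s => G s u) (Set.Icc 0 T) t

/-- The test functions `C_c^{1,∞}([0,T] × (0,1))`, extended by zero outside `(0,1)`: `G`, `∂_t G`
and all `∂_u^n G` exist and are continuous on `[0,T] × (0,1)`, and `G` vanishes outside `[0,T] × K`
for some compact `K ⊆ (0,1)`. -/
structure IsTestFunction (T : ℝ) (G : ℝ → ℝ → ℝ) : Prop where
  smooth : ∀ t ∈ Set.Icc 0 T, ContDiff ℝ ∞ (G t)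
  continuousOn_iteratedDeriv : ∀ n : ℕ,
    ContinuousOn (fun q : ℝ × ℝ => iteratedDeriv n (G q.1) q.2) (Set.Icc 0 T ×ˢ Set.univ)
  differentiableOn : ∀ u : ℝ, DifferentiableOn ℝ (fun t => G t u) (Set.Icc 0 T)
  continuousOn_timeDeriv :
    ContinuousOn (fun q : ℝ × ℝ => timeDeriv T G q.1 q.2) (Set.Icc 0 T ×ˢ Set.univ)
  compactSupport : ∃ K : Set ℝ, IsCompact K ∧ K ⊆ Set.Ioo 0 1 ∧
    ∀ t ∈ Set.Icc 0 T, ∀ u, u ∉ K → G t u = 0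

/-- `‖f‖² + ‖f‖²_{γ/2}`, the square of the norm of `ℋ^{γ/2}` (infinite outside `ℋ^{γ/2}`). -/
def sobolevNormSq (γ : ℝ) (f : ℝ → ℝ) : ℝ≥0∞ :=
  (∫⁻ u in Set.Ioo (0 : ℝ) 1, ENNReal.ofReal (f u ^ 2)) +
    ENNReal.ofReal (cGamma γ / 2) *
      ∫⁻ u in Set.Ioo (0 : ℝ) 1, ∫⁻ v in Set.Ioo (0 : ℝ) 1,
        ENNReal.ofReal ((f u - f v) ^ 2 / |u - v| ^ (1 + γ))

/-- The integral condition that encodes the Dirichlet conditions `ρ_t(0) = α`, `ρ_t(1) = β`. -/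
def BoundaryEnergyFinite (γ α β T : ℝ) (ρ : ℝ → ℝ → ℝ) : Prop :=
  ∫⁻ t in Set.Icc 0 T, ∫⁻ u in Set.Ioo (0 : ℝ) 1,
    ENNReal.ofReal ((α - ρ t u) ^ 2 / u ^ γ + (β - ρ t u) ^ 2 / (1 - u) ^ γ) < ⊤

/-- A measurable function `[0,T] × [0,1] → [0,1]`. -/
structure IsDensity (T : ℝ) (ρ : ℝ → ℝ → ℝ) : Prop where
  measurable : Measurable (Function.uncurry ρ)
  mem_Icc : ∀ t ∈ Set.Icc 0 T, ∀ u ∈ Set.Icc (0 : ℝ) 1, ρ t u ∈ Set.Icc (0 : ℝ) 1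

/-- Weak solutions of the regional fractional reaction-diffusion equation
`∂_t ρ = (𝕃 - κ V₁) ρ + κ V₀` with `ρ_t(0) = α`, `ρ_t(1) = β` and `ρ_0 = g`, for `κ > 0`. -/
structure IsWeakSolutionDir (γ α β κ T : ℝ) (g : ℝ → ℝ) (ρ : ℝ → ℝ → ℝ) : Prop where
  isDensity : IsDensity T ρ
  sobolev : ∫⁻ t in Set.Icc 0 T, sobolevNormSq γ (ρ t) < ⊤
  boundary : BoundaryEnergyFinite γ α β T ρ
  weak : ∀ t ∈ Set.Icc 0 T, ∀ G : ℝ → ℝ → ℝ, IsTestFunction T G →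
    (∫ u in (0 : ℝ)..1, ρ t u * G t u) - (∫ u in (0 : ℝ)..1, g u * G 0 u)
      - (∫ s in (0 : ℝ)..t, ∫ u in (0 : ℝ)..1,
          ρ s u * (timeDeriv T G s u + (regionalLaplacian γ (G s) u - κ * V₁ γ u * G s u)))
      - κ * (∫ s in (0 : ℝ)..t, ∫ u in (0 : ℝ)..1, G s u * V₀ γ α β u) = 0

/-- Weak solutions of the reaction equation `∂_t ρ = - κ V₁ ρ + κ V₀` with `ρ_t(0) = α`,
`ρ_t(1) = β` and `ρ_0 = g`, for `κ > 0`. -/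
structure IsWeakSolutionReac (γ α β κ T : ℝ) (g : ℝ → ℝ) (ρ : ℝ → ℝ → ℝ) : Prop where
  isDensity : IsDensity T ρ
  boundary : BoundaryEnergyFinite γ α β T ρ
  weak : ∀ t ∈ Set.Icc 0 T, ∀ G : ℝ → ℝ → ℝ, IsTestFunction T G →
    (∫ u in (0 : ℝ)..1, ρ t u * G t u) - (∫ u in (0 : ℝ)..1, g u * G 0 u)
      - (∫ s in (0 : ℝ)..t, ∫ u in (0 : ℝ)..1, ρ s u * timeDeriv T G s u)
      + κ * (∫ s in (0 : ℝ)..t, ∫ u in (0 : ℝ)..1, ρ s u * G s u * V₁ γ u)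
      - κ * (∫ s in (0 : ℝ)..t, ∫ u in (0 : ℝ)..1, G s u * V₀ γ α β u) = 0

/-- `ρ` is the unique function satisfying `S`, where functions on `[0,T] × [0,1]` are identified
if at each time `t ∈ [0,T]` they agree for almost every `u ∈ [0,1]`. -/
def IsUniqueSolution (T : ℝ) (S : (ℝ → ℝ → ℝ) → Prop) (ρ : ℝ → ℝ → ℝ) : Prop :=
  S ρ ∧ ∀ ρ' : ℝ → ℝ → ℝ, S ρ' →
    ∀ t ∈ Set.Icc 0 T, ∀ᵐ u ∂(volume.restrict (Set.Icc (0 : ℝ) 1)), ρ' t u = ρ t u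

end LongJumpExclusion

end

open LongJumpExclusion

/-! The exchange dynamics is symmetric and the drift `c_x(η;r)(1-2η_x) = r - η_x` of a reservoir is
affine. Hence the generator maps a linear observable `(1/N) ∑ a_x η_x` to an affine one, and the
mean density solves a closed discrete linear equation. Its operator, extended to `L²(0,1)` as
`discGen`, is a bounded symmetric operator `B_N` which discretises `κ V₁ - e_N 𝕃` with `e_N = N^θ`:
after acceleration the reservoirs act at speed `N^γ` and the exchanges at speed `N^(γ+θ)`. For `θ =
0` one has `e_N = 1`, for `θ < 0` one has `e_N → 0`. Both cases are treated together, with a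
limiting exchange strength `e ∈ {0,1}`.

Fluctuations. Test the empirical density, centred by the discrete stationary profile, against
`exp(-(t-s)B_N) v`. The drift cancels and only the square field is left in Dynkin's formula for the
square. It is at most `N⁻¹ ⟨B_N S_s, S_s⟩` with `S_s = exp(-(t-s)B_N) v`, whose time integral is at
most `‖v‖²/(2N)` (`Params.expect_sq_le`, `IsSymmGe.integral_energy_le`). So neither entropy
estimates nor replacement lemmas are needed, and the theorem reduces to the strong convergence of
the deterministic semigroups `exp(-tB_N)`.

Semigroups. The `B_N` have a common positive lower bound coming from the reservoirs, and
`exists_tendsto_expSg` deduces convergence of the semigroups from strong convergence of the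
inverses. The limit of the inverses is `J J*`, where `J` embeds the form domain, the completion of
`C_c^∞(0,1)` in the energy norm of `κ V₁ - e 𝕃`. By `tendsto_inverse_of_consistent` two facts
suffice. The first is consistency of `B_N` on sampled test functions, by dominated convergence after
the odd part of the singular kernel is removed. The second is that weak limits of sequences of
bounded discrete energy lie in the form domain. For the latter, the energy is weakly lower
semicontinuous, and every function of finite energy is approximated by dilated mollifications
bounded in form norm (`exists_formEmb_eq`). The weight `u^(-γ) + (1-u)^(-γ)` pays for the extension
by zero needed there.

The inhomogeneous boundary values are removed by subtracting a smooth profile equal to `α` near 0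
and to `β` near 1, which leaves a bounded source. The limit curve inherits the weak equation and the
energy bounds from the discrete equation, and the bounds `0 ≤ ρ ≤ 1` from the particle system.

Uniqueness. The finite energy conditions put the difference `w` of two solutions in the form domain
for almost every time. This allows the test function `R φ`, where `R = J J*`, giving `⟨w_t, R φ⟩ =
-∫₀ᵗ ⟨w_s, φ⟩ ds`. Iteration gives `‖Rⁿ w_t‖ ≤ C tⁿ/n!`, whereas for symmetric `R` these norms decay
at most geometrically unless `R w_t = 0`. -/

noncomputable section

set_option linter.unusedSectionVars false

namespace LongJumpExclusion

/-! ### Semigroups of bounded symmetric operators on a Hilbert space. -/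

section Abstract

variable {H : Type*} [NormedAddCommGroup H] [InnerProductSpace ℝ H] [CompleteSpace H]

local notation "⟪" x "," y "⟫" => inner ℝ x y

/-- A bounded symmetric operator which is bounded below by `m`. -/
structure IsSymmGe (m : ℝ) (B : H →L[ℝ] H) : Prop where
  symm : ∀ x y, ⟪B x, y⟫ = ⟪x, B y⟫
  lower : ∀ x, m * ‖x‖ ^ 2 ≤ ⟪B x, x⟫

/-- Lax–Milgram: the lower bound is coercivity of the bilinear form `⟪B x, y⟫`. -/
theorem IsSymmGe.exists_inverse {m : ℝ} (hm : 0 < m) {B : H →L[ℝ] H} (hB : IsSymmGe m B) :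
    ∃ K : H →L[ℝ] H, (∀ x, B (K x) = x) ∧ (∀ x, K (B x) = x) := by
  have hc : IsCoercive ((innerSL ℝ).comp B : H →L[ℝ] H →L[ℝ] ℝ) := by
    refine ⟨m, hm, fun u => ?_⟩
    have := hB.lower u
    simpa [pow_two, mul_assoc] using this
  have hcB : ∀ x, hc.continuousLinearEquivOfBilin x = B x := by
    intro x
    refine ext_inner_right ℝ fun y => ?_
    rw [hc.continuousLinearEquivOfBilin_apply]
    simp
  refine ⟨hc.continuousLinearEquivOfBilin.symm, fun x => ?_, fun x => ?_⟩
  · rw [← hcB]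
    simp
  · rw [← hcB]
    simp

theorem IsSymmGe.norm_inverse_le {m : ℝ} (hm : 0 < m) {B K : H →L[ℝ] H} (hB : IsSymmGe m B)
    (hK : ∀ x, B (K x) = x) (x : H) : ‖K x‖ ≤ m⁻¹ * ‖x‖ := by
  have h1 := hB.lower (K x)
  rw [hK] at h1
  have h2 := real_inner_le_norm x (K x)
  rcases (norm_nonneg (K x)).eq_or_lt with h0 | h0
  · rw [← h0]
    positivity
  · rw [inv_mul_eq_div, le_div_iff₀ hm]
    nlinarith

theorem IsSymmGe.inverse_symm {m : ℝ} {B K : H →L[ℝ] H} (hB : IsSymmGe m B)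
    (hK : ∀ x, B (K x) = x) (x y : H) : ⟪K x, y⟫ = ⟪x, K y⟫ := by
  conv_lhs => rw [← hK y]
  rw [← hB.symm, hK]

theorem IsSymmGe.inverse_nonneg {m : ℝ} (hm : 0 ≤ m) {B K : H →L[ℝ] H} (hB : IsSymmGe m B)
    (hK : ∀ x, B (K x) = x) : IsSymmGe 0 K := by
  refine ⟨hB.inverse_symm hK, fun x => ?_⟩
  have h1 := hB.lower (K x)
  rw [hK, real_inner_comm] at h1
  rw [zero_mul]
  exact le_trans (by positivity) h1

/-- The semigroup `exp(-tB)` generated by a bounded operator. -/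
def expSg (B : H →L[ℝ] H) (t : ℝ) : H →L[ℝ] H := NormedSpace.exp (t • (-B))

@[simp] theorem expSg_zero (B : H →L[ℝ] H) (x : H) : expSg B 0 x = x := by
  simp [expSg]

theorem hasDerivAt_expSg (B : H →L[ℝ] H) (x : H) (t : ℝ) :
    HasDerivAt (fun s => expSg B s x) (-(B (expSg B t x))) t := by
  have h := hasDerivAt_exp_smul_const' (𝕂 := ℝ) (-B) t
  have := h.clm_apply (hasDerivAt_const t x)
  simpa [expSg] using this

theorem hasDerivAt_expSg' (B : H →L[ℝ] H) (x : H) (t : ℝ) :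
    HasDerivAt (fun s => expSg B s x) (-(expSg B t (B x))) t := by
  have h := hasDerivAt_exp_smul_const (𝕂 := ℝ) (-B) t
  have := h.clm_apply (hasDerivAt_const t x)
  simpa [expSg] using this

theorem continuous_expSg (B : H →L[ℝ] H) (x : H) : Continuous fun t => expSg B t x :=
  continuous_iff_continuousAt.2 fun t => (hasDerivAt_expSg B x t).continuousAt

theorem hasDerivAt_normSq_expSg {B : H →L[ℝ] H} (x : H) (t : ℝ) :
    HasDerivAt (fun s => ‖expSg B s x‖ ^ 2) (-2 * ⟪B (expSg B t x), expSg B t x⟫) t := by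
  have h := (hasDerivAt_expSg B x t).norm_sq
  convert h using 1
  rw [inner_neg_right, real_inner_comm]
  ring

/-- The derivative of `‖exp(-sB) x‖²` is `-2⟪B ·, ·⟫ ≤ 0`. -/
theorem IsSymmGe.norm_expSg_le {B : H →L[ℝ] H} (hB : IsSymmGe 0 B) {t : ℝ} (ht : 0 ≤ t) (x : H) :
    ‖expSg B t x‖ ≤ ‖x‖ := by
  have hanti : Antitone fun s => ‖expSg B s x‖ ^ 2 := by
    refine antitone_of_deriv_nonpos (fun s => (hasDerivAt_normSq_expSg x s).differentiableAt)
      fun s => ?_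
    rw [(hasDerivAt_normSq_expSg x s).deriv]
    have := hB.lower (expSg B s x)
    linarith
  have := hanti ht
  simp only [expSg_zero] at this
  exact le_of_sq_le_sq this (norm_nonneg _)

theorem IsSymmGe.expSg_symm {m : ℝ} {B : H →L[ℝ] H} (hB : IsSymmGe m B) (t : ℝ) (x y : H) :
    ⟪expSg B t x, y⟫ = ⟪x, expSg B t y⟫ := by
  have hsa : IsSelfAdjoint (t • (-B)) := by
    rw [ContinuousLinearMap.isSelfAdjoint_iff_isSymmetric]
    intro x y
    simp only [ContinuousLinearMap.coe_coe, smul_apply,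
      neg_apply, inner_smul_left, inner_smul_right, inner_neg_left,
      inner_neg_right, hB.symm]
    simp
  have h2 : IsSelfAdjoint (expSg B t) := by
    unfold expSg
    rw [IsSelfAdjoint, NormedSpace.star_exp, hsa.star_eq]
  rw [ContinuousLinearMap.isSelfAdjoint_iff_isSymmetric] at h2
  exact h2 x y

/-- The energy dissipated is half the loss of squared norm, whatever the size of `‖B‖`. This
uniformity controls both the variance of the empirical density and the space-time energy of the
limit. -/
theorem IsSymmGe.integral_energy_le {B : H →L[ℝ] H} (x : H) {T : ℝ} :
    ∫ t in (0 : ℝ)..T, ⟪B (expSg B t x), expSg B t x⟫ ≤ ‖x‖ ^ 2 / 2 := by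
  have hc : Continuous fun t => ⟪B (expSg B t x), expSg B t x⟫ :=
    (B.continuous.comp (continuous_expSg B x)).inner (continuous_expSg B x)
  have h := intervalIntegral.integral_eq_sub_of_hasDerivAt (a := 0) (b := T)
    (fun t _ => hasDerivAt_normSq_expSg (B := B) x t)
    ((continuous_const.mul hc).intervalIntegrable _ _)
  rw [intervalIntegral.integral_const_mul] at h
  simp only [expSg_zero] at h
  have : 0 ≤ ‖expSg B T x‖ ^ 2 := by positivity
  linarith

theorem le_of_isSymmGe {m m' : ℝ} (h : m' ≤ m) {B : H →L[ℝ] H} (hB : IsSymmGe m B) :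
    IsSymmGe m' B :=
  ⟨hB.symm, fun x => (mul_le_mul_of_nonneg_right h (by positivity)).trans (hB.lower x)⟩

/-- Comparison of the semigroups of two commuting generators. -/
theorem norm_expSg_sub_le {X Y : H →L[ℝ] H} (hX : IsSymmGe 0 X) (hY : IsSymmGe 0 Y)
    (hXY : ∀ x, X (Y x) = Y (X x)) {t : ℝ} (ht : 0 ≤ t) (x : H) :
    ‖expSg X t x - expSg Y t x‖ ≤ t * ‖X x - Y x‖ := by
  have hcomm : ∀ s z, expSg Y s (X z) = X (expSg Y s z) := by
    intro s z
    have hc : Commute (X : H →L[ℝ] H) (s • (-Y)) := by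
      refine ContinuousLinearMap.ext fun w => ?_
      simp [hXY]
    have := hc.exp_right
    exact (congrArg (fun L : H →L[ℝ] H => L z) this.eq).symm
  -- interpolate with `s ↦ exp(-(t-s)X) exp(-sY) x`
  have hd : ∀ s, HasDerivAt (fun s => expSg X (t - s) (expSg Y s x))
      (expSg X (t - s) (expSg Y s (X x - Y x))) s := by
    intro s
    have h1 : HasDerivAt (fun s : ℝ => expSg X (t - s)) (-(expSg X (t - s) * (-X))) s := by
      have h := hasDerivAt_exp_smul_const (𝕂 := ℝ) (-X) (t - s)
      have h3 : HasDerivAt (fun s : ℝ => t - s) (-1) s := by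
        simpa using (hasDerivAt_id s).const_sub t
      have := h.scomp s h3
      simpa [expSg, Function.comp_def] using this
    have h2 := h1.clm_apply (hasDerivAt_expSg' Y x s)
    refine h2.congr_deriv ?_
    have h4 : (-(expSg X (t - s) * (-X))) (expSg Y s x) = expSg X (t - s) (X (expSg Y s x)) := by
      change -(expSg X (t - s) (-(X (expSg Y s x)))) = _
      rw [map_neg, neg_neg]
    rw [h4, ← hcomm, map_neg, map_sub, map_sub]
    abel
  -- The substitution `s = r t` moves the interpolation to `[0,1]`, where the mean value inequality
  -- applies; both exponentials are contractions there.
  have hb := norm_image_sub_le_of_norm_deriv_le_segment_01'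
    (f := fun r => expSg X (t - r * t) (expSg Y (r * t) x))
    (f' := fun r => t • (expSg X (t - r * t) (expSg Y (r * t) (X x - Y x))))
    (C := t * ‖X x - Y x‖) ?_ ?_
  · simp only [one_mul, zero_mul, sub_self, expSg_zero, sub_zero] at hb
    rw [norm_sub_rev]
    exact hb
  · intro r hr
    have h3 : HasDerivAt (fun r : ℝ => r * t) t r := by simpa using (hasDerivAt_id r).mul_const t
    have := (hd (r * t)).scomp r h3
    exact this.hasDerivWithinAt
  · intro r hr
    rw [norm_smul, Real.norm_of_nonneg ht]
    refine mul_le_mul_of_nonneg_left ?_ ht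
    refine (hX.norm_expSg_le ?_ _).trans (hY.norm_expSg_le ?_ _)
    · nlinarith [hr.1, hr.2]
    · nlinarith [hr.1, hr.2]

theorem expSg_eq_tsum (B : H →L[ℝ] H) (t : ℝ) (x : H) :
    expSg B t x = ∑' n : ℕ, ((n.factorial : ℝ)⁻¹) • (((t • (-B)) ^ n) x) := by
  have h := NormedSpace.exp_series_hasSum_exp' (𝕂 := ℝ) (t • (-B))
  have h2 := h.mapL (ContinuousLinearMap.apply ℝ H x)
  simp only [ContinuousLinearMap.apply_apply, smul_apply] at h2
  exact h2.tsum_eq.symm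

/-- Strong convergence passes to products only under a uniform bound on the norms, which absorbs the
first term of `X^(k+1) x = X (X^k x - Y^k x) + X Y^k x`. -/
theorem tendsto_pow_apply {X : ℕ → H →L[ℝ] H} {Y : H →L[ℝ] H} {C : ℝ} (hC : ∀ n, ‖X n‖ ≤ C)
    (h : ∀ x, Tendsto (fun n => X n x) atTop (𝓝 (Y x))) (k : ℕ) (x : H) :
    Tendsto (fun n => (X n ^ k) x) atTop (𝓝 ((Y ^ k) x)) := by
  induction k with
  | zero => simp
  | succ k ih =>
    have h1 : ∀ n, (X n ^ (k + 1)) x = X n ((X n ^ k) x - (Y ^ k) x) + X n ((Y ^ k) x) := by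
      intro n
      rw [pow_succ', map_sub, sub_add_cancel]
      rfl
    simp only [h1]
    have h2 : Tendsto (fun n => X n ((X n ^ k) x - (Y ^ k) x)) atTop (𝓝 0) := by
      refine squeeze_zero_norm (a := fun n => C * ‖(X n ^ k) x - (Y ^ k) x‖) (fun n => ?_) ?_
      · exact (X n).le_of_opNorm_le (hC n) _
      · have := (tendsto_iff_norm_sub_tendsto_zero.1 ih).const_mul C
        simpa using this
    have := h2.add (h ((Y ^ k) x))
    simpa [pow_succ'] using this

/-- Dominated convergence in the exponential series. It will only be applied to the Yosida
approximations, since the discrete generators themselves have no uniform bound. -/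
theorem tendsto_expSg_of_bounded {X : ℕ → H →L[ℝ] H} {Y : H →L[ℝ] H} {C : ℝ}
    (hC : ∀ n, ‖X n‖ ≤ C) (h : ∀ x, Tendsto (fun n => X n x) atTop (𝓝 (Y x))) (t : ℝ) (x : H) :
    Tendsto (fun n => expSg (X n) t x) atTop (𝓝 (expSg Y t x)) := by
  simp only [expSg_eq_tsum]
  have hC0 : 0 ≤ C := (norm_nonneg _).trans (hC 0)
  refine tendsto_tsum_of_dominated_convergence
    (bound := fun k : ℕ => ((|t| * C) ^ k / (k.factorial : ℝ)) * ‖x‖) ?_ ?_ ?_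
  · exact (Real.summable_pow_div_factorial _).mul_right _
  · intro k
    refine Tendsto.const_smul ?_ _
    refine tendsto_pow_apply (C := |t| * C) (fun n => ?_) (fun y => ?_) k x
    · rw [norm_smul, norm_neg, Real.norm_eq_abs]
      gcongr
      exact hC n
    · exact ((h y).neg).const_smul t
  · refine Eventually.of_forall fun n k => ?_
    rw [norm_smul, norm_inv, Real.norm_natCast, div_mul_eq_mul_div, div_eq_inv_mul]
    refine mul_le_mul_of_nonneg_left ?_ (by positivity)
    have h1 : ‖(t • (-(X n))) ^ k‖ ≤ (|t| * C) ^ k := by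
      rcases k.eq_zero_or_pos with rfl | hk
      · rw [pow_zero, pow_zero]
        exact ContinuousLinearMap.norm_id_le
      · refine (norm_pow_le' _ hk).trans ?_
        gcongr
        rw [norm_smul, norm_neg, Real.norm_eq_abs]
        gcongr
        exact hC n
    exact ContinuousLinearMap.le_of_opNorm_le _ h1 x

end Abstract

/-! ### Convergence of semigroups from convergence of inverses, weak limits, and abstract
uniqueness. -/

section AbstractLimits

variable {H : Type*} [NormedAddCommGroup H] [InnerProductSpace ℝ H] [CompleteSpace H]

local notation "⟪" x "," y "⟫" => inner ℝ x y

theorem cauchySeq_of_approx {a : ℕ → H}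
    (h : ∀ ε > 0, ∃ b : ℕ → H, CauchySeq b ∧ ∀ᶠ n in atTop, ‖a n - b n‖ ≤ ε) : CauchySeq a := by
  rw [Metric.cauchySeq_iff']
  intro ε hε
  obtain ⟨b, hb, hab⟩ := h (ε / 4) (by positivity)
  obtain ⟨N₁, hN₁⟩ := eventually_atTop.1 hab
  obtain ⟨N₂, hN₂⟩ := Metric.cauchySeq_iff.1 hb (ε / 4) (by positivity)
  refine ⟨max N₁ N₂, fun n hn => ?_⟩
  have h1 := hN₁ n ((le_max_left _ _).trans hn)
  have h2 := hN₁ (max N₁ N₂) (le_max_left _ _)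
  have h3 := hN₂ n ((le_max_right _ _).trans hn) (max N₁ N₂) (le_max_right _ _)
  rw [dist_eq_norm] at h3 ⊢
  have : a n - a (max N₁ N₂) = (a n - b n) + (b n - b (max N₁ N₂))
      - (a (max N₁ N₂) - b (max N₁ N₂)) := by abel
  rw [this]
  refine (norm_sub_le _ _).trans_lt ?_
  have := norm_add_le (a n - b n) (b n - b (max N₁ N₂))
  linarith

/-- The orthogonal complement of the range of a symmetric operator is its kernel. -/
theorem denseRange_of_symm_injective {L : H →L[ℝ] H} (hs : ∀ x y, ⟪L x, y⟫ = ⟪x, L y⟫)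
    (hi : ∀ x, L x = 0 → x = 0) : DenseRange L := by
  have h : (LinearMap.range (L : H →ₗ[ℝ] H)).topologicalClosure = ⊤ := by
    rw [Submodule.topologicalClosure_eq_top_iff, Submodule.eq_bot_iff]
    intro x hx
    refine hi x ?_
    refine ext_inner_left ℝ fun y => ?_
    rw [inner_zero_right, ← hs]
    exact hx (L y) ⟨y, rfl⟩
  have h2 := congrArg (fun S : Submodule ℝ H => (S : Set H)) h
  simp only [Submodule.topologicalClosure_coe, Submodule.top_coe] at h2
  exact dense_iff_closure_eq.2 h2

/-- A Trotter–Kato argument which never names the limiting generator. The Yosida approximations `(K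
n + δ)⁻¹` are bounded by `δ⁻¹` and converge strongly, so their exponentials converge. On vectors `K
n (K n φ)` they differ from `exp(-t B n)` by at most `2tδ‖φ‖`, uniformly in `n`. Such vectors
converge to `R (R φ)`, and these are dense because `R` is symmetric and injective. -/
theorem exists_tendsto_expSg {m : ℝ} (hm : 0 < m) {B K : ℕ → H →L[ℝ] H}
    (hB : ∀ n, IsSymmGe m (B n)) (hBK : ∀ n x, B n (K n x) = x) (hKB : ∀ n x, K n (B n x) = x)
    {R : H →L[ℝ] H} (hR : IsSymmGe 0 R) (hRi : ∀ x, R x = 0 → x = 0)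
    (hconv : ∀ x, Tendsto (fun n => K n x) atTop (𝓝 (R x))) {t : ℝ} (ht : 0 ≤ t) (x : H) :
    ∃ y, Tendsto (fun n => expSg (B n) t x) atTop (𝓝 y) := by
  have hB0 : ∀ n, IsSymmGe 0 (B n) := fun n => le_of_isSymmGe hm.le (hB n)
  have hKnorm : ∀ n, ‖K n‖ ≤ m⁻¹ := fun n =>
    ContinuousLinearMap.opNorm_le_bound _ (by positivity) ((hB n).norm_inverse_le hm (hBK n))
  have hKK : ∀ φ, Tendsto (fun n => K n (K n φ)) atTop (𝓝 (R (R φ))) := by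
    intro φ
    have := tendsto_pow_apply hKnorm hconv 2 φ
    simp only [pow_two] at this
    exact this
  have hadd : ∀ (L : H →L[ℝ] H), IsSymmGe 0 L → ∀ δ : ℝ, 0 < δ →
      IsSymmGe δ (L + δ • ContinuousLinearMap.id ℝ H) := by
    intro L hL δ hδ
    refine ⟨fun x y => ?_, fun x => ?_⟩
    · simp [inner_add_left, inner_add_right, hL.symm, inner_smul_left, inner_smul_right]
    · have := hL.lower x
      simp only [add_apply, smul_apply, ContinuousLinearMap.id_apply, inner_add_left,
        inner_smul_left, real_inner_self_eq_norm_sq]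
      simp only [RCLike.conj_to_real]
      linarith
  have key : ∀ φ, CauchySeq fun n => expSg (B n) t (K n (K n φ)) := by
    intro φ
    refine cauchySeq_of_approx fun ε hε => ?_
    -- The left side is the bound for the error of the Yosida approximation obtained below; the `+
    -- 1` only keeps the denominator positive.
    obtain ⟨δ, hδ, hδε⟩ : ∃ δ : ℝ, 0 < δ ∧ t * (δ * (2 * ‖φ‖)) ≤ ε := by
      refine ⟨ε / (t * (2 * ‖φ‖) + 1), by positivity, ?_⟩
      rw [← mul_assoc, mul_comm t, mul_assoc, div_mul_eq_mul_div, div_le_iff₀ (by positivity)]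
      nlinarith [mul_nonneg ht (norm_nonneg φ)]
    have hKn : ∀ n, IsSymmGe δ (K n + δ • ContinuousLinearMap.id ℝ H) := fun n =>
      hadd _ ((hB n).inverse_nonneg hm.le (hBK n)) δ hδ
    have hRδ := hadd R hR δ hδ
    -- `C n = (K n + δ)⁻¹ = B n (1 + δ B n)⁻¹`.
    choose C hC1 hC2 using fun n => (hKn n).exists_inverse hδ
    obtain ⟨D, hD1, hD2⟩ := hRδ.exists_inverse hδ
    have hC1' : ∀ n x, K n (C n x) + δ • C n x = x := fun n x => by simpa using hC1 n x
    have hC2' : ∀ n x, C n (K n x) + δ • C n x = x := fun n x => by simpa using hC2 n x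
    have hD1' : ∀ x, R (D x) + δ • D x = x := fun x => by simpa using hD1 x
    have hCnorm : ∀ n, ‖C n‖ ≤ δ⁻¹ := fun n =>
      ContinuousLinearMap.opNorm_le_bound _ (by positivity) ((hKn n).norm_inverse_le hδ (hC1 n))
    have hC0 : ∀ n, IsSymmGe 0 (C n) := fun n => (hKn n).inverse_nonneg hδ.le (hC1 n)
    have hCD : ∀ ψ, Tendsto (fun n => C n ψ) atTop (𝓝 (D ψ)) := by
      intro ψ
      rw [tendsto_iff_norm_sub_tendsto_zero]
      refine squeeze_zero (g := fun n => δ⁻¹ * ‖K n (D ψ) - R (D ψ)‖) (fun _ => norm_nonneg _)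
        (fun n => ?_) ?_
      · have h1 : C n ψ - D ψ = -C n (K n (D ψ) - R (D ψ)) := by
          have h2 := hC2' n (D ψ)
          have h3 : C n ψ = C n (R (D ψ)) + δ • C n (D ψ) := by
            conv_lhs => rw [← hD1' ψ]
            rw [map_add, map_smul]
          rw [h3, map_sub]
          nth_rewrite 3 [← h2]
          abel
        rw [h1, norm_neg]
        exact (C n).le_of_opNorm_le (hCnorm n) _
      · have := (tendsto_iff_norm_sub_tendsto_zero.1 (hconv (D ψ))).const_mul δ⁻¹
        simpa using this
    refine ⟨fun n => expSg (C n) t (K n (K n φ)), ?_, Eventually.of_forall fun n => ?_⟩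
    · have h1 := tendsto_expSg_of_bounded hCnorm hCD t (R (R φ))
      have h2 : Tendsto (fun n => expSg (C n) t (K n (K n φ) - R (R φ))) atTop (𝓝 0) := by
        refine squeeze_zero_norm (a := fun n => ‖K n (K n φ) - R (R φ)‖)
          (fun n => (hC0 n).norm_expSg_le ht _) ?_
        exact tendsto_iff_norm_sub_tendsto_zero.1 (hKK φ)
      have h3 := h2.add h1
      simp only [map_sub, sub_add_cancel] at h3
      exact h3.cauchySeq
    · have hcomm : ∀ x, B n (C n x) = C n (B n x) := by
        intro x
        have h1 : B n x = C n x + δ • B n (C n x) := by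
          conv_lhs => rw [← hC1' n x]
          rw [map_add, map_smul, hBK]
        have h2 := hC2' n (B n (C n x))
        rw [hKB] at h2
        rw [h1, map_add, map_smul]
        exact h2.symm
      refine (norm_expSg_sub_le (hB0 n) (hC0 n) hcomm ht _).trans
        ((mul_le_mul_of_nonneg_left ?_ ht).trans hδε)
      -- One inverse cancels `B n`; the second one lets `C n (K n φ) = φ - δ C n φ` be bounded by
      -- `2‖φ‖` independently of `δ`.
      have h1 : B n (K n (K n φ)) - C n (K n (K n φ)) = δ • C n (K n φ) := by
        rw [hBK]
        nth_rewrite 1 [← hC2' n (K n φ)]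
        abel
      rw [h1, norm_smul, Real.norm_of_nonneg hδ.le]
      refine mul_le_mul_of_nonneg_left ?_ hδ.le
      have h2 : C n (K n φ) = φ - δ • C n φ := eq_sub_of_add_eq (hC2' n φ)
      rw [h2]
      refine (norm_sub_le _ _).trans ?_
      rw [norm_smul, Real.norm_of_nonneg hδ.le]
      have h3 := (C n).le_of_opNorm_le (hCnorm n) φ
      have h4 : δ * ‖C n φ‖ ≤ ‖φ‖ := by
        calc δ * ‖C n φ‖ ≤ δ * (δ⁻¹ * ‖φ‖) := by gcongr
          _ = ‖φ‖ := by field_simp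
      linarith
  have hdense : DenseRange (R * R : H →L[ℝ] H) := by
    refine denseRange_of_symm_injective (fun x y => ?_) (fun x hx => hRi x (hRi _ hx))
    change ⟪R (R x), y⟫ = ⟪x, R (R y)⟫
    rw [hR.symm, hR.symm]
  refine cauchySeq_tendsto_of_complete (cauchySeq_of_approx fun ε hε => ?_)
  obtain ⟨φ, hφ⟩ := hdense.exists_dist_lt x (half_pos hε)
  refine ⟨_, key φ, ?_⟩
  have h1 := (tendsto_iff_norm_sub_tendsto_zero.1 (hKK φ)).eventually (gt_mem_nhds (half_pos hε))
  filter_upwards [h1] with n hn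
  rw [← map_sub]
  refine ((hB0 n).norm_expSg_le ht _).trans ?_
  have h2 : x - K n (K n φ) = (x - R (R φ)) - (K n (K n φ) - R (R φ)) := by abel
  rw [h2]
  refine (norm_sub_le _ _).trans ?_
  rw [dist_eq_norm] at hφ
  have h3 : ‖x - R (R φ)‖ < ε / 2 := hφ
  linarith

/-- Along an ultrafilter every bounded real family converges, so `y ↦ lim ⟪x i, y⟫` is defined
everywhere and is a bounded functional; Riesz represents it. No diagonal extraction is required. -/
theorem exists_weak_limit {ι : Type*} (U : Ultrafilter ι) {x : ι → H} {C : ℝ}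
    (hx : ∀ᶠ i in (U : Filter ι), ‖x i‖ ≤ C) :
    ∃ w : H, ‖w‖ ≤ C ∧ ∀ y, Tendsto (fun i => ⟪x i, y⟫) U (𝓝 ⟪w, y⟫) := by
  have hC : 0 ≤ C := by
    obtain ⟨i, hi⟩ := hx.exists
    exact (norm_nonneg _).trans hi
  have h1 : ∀ y, ∃ l, |l| ≤ C * ‖y‖ ∧ Tendsto (fun i => ⟪x i, y⟫) U (𝓝 l) := by
    intro y
    have hmem : ∀ᶠ i in (U : Filter ι), ⟪x i, y⟫ ∈ Icc (-(C * ‖y‖)) (C * ‖y‖) := by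
      filter_upwards [hx] with i hi
      exact abs_le.1 ((abs_real_inner_le_norm _ _).trans (by gcongr))
    obtain ⟨l, hl, hle⟩ := (isCompact_Icc (a := -(C * ‖y‖)) (b := C * ‖y‖)).ultrafilter_le_nhds
      (U.map fun i => ⟪x i, y⟫) (le_principal_iff.2 hmem)
    exact ⟨l, abs_le.2 hl, hle⟩
  choose l hl1 hl2 using h1
  let L : H →ₗ[ℝ] ℝ :=
    { toFun := l
      map_add' := fun y z => by
        refine tendsto_nhds_unique (hl2 (y + z)) ?_
        simpa [inner_add_right] using (hl2 y).add (hl2 z)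
      map_smul' := fun c y => by
        refine tendsto_nhds_unique (hl2 (c • y)) ?_
        simpa [inner_smul_right] using (hl2 y).const_mul c }
  let L' : H →L[ℝ] ℝ := L.mkContinuous C fun y => hl1 y
  refine ⟨(InnerProductSpace.toDual ℝ H).symm L', ?_, fun y => ?_⟩
  · rw [LinearIsometryEquiv.norm_map]
    exact LinearMap.mkContinuous_norm_le _ hC _
  · rw [InnerProductSpace.toDual_symm_apply]
    exact hl2 y

/-- Weak limits of bounded sequences of the form domain stay in the form domain. -/
theorem exists_preimage_of_weak_limit {V : Type*} [NormedAddCommGroup V] [InnerProductSpace ℝ V]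
    [CompleteSpace V] (J : V →L[ℝ] H) {l : Filter ℕ} [l.NeBot] {v : ℕ → V} {C : ℝ}
    (hv : ∀ᶠ i in l, ‖v i‖ ≤ C) {w : H} (hw : Tendsto (fun i => J (v i)) l (𝓝 w)) :
    ∃ v' : V, ‖v'‖ ≤ C ∧ J v' = w := by
  -- A weak limit in `V` is taken along an ultrafilter finer than `l`. Bounded operators are weakly
  -- continuous, so `J` maps it to the given limit `w`.
  obtain ⟨v', hv', hlim⟩ := exists_weak_limit (Ultrafilter.of l) (hv.filter_mono (Ultrafilter.of_le l))
  refine ⟨v', hv', ext_inner_right ℝ fun y => ?_⟩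
  rw [← ContinuousLinearMap.adjoint_inner_right]
  refine tendsto_nhds_unique (hlim _) ?_
  simp only [ContinuousLinearMap.adjoint_inner_right]
  exact (hw.mono_left (Ultrafilter.of_le l)).inner tendsto_const_nhds

/-- Strong resolvent convergence from consistency on a form core and weak compactness. -/
theorem tendsto_inverse_of_consistent {V : Type*} [NormedAddCommGroup V] [InnerProductSpace ℝ V]
    [CompleteSpace V] (J : V →L[ℝ] H) {C : Type*} (e : C → V) (he : DenseRange e) (b : C → H)
    (hb : ∀ v c, ⟪v, e c⟫ = ⟪J v, b c⟫) {m : ℝ} (hm : 0 < m) {B K : ℕ → H →L[ℝ] H}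
    (hB : ∀ n, IsSymmGe m (B n)) (hBK : ∀ n x, B n (K n x) = x)
    (s : ℕ → C → H) (hs : ∀ c, Tendsto (fun n => s n c) atTop (𝓝 (J (e c))))
    (hBs : ∀ c, Tendsto (fun n => B n (s n c)) atTop (𝓝 (b c)))
    (hlsc : ∀ (U : Ultrafilter ℕ), (U : Filter ℕ) ≤ atTop → ∀ (w : ℕ → H) (z : H) (Q : ℝ),
      (∀ y, Tendsto (fun n => ⟪w n, y⟫) U (𝓝 ⟪z, y⟫)) → (∀ n, ‖w n‖ ≤ Q) →
      (∀ n, ⟪B n (w n), w n⟫ ≤ Q) → ∃ v, J v = z) (f : H) :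
    Tendsto (fun n => K n f) atTop (𝓝 (J (ContinuousLinearMap.adjoint J f))) := by
  set v₀ := ContinuousLinearMap.adjoint J f with hv₀
  have hKf : ∀ n, ‖K n f‖ ≤ m⁻¹ * ‖f‖ := fun n => (hB n).norm_inverse_le hm (hBK n) f
  -- Weak convergence first. Every weak limit point of `K n f` is some `J v` by `hlsc`, and `⟪K n f,
  -- B n (s n c)⟫ = ⟪f, s n c⟫` tests it against the core, which forces `v = v₀`.
  have hweak : ∀ y, Tendsto (fun n => ⟪K n f, y⟫) atTop (𝓝 ⟪J v₀, y⟫) := by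
    intro y
    rw [tendsto_iff_ultrafilter]
    intro U hU
    obtain ⟨z, -, hz⟩ := exists_weak_limit U (Eventually.of_forall hKf)
    -- The energy of `K n f` is `⟪f, K n f⟫`, hence at most `‖f‖ · m⁻¹‖f‖`; the maximum bounds norm
    -- and energy at once.
    obtain ⟨v, hv⟩ := hlsc U hU (fun n => K n f) z (max (m⁻¹ * ‖f‖) (‖f‖ * (m⁻¹ * ‖f‖))) hz
      (fun n => (hKf n).trans (le_max_left _ _)) (fun n => by
        rw [hBK]
        refine (real_inner_le_norm _ _).trans (le_trans ?_ (le_max_right _ _))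
        gcongr
        exact hKf n)
    have hvv : v = v₀ := by
      have hall : ∀ u, ⟪v - v₀, u⟫ = 0 := by
        intro u
        refine he.induction_on (p := fun u => ⟪v - v₀, u⟫ = 0) u
          (isClosed_eq (by fun_prop) continuous_const) fun c => ?_
        rw [inner_sub_left, sub_eq_zero, hb, hv, hv₀, ContinuousLinearMap.adjoint_inner_left]
        have h1 : Tendsto (fun n => ⟪K n f, B n (s n c)⟫) U (𝓝 ⟪z, b c⟫) := by
          have h2 : Tendsto (fun n => ⟪K n f, B n (s n c) - b c⟫) U (𝓝 0) := by
            refine squeeze_zero_norm (a := fun n => (m⁻¹ * ‖f‖) * ‖B n (s n c) - b c‖)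
              (fun n => ?_) ?_
            · rw [Real.norm_eq_abs]
              exact (abs_real_inner_le_norm _ _).trans (by gcongr; exact hKf n)
            · have := ((tendsto_iff_norm_sub_tendsto_zero.1 (hBs c)).const_mul
                (m⁻¹ * ‖f‖)).mono_left hU
              simpa using this
          have h3 := h2.add (hz (b c))
          simpa [inner_sub_right] using h3
        have h4 : ∀ n, ⟪K n f, B n (s n c)⟫ = ⟪f, s n c⟫ := fun n => by
          rw [← (hB n).symm, hBK]
        simp only [h4] at h1
        exact tendsto_nhds_unique h1 ((tendsto_const_nhds.inner (hs c)).mono_left hU)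
      have := hall (v - v₀)
      rwa [inner_self_eq_zero, sub_eq_zero] at this
    rw [← hvv, hv]
    exact hz y
  rw [Metric.tendsto_atTop']
  intro ε hε
  -- From weak to strong convergence through a core element close to `v₀` in form norm. The factor
  -- `√m` serves the lower bound of `B n`, the factor `1/(‖J‖+1)` the passage to `H`.
  obtain ⟨c, hc⟩ := he.exists_dist_lt v₀ (ε := (ε / 4) * min (Real.sqrt m) (1 / (‖J‖ + 1)))
    (by have := Real.sqrt_pos.2 hm; positivity)
  rw [dist_eq_norm] at hc
  have hc1 : ‖v₀ - e c‖ < (ε / 4) * Real.sqrt m :=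
    hc.trans_le (mul_le_mul_of_nonneg_left (min_le_left _ _) (by positivity))
  have hc2 : ‖J v₀ - J (e c)‖ < ε / 4 := by
    rw [← map_sub]
    have h1 : ‖v₀ - e c‖ < (ε / 4) * (1 / (‖J‖ + 1)) :=
      hc.trans_le (mul_le_mul_of_nonneg_left (min_le_right _ _) (by positivity))
    have h2 := J.le_opNorm (v₀ - e c)
    rw [mul_one_div, lt_div_iff₀ (by positivity)] at h1
    nlinarith [norm_nonneg (v₀ - e c)]
  -- In the expanded energy the quadratic term in `K n f` is the linear quantity `⟪K n f, f⟫`, so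
  -- weak convergence suffices to pass to the limit.
  have hlim : Tendsto (fun n => ⟪B n (K n f - s n c), K n f - s n c⟫) atTop
      (𝓝 (‖v₀ - e c‖ ^ 2)) := by
    have h1 : ∀ n, ⟪B n (K n f - s n c), K n f - s n c⟫
        = ⟪K n f, f⟫ - 2 * ⟪f, s n c⟫ + ⟪B n (s n c), s n c⟫ := by
      intro n
      rw [map_sub, hBK, inner_sub_left, inner_sub_right, inner_sub_right, (hB n).symm (s n c) (K n f),
        hBK, real_inner_comm (s n c) f, real_inner_comm (K n f) f]
      ring
    simp only [h1]
    have h2 : ‖v₀ - e c‖ ^ 2 = ⟪J v₀, f⟫ - 2 * ⟪f, J (e c)⟫ + ⟪b c, J (e c)⟫ := by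
      rw [← real_inner_self_eq_norm_sq, inner_sub_left, inner_sub_right, inner_sub_right,
        hb (e c) c, real_inner_comm v₀ (e c), real_inner_comm (b c)]
      have h3 : ⟪v₀, v₀⟫ = ⟪J v₀, f⟫ := by
        conv_lhs => rw [hv₀]
        rw [ContinuousLinearMap.adjoint_inner_left, ← hv₀, real_inner_comm]
      have h4 : ⟪v₀, e c⟫ = ⟪f, J (e c)⟫ := by
        rw [hv₀, ContinuousLinearMap.adjoint_inner_left]
      rw [h3, h4]
      ring
    rw [h2]
    exact ((hweak f).sub ((tendsto_const_nhds.inner (hs c)).const_mul 2)).add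
      ((hBs c).inner (hs c))
  have hlt : ‖v₀ - e c‖ ^ 2 < m * (ε / 4) ^ 2 := by
    have := pow_lt_pow_left₀ hc1 (norm_nonneg _) two_ne_zero
    rw [mul_pow, Real.sq_sqrt hm.le] at this
    linarith
  have h1 := hlim.eventually (gt_mem_nhds hlt)
  have h2 := (tendsto_iff_norm_sub_tendsto_zero.1 (hs c)).eventually
    (gt_mem_nhds (show (0 : ℝ) < ε / 4 by positivity))
  obtain ⟨N, hN⟩ := eventually_atTop.1 (h1.and h2)
  refine ⟨N, fun n hn => ?_⟩
  obtain ⟨h3, h4⟩ := hN n hn.le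
  have h5 := (hB n).lower (K n f - s n c)
  have h6 : ‖K n f - s n c‖ < ε / 4 := by
    refine lt_of_pow_lt_pow_left₀ 2 (by positivity) ?_
    exact lt_of_mul_lt_mul_left (h5.trans_lt h3) hm.le
  rw [dist_eq_norm]
  have h7 : K n f - J v₀ = (K n f - s n c) + (s n c - J (e c)) - (J v₀ - J (e c)) := by abel
  rw [h7]
  have h8 := norm_sub_le ((K n f - s n c) + (s n c - J (e c))) (J v₀ - J (e c))
  have h9 := norm_add_le (K n f - s n c) (s n c - J (e c))
  linarith

/-- Each power of `R` is traded for one time integral, and `n` nested integrals over `[0,t]` give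
`tⁿ/n!`. -/
theorem abs_inner_pow_le {R : H →L[ℝ] H} {T C : ℝ} {w : ℝ → H}
    (hw : ∀ s ∈ Icc 0 T, ‖w s‖ ≤ C)
    (h : ∀ t ∈ Icc 0 T, ∀ φ, ⟪w t, R φ⟫ = -∫ s in (0 : ℝ)..t, ⟪w s, φ⟫) (n : ℕ) (φ : H) :
    ∀ t ∈ Icc 0 T, |⟪w t, (R ^ n) φ⟫| ≤ C * ‖φ‖ * (t ^ n / n.factorial) := by
  induction n with
  | zero =>
    intro t ht
    have h1 := hw t ht
    simp only [pow_zero, Nat.factorial_zero, Nat.cast_one, div_one, mul_one]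
    exact (abs_real_inner_le_norm _ _).trans (mul_le_mul_of_nonneg_right h1 (norm_nonneg _))
  | succ n ih =>
    intro t ht
    have h1 : (R ^ (n + 1)) φ = R ((R ^ n) φ) := by rw [pow_succ']; rfl
    rw [h1, h t ht, abs_neg, ← Real.norm_eq_abs]
    have h2 : ∀ s ∈ Ioc 0 t, ‖⟪w s, (R ^ n) φ⟫‖ ≤ C * ‖φ‖ * (s ^ n / n.factorial) :=
      fun s hs => ih s ⟨hs.1.le, hs.2.trans ht.2⟩
    refine (intervalIntegral.norm_integral_le_of_norm_le ht.1
      (ae_of_all _ h2) (Continuous.intervalIntegrable (by fun_prop) _ _)).trans ?_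
    rw [intervalIntegral.integral_const_mul, intervalIntegral.integral_div, integral_pow,
      Nat.factorial_succ]
    refine le_of_eq ?_
    push_cast
    field_simp
    simp

/-- Formally `R w' = -w` with `w_0 = 0`. The preceding lemma with `φ = Rⁿ w_t` makes `‖Rⁿ w_t‖`
decay factorially. For symmetric `R` these norms are log-convex in `n`, so they cannot decay faster
than geometrically unless `R w_t = 0`. Neither positivity nor compactness of `R` enters. -/
theorem eq_zero_of_inner_eq_neg_integral {R : H →L[ℝ] H} (hR : ∀ x y, ⟪R x, y⟫ = ⟪x, R y⟫)
    (hRi : ∀ x, R x = 0 → x = 0) {T C : ℝ} {w : ℝ → H} (hw : ∀ s ∈ Icc 0 T, ‖w s‖ ≤ C)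
    (h : ∀ t ∈ Icc 0 T, ∀ φ, ⟪w t, R φ⟫ = -∫ s in (0 : ℝ)..t, ⟪w s, φ⟫) :
    ∀ t ∈ Icc 0 T, w t = 0 := by
  intro t ht
  by_contra hne
  have hRw : 0 < ‖R (w t)‖ := norm_pos_iff.2 fun h0 => hne (hRi _ h0)
  have hwt := hw t ht
  have hC : 0 ≤ C := (norm_nonneg _).trans hwt
  have hsymm : ∀ n (x y : H), ⟪(R ^ n) x, y⟫ = ⟪x, (R ^ n) y⟫ := by
    intro n
    induction n with
    | zero => intro x y; rfl
    | succ n ih =>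
      intro x y
      have h1 : ∀ z, (R ^ (n + 1)) z = R ((R ^ n) z) := fun z => by rw [pow_succ']; rfl
      have h2 : ∀ z, (R ^ (n + 1)) z = (R ^ n) (R z) := fun z => by rw [pow_succ]; rfl
      rw [h1 x, h2 y, hR, ih]
  have hdouble : ∀ n x, (R ^ n) ((R ^ n) x) = (R ^ (n + n)) x := fun n x => by
    rw [pow_add]; rfl
  have hpow : ∀ n, ‖(R ^ n) (w t)‖ ≤ C * (t ^ n / n.factorial) := by
    intro n
    have h1 := abs_inner_pow_le hw h n ((R ^ n) (w t)) t ht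
    rw [← hsymm, real_inner_self_eq_norm_sq, abs_of_nonneg (by positivity)] at h1
    rcases (norm_nonneg ((R ^ n) (w t))).eq_or_lt with h0 | h0
    · rw [← h0]
      have := ht.1
      positivity
    · refine le_of_mul_le_mul_right ?_ h0
      linarith
  -- Log-convexity along powers of two: `‖Rⁿ w‖² = ⟪w, R²ⁿ w⟫ ≤ C‖R²ⁿ w‖`, iterated by doubling `n`.
  have hlog : ∀ k : ℕ, ‖R (w t)‖ ^ (2 ^ k) * C ≤ C ^ (2 ^ k) * ‖(R ^ (2 ^ k)) (w t)‖ := by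
    intro k
    induction k with
    | zero => simp [mul_comm]
    | succ k ih =>
      have h1 : ‖(R ^ (2 ^ k)) (w t)‖ ^ 2 ≤ C * ‖(R ^ (2 ^ (k + 1))) (w t)‖ := by
        rw [← real_inner_self_eq_norm_sq, hsymm, hdouble, ← two_mul, ← pow_succ']
        exact (real_inner_le_norm _ _).trans (by gcongr)
      rcases hC.eq_or_lt with hC0 | hC0
      · rw [← hC0]
        simp
      refine le_of_mul_le_mul_right ?_ hC0
      calc ‖R (w t)‖ ^ (2 ^ (k + 1)) * C * C = (‖R (w t)‖ ^ (2 ^ k) * C) ^ 2 := by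
            rw [mul_pow, ← pow_mul, pow_succ 2 k]; ring
        _ ≤ (C ^ (2 ^ k) * ‖(R ^ (2 ^ k)) (w t)‖) ^ 2 := by gcongr
        _ = C ^ (2 ^ (k + 1)) * ‖(R ^ (2 ^ k)) (w t)‖ ^ 2 := by
            rw [mul_pow, ← pow_mul, pow_succ 2 k]
        _ ≤ C ^ (2 ^ (k + 1)) * (C * ‖(R ^ (2 ^ (k + 1))) (w t)‖) := by gcongr
        _ = _ := by ring
  have hC0 : 0 < C := by
    refine lt_of_lt_of_le (norm_pos_iff.2 hne) hwt
  have hfin : ∀ k : ℕ, 1 ≤ (C * t / ‖R (w t)‖) ^ (2 ^ k) / (2 ^ k).factorial := by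
    intro k
    have h1 := (hlog k).trans (mul_le_mul_of_nonneg_left (hpow (2 ^ k)) (by positivity))
    have h2 : ‖R (w t)‖ ^ (2 ^ k) ≤ C ^ (2 ^ k) * (t ^ (2 ^ k) / (2 ^ k).factorial) :=
      le_of_mul_le_mul_right (by linarith) hC0
    rw [div_pow, mul_pow, div_div, le_div_iff₀ (by positivity), one_mul]
    rw [← mul_div_assoc, le_div_iff₀ (by positivity)] at h2
    exact h2
  have ht1 := (FloorSemiring.tendsto_pow_div_factorial_atTop (C * t / ‖R (w t)‖)).comp
    (tendsto_pow_atTop_atTop_of_one_lt (one_lt_two : (1 : ℕ) < 2))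
  have := ge_of_tendsto' ht1 hfin
  linarith

end AbstractLimits

/-! ### The jump law and its tails -/

section JumpLaw

variable {γ : ℝ}

theorem summable_abs_rpow (hγ : 1 < γ) :
    Summable fun z : ℤ => if z = 0 then (0 : ℝ) else 1 / |(z : ℝ)| ^ (γ + 1) := by
  refine (Real.summable_abs_int_rpow (b := γ + 1) (by linarith)).congr fun z => ?_
  split_ifs with h
  · subst h
    simp only [Int.cast_zero, abs_zero]
    rw [Real.zero_rpow (by linarith)]
  · rw [Real.rpow_neg (abs_nonneg _), one_div]

theorem cGamma_pos (hγ : 1 < γ) : 0 < cGamma γ := by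
  refine inv_pos.2 ?_
  refine (summable_abs_rpow hγ).tsum_pos (fun z => ?_) 1 ?_
  · split_ifs <;> positivity
  · simp

theorem jump_nonneg (hγ : 1 < γ) (z : ℤ) : 0 ≤ jump γ z := by
  have := cGamma_pos hγ
  unfold jump
  split_ifs <;> positivity

theorem jump_neg (z : ℤ) : jump γ (-z) = jump γ z := by
  simp [jump]

theorem jump_sub_comm (x y : ℤ) : jump γ (x - y) = jump γ (y - x) := by
  rw [← jump_neg, neg_sub]

/-- The mass that the jump law gives to `{n, n+1, …}`. -/
def tail (γ : ℝ) (n : ℝ) : ℝ := ∑' k : ℕ, cGamma γ / (n + k) ^ (γ + 1)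

/-- The middle quantity is `∫ s^(-γ-1) ds` over `[a, a+1]`, hence a value of the decreasing
integrand at an intermediate point. Summed over unit steps, this compares the tails with integrals.
-/
theorem rpow_sub_rpow_mem (hγ : 1 < γ) {a : ℝ} (ha : 0 < a) :
    γ⁻¹ * (a ^ (-γ) - (a + 1) ^ (-γ)) ∈ Icc (1 / (a + 1) ^ (γ + 1)) (1 / a ^ (γ + 1)) := by
  have hd : ∀ s ∈ Ioo a (a + 1), HasDerivAt (fun s : ℝ => -γ⁻¹ * s ^ (-γ)) (s ^ (-γ - 1)) s := by
    intro s hs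
    have hs0 : s ≠ 0 := (ha.trans hs.1).ne'
    have := (Real.hasDerivAt_rpow_const (x := s) (p := -γ) (Or.inl hs0)).const_mul (-γ⁻¹)
    refine this.congr_deriv ?_
    have : γ ≠ 0 := by linarith
    field_simp
  have hc : ContinuousOn (fun s : ℝ => -γ⁻¹ * s ^ (-γ)) (Icc a (a + 1)) := by
    refine ContinuousOn.mul continuousOn_const ?_
    exact ContinuousOn.rpow_const continuousOn_id fun s hs => Or.inl (ha.trans_le hs.1).ne'
  obtain ⟨c, hc1, hc2⟩ := exists_hasDerivAt_eq_slope _ _ (by linarith) hc hd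
  have h1 : γ⁻¹ * (a ^ (-γ) - (a + 1) ^ (-γ)) = c ^ (-γ - 1) := by
    rw [hc2]
    field_simp
    ring
  have h2 : ∀ s : ℝ, 0 < s → 1 / s ^ (γ + 1) = s ^ (-γ - 1) := by
    intro s hs
    rw [show -γ - 1 = -(γ + 1) by ring, Real.rpow_neg hs.le, one_div]
  rw [h1, h2 _ (by linarith), h2 _ ha]
  have hc0 : 0 < c := ha.trans hc1.1
  constructor
  · exact Real.rpow_le_rpow_of_nonpos hc0 hc1.2.le (by linarith)
  · exact Real.rpow_le_rpow_of_nonpos ha hc1.1.le (by linarith)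

theorem summable_tail (hγ : 1 < γ) {n : ℝ} (hn : 0 < n) :
    Summable fun k : ℕ => cGamma γ / (n + k) ^ (γ + 1) := by
  have h : Summable fun k : ℕ => (n + k) ^ (-(γ + 1)) := by
    have := (Real.summable_nat_rpow_inv (p := γ + 1)).2 (by linarith)
    refine (summable_nat_add_iff 1).1 ?_
    refine Summable.of_nonneg_of_le (fun k => by positivity) (fun k => ?_)
      ((summable_nat_add_iff 1).2 this)
    rw [← Real.rpow_neg (by positivity)]
    refine Real.rpow_le_rpow_of_nonpos (by positivity) ?_ (by linarith)
    push_cast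
    linarith
  refine (h.mul_left (cGamma γ)).congr fun k => ?_
  rw [Real.rpow_neg (by positivity), div_eq_mul_inv]

theorem tendsto_rpow_neg_shift (hγ : 1 < γ) (n : ℝ) :
    Tendsto (fun k : ℕ => (n + k) ^ (-γ)) atTop (𝓝 0) := by
  have h1 : Tendsto (fun k : ℕ => n + (k : ℝ)) atTop atTop :=
    tendsto_atTop_add_const_left _ _ tendsto_natCast_atTop_atTop
  exact (tendsto_rpow_neg_atTop (by linarith : 0 < γ)).comp h1

/-- The lower bounds telescope. Together with `tail_le`, which loses one lattice unit, this gives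
the exact asymptotics of the reservoir rates. -/
theorem le_tail (hγ : 1 < γ) {n : ℝ} (hn : 0 < n) :
    cGamma γ * γ⁻¹ * n ^ (-γ) ≤ tail γ n := by
  have hs := (summable_tail hγ hn).hasSum.tendsto_sum_nat
  have h1 : Tendsto (fun M : ℕ => cGamma γ * γ⁻¹ * (n ^ (-γ) - (n + M) ^ (-γ))) atTop
      (𝓝 (cGamma γ * γ⁻¹ * (n ^ (-γ) - 0))) :=
    (tendsto_const_nhds.sub (tendsto_rpow_neg_shift hγ n)).const_mul _
  rw [sub_zero] at h1
  refine le_of_tendsto_of_tendsto' h1 hs fun M => ?_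
  induction M with
  | zero => simp
  | succ M ih =>
    rw [Finset.sum_range_succ]
    have h2 := (rpow_sub_rpow_mem hγ (a := n + M) (by positivity)).2
    have h3 := mul_le_mul_of_nonneg_left h2 (cGamma_pos hγ).le
    push_cast
    rw [← add_assoc]
    rw [mul_one_div] at h3
    nlinarith

theorem tail_le (hγ : 1 < γ) {n : ℝ} (hn : 0 < n) :
    tail γ (n + 1) ≤ cGamma γ * γ⁻¹ * n ^ (-γ) := by
  have hs := (summable_tail hγ (by linarith : 0 < n + 1)).hasSum.tendsto_sum_nat
  refine le_of_tendsto' hs fun M => ?_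
  have hind : ∑ k ∈ Finset.range M, cGamma γ / (n + 1 + k) ^ (γ + 1) ≤
      cGamma γ * γ⁻¹ * (n ^ (-γ) - (n + M) ^ (-γ)) := by
    induction M with
    | zero => simp
    | succ M ih =>
      rw [Finset.sum_range_succ]
      have h2 := (rpow_sub_rpow_mem hγ (a := n + M) (by positivity)).1
      have h3 := mul_le_mul_of_nonneg_left h2 (cGamma_pos hγ).le
      push_cast
      rw [← add_assoc]
      rw [mul_one_div] at h3
      have h4 : n + 1 + M = n + M + 1 := by ring
      rw [h4]
      nlinarith
  refine hind.trans ?_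
  have : 0 ≤ (n + M : ℝ) ^ (-γ) := by positivity
  have hc := cGamma_pos hγ
  have h5 : 0 ≤ cGamma γ * γ⁻¹ := by positivity
  nlinarith

theorem tsum_jump_left {x : ℤ} (hx : 1 ≤ x) :
    ∑' y : Set.Iic (0 : ℤ), jump γ (x - (y : ℤ)) = tail γ x := by
  let e : ℕ ≃ Set.Iic (0 : ℤ) :=
    { toFun := fun k => ⟨-(k : ℤ), by simp⟩
      invFun := fun y => (-(y : ℤ)).toNat
      left_inv := fun k => by simp
      right_inv := fun y => by
        have := y.2
        rw [Set.mem_Iic] at this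
        ext
        simp [Int.toNat_of_nonneg (by omega : 0 ≤ -(y : ℤ))] }
  rw [← e.tsum_eq, tail]
  refine tsum_congr fun k => ?_
  have h1 : x - ((e k : Set.Iic (0 : ℤ)) : ℤ) = x + k := by simp [e]
  rw [h1, jump, if_neg (by omega)]
  have h2 : (0 : ℝ) ≤ x := by exact_mod_cast (by omega : 0 ≤ x)
  push_cast
  rw [abs_of_nonneg (by positivity)]

theorem tsum_jump_right {x : ℤ} {N : ℕ} (hx : x ≤ N - 1) :
    ∑' y : Set.Ici (N : ℤ), jump γ (x - (y : ℤ)) = tail γ (N - x) := by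
  let e : ℕ ≃ Set.Ici (N : ℤ) :=
    { toFun := fun k => ⟨N + k, by simp⟩
      invFun := fun y => ((y : ℤ) - N).toNat
      left_inv := fun k => by simp
      right_inv := fun y => by
        have := y.2
        rw [Set.mem_Ici] at this
        refine Subtype.ext ?_
        change (N : ℤ) + (((y : ℤ) - N).toNat : ℤ) = y
        omega }
  rw [← e.tsum_eq, tail]
  refine tsum_congr fun k => ?_
  have h1 : x - ((e k : Set.Ici (N : ℤ)) : ℤ) = -(N - x + k) := by simp [e]; ring
  rw [h1, jump_neg, jump, if_neg (by omega)]
  have h2 : (0 : ℝ) ≤ N - x := by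
    have : (0 : ℤ) ≤ N - x := by omega
    exact_mod_cast this
  push_cast
  rw [abs_of_nonneg (by positivity)]

end JumpLaw

/-! ### Lattice sums as integrals -/

section Lattice

/-- The bulk sites as a finset of integers. -/
abbrev bulk (N : ℕ) : Finset ℤ := Finset.Icc (1 : ℤ) ((N : ℤ) - 1)

theorem measurable_floor_mul (N : ℕ) : Measurable fun u : ℝ => ⌊(N : ℝ) * u⌋ :=
  Int.measurable_floor.comp (measurable_const.mul measurable_id)

theorem floor_mul_eq_iff {N : ℕ} (hN : 0 < N) (u : ℝ) (x : ℤ) :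
    ⌊(N : ℝ) * u⌋ = x ↔ u ∈ Ico ((x : ℝ) / N) ((x + 1) / N) := by
  have hN' : (0 : ℝ) < N := by exact_mod_cast hN
  rw [Int.floor_eq_iff, Set.mem_Ico, div_le_iff₀ hN', lt_div_iff₀ hN', mul_comm]

/-- The level sets of `u ↦ ⌊N u⌋` on `(0,1)` are cells of length `1/N`, one for each of `0, …, N-1`.
The cell of `0` carries no bulk site, whence the condition on `F 0`. -/
theorem lintegral_floor {N : ℕ} (hN : 0 < N) (F : ℤ → ℝ≥0∞) (hF : F 0 = 0) :
    ∫⁻ u in Ioo (0 : ℝ) 1, F ⌊(N : ℝ) * u⌋ = (N : ℝ≥0∞)⁻¹ * ∑ x ∈ bulk N, F x := by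
  have hN' : (0 : ℝ) < N := by exact_mod_cast hN
  have h1 : ∀ u ∈ Ioo (0 : ℝ) 1, F ⌊(N : ℝ) * u⌋ =
      ∑ x ∈ bulk N, (Ico ((x : ℝ) / N) ((x + 1) / N)).indicator (fun _ => F x) u := by
    intro u hu
    have h2 : ∀ x : ℤ, (Ico ((x : ℝ) / N) ((x + 1) / N)).indicator (fun _ => F x) u =
        if ⌊(N : ℝ) * u⌋ = x then F x else 0 := by
      intro x
      rw [Set.indicator_apply]
      simp only [floor_mul_eq_iff hN]
    simp only [h2, Finset.sum_ite_eq]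
    split_ifs with h3
    · rfl
    · have h4 : ⌊(N : ℝ) * u⌋ = 0 := by
        have h5 : 0 ≤ ⌊(N : ℝ) * u⌋ := Int.floor_nonneg.2 (mul_nonneg hN'.le hu.1.le)
        have h6 : ⌊(N : ℝ) * u⌋ < N := by
          rw [Int.floor_lt]
          push_cast
          nlinarith [hu.2]
        rw [Finset.mem_Icc] at h3
        omega
      rw [h4, hF]
  rw [setLIntegral_congr_fun measurableSet_Ioo h1, lintegral_finsetSum _ fun x _ =>
    measurable_const.indicator measurableSet_Ico, Finset.mul_sum]
  refine Finset.sum_congr rfl fun x hx => ?_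
  rw [lintegral_indicator measurableSet_Ico, lintegral_const, Measure.restrict_restrict
    measurableSet_Ico, Measure.restrict_apply_univ]
  have hsub : Ico ((x : ℝ) / N) ((x + 1) / N) ⊆ Ioo 0 1 := by
    rw [Finset.mem_Icc] at hx
    intro u hu
    have hx1 : (1 : ℝ) ≤ x := by exact_mod_cast hx.1
    have hx2 : (x : ℝ) ≤ N - 1 := by exact_mod_cast hx.2
    refine ⟨lt_of_lt_of_le (by positivity) hu.1, hu.2.trans_le ?_⟩
    rw [div_le_one hN']
    linarith
  rw [Set.inter_eq_left.2 hsub, Real.volume_Ico, mul_comm]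
  congr 1
  rw [← sub_div, add_sub_cancel_left, one_div, ENNReal.ofReal_inv_of_pos hN',
    ENNReal.ofReal_natCast]

theorem integral_floor {N : ℕ} (hN : 0 < N) (F : ℤ → ℝ) (hF : F 0 = 0) :
    ∫ u in Ioo (0 : ℝ) 1, F ⌊(N : ℝ) * u⌋ = (N : ℝ)⁻¹ * ∑ x ∈ bulk N, F x := by
  have hm : AEStronglyMeasurable (fun u => F ⌊(N : ℝ) * u⌋) (volume.restrict (Ioo (0 : ℝ) 1)) :=
    ((measurable_of_countable F).comp (measurable_floor_mul N)).aestronglyMeasurable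
  have hfin : ∀ G : ℤ → ℝ, (N : ℝ≥0∞)⁻¹ * ∑ x ∈ bulk N, ENNReal.ofReal (G x) ≠ ⊤ := by
    intro G
    refine ENNReal.mul_ne_top (ENNReal.inv_ne_top.2 (by exact_mod_cast hN.ne')) ?_
    exact (ENNReal.sum_lt_top.2 fun x _ => ENNReal.ofReal_lt_top).ne
  have hi : Integrable (fun u => F ⌊(N : ℝ) * u⌋) (volume.restrict (Ioo (0 : ℝ) 1)) := by
    refine ⟨hm, ?_⟩
    rw [hasFiniteIntegral_iff_norm]
    rw [lintegral_floor hN (fun x => ENNReal.ofReal ‖F x‖) (by simp [hF])]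
    exact (hfin _).lt_top
  rw [integral_eq_lintegral_pos_part_sub_lintegral_neg_part hi,
    lintegral_floor hN (fun x => ENNReal.ofReal (F x)) (by simp [hF]),
    lintegral_floor hN (fun x => ENNReal.ofReal (-F x)) (by simp [hF]),
    ENNReal.toReal_mul, ENNReal.toReal_mul, ENNReal.toReal_inv, ENNReal.toReal_natCast,
    ENNReal.toReal_sum fun x _ => ENNReal.ofReal_ne_top,
    ENNReal.toReal_sum fun x _ => ENNReal.ofReal_ne_top, ← mul_sub, ← Finset.sum_sub_distrib]
  congr 1
  refine Finset.sum_congr rfl fun x _ => ?_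
  rw [ENNReal.toReal_ofReal', ENNReal.toReal_ofReal', max_zero_sub_eq_self]

end Lattice

/-! ### The space `L²(0,1)` and the discrete generators -/

section DiscreteGenerator

local notation "⟪" x "," y "⟫" => inner ℝ x y

/-- Lebesgue measure on the unit interval. -/
abbrev unitMeas : Measure ℝ := volume.restrict (Ioo (0 : ℝ) 1)

instance : IsProbabilityMeasure unitMeas := ⟨by simp [unitMeas]⟩

/-- The space `L²(0,1)`. -/
abbrev HS : Type := Lp ℝ 2 unitMeas

theorem inner_toLp {Ω : Type*} [MeasurableSpace Ω] {μ : Measure Ω} {f g : Ω → ℝ}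
    (hf : MemLp f 2 μ) (hg : MemLp g 2 μ) :
    ⟪hf.toLp f, hg.toLp g⟫ = ∫ u, f u * g u ∂μ := by
  rw [L2.inner_def]
  refine integral_congr_ae ?_
  filter_upwards [hf.coeFn_toLp, hg.coeFn_toLp] with u h1 h2
  rw [h1, h2, real_inner_eq_re_inner]
  simp [mul_comm]

theorem inner_toLp_left {Ω : Type*} [MeasurableSpace Ω] {μ : Measure Ω} {f : Ω → ℝ}
    (hf : MemLp f 2 μ) (w : Lp ℝ 2 μ) :
    ⟪hf.toLp f, w⟫ = ∫ u, f u * w u ∂μ := by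
  conv_lhs => rw [← Lp.toLp_coeFn w (Lp.memLp w)]
  exact inner_toLp hf (Lp.memLp w)

theorem inner_toLp_right {Ω : Type*} [MeasurableSpace Ω] {μ : Measure Ω} {f : Ω → ℝ}
    (hf : MemLp f 2 μ) (w : Lp ℝ 2 μ) :
    ⟪w, hf.toLp f⟫ = ∫ u, w u * f u ∂μ := by
  rw [real_inner_comm, inner_toLp_left]
  simp only [mul_comm]

theorem norm_sq_toLp {Ω : Type*} [MeasurableSpace Ω] {μ : Measure Ω} {f : Ω → ℝ}
    (hf : MemLp f 2 μ) : ‖hf.toLp f‖ ^ 2 = ∫ u, f u ^ 2 ∂μ := by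
  rw [← real_inner_self_eq_norm_sq, inner_toLp]
  simp only [pow_two]

theorem memLp_two_of_bound {Ω : Type*} [MeasurableSpace Ω] {μ : Measure Ω} [IsFiniteMeasure μ]
    {f : Ω → ℝ} (hf : AEStronglyMeasurable f μ) {C : ℝ} (hC : ∀ᵐ u ∂μ, |f u| ≤ C) :
    MemLp f 2 μ :=
  MemLp.of_bound hf C hC

theorem tendsto_toLp_of_dominated {Ω : Type*} [MeasurableSpace Ω] {μ : Measure Ω}
    [IsFiniteMeasure μ] {f : ℕ → Ω → ℝ} {g : Ω → ℝ} (hf : ∀ n, MemLp (f n) 2 μ) (hg : MemLp g 2 μ)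
    {C : ℝ} (hC : ∀ᶠ n in atTop, ∀ᵐ u ∂μ, |f n u| ≤ C)
    (h : ∀ᵐ u ∂μ, Tendsto (fun n => f n u) atTop (𝓝 (g u))) :
    Tendsto (fun n => (hf n).toLp (f n)) atTop (𝓝 (hg.toLp g)) := by
  rw [tendsto_iff_norm_sub_tendsto_zero]
  have hgC : ∀ᵐ u ∂μ, |g u| ≤ C := by
    obtain ⟨n₀, hn₀⟩ := eventually_atTop.1 hC
    have h1 : ∀ᵐ u ∂μ, ∀ n ≥ n₀, |f n u| ≤ C := by
      rw [ae_all_iff]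
      intro n
      by_cases hn : n ≥ n₀
      · filter_upwards [hn₀ n hn] with u hu _ using hu
      · exact ae_of_all _ fun u h => absurd h hn
    filter_upwards [h, h1] with u hu1 hu2
    exact le_of_tendsto hu1.abs (eventually_atTop.2 ⟨n₀, hu2⟩)
  have h2 : Tendsto (fun n => ∫ u, (f n u - g u) ^ 2 ∂μ) atTop (𝓝 (∫ _, (0 : ℝ) ∂μ)) := by
    refine tendsto_integral_filter_of_dominated_convergence (fun _ => (2 * C) ^ 2) ?_ ?_
      (integrable_const _) ?_
    · exact Eventually.of_forall fun n => ((hf n).1.sub hg.1).pow 2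
    · filter_upwards [hC] with n hn
      filter_upwards [hn, hgC] with u h3 h4
      rw [Real.norm_eq_abs, abs_pow]
      refine pow_le_pow_left₀ (abs_nonneg _) ?_ 2
      exact (abs_sub _ _).trans (by linarith)
    · filter_upwards [h] with u hu
      have := (hu.sub_const (g u)).pow 2
      simpa using this
  have h3 : ∀ n, ‖(hf n).toLp (f n) - hg.toLp g‖ = Real.sqrt (∫ u, (f n u - g u) ^ 2 ∂μ) := by
    intro n
    rw [← MemLp.toLp_sub, eq_comm, Real.sqrt_eq_iff_mul_self_eq]
    · rw [← pow_two, norm_sq_toLp]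
      rfl
    · positivity
    · positivity
  simp only [h3]
  have := (Real.continuous_sqrt.tendsto _).comp h2
  simpa [Function.comp_def] using this

/-- The step function with value `a x` on the cell of the bulk site `x`. -/
def stepFun (N : ℕ) (a : ℤ → ℝ) (u : ℝ) : ℝ :=
  if ⌊(N : ℝ) * u⌋ ∈ bulk N then a ⌊(N : ℝ) * u⌋ else 0

theorem measurable_stepFun (N : ℕ) (a : ℤ → ℝ) : Measurable (stepFun N a) :=
  (measurable_of_countable fun z : ℤ => if z ∈ bulk N then a z else 0).comp (measurable_floor_mul N)

theorem abs_stepFun_le {N : ℕ} {a : ℤ → ℝ} {C : ℝ} (hC : 0 ≤ C) (h : ∀ x ∈ bulk N, |a x| ≤ C)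
    (u : ℝ) : |stepFun N a u| ≤ C := by
  unfold stepFun
  split_ifs with hu
  · exact h _ hu
  · simpa using hC

theorem memLp_stepFun (N : ℕ) (a : ℤ → ℝ) : MemLp (stepFun N a) 2 unitMeas :=
  memLp_two_of_bound (measurable_stepFun N a).aestronglyMeasurable
    (C := ∑ x ∈ bulk N, |a x|) (ae_of_all _ (abs_stepFun_le (by positivity) fun x hx =>
      Finset.single_le_sum (f := fun x => |a x|) (fun _ _ => abs_nonneg _) hx))

/-- The step function as an element of `L²(0,1)`. -/
def stepL (N : ℕ) : (ℤ → ℝ) →ₗ[ℝ] HS where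
  toFun a := (memLp_stepFun N a).toLp _
  map_add' a b := by
    rw [← MemLp.toLp_add]
    congr 1
    ext u
    simp only [stepFun, Pi.add_apply]
    split_ifs <;> simp
  map_smul' c a := by
    rw [RingHom.id_apply, ← MemLp.toLp_const_smul]
    congr 1
    ext u
    simp only [stepFun, Pi.smul_apply]
    split_ifs <;> simp

theorem stepL_apply (N : ℕ) (a : ℤ → ℝ) : stepL N a = (memLp_stepFun N a).toLp _ := rfl

theorem coeFn_stepL (N : ℕ) (a : ℤ → ℝ) : stepL N a =ᵐ[unitMeas] stepFun N a :=
  (memLp_stepFun N a).coeFn_toLp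

theorem stepL_congr {N : ℕ} {a b : ℤ → ℝ} (h : ∀ x ∈ bulk N, a x = b x) :
    stepL N a = stepL N b := by
  rw [stepL_apply, stepL_apply]
  congr 1
  ext u
  unfold stepFun
  split_ifs with hu
  · exact h _ hu
  · rfl

theorem pos_of_mem_bulk {N : ℕ} {x : ℤ} (hx : x ∈ bulk N) : 0 < N := by
  rw [Finset.mem_Icc] at hx
  omega

theorem inner_stepL (N : ℕ) (a b : ℤ → ℝ) :
    ⟪stepL N a, stepL N b⟫ = (N : ℝ)⁻¹ * ∑ x ∈ bulk N, a x * b x := by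
  rw [stepL_apply, stepL_apply, inner_toLp]
  rcases N.eq_zero_or_pos with rfl | hN
  · simp [stepFun, bulk]
  have := integral_floor hN (fun x => (if x ∈ bulk N then a x else 0) *
    (if x ∈ bulk N then b x else 0)) (by simp [bulk])
  simp only [stepFun]
  rw [this]
  congr 1
  refine Finset.sum_congr rfl fun x hx => ?_
  rw [if_pos hx, if_pos hx]

/-- The indicator of the cell of the site `x`. -/
def siteInd (N : ℕ) (x : ℤ) : HS := stepL N (Pi.single x 1)

theorem stepL_eq_sum (N : ℕ) (a : ℤ → ℝ) : stepL N a = ∑ x ∈ bulk N, a x • siteInd N x := by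
  have h : stepL N a = stepL N (∑ x ∈ bulk N, a x • Pi.single x (1 : ℝ)) := by
    refine stepL_congr fun y hy => ?_
    simp only [Finset.sum_apply, Pi.smul_apply, smul_eq_mul, Pi.single_apply, mul_ite, mul_one,
      mul_zero, Finset.sum_ite_eq]
    rw [if_pos hy]
  rw [h, map_sum]
  simp only [map_smul, siteInd]

/-- The average over the cell of the site `x`. -/
def cellAvg (N : ℕ) (x : ℤ) : HS →L[ℝ] ℝ := (N : ℝ) • innerSL ℝ (siteInd N x)

theorem cellAvg_apply (N : ℕ) (x : ℤ) (w : HS) : cellAvg N x w = N * ⟪siteInd N x, w⟫ := by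
  simp [cellAvg]

theorem inner_siteInd {N : ℕ} {x : ℤ} (hx : x ∈ bulk N) (w : HS) :
    ⟪siteInd N x, w⟫ = (N : ℝ)⁻¹ * cellAvg N x w := by
  have : (N : ℝ) ≠ 0 := by exact_mod_cast (pos_of_mem_bulk hx).ne'
  rw [cellAvg_apply, inv_mul_cancel_left₀ this]

theorem inner_stepL_left (N : ℕ) (a : ℤ → ℝ) (w : HS) :
    ⟪stepL N a, w⟫ = (N : ℝ)⁻¹ * ∑ x ∈ bulk N, a x * cellAvg N x w := by
  rw [stepL_eq_sum, sum_inner, Finset.mul_sum]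
  refine Finset.sum_congr rfl fun x hx => ?_
  rw [inner_smul_left, inner_siteInd hx]
  simp only [RCLike.conj_to_real]
  ring

theorem cellAvg_stepL {N : ℕ} {x : ℤ} (hx : x ∈ bulk N) (a : ℤ → ℝ) :
    cellAvg N x (stepL N a) = a x := by
  have hN : (N : ℝ) ≠ 0 := by exact_mod_cast (pos_of_mem_bulk hx).ne'
  rw [cellAvg_apply, siteInd, inner_stepL, mul_inv_cancel_left₀ hN]
  simp only [Pi.single_apply, ite_mul, one_mul, zero_mul, Finset.sum_ite_eq']
  rw [if_pos hx]

theorem norm_stepL_cellAvg_le (N : ℕ) (w : HS) : ‖stepL N fun x => cellAvg N x w‖ ≤ ‖w‖ := by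
  set p := stepL N fun x => cellAvg N x w with hp
  have h1 : ‖p‖ ^ 2 = ⟪p, w⟫ := by
    rw [← real_inner_self_eq_norm_sq, hp, inner_stepL, inner_stepL_left]
  have h2 := real_inner_le_norm p w
  rcases (norm_nonneg p).eq_or_lt with h0 | h0
  · rw [← h0]
    positivity
  · nlinarith

/-- The cell averages give the orthogonal projection to the step functions. -/
theorem norm_sub_stepL_cellAvg_le (N : ℕ) (w : HS) (a : ℤ → ℝ) :
    ‖w - stepL N fun x => cellAvg N x w‖ ≤ ‖w - stepL N a‖ := by
  set p := stepL N fun x => cellAvg N x w with hp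
  have h1 : ⟪w - p, p - stepL N a⟫ = 0 := by
    rw [hp, ← map_sub, real_inner_comm, inner_sub_right, inner_stepL_left, inner_stepL, sub_self]
  have h2 : ‖w - stepL N a‖ ^ 2 = ‖w - p‖ ^ 2 + ‖p - stepL N a‖ ^ 2 := by
    have := norm_add_sq_real (w - p) (p - stepL N a)
    rw [h1, sub_add_sub_cancel] at this
    linarith
  refine le_of_sq_le_sq ?_ (norm_nonneg _)
  rw [h2]
  have : 0 ≤ ‖p - stepL N a‖ ^ 2 := by positivity
  linarith

/-- The total rate of jumps from `x` to the reservoirs. -/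
def resRate (γ : ℝ) (N : ℕ) (x : ℤ) : ℝ := tail γ x + tail γ (N - x)

/-- The discrete operator `-N^γ (e L_N - κ (r⁻ + r⁺))`. -/
def discOp (γ κ e : ℝ) (N : ℕ) (a : ℤ → ℝ) (x : ℤ) : ℝ :=
  (N : ℝ) ^ γ * (e * ∑ y ∈ bulk N, jump γ (x - y) * (a x - a y) + κ * resRate γ N x * a x)

/-- A lower bound for the discrete operators. -/
def lowBd (γ κ : ℝ) : ℝ := 2 * κ * (cGamma γ * γ⁻¹)

/-- The discrete operator as a bounded operator of `L²(0,1)`. -/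
def discGen (γ κ e : ℝ) (N : ℕ) : HS →L[ℝ] HS :=
  -- On step functions the two multiples of `lowBd` cancel and `discOp` is left; on their orthogonal
  -- complement the operator is `lowBd` times the identity. The lower bound thus holds on all of
  -- `L²(0,1)`.
  lowBd γ κ • ContinuousLinearMap.id ℝ HS +
    ∑ x ∈ bulk N, ((N : ℝ) ^ γ • (e • ∑ y ∈ bulk N, jump γ (x - y) • (cellAvg N x - cellAvg N y) +
      (κ * resRate γ N x) • cellAvg N x) - lowBd γ κ • cellAvg N x).smulRight (siteInd N x)

variable {γ κ e : ℝ}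

theorem discGen_apply (N : ℕ) (w : HS) :
    discGen γ κ e N w = lowBd γ κ • w + stepL N fun x =>
      discOp γ κ e N (fun z => cellAvg N z w) x - lowBd γ κ * cellAvg N x w := by
  rw [stepL_eq_sum, discGen]
  simp only [add_apply, sum_apply, smul_apply, sub_apply,
    ContinuousLinearMap.id_apply, ContinuousLinearMap.smulRight_apply, smul_eq_mul, discOp]

theorem discOp_congr {N : ℕ} {a b : ℤ → ℝ} (h : ∀ x ∈ bulk N, a x = b x) {x : ℤ}
    (hx : x ∈ bulk N) : discOp γ κ e N a x = discOp γ κ e N b x := by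
  unfold discOp
  rw [h x hx]
  congr 3
  refine Finset.sum_congr rfl fun y hy => ?_
  rw [h y hy]

theorem cellAvg_discGen {N : ℕ} {x : ℤ} (hx : x ∈ bulk N) (w : HS) :
    cellAvg N x (discGen γ κ e N w) = discOp γ κ e N (fun z => cellAvg N z w) x := by
  rw [discGen_apply, map_add, cellAvg_stepL hx, map_smul, smul_eq_mul]
  ring

theorem discGen_stepL (N : ℕ) (a : ℤ → ℝ) :
    discGen γ κ e N (stepL N a) = stepL N (discOp γ κ e N a) := by
  rw [discGen_apply, ← map_smul, ← map_add]
  refine stepL_congr fun x hx => ?_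
  simp only [Pi.add_apply, Pi.smul_apply, smul_eq_mul]
  rw [cellAvg_stepL hx, discOp_congr (fun y hy => cellAvg_stepL hy a) hx]
  ring

/-- Summation by parts: the symmetry of the jump law symmetrises the bulk term in `x` and `y`, which
yields a Dirichlet form plus a killing term from the reservoirs. -/
theorem sum_discOp_mul (N : ℕ) (a b : ℤ → ℝ) :
    ∑ x ∈ bulk N, discOp γ κ e N a x * b x = (N : ℝ) ^ γ *
      (e / 2 * ∑ x ∈ bulk N, ∑ y ∈ bulk N, jump γ (x - y) * ((a x - a y) * (b x - b y)) +
        κ * ∑ x ∈ bulk N, resRate γ N x * (a x * b x)) := by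
  have h1 : ∑ x ∈ bulk N, ∑ y ∈ bulk N, jump γ (x - y) * ((a x - a y) * (b x - b y)) =
      2 * ∑ x ∈ bulk N, ∑ y ∈ bulk N, jump γ (x - y) * ((a x - a y) * b x) := by
    have h2 : ∑ x ∈ bulk N, ∑ y ∈ bulk N, jump γ (x - y) * ((a x - a y) * b y) =
        -∑ x ∈ bulk N, ∑ y ∈ bulk N, jump γ (x - y) * ((a x - a y) * b x) := by
      rw [Finset.sum_comm, ← Finset.sum_neg_distrib]
      refine Finset.sum_congr rfl fun x _ => ?_
      rw [← Finset.sum_neg_distrib]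
      refine Finset.sum_congr rfl fun y _ => ?_
      rw [jump_sub_comm]
      ring
    have h3 : ∀ x y, jump γ (x - y) * ((a x - a y) * (b x - b y)) =
        jump γ (x - y) * ((a x - a y) * b x) - jump γ (x - y) * ((a x - a y) * b y) := by
      intro x y; ring
    simp only [h3, Finset.sum_sub_distrib]
    rw [h2]
    ring
  rw [h1, mul_add, Finset.mul_sum, Finset.mul_sum, Finset.mul_sum, Finset.mul_sum, Finset.mul_sum,
    ← Finset.sum_add_distrib]
  refine Finset.sum_congr rfl fun x _ => ?_
  have h4 : ∑ y ∈ bulk N, jump γ (x - y) * ((a x - a y) * b x) =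
      (∑ y ∈ bulk N, jump γ (x - y) * (a x - a y)) * b x := by
    rw [Finset.sum_mul]
    refine Finset.sum_congr rfl fun y _ => ?_
    ring
  rw [h4, discOp]
  ring

theorem sum_discOp_mul_comm (N : ℕ) (a b : ℤ → ℝ) :
    ∑ x ∈ bulk N, discOp γ κ e N a x * b x = ∑ x ∈ bulk N, a x * discOp γ κ e N b x := by
  have : ∀ x, a x * discOp γ κ e N b x = discOp γ κ e N b x * a x := fun x => mul_comm _ _
  simp only [this]
  rw [sum_discOp_mul, sum_discOp_mul]
  simp only [mul_comm (b _ - b _), mul_comm (b _)]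

theorem inner_discGen (N : ℕ) (w z : HS) :
    ⟪discGen γ κ e N w, z⟫ = lowBd γ κ * ⟪w, z⟫ + (N : ℝ)⁻¹ *
      (∑ x ∈ bulk N, discOp γ κ e N (fun y => cellAvg N y w) x * cellAvg N x z -
        lowBd γ κ * ∑ x ∈ bulk N, cellAvg N x w * cellAvg N x z) := by
  rw [discGen_apply, inner_add_left, inner_stepL_left, inner_smul_left]
  simp only [RCLike.conj_to_real, sub_mul, Finset.sum_sub_distrib, Finset.mul_sum, mul_assoc]

/-- No bulk site is farther than `N` from either reservoir, so each of the two tails is at least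
`c_γ γ⁻¹ N^(-γ)`; this is the factor 2 in `lowBd`. -/
theorem lowBd_le_resRate (hγ : 1 < γ) (hκ : 0 ≤ κ) {N : ℕ} {x : ℤ} (hx : x ∈ bulk N) :
    lowBd γ κ ≤ (N : ℝ) ^ γ * (κ * resRate γ N x) := by
  have hN : (0 : ℝ) < N := by exact_mod_cast pos_of_mem_bulk hx
  rw [Finset.mem_Icc] at hx
  have hx1 : (1 : ℝ) ≤ x := by exact_mod_cast hx.1
  have hx2 : (x : ℝ) ≤ N - 1 := by exact_mod_cast hx.2
  have hc := cGamma_pos hγ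
  have key : ∀ n : ℝ, 0 < n → n ≤ N → cGamma γ * γ⁻¹ ≤ (N : ℝ) ^ γ * tail γ n := by
    intro n hn hnN
    have h1 := le_tail hγ hn
    have h2 : 1 ≤ (N : ℝ) ^ γ * n ^ (-γ) := by
      rw [Real.rpow_neg hn.le, ← div_eq_mul_inv, one_le_div (by positivity)]
      exact Real.rpow_le_rpow hn.le hnN (by linarith)
    have h3 : 0 ≤ cGamma γ * γ⁻¹ := by positivity
    calc cGamma γ * γ⁻¹ ≤ cGamma γ * γ⁻¹ * ((N : ℝ) ^ γ * n ^ (-γ)) := le_mul_of_one_le_right h3 h2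
      _ = (N : ℝ) ^ γ * (cGamma γ * γ⁻¹ * n ^ (-γ)) := by ring
      _ ≤ _ := by gcongr
  have h1 := key x (by linarith) (by linarith)
  have h2 := key (N - x) (by linarith) (by linarith)
  unfold lowBd resRate
  nlinarith

theorem lowBd_pos (hγ : 1 < γ) (hκ : 0 < κ) : 0 < lowBd γ κ := by
  have := cGamma_pos hγ
  unfold lowBd
  positivity

theorem lowBd_sum_le (hγ : 1 < γ) (hκ : 0 ≤ κ) (he : 0 ≤ e) (N : ℕ) (a : ℤ → ℝ) :
    lowBd γ κ * ∑ x ∈ bulk N, a x * a x ≤ ∑ x ∈ bulk N, discOp γ κ e N a x * a x := by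
  rw [sum_discOp_mul]
  have h1 : 0 ≤ ∑ x ∈ bulk N, ∑ y ∈ bulk N, jump γ (x - y) * ((a x - a y) * (a x - a y)) :=
    Finset.sum_nonneg fun x _ => Finset.sum_nonneg fun y _ =>
      mul_nonneg (jump_nonneg hγ _) (mul_self_nonneg _)
  rw [mul_add]
  have h2 : 0 ≤ (N : ℝ) ^ γ * (e / 2 * ∑ x ∈ bulk N, ∑ y ∈ bulk N, jump γ (x - y) *
      ((a x - a y) * (a x - a y))) := by positivity
  refine le_add_of_nonneg_of_le h2 ?_
  rw [Finset.mul_sum, Finset.mul_sum, Finset.mul_sum]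
  refine Finset.sum_le_sum fun x hx => ?_
  have := mul_le_mul_of_nonneg_right (lowBd_le_resRate hγ hκ hx) (mul_self_nonneg (a x))
  linarith

theorem isSymmGe_discGen (hγ : 1 < γ) (hκ : 0 ≤ κ) (he : 0 ≤ e) (N : ℕ) :
    IsSymmGe (lowBd γ κ) (discGen γ κ e N) := by
  refine ⟨fun w z => ?_, fun w => ?_⟩
  · rw [inner_discGen, real_inner_comm (discGen γ κ e N z) w, inner_discGen,
      real_inner_comm z w, sum_discOp_mul_comm]
    simp only [mul_comm]
  · rw [inner_discGen, real_inner_self_eq_norm_sq]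
    have := lowBd_sum_le (e := e) hγ hκ he N fun x => cellAvg N x w
    have h2 : 0 ≤ (N : ℝ)⁻¹ * (∑ x ∈ bulk N, discOp γ κ e N (fun y => cellAvg N y w) x *
        cellAvg N x w - lowBd γ κ * ∑ x ∈ bulk N, cellAvg N x w * cellAvg N x w) :=
      mul_nonneg (by positivity) (by linarith)
    linarith

/-- What the full form adds is `lowBd` times `‖w‖²` minus the squared norm of the projection of `w`,
which is nonnegative. -/
theorem sum_discOp_cellAvg_le (hγ : 1 < γ) (hκ : 0 ≤ κ) (N : ℕ) (w : HS) :
    (N : ℝ)⁻¹ * ∑ x ∈ bulk N, discOp γ κ e N (fun y => cellAvg N y w) x * cellAvg N x w ≤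
      ⟪discGen γ κ e N w, w⟫ := by
  rw [inner_discGen, mul_sub]
  have h1 : (N : ℝ)⁻¹ * ∑ x ∈ bulk N, cellAvg N x w * cellAvg N x w ≤ ‖w‖ ^ 2 := by
    rw [← inner_stepL, real_inner_self_eq_norm_sq]
    exact pow_le_pow_left₀ (norm_nonneg _) (norm_stepL_cellAvg_le N w) 2
  have h2 : 0 ≤ lowBd γ κ := by
    have := cGamma_pos hγ
    unfold lowBd
    positivity
  rw [real_inner_self_eq_norm_sq]
  nlinarith

theorem tendsto_floor_div (u : ℝ) :
    Tendsto (fun N : ℕ => (⌊(N : ℝ) * u⌋ : ℝ) / N) atTop (𝓝 u) := by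
  have h1 : Tendsto (fun N : ℕ => u - 1 / (N : ℝ)) atTop (𝓝 (u - 0)) :=
    tendsto_const_nhds.sub tendsto_one_div_atTop_nhds_zero_nat
  rw [sub_zero] at h1
  refine tendsto_of_tendsto_of_tendsto_of_le_of_le' h1 tendsto_const_nhds ?_ ?_
  · filter_upwards [eventually_gt_atTop 0] with N hN
    have hN' : (0 : ℝ) < N := by exact_mod_cast hN
    rw [le_div_iff₀ hN', sub_mul, one_div_mul_cancel hN'.ne', mul_comm]
    exact (Int.sub_one_lt_floor _).le
  · filter_upwards [eventually_gt_atTop 0] with N hN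
    have hN' : (0 : ℝ) < N := by exact_mod_cast hN
    rw [div_le_iff₀ hN', mul_comm]
    exact Int.floor_le _

theorem floor_mem_bulk {u : ℝ} {N : ℕ} (hu : u ∈ Ioo (0 : ℝ) 1) (h : 1 / u ≤ N) :
    ⌊(N : ℝ) * u⌋ ∈ bulk N := by
  rw [Finset.mem_Icc]
  constructor
  · rw [Int.le_floor]
    rw [div_le_iff₀ hu.1] at h
    exact_mod_cast h
  · have hN : (0 : ℝ) < N := lt_of_lt_of_le (by have := hu.1; positivity) h
    have : ⌊(N : ℝ) * u⌋ < N := by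
      rw [Int.floor_lt]
      push_cast
      nlinarith [hu.2]
    omega

theorem eventually_floor_mem_bulk {u : ℝ} (hu : u ∈ Ioo (0 : ℝ) 1) :
    ∀ᶠ N : ℕ in atTop, ⌊(N : ℝ) * u⌋ ∈ bulk N := by
  filter_upwards [eventually_ge_atTop ⌈1 / u⌉₊] with N hN
  exact floor_mem_bulk hu (Nat.ceil_le.1 hN)

theorem tendsto_stepL {f : ℕ → ℤ → ℝ} {g : ℝ → ℝ} (hg : MemLp g 2 unitMeas) {C : ℝ}
    (hC : ∀ᶠ N in atTop, ∀ x ∈ bulk N, |f N x| ≤ C)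
    (h : ∀ᵐ u ∂unitMeas, Tendsto (fun N : ℕ => f N ⌊(N : ℝ) * u⌋) atTop (𝓝 (g u))) :
    Tendsto (fun N => stepL N (f N)) atTop (𝓝 (hg.toLp g)) := by
  refine tendsto_toLp_of_dominated (fun N => memLp_stepFun N (f N)) hg (C := max C 0) ?_ ?_
  · filter_upwards [hC] with N hN
    exact ae_of_all _ (abs_stepFun_le (le_max_right _ _) fun x hx => (hN x hx).trans
      (le_max_left _ _))
  · filter_upwards [h, ae_restrict_mem measurableSet_Ioo] with u hu hu1
    refine hu.congr' ?_
    filter_upwards [eventually_floor_mem_bulk hu1] with N hN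
    rw [stepFun, if_pos hN]

theorem div_mem_of_mem_bulk {N : ℕ} {x : ℤ} (hx : x ∈ bulk N) : (x : ℝ) / N ∈ Ioo (0 : ℝ) 1 := by
  have hN : (0 : ℝ) < N := by exact_mod_cast pos_of_mem_bulk hx
  rw [Finset.mem_Icc] at hx
  have hx1 : (1 : ℝ) ≤ x := by exact_mod_cast hx.1
  have hx2 : (x : ℝ) ≤ N - 1 := by exact_mod_cast hx.2
  refine ⟨by positivity, ?_⟩
  rw [div_lt_one hN]
  linarith

theorem memLp_of_continuousOn {φ : ℝ → ℝ} (hφ : ContinuousOn φ (Icc 0 1)) :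
    MemLp φ 2 unitMeas := by
  obtain ⟨C, hC⟩ := isCompact_Icc.exists_bound_of_continuousOn hφ
  refine memLp_two_of_bound (C := C) ?_ ?_
  · exact (hφ.mono Ioo_subset_Icc_self).aestronglyMeasurable measurableSet_Ioo
  · filter_upwards [ae_restrict_mem measurableSet_Ioo] with u hu
    exact hC u (Ioo_subset_Icc_self hu)

theorem tendsto_stepL_sample {φ : ℝ → ℝ} (hφ : ContinuousOn φ (Icc 0 1)) :
    Tendsto (fun N : ℕ => stepL N fun x => φ ((x : ℝ) / N)) atTop
      (𝓝 ((memLp_of_continuousOn hφ).toLp φ)) := by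
  obtain ⟨C, hC⟩ := isCompact_Icc.exists_bound_of_continuousOn hφ
  refine tendsto_stepL _ (C := C) ?_ ?_
  · exact Eventually.of_forall fun N x hx => hC _ (Ioo_subset_Icc_self (div_mem_of_mem_bulk hx))
  · filter_upwards [ae_restrict_mem measurableSet_Ioo] with u hu
    have h1 := (hφ.mono Ioo_subset_Icc_self).continuousAt (Ioo_mem_nhds hu.1 hu.2)
    exact h1.tendsto.comp (tendsto_floor_div u)

theorem exists_continuous_approx (w : HS) {ε : ℝ} (hε : 0 < ε) :
    ∃ (φ : ℝ → ℝ) (hφ : Continuous φ),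
      ‖w - (memLp_of_continuousOn (hφ.continuousOn (s := Icc 0 1))).toLp φ‖ < ε := by
  obtain ⟨g, hg1, hg2⟩ := (Lp.memLp w).exists_boundedContinuous_eLpNorm_sub_le (by simp)
    (ε := ENNReal.ofReal (ε / 2)) (by simpa using hε)
  refine ⟨g, g.continuous, ?_⟩
  have h1 : w - (memLp_of_continuousOn (g.continuous.continuousOn (s := Icc 0 1))).toLp g =
      ((Lp.memLp w).sub hg2).toLp _ := by
    rw [MemLp.toLp_sub (Lp.memLp w) hg2, Lp.toLp_coeFn]
  rw [h1, Lp.norm_toLp]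
  refine lt_of_le_of_lt (ENNReal.toReal_le_of_le_ofReal (by positivity) hg1) (by linarith)

/-- The projection is the best approximation by step functions, hence at least as good as sampling a
nearby continuous function. -/
theorem tendsto_stepL_cellAvg (w : HS) :
    Tendsto (fun N : ℕ => stepL N fun x => cellAvg N x w) atTop (𝓝 w) := by
  rw [Metric.tendsto_atTop']
  intro ε hε
  obtain ⟨φ, hφ, hw⟩ := exists_continuous_approx w (half_pos hε)
  have h1 := (tendsto_iff_norm_sub_tendsto_zero.1 (tendsto_stepL_sample
    (hφ.continuousOn (s := Icc 0 1)))).eventually (gt_mem_nhds (half_pos hε))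
  obtain ⟨N₀, hN₀⟩ := eventually_atTop.1 h1
  refine ⟨N₀, fun N hN => ?_⟩
  rw [dist_comm, dist_eq_norm]
  refine (norm_sub_stepL_cellAvg_le N w fun x => φ ((x : ℝ) / N)).trans_lt ?_
  have h2 := hN₀ N hN.le
  set z := (memLp_of_continuousOn (hφ.continuousOn (s := Icc 0 1))).toLp φ
  have h3 : w - stepL N (fun x => φ ((x : ℝ) / N)) =
      (w - z) - (stepL N (fun x => φ ((x : ℝ) / N)) - z) := by abel
  rw [h3]
  refine (norm_sub_le _ _).trans_lt ?_
  linarith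

end DiscreteGenerator

/-! ### Consistency of the discrete operators -/

section Consistency

variable {γ : ℝ}

/-- The integrable singularity `|z|^{1-γ}`, cut off at distance one. -/
def sing (γ z : ℝ) : ℝ := (Icc (-1 : ℝ) 1).indicator (fun z => |z| ^ (1 - γ)) z

theorem sing_nonneg (z : ℝ) : 0 ≤ sing γ z :=
  Set.indicator_nonneg (fun _ _ => by positivity) _

theorem sing_of_abs_le {z : ℝ} (hz : |z| ≤ 1) : sing γ z = |z| ^ (1 - γ) := by
  rw [sing, Set.indicator_of_mem (Set.mem_Icc.2 (abs_le.1 hz))]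

theorem measurable_sing : Measurable (sing γ) := by
  unfold sing
  exact (measurable_norm.pow_const _).indicator measurableSet_Icc

theorem integrable_sing (hγ2 : γ < 2) : Integrable (sing γ) := by
  unfold sing
  rw [integrable_indicator_iff measurableSet_Icc]
  have h1 : IntervalIntegrable (fun z : ℝ => |z| ^ (1 - γ)) volume 0 1 := by
    refine (intervalIntegral.intervalIntegrable_rpow' (a := 0) (b := 1) (r := 1 - γ)
      (by linarith)).congr fun z hz => ?_
    rw [Set.uIoc_of_le zero_le_one] at hz
    simp only [abs_of_pos hz.1]
  have h2 : IntervalIntegrable (fun z : ℝ => |z| ^ (1 - γ)) volume (-1) 0 := by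
    have := (IntervalIntegrable.iff_comp_neg (f := fun z : ℝ => |z| ^ (1 - γ))
      (a := 0) (b := 1)).1 h1
    simp only [abs_neg, neg_zero] at this
    exact this.symm
  have h3 := h2.trans h1
  rw [intervalIntegrable_iff_integrableOn_Icc_of_le (by norm_num)] at h3
  exact h3

/-- The integral of `sing`. -/
def singMass (γ : ℝ) : ℝ := ∫ z, sing γ z

theorem integrable_sing_sub (hγ2 : γ < 2) (u : ℝ) :
    Integrable (fun v => sing γ (u - v)) unitMeas :=
  ((integrable_sing hγ2).comp_sub_left u).restrict

theorem integral_sing_sub_le (hγ2 : γ < 2) (u : ℝ) :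
    ∫ v, sing γ (u - v) ∂unitMeas ≤ singMass γ := by
  refine (setIntegral_le_integral ((integrable_sing hγ2).comp_sub_left u)
    (ae_of_all _ fun v => sing_nonneg _)).trans ?_
  rw [integral_sub_left_eq_self (fun z => sing γ z) volume u]
  rfl

theorem integrable_sing_prod (hγ2 : γ < 2) :
    Integrable (fun q : ℝ × ℝ => sing γ (q.1 - q.2)) (unitMeas.prod unitMeas) := by
  have hm : Measurable fun q : ℝ × ℝ => sing γ (q.1 - q.2) :=
    measurable_sing.comp (measurable_fst.sub measurable_snd)
  rw [integrable_prod_iff hm.aestronglyMeasurable]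
  refine ⟨ae_of_all _ fun u => integrable_sing_sub hγ2 u, ?_⟩
  refine Integrable.mono' (integrable_const (singMass γ)) ?_ (ae_of_all _ fun u => ?_)
  · exact hm.norm.stronglyMeasurable.integral_prod_right.aestronglyMeasurable
  · have h1 : ∀ v, ‖sing γ (u - v)‖ = sing γ (u - v) := fun v =>
      Real.norm_of_nonneg (sing_nonneg _)
    simp only [h1]
    rw [Real.norm_of_nonneg (integral_nonneg fun v => sing_nonneg _)]
    exact integral_sing_sub_le hγ2 u

/-- Smooth functions which are constant near the end points, with explicit bounds. -/
structure IsProfile (r C : ℝ) (G : ℝ → ℝ) : Prop where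
  pos : 0 < r
  nonneg : 0 ≤ C
  cont : Continuous G
  contDeriv : Continuous (deriv G)
  -- The margin `2r` exceeds the radius `r` of the compensation in `regInc`. So where `G'` does not
  -- vanish the symmetric window around `u` stays inside `(0,1)`, and the odd term has zero
  -- integral.
  deriv_eq_zero : ∀ u ∈ Ioo (0 : ℝ) 1, (u < 2 * r ∨ 1 - 2 * r < u) → deriv G u = 0
  bound : ∀ u ∈ Ioo (0 : ℝ) 1, |G u| ≤ C
  lip : ∀ a ∈ Ioo (0 : ℝ) 1, ∀ b ∈ Ioo (0 : ℝ) 1, |G a - G b| ≤ C * |a - b|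
  taylor : ∀ a ∈ Ioo (0 : ℝ) 1, ∀ b ∈ Ioo (0 : ℝ) 1, |G b - G a - deriv G a * (b - a)| ≤ C * (b - a) ^ 2

/-- The increment of `G`, compensated near the diagonal. -/
def regInc (r : ℝ) (G : ℝ → ℝ) (a b : ℝ) : ℝ :=
  G b - G a - if |b - a| ≤ r then deriv G a * (b - a) else 0

variable {r C : ℝ} {G : ℝ → ℝ}

/-- Near the diagonal this is Taylor's formula. Beyond distance `r` the crude bound `2C` is at most
`(2C/r²)(b-a)²`. -/
theorem IsProfile.abs_regInc_le (hG : IsProfile r C G) {a b : ℝ} (ha : a ∈ Ioo (0 : ℝ) 1)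
    (hb : b ∈ Ioo (0 : ℝ) 1) : |regInc r G a b| ≤ (C + 2 * C / r ^ 2) * (b - a) ^ 2 := by
  have hr := hG.pos
  have hC := hG.nonneg
  unfold regInc
  split_ifs with h
  · refine (hG.taylor a ha b hb).trans (mul_le_mul_of_nonneg_right ?_ (by positivity))
    have : 0 ≤ 2 * C / r ^ 2 := by positivity
    linarith
  · rw [sub_zero]
    have h1 := hG.bound a ha
    have h2 := hG.bound b hb
    have h3 : |G b - G a| ≤ 2 * C := (abs_sub _ _).trans (by linarith)
    have h4 : r ^ 2 ≤ (b - a) ^ 2 := by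
      rw [← sq_abs (b - a)]
      exact pow_le_pow_left₀ hr.le (not_le.1 h).le 2
    have h5 : 2 * C ≤ 2 * C / r ^ 2 * (b - a) ^ 2 := by
      rw [div_mul_eq_mul_div, le_div_iff₀ (by positivity)]
      gcongr
    have h6 : 0 ≤ C * (b - a) ^ 2 := by positivity
    linarith

theorem sq_div_abs_rpow (a b : ℝ) :
    (b - a) ^ 2 / |a - b| ^ (1 + γ) = if a = b then 0 else |a - b| ^ (1 - γ) := by
  split_ifs with h
  · simp [h]
  · have h1 : 0 < |a - b| := abs_pos.2 (sub_ne_zero.2 h)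
    rw [← neg_sub a b, neg_sq, ← sq_abs, ← Real.rpow_natCast, ← Real.rpow_sub h1]
    congr 1
    push_cast
    ring

/-- The compensated kernel. -/
def regKer (γ r : ℝ) (G : ℝ → ℝ) (a b : ℝ) : ℝ := regInc r G a b / |a - b| ^ (1 + γ)

theorem IsProfile.abs_regKer_le (hG : IsProfile r C G) {a b : ℝ}
    (ha : a ∈ Ioo (0 : ℝ) 1) (hb : b ∈ Ioo (0 : ℝ) 1) :
    |regKer γ r G a b| ≤ (C + 2 * C / r ^ 2) * if a = b then 0 else |a - b| ^ (1 - γ) := by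
  rw [regKer, abs_div, abs_of_nonneg (by positivity : 0 ≤ |a - b| ^ (1 + γ)),
    ← sq_div_abs_rpow a b, ← mul_div_assoc]
  gcongr
  exact hG.abs_regInc_le ha hb

theorem abs_sub_lt_one {a b : ℝ} (ha : a ∈ Ioo (0 : ℝ) 1) (hb : b ∈ Ioo (0 : ℝ) 1) :
    |a - b| ≤ 1 := by
  rw [abs_le]
  constructor <;> linarith [ha.1, ha.2, hb.1, hb.2]

theorem IsProfile.abs_regKer_le_sing (hG : IsProfile r C G) {a b : ℝ}
    (ha : a ∈ Ioo (0 : ℝ) 1) (hb : b ∈ Ioo (0 : ℝ) 1) :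
    |regKer γ r G a b| ≤ (C + 2 * C / r ^ 2) * sing γ (a - b) := by
  have hC := hG.nonneg
  have hr := hG.pos
  refine (hG.abs_regKer_le ha hb).trans ?_
  gcongr
  rw [sing_of_abs_le (abs_sub_lt_one ha hb)]
  split_ifs
  · positivity
  · rfl

/-- Comparison of the lattice distance with the distance. -/
theorem abs_sub_le_two_mul {N : ℕ} (hN : 0 < N) {u v : ℝ}
    (h : ⌊(N : ℝ) * u⌋ ≠ ⌊(N : ℝ) * v⌋) :
    |u - v| ≤ 2 * |(⌊(N : ℝ) * u⌋ : ℝ) / N - (⌊(N : ℝ) * v⌋ : ℝ) / N| := by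
  have hN' : (0 : ℝ) < N := by exact_mod_cast hN
  set x := ⌊(N : ℝ) * u⌋
  set y := ⌊(N : ℝ) * v⌋
  have h1 : (1 : ℝ) ≤ |(x : ℝ) - y| := by
    have : 1 ≤ |x - y| := Int.one_le_abs (sub_ne_zero.2 h)
    exact_mod_cast this
  have h2 : (N : ℝ) * |u - v| ≤ |(x : ℝ) - y| + 1 := by
    have e0 : (N : ℝ) * |u - v| = |N * u - N * v| := by
      rw [← mul_sub, abs_mul, abs_of_pos hN']
    rw [e0]
    have e1 := Int.floor_le ((N : ℝ) * u)
    have e2 := Int.lt_floor_add_one ((N : ℝ) * u)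
    have e3 := Int.floor_le ((N : ℝ) * v)
    have e4 := Int.lt_floor_add_one ((N : ℝ) * v)
    change (x : ℝ) ≤ _ at e1
    change _ < (x : ℝ) + 1 at e2
    change (y : ℝ) ≤ _ at e3
    change _ < (y : ℝ) + 1 at e4
    rw [abs_le]
    constructor
    · linarith [neg_abs_le ((x : ℝ) - y)]
    · linarith [le_abs_self ((x : ℝ) - y)]
  rw [← sub_div, abs_div, abs_of_pos hN', ← mul_div_assoc, le_div_iff₀ hN']
  linarith

/-- Points in distinct cells have lattice distance at least `|u-v|/2`, and the exponent `1-γ` is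
negative. This provides one integrable majorant for the discrete kernels of all `N`. -/
theorem lattice_sing_le (hγ : 1 < γ) {N : ℕ} {u v : ℝ} (hu : u ∈ Ioo (0 : ℝ) 1)
    (hv : v ∈ Ioo (0 : ℝ) 1) (hN : 0 < N) :
    (if (⌊(N : ℝ) * u⌋ : ℝ) / N = (⌊(N : ℝ) * v⌋ : ℝ) / N then 0 else
      |(⌊(N : ℝ) * u⌋ : ℝ) / N - (⌊(N : ℝ) * v⌋ : ℝ) / N| ^ (1 - γ)) ≤
        2 ^ (γ - 1) * sing γ (u - v) := by
  split_ifs with h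
  · exact mul_nonneg (by positivity) (sing_nonneg _)
  · have h0 : ⌊(N : ℝ) * u⌋ ≠ ⌊(N : ℝ) * v⌋ := fun h1 => h (by rw [h1])
    have h1 := abs_sub_le_two_mul hN h0
    have h2 : 0 < |u - v| := by
      refine abs_pos.2 (sub_ne_zero.2 fun h3 => h0 (by rw [h3]))
    rw [sing_of_abs_le (abs_sub_lt_one hu hv)]
    have h3 : |u - v| / 2 ≤ |(⌊(N : ℝ) * u⌋ : ℝ) / N - (⌊(N : ℝ) * v⌋ : ℝ) / N| := by linarith
    refine (Real.rpow_le_rpow_of_nonpos (by positivity) h3 (by linarith)).trans (le_of_eq ?_)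
    rw [Real.div_rpow (abs_nonneg _) (by norm_num), div_eq_mul_inv, ← Real.rpow_neg (by norm_num),
      neg_sub, mul_comm]

/-! #### The continuous operator -/

/-- The reflection `v ↦ 2u - v` preserves the window and changes the sign of the integrand. -/
theorem integral_odd_eq_zero (u : ℝ) {ε : ℝ} :
    ∫ v in {v : ℝ | ε ≤ |u - v| ∧ |u - v| ≤ r}, (v - u) / |u - v| ^ (1 + γ) = 0 := by
  have hmeas : MeasurableSet {v : ℝ | ε ≤ |u - v| ∧ |u - v| ≤ r} := by
    have h1 : Measurable fun v : ℝ => |u - v| := (measurable_const.sub measurable_id).abs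
    exact (measurableSet_le measurable_const h1).inter (measurableSet_le h1 measurable_const)
  rw [← integral_indicator hmeas]
  have h := integral_sub_left_eq_self ({v : ℝ | ε ≤ |u - v| ∧ |u - v| ≤ r}.indicator
    fun v => (v - u) / |u - v| ^ (1 + γ)) volume (2 * u)
  have h2 : ∀ v, {v : ℝ | ε ≤ |u - v| ∧ |u - v| ≤ r}.indicator
      (fun v => (v - u) / |u - v| ^ (1 + γ)) (2 * u - v) =
      -{v : ℝ | ε ≤ |u - v| ∧ |u - v| ≤ r}.indicator (fun v => (v - u) / |u - v| ^ (1 + γ)) v := by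
    intro v
    have e1 : |u - (2 * u - v)| = |u - v| := by rw [← abs_neg]; congr 1; ring
    simp only [Set.indicator_apply, Set.mem_ofPred_eq, e1]
    split_ifs
    · rw [← neg_div]; congr 1; ring
    · simp
  simp only [h2, integral_neg] at h
  linarith

theorem measurable_regKer (hG : IsProfile r C G) (u : ℝ) : Measurable fun v => regKer γ r G u v := by
  have h1 : Measurable fun v : ℝ => |u - v| := (measurable_const.sub measurable_id).abs
  have h2 : Measurable fun v : ℝ => |v - u| := (measurable_id.sub measurable_const).abs
  unfold regKer regInc
  refine Measurable.div ?_ (h1.pow_const _)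
  refine (hG.cont.measurable.sub measurable_const).sub ?_
  exact Measurable.ite (measurableSet_le h2 measurable_const)
    (measurable_const.mul (measurable_id.sub measurable_const)) measurable_const

theorem IsProfile.integrable_regKer (hγ2 : γ < 2) (hG : IsProfile r C G) {u : ℝ}
    (hu : u ∈ Ioo (0 : ℝ) 1) : Integrable (fun v => regKer γ r G u v) unitMeas := by
  refine Integrable.mono' ((integrable_sing_sub hγ2 u).const_mul (C + 2 * C / r ^ 2))
    (measurable_regKer hG u).aestronglyMeasurable ?_
  filter_upwards [ae_restrict_mem measurableSet_Ioo] with v hv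
  exact hG.abs_regKer_le_sing hu hv

/-- Removing the linear term near the diagonal changes none of the truncated integrals, because that
term is odd about `u`. The compensated kernel is absolutely integrable as `γ < 2`, so the principal
value becomes an ordinary integral. -/
theorem IsProfile.regionalLaplacian_eq (hγ : 1 < γ) (hγ2 : γ < 2) (hG : IsProfile r C G) {u : ℝ}
    (hu : u ∈ Ioo (0 : ℝ) 1) :
    regionalLaplacian γ G u = cGamma γ * ∫ v, regKer γ r G u v ∂unitMeas := by
  have hr := hG.pos
  unfold regionalLaplacian
  congr 1
  refine Tendsto.limUnder_eq ?_
  have hInt := hG.integrable_regKer hγ2 hu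
  have hInt' : IntegrableOn (fun v => regKer γ r G u v) (Icc 0 1) := by
    rw [integrableOn_Icc_iff_integrableOn_Ioo]
    exact hInt
  have hm : Measurable fun v : ℝ => |u - v| := (measurable_const.sub measurable_id).abs
  have hS : ∀ ε : ℝ, MeasurableSet {v : ℝ | v ∈ Icc (0 : ℝ) 1 ∧ ε ≤ |u - v|} := fun ε =>
    measurableSet_Icc.inter (measurableSet_le measurable_const hm)
  have hA : ∀ ε : ℝ, MeasurableSet {v : ℝ | ε ≤ |u - v| ∧ |u - v| ≤ r} := fun ε =>
    (measurableSet_le measurable_const hm).inter (measurableSet_le hm measurable_const)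
  have h1 : ∀ᶠ ε in 𝓝[>] (0 : ℝ),
      ∫ v in {v : ℝ | v ∈ Icc (0 : ℝ) 1 ∧ ε ≤ |u - v|}, regKer γ r G u v =
      ∫ v in {v : ℝ | v ∈ Icc (0 : ℝ) 1 ∧ ε ≤ |u - v|}, (G v - G u) / |u - v| ^ (1 + γ) := by
    filter_upwards [self_mem_nhdsWithin] with ε hε
    rw [Set.mem_Ioi] at hε
    by_cases hd : deriv G u = 0
    · refine setIntegral_congr_fun (hS ε) fun v _ => ?_
      simp [regKer, regInc, hd]
    have hu2 : 2 * r ≤ u ∧ u ≤ 1 - 2 * r := by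
      constructor
      · by_contra h
        exact hd (hG.deriv_eq_zero u hu (Or.inl (not_le.1 h)))
      · by_contra h
        exact hd (hG.deriv_eq_zero u hu (Or.inr (not_le.1 h)))
    have hsub : {v : ℝ | ε ≤ |u - v| ∧ |u - v| ≤ r} ⊆ {v : ℝ | v ∈ Icc (0 : ℝ) 1 ∧ ε ≤ |u - v|} := by
      rintro v ⟨hv1, hv2⟩
      rw [abs_le] at hv2
      exact ⟨⟨by linarith [hv2.1, hv2.2], by linarith [hv2.1, hv2.2]⟩, hv1⟩
    have e1 : ∀ v, regKer γ r G u v + {v : ℝ | ε ≤ |u - v| ∧ |u - v| ≤ r}.indicator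
        (fun v => deriv G u * ((v - u) / |u - v| ^ (1 + γ))) v =
        (if ε ≤ |u - v| then (G v - G u) / |u - v| ^ (1 + γ) else regKer γ r G u v) := by
      intro v
      unfold regKer regInc
      rw [Set.indicator_apply, abs_sub_comm v u]
      simp only [Set.mem_ofPred_eq]
      by_cases c1 : ε ≤ |u - v| <;> by_cases c2 : |u - v| ≤ r <;> simp [c1, c2]; ring
    have e2 : ∫ v in {v : ℝ | v ∈ Icc (0 : ℝ) 1 ∧ ε ≤ |u - v|}, (G v - G u) / |u - v| ^ (1 + γ) =
        ∫ v in {v : ℝ | v ∈ Icc (0 : ℝ) 1 ∧ ε ≤ |u - v|}, (regKer γ r G u v +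
          {v : ℝ | ε ≤ |u - v| ∧ |u - v| ≤ r}.indicator
        (fun v => deriv G u * ((v - u) / |u - v| ^ (1 + γ))) v) := by
      refine setIntegral_congr_fun (hS ε) fun v hv => ?_
      rw [e1, if_pos hv.2]
    have hbd : IntegrableOn ({v : ℝ | ε ≤ |u - v| ∧ |u - v| ≤ r}.indicator
        (fun v => deriv G u * ((v - u) / |u - v| ^ (1 + γ))))
        {v : ℝ | v ∈ Icc (0 : ℝ) 1 ∧ ε ≤ |u - v|} := by
      have hfin : volume {v : ℝ | v ∈ Icc (0 : ℝ) 1 ∧ ε ≤ |u - v|} < ⊤ :=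
        (measure_mono (fun v hv => hv.1)).trans_lt (measure_Icc_lt_top (a := (0 : ℝ)) (b := 1))
      refine Measure.integrableOn_of_bounded hfin.ne (M := |deriv G u| * (r / ε ^ (1 + γ))) ?_ ?_
      · refine (Measurable.indicator ?_ (hA ε)).aestronglyMeasurable
        exact measurable_const.mul ((measurable_id.sub measurable_const).div (hm.pow_const _))
      · refine ae_of_all _ fun v => ?_
        rw [Set.indicator_apply]
        split_ifs with hv
        · rw [Real.norm_eq_abs, abs_mul, abs_div, abs_of_nonneg (by positivity :
            0 ≤ |u - v| ^ (1 + γ)), abs_sub_comm v u]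
          gcongr
          · exact hv.2
          · exact hv.1
        · rw [norm_zero]
          positivity
    rw [e2, integral_add (hInt'.mono_set fun v hv => hv.1) hbd, setIntegral_indicator (hA ε),
      Set.inter_eq_right.2 hsub, integral_const_mul, integral_odd_eq_zero]
    simp
  refine Tendsto.congr' h1 ?_
  have h2 : ∫ v, regKer γ r G u v ∂unitMeas = ∫ v in Icc (0 : ℝ) 1, regKer γ r G u v := by
    rw [integral_Icc_eq_integral_Ioo]
  rw [h2]
  have h3 : ∀ ε : ℝ, ∫ v in {v : ℝ | v ∈ Icc (0 : ℝ) 1 ∧ ε ≤ |u - v|}, regKer γ r G u v =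
      ∫ v in Icc (0 : ℝ) 1, {v : ℝ | ε ≤ |u - v|}.indicator (fun v => regKer γ r G u v) v := by
    intro ε
    rw [setIntegral_indicator (measurableSet_le measurable_const hm)]
    rfl
  simp only [h3]
  refine tendsto_integral_filter_of_dominated_convergence (fun v => ‖regKer γ r G u v‖) ?_ ?_
    hInt'.norm ?_
  · exact Eventually.of_forall fun ε => ((measurable_regKer hG u).indicator
      (measurableSet_le measurable_const hm)).aestronglyMeasurable
  · exact Eventually.of_forall fun ε => ae_of_all _ fun v => norm_indicator_le_norm_self _ _
  · refine ae_of_all _ fun v => ?_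
    by_cases hv : u = v
    · subst hv
      have : regKer γ r G u u = 0 := by simp [regKer, regInc]
      refine tendsto_const_nhds.congr fun ε => ?_
      rw [Set.indicator_apply]
      split_ifs <;> simp [this]
    · refine tendsto_const_nhds.congr' ?_
      have h4 : (0 : ℝ) < |u - v| := abs_pos.2 (sub_ne_zero.2 hv)
      filter_upwards [Ioo_mem_nhdsGT h4] with ε hε
      rw [Set.indicator_of_mem]
      exact hε.2.le

/-! #### The discrete operator -/

/-- The discrete regional Laplacian of a sampled function. -/
def discLap (γ : ℝ) (N : ℕ) (G : ℝ → ℝ) (x : ℤ) : ℝ :=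
  (N : ℝ) ^ γ * ∑ y ∈ bulk N, jump γ (x - y) * (G ((y : ℝ) / N) - G ((x : ℝ) / N))

/-- The lattice form of the same cancellation: `y ↦ 2x - y` maps the window to itself, and the
margins keep it in the bulk. -/
theorem sum_odd_eq_zero {N : ℕ} {x : ℤ} (h1 : 2 * r ≤ (x : ℝ) / N) (h2 : (x : ℝ) / N ≤ 1 - 2 * r)
    (hr : 0 < r) (hN : 0 < N) :
    ∑ y ∈ bulk N, jump γ (x - y) *
      (if |(y : ℝ) / N - (x : ℝ) / N| ≤ r then ((y : ℝ) / N - (x : ℝ) / N) else 0) = 0 := by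
  have hN' : (0 : ℝ) < N := by exact_mod_cast hN
  have key : ∀ y : ℤ, |(y : ℝ) / N - (x : ℝ) / N| ≤ r → 2 * x - y ∈ bulk N := by
    intro y hy
    rw [abs_le] at hy
    have e1 : (0 : ℝ) < (2 * x - y) / N := by
      rw [sub_div, mul_div_assoc]
      linarith [hy.1, hy.2]
    have e2 : (2 * x - y : ℝ) / N < 1 := by
      rw [sub_div, mul_div_assoc]
      linarith [hy.1, hy.2]
    rw [div_lt_one hN'] at e2
    rw [lt_div_iff₀ hN', zero_mul] at e1
    have e1' : 0 < 2 * x - y := by exact_mod_cast e1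
    have e2' : 2 * x - y < N := by exact_mod_cast e2
    rw [Finset.mem_Icc]
    omega
  rw [← Finset.sum_filter_add_sum_filter_not (bulk N)
    (fun y : ℤ => |(y : ℝ) / N - (x : ℝ) / N| ≤ r)]
  have hz : ∑ y ∈ (bulk N).filter (fun y : ℤ => ¬|(y : ℝ) / N - (x : ℝ) / N| ≤ r), jump γ (x - y) *
      (if |(y : ℝ) / N - (x : ℝ) / N| ≤ r then ((y : ℝ) / N - (x : ℝ) / N) else 0) = 0 := by
    refine Finset.sum_eq_zero fun y hy => ?_
    rw [if_neg (Finset.mem_filter.1 hy).2, mul_zero]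
  rw [hz, add_zero]
  have hrefl : ∀ y : ℤ, ((2 * x - y : ℤ) : ℝ) / N - (x : ℝ) / N = -((y : ℝ) / N - (x : ℝ) / N) := by
    intro y
    push_cast
    ring
  have hS : ∑ y ∈ (bulk N).filter (fun y : ℤ => |(y : ℝ) / N - (x : ℝ) / N| ≤ r), jump γ (x - y) *
      (if |(y : ℝ) / N - (x : ℝ) / N| ≤ r then ((y : ℝ) / N - (x : ℝ) / N) else 0) =
      -∑ y ∈ (bulk N).filter (fun y : ℤ => |(y : ℝ) / N - (x : ℝ) / N| ≤ r), jump γ (x - y) *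
      (if |(y : ℝ) / N - (x : ℝ) / N| ≤ r then ((y : ℝ) / N - (x : ℝ) / N) else 0) := by
    rw [← Finset.sum_neg_distrib]
    refine Finset.sum_bij' (fun y _ => 2 * x - y) (fun y _ => 2 * x - y) ?_ ?_ ?_ ?_ ?_
    · intro y hy
      rw [Finset.mem_filter] at hy ⊢
      refine ⟨key y hy.2, ?_⟩
      rw [hrefl, abs_neg]
      exact hy.2
    · intro y hy
      rw [Finset.mem_filter] at hy ⊢
      refine ⟨key y hy.2, ?_⟩
      rw [hrefl, abs_neg]
      exact hy.2
    · intro y _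
      ring
    · intro y _
      ring
    · intro y hy
      have h3 := (Finset.mem_filter.1 hy).2
      rw [hrefl, abs_neg, if_pos h3, if_pos h3, show x - (2 * x - y) = y - x by ring,
        jump_sub_comm y x]
      ring
  linarith

theorem IsProfile.discLap_eq_sum (hG : IsProfile r C G) {N : ℕ} {x : ℤ} (hx : x ∈ bulk N) :
    discLap γ N G x =
      (N : ℝ) ^ γ * ∑ y ∈ bulk N, jump γ (x - y) * regInc r G ((x : ℝ) / N) ((y : ℝ) / N) := by
  unfold discLap
  congr 1
  have h1 : ∀ y : ℤ, jump γ (x - y) * regInc r G ((x : ℝ) / N) ((y : ℝ) / N) =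
      jump γ (x - y) * (G ((y : ℝ) / N) - G ((x : ℝ) / N)) - deriv G ((x : ℝ) / N) *
        (jump γ (x - y) *
          (if |(y : ℝ) / N - (x : ℝ) / N| ≤ r then ((y : ℝ) / N - (x : ℝ) / N) else 0)) := by
    intro y
    unfold regInc
    split_ifs <;> ring
  simp only [h1, Finset.sum_sub_distrib, ← Finset.mul_sum]
  by_cases hd : deriv G ((x : ℝ) / N) = 0
  · rw [hd, zero_mul, sub_zero]
  · have hu := div_mem_of_mem_bulk hx
    have h2 : 2 * r ≤ (x : ℝ) / N := by
      by_contra h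
      exact hd (hG.deriv_eq_zero _ hu (Or.inl (not_le.1 h)))
    have h3 : (x : ℝ) / N ≤ 1 - 2 * r := by
      by_contra h
      exact hd (hG.deriv_eq_zero _ hu (Or.inr (not_le.1 h)))
    rw [sum_odd_eq_zero h2 h3 hG.pos (pos_of_mem_bulk hx), mul_zero, sub_zero]

/-- Scaling of the jump law: `N^(γ+1) p(x-y)` is the continuous kernel at `x/N, y/N`. The diagonal
has to be killed by `z`, because `p(0) = 0`. -/
theorem rpow_mul_jump {N : ℕ} (hN : 0 < N) (x y : ℤ) (z : ℝ) (hz : x = y → z = 0) :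
    (N : ℝ) ^ (γ + 1) * (jump γ (x - y) * z) =
      cGamma γ * (z / |(x : ℝ) / N - (y : ℝ) / N| ^ (1 + γ)) := by
  have hN' : (0 : ℝ) < N := by exact_mod_cast hN
  by_cases h : x = y
  · rw [hz h]
    simp
  · rw [jump, if_neg (sub_ne_zero.2 h), ← sub_div, abs_div, abs_of_pos hN',
      Real.div_rpow (abs_nonneg _) hN'.le, add_comm 1 γ]
    push_cast
    have h1 : 0 < |(x : ℝ) - y| := abs_pos.2 (sub_ne_zero.2 (by exact_mod_cast h))
    have h2 : 0 < |(x : ℝ) - y| ^ (γ + 1) := by positivity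
    have h3 : 0 < (N : ℝ) ^ (γ + 1) := by positivity
    field_simp

theorem IsProfile.discLap_eq_integral (hG : IsProfile r C G) {N : ℕ} {x : ℤ} (hx : x ∈ bulk N) :
    discLap γ N G x = cGamma γ * ∫ v, stepFun N
      (fun y => regKer γ r G ((x : ℝ) / N) ((y : ℝ) / N)) v ∂unitMeas := by
  have hN := pos_of_mem_bulk hx
  have hN' : (0 : ℝ) < N := by exact_mod_cast hN
  unfold stepFun
  rw [integral_floor hN (fun y => if y ∈ bulk N then
    regKer γ r G ((x : ℝ) / N) ((y : ℝ) / N) else 0) (by simp [bulk]), hG.discLap_eq_sum hx,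
    Finset.mul_sum, Finset.mul_sum, Finset.mul_sum]
  refine Finset.sum_congr rfl fun y hy => ?_
  rw [if_pos hy]
  have h1 := rpow_mul_jump (γ := γ) hN x y (regInc r G ((x : ℝ) / N) ((y : ℝ) / N)) (by
    rintro rfl
    simp [regInc])
  unfold regKer
  rw [Real.rpow_add hN', Real.rpow_one] at h1
  rw [mul_left_comm (cGamma γ), ← h1]
  field_simp

/-- The uniform bound for the discrete Laplacian of a profile. -/
def lapBound (γ r C : ℝ) : ℝ :=
  cGamma γ * ((C + 2 * C / r ^ 2) * (2 ^ (γ - 1) * singMass γ))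

theorem floor_mul_div {N : ℕ} (hN : 0 < N) (x : ℤ) : ⌊(N : ℝ) * ((x : ℝ) / N)⌋ = x := by
  have hN' : (N : ℝ) ≠ 0 := by exact_mod_cast hN.ne'
  rw [mul_div_cancel₀ _ hN', Int.floor_intCast]

theorem IsProfile.abs_stepFun_regKer_le (hγ : 1 < γ) (hG : IsProfile r C G)
    {N : ℕ} {u v : ℝ} (hu : u ∈ Ioo (0 : ℝ) 1) (hx : ⌊(N : ℝ) * u⌋ ∈ bulk N)
    (hv : v ∈ Ioo (0 : ℝ) 1) :
    |stepFun N (fun y => regKer γ r G ((⌊(N : ℝ) * u⌋ : ℝ) / N) ((y : ℝ) / N)) v| ≤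
      (C + 2 * C / r ^ 2) * (2 ^ (γ - 1) * sing γ (u - v)) := by
  have hN := pos_of_mem_bulk hx
  have hC := hG.nonneg
  unfold stepFun
  split_ifs with h
  · refine (hG.abs_regKer_le (div_mem_of_mem_bulk hx) (div_mem_of_mem_bulk h)).trans ?_
    exact mul_le_mul_of_nonneg_left (lattice_sing_le hγ hu hv hN) (by positivity)
  · rw [abs_zero]
    have := sing_nonneg (γ := γ) (u - v)
    positivity

theorem IsProfile.abs_discLap_le (hγ : 1 < γ) (hγ2 : γ < 2) (hG : IsProfile r C G) {N : ℕ} {x : ℤ}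
    (hx : x ∈ bulk N) : |discLap γ N G x| ≤ lapBound γ r C := by
  have hN := pos_of_mem_bulk hx
  have hc := cGamma_pos hγ
  have hC := hG.nonneg
  have hu := div_mem_of_mem_bulk hx
  have hfl := floor_mul_div hN x
  rw [hG.discLap_eq_integral hx, abs_mul, abs_of_pos hc, lapBound]
  refine mul_le_mul_of_nonneg_left ?_ hc.le
  rw [← Real.norm_eq_abs]
  refine (norm_integral_le_of_norm_le (g := fun v => (C + 2 * C / r ^ 2) *
    (2 ^ (γ - 1) * sing γ ((x : ℝ) / N - v))) ?_ ?_).trans ?_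
  · exact ((integrable_sing_sub hγ2 _).const_mul _).const_mul _
  · filter_upwards [ae_restrict_mem measurableSet_Ioo] with v hv
    have := hG.abs_stepFun_regKer_le hγ hu (by rw [hfl]; exact hx) hv
    rw [hfl] at this
    exact this
  · rw [integral_const_mul, integral_const_mul]
    gcongr
    exact integral_sing_sub_le hγ2 _

/-- The discrete Laplacian is the integral of a step version of the compensated kernel, dominated by
a multiple of `sing (u - v)`. -/
theorem IsProfile.tendsto_discLap (hγ : 1 < γ) (hγ2 : γ < 2) (hG : IsProfile r C G) {u : ℝ}
    (hu : u ∈ Ioo (0 : ℝ) 1) :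
    Tendsto (fun N : ℕ => discLap γ N G ⌊(N : ℝ) * u⌋) atTop (𝓝 (regionalLaplacian γ G u)) := by
  rw [hG.regionalLaplacian_eq hγ hγ2 hu]
  have hev : ∀ᶠ N : ℕ in atTop, cGamma γ * ∫ v, stepFun N
      (fun y => regKer γ r G ((⌊(N : ℝ) * u⌋ : ℝ) / N) ((y : ℝ) / N)) v ∂unitMeas =
      discLap γ N G ⌊(N : ℝ) * u⌋ := by
    filter_upwards [eventually_floor_mem_bulk hu] with N hN
    rw [hG.discLap_eq_integral hN]
  refine Tendsto.congr' hev (Tendsto.const_mul _ ?_)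
  refine tendsto_integral_filter_of_dominated_convergence (fun v => (C + 2 * C / r ^ 2) *
    (2 ^ (γ - 1) * sing γ (u - v))) ?_ ?_
    (((integrable_sing_sub hγ2 _).const_mul _).const_mul _) ?_
  · exact Eventually.of_forall fun N => (measurable_stepFun N _).aestronglyMeasurable
  · filter_upwards [eventually_floor_mem_bulk hu] with N hN
    filter_upwards [ae_restrict_mem measurableSet_Ioo] with v hv
    exact hG.abs_stepFun_regKer_le hγ hu hN hv
  -- The compensated kernel may be discontinuous at `v = u` and where the cut-off `|v-u| = r`
  -- switches; these three points are null.
  · have hne : ∀ c : ℝ, ∀ᵐ v ∂unitMeas, v ≠ c := fun c => Measure.ae_ne _ c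
    filter_upwards [ae_restrict_mem measurableSet_Ioo, hne u, hne (u + r), hne (u - r)]
      with v hv h1 h2 h3
    have hva := tendsto_floor_div u
    have hvb := tendsto_floor_div v
    have hlim : Tendsto (fun N : ℕ => regKer γ r G ((⌊(N : ℝ) * u⌋ : ℝ) / N)
        ((⌊(N : ℝ) * v⌋ : ℝ) / N)) atTop (𝓝 (regKer γ r G u v)) := by
      unfold regKer
      have hpos : 0 < |u - v| := abs_pos.2 (sub_ne_zero.2 (Ne.symm h1))
      refine Tendsto.div ?_ ?_ (by positivity)
      · unfold regInc
        refine (((hG.cont.tendsto v).comp hvb).sub ((hG.cont.tendsto u).comp hva)).sub ?_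
        have hd := (hvb.sub hva).abs
        have hne' : |v - u| ≠ r := by
          intro h
          rcases abs_cases (v - u) with ⟨h4, _⟩ | ⟨h4, _⟩
          · exact h2 (by linarith)
          · exact h3 (by linarith)
        rcases lt_or_gt_of_ne hne' with h4 | h4
        · rw [if_pos h4.le]
          refine Tendsto.congr' ?_ (((hG.contDeriv.tendsto u).comp hva).mul (hvb.sub hva))
          filter_upwards [hd.eventually (gt_mem_nhds h4)] with N hN
          rw [if_pos hN.le]
          rfl
        · rw [if_neg (not_le.2 h4)]
          refine Tendsto.congr' ?_ tendsto_const_nhds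
          filter_upwards [hd.eventually (lt_mem_nhds h4)] with N hN
          rw [if_neg (not_le.2 hN)]
      · exact ((hva.sub hvb).abs).rpow_const (Or.inl hpos.ne')
    refine hlim.congr' ?_
    filter_upwards [eventually_floor_mem_bulk hv] with N hN
    rw [stepFun, if_pos hN]

end Consistency

/-! ### Convergence of the discrete generators on profiles -/

section Core

local notation "⟪" x "," y "⟫" => inner ℝ x y

variable {γ κ e : ℝ}

/-- The integral bound applies only after a shift by one, so the first term is split off; this
covers `n = 1`. -/
theorem tail_le_two_mul (hγ : 1 < γ) {n : ℝ} (hn : 1 ≤ n) :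
    tail γ n ≤ 2 * cGamma γ * n ^ (-γ) := by
  have hc := cGamma_pos hγ
  have hn0 : 0 < n := by linarith
  have h1 : tail γ n = cGamma γ / n ^ (γ + 1) + tail γ (n + 1) := by
    rw [tail, (summable_tail hγ hn0).tsum_eq_zero_add, tail]
    simp only [Nat.cast_zero, add_zero, Nat.cast_add, Nat.cast_one]
    congr 1
    refine tsum_congr fun k => ?_
    congr 2
    ring
  have h2 := tail_le hγ hn0
  have h3 : cGamma γ / n ^ (γ + 1) ≤ cGamma γ * n ^ (-γ) := by
    rw [Real.rpow_neg hn0.le, ← div_eq_mul_inv]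
    gcongr
    linarith
  have h4 : cGamma γ * γ⁻¹ * n ^ (-γ) ≤ cGamma γ * n ^ (-γ) := by
    have : γ⁻¹ ≤ 1 := inv_le_one_of_one_le₀ hγ.le
    have h5 : 0 ≤ n ^ (-γ) := by positivity
    nlinarith [mul_nonneg hc.le h5]
  rw [h1]
  linarith

theorem rpow_mul_rpow_neg {N : ℕ} (hN : 0 < N) {n : ℝ} (hn : 0 < n) :
    (N : ℝ) ^ γ * n ^ (-γ) = (n / N) ^ (-γ) := by
  have hN' : (0 : ℝ) < N := by exact_mod_cast hN
  rw [Real.div_rpow hn.le hN'.le, Real.rpow_neg hN'.le, div_inv_eq_mul, mul_comm]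

theorem rpow_mul_tail_le (hγ : 1 < γ) {N : ℕ} (hN : 0 < N) {n r : ℝ} (hn : 1 ≤ n) (hr : 0 < r)
    (h : r ≤ n / N) : (N : ℝ) ^ γ * tail γ n ≤ 2 * cGamma γ * r ^ (-γ) := by
  have hc := cGamma_pos hγ
  calc (N : ℝ) ^ γ * tail γ n ≤ (N : ℝ) ^ γ * (2 * cGamma γ * n ^ (-γ)) := by
        gcongr
        exact tail_le_two_mul hγ hn
    _ = 2 * cGamma γ * (n / N) ^ (-γ) := by
        rw [← rpow_mul_rpow_neg hN (by linarith)]; ring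
    _ ≤ _ := by
        refine mul_le_mul_of_nonneg_left ?_ (by positivity)
        exact Real.rpow_le_rpow_of_nonpos hr h (by linarith)

theorem tail_nonneg (hγ : 1 < γ) {n : ℝ} (hn : 0 ≤ n) : 0 ≤ tail γ n := by
  have hc := cGamma_pos hγ
  exact tsum_nonneg fun k => by positivity

/-- Squeezed between the integral bounds at `n` and at `n - 1`, whose difference disappears after
division by `N`. -/
theorem tendsto_rpow_mul_tail (hγ : 1 < γ) {n : ℕ → ℝ} {a : ℝ} (ha : 0 < a)
    (hn : Tendsto (fun N : ℕ => n N / N) atTop (𝓝 a)) :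
    Tendsto (fun N : ℕ => (N : ℝ) ^ γ * tail γ (n N)) atTop (𝓝 (cGamma γ * γ⁻¹ * a ^ (-γ))) := by
  have hbig : ∀ᶠ N : ℕ in atTop, 1 < n N := by
    have h1 : Tendsto (fun N : ℕ => n N / N * N) atTop atTop :=
      hn.pos_mul_atTop ha tendsto_natCast_atTop_atTop
    filter_upwards [h1.eventually_gt_atTop 1, eventually_gt_atTop 0] with N hN hN0
    have : (N : ℝ) ≠ 0 := by exact_mod_cast hN0.ne'
    rwa [div_mul_cancel₀ _ this] at hN
  have hn' : Tendsto (fun N : ℕ => (n N - 1) / N) atTop (𝓝 a) := by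
    have := hn.sub tendsto_one_div_atTop_nhds_zero_nat
    simpa [sub_div] using this
  have hup : Tendsto (fun N : ℕ => cGamma γ * γ⁻¹ * ((n N - 1) / N) ^ (-γ)) atTop
      (𝓝 (cGamma γ * γ⁻¹ * a ^ (-γ))) := (hn'.rpow_const (Or.inl ha.ne')).const_mul _
  have hlo : Tendsto (fun N : ℕ => cGamma γ * γ⁻¹ * (n N / N) ^ (-γ)) atTop
      (𝓝 (cGamma γ * γ⁻¹ * a ^ (-γ))) := (hn.rpow_const (Or.inl ha.ne')).const_mul _
  refine tendsto_of_tendsto_of_tendsto_of_le_of_le' hlo hup ?_ ?_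
  · filter_upwards [hbig, eventually_gt_atTop 0] with N hN hN0
    rw [← rpow_mul_rpow_neg hN0 (by linarith)]
    have := mul_le_mul_of_nonneg_left (le_tail hγ (by linarith : 0 < n N))
      (by positivity : 0 ≤ (N : ℝ) ^ γ)
    linarith
  · filter_upwards [hbig, eventually_gt_atTop 0] with N hN hN0
    rw [← rpow_mul_rpow_neg hN0 (by linarith)]
    have h2 := tail_le hγ (by linarith : 0 < n N - 1)
    rw [sub_add_cancel] at h2
    have := mul_le_mul_of_nonneg_left h2 (by positivity : 0 ≤ (N : ℝ) ^ γ)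
    linarith

theorem tendsto_tail_left (hγ : 1 < γ) {u : ℝ} (hu : u ∈ Ioo (0 : ℝ) 1) :
    Tendsto (fun N : ℕ => (N : ℝ) ^ γ * tail γ ⌊(N : ℝ) * u⌋) atTop (𝓝 (rMinus γ u)) :=
  tendsto_rpow_mul_tail hγ hu.1 (tendsto_floor_div u)

theorem tendsto_tail_right (hγ : 1 < γ) {u : ℝ} (hu : u ∈ Ioo (0 : ℝ) 1) :
    Tendsto (fun N : ℕ => (N : ℝ) ^ γ * tail γ (N - ⌊(N : ℝ) * u⌋)) atTop (𝓝 (rPlus γ u)) := by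
  refine tendsto_rpow_mul_tail hγ (sub_pos.2 hu.2) ?_
  refine (tendsto_const_nhds.sub (tendsto_floor_div u)).congr' ?_
  filter_upwards [eventually_gt_atTop 0] with N hN
  have : (N : ℝ) ≠ 0 := by exact_mod_cast hN.ne'
  rw [sub_div, div_self this]

/-- Profiles which vanish near the end points. -/
structure IsCore (r C : ℝ) (G : ℝ → ℝ) : Prop extends IsProfile r C G where
  eq_zero : ∀ u ∈ Ioo (0 : ℝ) 1, (u < 2 * r ∨ 1 - 2 * r < u) → G u = 0

variable {r C E : ℝ} {G : ℝ → ℝ}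

/-- The limiting operator `κ V₁ - e 𝕃`. -/
def coreOp (γ κ e : ℝ) (G : ℝ → ℝ) (u : ℝ) : ℝ :=
  κ * (V₁ γ u * G u) - e * regionalLaplacian γ G u

theorem discOp_sample (N : ℕ) (x : ℤ) :
    discOp γ κ e N (fun x => G ((x : ℝ) / N)) x =
      κ * (((N : ℝ) ^ γ * tail γ x + (N : ℝ) ^ γ * tail γ (N - x)) * G ((x : ℝ) / N)) -
        e * discLap γ N G x := by
  unfold discOp discLap resRate
  have h : ∑ y ∈ bulk N, jump γ (x - y) * (G ((x : ℝ) / N) - G ((y : ℝ) / N)) =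
      -∑ y ∈ bulk N, jump γ (x - y) * (G ((y : ℝ) / N) - G ((x : ℝ) / N)) := by
    rw [← Finset.sum_neg_distrib]
    refine Finset.sum_congr rfl fun y _ => ?_
    ring
  rw [h]
  ring

/-- The uniform bound for the discrete operators on core functions. -/
def opBound (γ κ E r C : ℝ) : ℝ :=
  κ * ((4 * cGamma γ * (2 * r) ^ (-γ)) * C) + E * lapBound γ r C

theorem one_le_of_mem_bulk {N : ℕ} {x : ℤ} (hx : x ∈ bulk N) :
    (1 : ℝ) ≤ x ∧ (1 : ℝ) ≤ N - x := by
  rw [Finset.mem_Icc] at hx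
  have h1 : (1 : ℝ) ≤ x := by exact_mod_cast hx.1
  have h2 : (x : ℝ) ≤ N - 1 := by exact_mod_cast hx.2
  exact ⟨h1, by linarith⟩

/-- The accelerated rates blow up only at the boundary. Where `G` is nonzero the site is at distance
at least `2rN` from both reservoirs, which bounds the tails. -/
theorem IsCore.abs_discOp_le (hγ : 1 < γ) (hγ2 : γ < 2) (hκ : 0 ≤ κ) (hG : IsCore r C G)
    (heE : |e| ≤ E) {N : ℕ} {x : ℤ} (hx : x ∈ bulk N) :
    |discOp γ κ e N (fun x => G ((x : ℝ) / N)) x| ≤ opBound γ κ E r C := by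
  have hc := cGamma_pos hγ
  have hN := pos_of_mem_bulk hx
  have hN' : (N : ℝ) ≠ 0 := by exact_mod_cast hN.ne'
  have hu := div_mem_of_mem_bulk hx
  have hr := hG.pos
  have hC := hG.nonneg
  rw [discOp_sample]
  refine (abs_sub _ _).trans (add_le_add ?_ ?_)
  · rw [abs_mul, abs_of_nonneg hκ]
    refine mul_le_mul_of_nonneg_left ?_ hκ
    by_cases h0 : G ((x : ℝ) / N) = 0
    · rw [h0, mul_zero, abs_zero]
      positivity
    have h1 : 2 * r ≤ (x : ℝ) / N := by
      by_contra h
      exact h0 (hG.eq_zero _ hu (Or.inl (not_le.1 h)))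
    have h2 : 2 * r ≤ ((N : ℝ) - x) / N := by
      rw [sub_div, div_self hN']
      by_contra h
      exact h0 (hG.eq_zero _ hu (Or.inr (by linarith [not_le.1 h])))
    obtain ⟨hx1, hx2⟩ := one_le_of_mem_bulk hx
    have h3 := rpow_mul_tail_le hγ hN hx1 (by positivity) h1
    have h4 := rpow_mul_tail_le hγ hN hx2 (by positivity) h2
    have h5 := tail_nonneg hγ (by linarith : (0 : ℝ) ≤ x)
    have h6 := tail_nonneg hγ (by linarith : (0 : ℝ) ≤ N - x)
    rw [abs_mul, abs_of_nonneg (by positivity)]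
    refine mul_le_mul (by linarith) (hG.bound _ hu) (abs_nonneg _) (by positivity)
  · rw [abs_mul]
    exact mul_le_mul heE (hG.abs_discLap_le hγ hγ2 hx) (abs_nonneg _)
      ((abs_nonneg _).trans heE)

theorem IsCore.tendsto_discOp (hγ : 1 < γ) (hγ2 : γ < 2) (hG : IsCore r C G) {eN : ℕ → ℝ}
    (heN : Tendsto eN atTop (𝓝 e)) {u : ℝ} (hu : u ∈ Ioo (0 : ℝ) 1) :
    Tendsto (fun N : ℕ => discOp γ κ (eN N) N (fun x => G ((x : ℝ) / N)) ⌊(N : ℝ) * u⌋) atTop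
      (𝓝 (coreOp γ κ e G u)) := by
  simp only [discOp_sample]
  refine Tendsto.sub ?_ (heN.mul (hG.tendsto_discLap hγ hγ2 hu))
  refine Tendsto.const_mul _ (Tendsto.mul ?_ ?_)
  · exact (tendsto_tail_left hγ hu).add (tendsto_tail_right hγ hu)
  · exact (hG.cont.tendsto u).comp (tendsto_floor_div u)

theorem aestronglyMeasurable_of_tendsto_stepFun {f : ℕ → ℤ → ℝ} {g : ℝ → ℝ}
    (h : ∀ u ∈ Ioo (0 : ℝ) 1, Tendsto (fun N : ℕ => f N ⌊(N : ℝ) * u⌋) atTop (𝓝 (g u))) :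
    AEStronglyMeasurable g unitMeas := by
  refine aestronglyMeasurable_of_tendsto_ae atTop
    (fun N => ((measurable_of_countable (f N)).comp (measurable_floor_mul N)).aestronglyMeasurable)
    ?_
  filter_upwards [ae_restrict_mem measurableSet_Ioo] with u hu
  exact h u hu

theorem abs_le_of_tendsto_stepFun {f : ℕ → ℤ → ℝ} {g : ℝ → ℝ}
    (h : ∀ u ∈ Ioo (0 : ℝ) 1, Tendsto (fun N : ℕ => f N ⌊(N : ℝ) * u⌋) atTop (𝓝 (g u)))
    (hC : ∀ N, ∀ x ∈ bulk N, |f N x| ≤ C) {u : ℝ} (hu : u ∈ Ioo (0 : ℝ) 1) : |g u| ≤ C := by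
  refine le_of_tendsto (h u hu).abs ?_
  filter_upwards [eventually_floor_mem_bulk hu] with N hN
  exact hC N _ hN

theorem memLp_of_tendsto_stepFun {f : ℕ → ℤ → ℝ} {g : ℝ → ℝ}
    (h : ∀ u ∈ Ioo (0 : ℝ) 1, Tendsto (fun N : ℕ => f N ⌊(N : ℝ) * u⌋) atTop (𝓝 (g u)))
    (hC : ∀ N, ∀ x ∈ bulk N, |f N x| ≤ C) : MemLp g 2 unitMeas := by
  refine memLp_two_of_bound (aestronglyMeasurable_of_tendsto_stepFun h) (C := C) ?_
  filter_upwards [ae_restrict_mem measurableSet_Ioo] with u hu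
  exact abs_le_of_tendsto_stepFun h hC hu

theorem IsCore.memLp_coreOp (hγ : 1 < γ) (hγ2 : γ < 2) (hκ : 0 ≤ κ) (hG : IsCore r C G) :
    MemLp (coreOp γ κ e G) 2 unitMeas :=
  memLp_of_tendsto_stepFun (fun _ hu => hG.tendsto_discOp hγ hγ2 tendsto_const_nhds hu)
    (fun _ _ hx => hG.abs_discOp_le hγ hγ2 hκ le_rfl hx)

theorem IsCore.memLp (hG : IsCore r C G) : MemLp G 2 unitMeas :=
  memLp_of_continuousOn hG.cont.continuousOn

theorem IsCore.tendsto_discGen (hγ : 1 < γ) (hγ2 : γ < 2) (hκ : 0 ≤ κ) (hG : IsCore r C G)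
    {eN : ℕ → ℝ} (heN : Tendsto eN atTop (𝓝 e)) (heE : ∀ N, |eN N| ≤ E) :
    Tendsto (fun N : ℕ => discGen γ κ (eN N) N (stepL N fun x => G ((x : ℝ) / N))) atTop
      (𝓝 ((hG.memLp_coreOp (e := e) hγ hγ2 hκ).toLp _)) := by
  simp only [discGen_stepL]
  refine tendsto_stepL _ (C := opBound γ κ E r C) ?_ ?_
  · exact Eventually.of_forall fun N x hx => hG.abs_discOp_le hγ hγ2 hκ (heE N) hx
  · filter_upwards [ae_restrict_mem measurableSet_Ioo] with u hu
    exact hG.tendsto_discOp hγ hγ2 heN hu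

/-! #### Symmetry -/

theorem IsProfile.memLp_regionalLaplacian (hγ : 1 < γ) (hγ2 : γ < 2) (hG : IsProfile r C G) :
    MemLp (regionalLaplacian γ G) 2 unitMeas :=
  memLp_of_tendsto_stepFun (fun _ hu => hG.tendsto_discLap hγ hγ2 hu)
    (fun _ _ hx => hG.abs_discLap_le hγ hγ2 hx)

theorem IsProfile.tendsto_stepL_discLap (hγ : 1 < γ) (hγ2 : γ < 2) (hG : IsProfile r C G) :
    Tendsto (fun N : ℕ => stepL N (discLap γ N G)) atTop
      (𝓝 ((hG.memLp_regionalLaplacian hγ hγ2).toLp _)) := by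
  refine tendsto_stepL _ (C := lapBound γ r C) ?_ ?_
  · exact Eventually.of_forall fun N x hx => hG.abs_discLap_le hγ hγ2 hx
  · filter_upwards [ae_restrict_mem measurableSet_Ioo] with u hu
    exact hG.tendsto_discLap hγ hγ2 hu

theorem sum_discLap_mul (N : ℕ) (G₁ G₂ : ℝ → ℝ) :
    ∑ x ∈ bulk N, discLap γ N G₁ x * G₂ ((x : ℝ) / N) = -((N : ℝ) ^ γ * (1 / 2 *
      ∑ x ∈ bulk N, ∑ y ∈ bulk N, jump γ (x - y) * ((G₁ ((x : ℝ) / N) - G₁ ((y : ℝ) / N)) *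
        (G₂ ((x : ℝ) / N) - G₂ ((y : ℝ) / N))))) := by
  have h := sum_discOp_mul (γ := γ) (κ := 0) (e := 1) N (fun x => G₁ ((x : ℝ) / N))
    (fun x => G₂ ((x : ℝ) / N))
  simp only [discOp_sample, zero_mul, zero_sub, one_mul, add_zero, neg_mul,
    Finset.sum_neg_distrib] at h
  rw [← h, neg_neg]

/-- The Gagliardo integrand. -/
def gagl (γ : ℝ) (G₁ G₂ : ℝ → ℝ) (a b : ℝ) : ℝ :=
  (G₁ a - G₁ b) * (G₂ a - G₂ b) / |a - b| ^ (1 + γ)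

theorem abs_gagl_le {r₁ C₁ r₂ C₂ : ℝ} {G₁ G₂ : ℝ → ℝ} (h₁ : IsProfile r₁ C₁ G₁)
    (h₂ : IsProfile r₂ C₂ G₂) {a b : ℝ} (ha : a ∈ Ioo (0 : ℝ) 1) (hb : b ∈ Ioo (0 : ℝ) 1) :
    |gagl γ G₁ G₂ a b| ≤ C₁ * C₂ * if a = b then 0 else |a - b| ^ (1 - γ) := by
  have hC1 := h₁.nonneg
  have hC2 := h₂.nonneg
  rw [gagl, abs_div, abs_of_nonneg (by positivity : 0 ≤ |a - b| ^ (1 + γ)),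
    ← sq_div_abs_rpow a b, ← mul_div_assoc]
  gcongr
  rw [abs_mul, ← sq_abs, abs_sub_comm b a]
  have := mul_le_mul (h₁.lip a ha b hb) (h₂.lip a ha b hb) (abs_nonneg _) (by positivity)
  linarith

theorem abs_gagl_le_sing {r₁ C₁ r₂ C₂ : ℝ} {G₁ G₂ : ℝ → ℝ} (h₁ : IsProfile r₁ C₁ G₁)
    (h₂ : IsProfile r₂ C₂ G₂) {a b : ℝ} (ha : a ∈ Ioo (0 : ℝ) 1) (hb : b ∈ Ioo (0 : ℝ) 1) :
    |gagl γ G₁ G₂ a b| ≤ C₁ * C₂ * sing γ (a - b) := by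
  have hC1 := h₁.nonneg
  have hC2 := h₂.nonneg
  refine (abs_gagl_le h₁ h₂ ha hb).trans ?_
  gcongr
  rw [sing_of_abs_le (abs_sub_lt_one ha hb)]
  split_ifs
  · positivity
  · rfl

theorem ae_mem_prod : ∀ᵐ q ∂(unitMeas.prod unitMeas),
    q.1 ∈ Ioo (0 : ℝ) 1 ∧ q.2 ∈ Ioo (0 : ℝ) 1 := by
  rw [unitMeas, Measure.prod_restrict]
  filter_upwards [ae_restrict_mem (measurableSet_Ioo.prod measurableSet_Ioo)] with q hq
  exact hq

theorem ae_ne_prod : ∀ᵐ q ∂(unitMeas.prod unitMeas), q.1 ≠ q.2 := by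
  have hm : MeasurableSet {q : ℝ × ℝ | q.1 ≠ q.2} :=
    (measurableSet_eq_fun measurable_fst measurable_snd).compl
  rw [Measure.ae_prod_iff_ae_ae hm]
  refine ae_of_all _ fun u => ?_
  filter_upwards [Measure.ae_ne unitMeas u] with v hv
  exact Ne.symm hv

theorem measurable_gagl {G₁ G₂ : ℝ → ℝ} (h₁ : Measurable G₁) (h₂ : Measurable G₂) :
    Measurable fun q : ℝ × ℝ => gagl γ G₁ G₂ q.1 q.2 := by
  unfold gagl
  have hm : Measurable fun q : ℝ × ℝ => |q.1 - q.2| := (measurable_fst.sub measurable_snd).abs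
  exact (((h₁.comp measurable_fst).sub (h₁.comp measurable_snd)).mul
    ((h₂.comp measurable_fst).sub (h₂.comp measurable_snd))).div (hm.pow_const _)

theorem integrable_gagl (hγ2 : γ < 2) {r₁ C₁ r₂ C₂ : ℝ} {G₁ G₂ : ℝ → ℝ}
    (h₁ : IsProfile r₁ C₁ G₁) (h₂ : IsProfile r₂ C₂ G₂) :
    Integrable (fun q : ℝ × ℝ => gagl γ G₁ G₂ q.1 q.2) (unitMeas.prod unitMeas) := by
  refine Integrable.mono' ((integrable_sing_prod hγ2).const_mul (C₁ * C₂))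
    (measurable_gagl h₁.cont.measurable h₂.cont.measurable).aestronglyMeasurable ?_
  filter_upwards [ae_mem_prod] with q hq
  exact abs_gagl_le_sing h₁ h₂ hq.1 hq.2

/-- Integration by parts. -/
theorem integral_gagl (hγ : 1 < γ) (hγ2 : γ < 2) {r₁ C₁ r₂ C₂ : ℝ}
    {G₁ G₂ : ℝ → ℝ} (h₁ : IsProfile r₁ C₁ G₁) (h₂ : IsProfile r₂ C₂ G₂) :
    ∫ u, regionalLaplacian γ G₁ u * G₂ u ∂unitMeas =
      -(cGamma γ / 2 * ∫ q, gagl γ G₁ G₂ q.1 q.2 ∂(unitMeas.prod unitMeas)) := by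
  -- Both sides are limits of the finite identity `sum_discLap_mul`: the left one by `L²`
  -- convergence, the right one by dominated convergence on the square. The singular kernel itself
  -- is never split.
  have l1 := (h₁.tendsto_stepL_discLap hγ hγ2).inner (𝕜 := ℝ) (tendsto_stepL_sample
    (h₂.cont.continuousOn (s := Icc 0 1)))
  rw [inner_toLp] at l1
  refine tendsto_nhds_unique l1 ?_
  let g : ℕ → ℤ → ℤ → ℝ := fun N x y => if x ∈ bulk N then if y ∈ bulk N then
    gagl γ G₁ G₂ ((x : ℝ) / N) ((y : ℝ) / N) else 0 else 0
  have hgm : ∀ N, Measurable fun q : ℝ × ℝ => g N ⌊(N : ℝ) * q.1⌋ ⌊(N : ℝ) * q.2⌋ := by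
    intro N
    exact (measurable_of_countable fun p : ℤ × ℤ => g N p.1 p.2).comp
      (((measurable_floor_mul N).comp measurable_fst).prodMk
        ((measurable_floor_mul N).comp measurable_snd))
  have hgb : ∀ N : ℕ, 0 < N → ∀ᵐ q ∂(unitMeas.prod unitMeas),
      ‖g N ⌊(N : ℝ) * q.1⌋ ⌊(N : ℝ) * q.2⌋‖ ≤ C₁ * C₂ * (2 ^ (γ - 1) * sing γ (q.1 - q.2)) := by
    intro N hN
    have hC1 := h₁.nonneg
    have hC2 := h₂.nonneg
    filter_upwards [ae_mem_prod] with q hq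
    have hs := sing_nonneg (γ := γ) (q.1 - q.2)
    simp only [g]
    split_ifs with hx hy
    · refine (abs_gagl_le h₁ h₂ (div_mem_of_mem_bulk hx) (div_mem_of_mem_bulk hy)).trans ?_
      exact mul_le_mul_of_nonneg_left (lattice_sing_le hγ hq.1 hq.2 hN) (by positivity)
    · rw [norm_zero]; positivity
    · rw [norm_zero]; positivity
  have hdom : Integrable (fun q : ℝ × ℝ => C₁ * C₂ * (2 ^ (γ - 1) * sing γ (q.1 - q.2)))
      (unitMeas.prod unitMeas) := ((integrable_sing_prod hγ2).const_mul _).const_mul _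
  have hsum : ∀ N : ℕ, 0 < N → ⟪stepL N (discLap γ N G₁), stepL N fun x => G₂ ((x : ℝ) / N)⟫ =
      -(cGamma γ / 2 * ∫ q, g N ⌊(N : ℝ) * q.1⌋ ⌊(N : ℝ) * q.2⌋ ∂(unitMeas.prod unitMeas)) := by
    intro N hN
    have hN' : (0 : ℝ) < N := by exact_mod_cast hN
    rw [integral_prod _ (Integrable.mono' hdom (hgm N).aestronglyMeasurable (hgb N hN))]
    have e1 : ∀ x : ℤ, ∫ v, g N x ⌊(N : ℝ) * v⌋ ∂unitMeas =
        (N : ℝ)⁻¹ * ∑ y ∈ bulk N, g N x y := fun x =>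
      integral_floor hN (g N x) (by simp [g, bulk])
    simp only [e1]
    rw [integral_floor hN (fun x => (N : ℝ)⁻¹ * ∑ y ∈ bulk N, g N x y) (by simp [g, bulk]),
      inner_stepL, sum_discLap_mul, mul_neg, ← Finset.mul_sum]
    congr 1
    have e2 : cGamma γ * ∑ x ∈ bulk N, ∑ y ∈ bulk N, g N x y = (N : ℝ) ^ (γ + 1) *
        ∑ x ∈ bulk N, ∑ y ∈ bulk N, jump γ (x - y) * ((G₁ ((x : ℝ) / N) - G₁ ((y : ℝ) / N)) *
        (G₂ ((x : ℝ) / N) - G₂ ((y : ℝ) / N))) := by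
      rw [Finset.mul_sum, Finset.mul_sum]
      refine Finset.sum_congr rfl fun x hx => ?_
      rw [Finset.mul_sum, Finset.mul_sum]
      refine Finset.sum_congr rfl fun y hy => ?_
      simp only [g, if_pos hx, if_pos hy]
      rw [rpow_mul_jump hN x y _ (by rintro rfl; simp), gagl]
    rw [Real.rpow_add hN', Real.rpow_one] at e2
    have e3 : cGamma γ / 2 * ((N : ℝ)⁻¹ * ((N : ℝ)⁻¹ * ∑ x ∈ bulk N, ∑ y ∈ bulk N, g N x y)) =
      (N : ℝ)⁻¹ * (N : ℝ)⁻¹ / 2 * (cGamma γ * ∑ x ∈ bulk N, ∑ y ∈ bulk N, g N x y) := by ring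
    rw [e3, e2]
    field_simp
  refine Tendsto.congr' (f₁ := fun N : ℕ => -(cGamma γ / 2 * ∫ q, g N ⌊(N : ℝ) * q.1⌋
    ⌊(N : ℝ) * q.2⌋ ∂(unitMeas.prod unitMeas))) ?_ ?_
  · filter_upwards [eventually_gt_atTop 0] with N hN
    rw [hsum N hN]
  refine (Tendsto.const_mul _ ?_).neg
  refine tendsto_integral_filter_of_dominated_convergence _
    (Eventually.of_forall fun N => (hgm N).aestronglyMeasurable)
    ((eventually_gt_atTop 0).mono hgb) hdom ?_
  filter_upwards [ae_mem_prod, ae_ne_prod] with q hq hne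
  have hva := tendsto_floor_div q.1
  have hvb := tendsto_floor_div q.2
  have hlim : Tendsto (fun N : ℕ => gagl γ G₁ G₂ ((⌊(N : ℝ) * q.1⌋ : ℝ) / N)
      ((⌊(N : ℝ) * q.2⌋ : ℝ) / N)) atTop (𝓝 (gagl γ G₁ G₂ q.1 q.2)) := by
    unfold gagl
    have hpos : 0 < |q.1 - q.2| := abs_pos.2 (sub_ne_zero.2 hne)
    refine Tendsto.div ?_ (((hva.sub hvb).abs).rpow_const (Or.inl hpos.ne')) (by positivity)
    exact (((h₁.cont.tendsto _).comp hva).sub ((h₁.cont.tendsto _).comp hvb)).mul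
      (((h₂.cont.tendsto _).comp hva).sub ((h₂.cont.tendsto _).comp hvb))
  refine hlim.congr' ?_
  filter_upwards [eventually_floor_mem_bulk hq.1, eventually_floor_mem_bulk hq.2] with N h3 h4
  simp only [g, if_pos h3, if_pos h4]

end Core

/-! ### The form domain -/

section FormDomain

local notation "⟪" x "," y "⟫" => inner ℝ x y

variable {γ κ e r C : ℝ} {G : ℝ → ℝ}

theorem isProfile_of_contDiff (hG : ContDiff ℝ 2 G) (hr : 0 < r)
    (hd : ∀ u ∈ Ioo (0 : ℝ) 1, (u < 2 * r ∨ 1 - 2 * r < u) → deriv G u = 0)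
    (b0 : ∀ u ∈ Icc (0 : ℝ) 1, |G u| ≤ C) (b1 : ∀ u ∈ Icc (0 : ℝ) 1, |deriv G u| ≤ C)
    (b2 : ∀ u ∈ Icc (0 : ℝ) 1, |deriv (deriv G) u| ≤ C) : IsProfile r C G := by
  have hG1 : ContDiff ℝ 1 (deriv G) := ((contDiff_succ_iff_deriv (n := 1)).1 hG).2.2
  have hdiff : Differentiable ℝ G := hG.differentiable (by norm_num)
  have hdiff' : Differentiable ℝ (deriv G) := hG1.differentiable (by norm_num)
  have hC : 0 ≤ C := (abs_nonneg _).trans (b0 0 ⟨le_rfl, zero_le_one⟩)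
  have hlip1 : ∀ a ∈ Icc (0 : ℝ) 1, ∀ b ∈ Icc (0 : ℝ) 1, |deriv G b - deriv G a| ≤ C * |b - a| :=
    fun a ha b hb => (convex_Icc (0 : ℝ) 1).norm_image_sub_le_of_norm_deriv_le
      (fun x _ => hdiff' x) b2 ha hb
  refine ⟨hr, hC, hG.continuous, hG1.continuous, hd, fun u hu => b0 u (Ioo_subset_Icc_self hu), ?_,
    ?_⟩
  · intro a ha b hb
    exact (convex_Icc (0 : ℝ) 1).norm_image_sub_le_of_norm_deriv_le
      (fun x _ => hdiff x) b1 (Ioo_subset_Icc_self hb) (Ioo_subset_Icc_self ha)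
  · intro a ha b hb
    have hsub : uIcc a b ⊆ Icc 0 1 :=
      uIcc_subset_Icc (Ioo_subset_Icc_self ha) (Ioo_subset_Icc_self hb)
    have h1 : ∀ x ∈ uIcc a b, HasDerivWithinAt (fun s => G s - deriv G a * s)
        (deriv G x - deriv G a) (uIcc a b) x := by
      intro x _
      have h3 : HasDerivAt (fun s => deriv G a * s) (deriv G a) x := by
        simpa using (hasDerivAt_id x).const_mul (deriv G a)
      exact ((hdiff x).hasDerivAt.sub h3).hasDerivWithinAt
    have h2 := (convex_uIcc a b).norm_image_sub_le_of_norm_hasDerivWithin_le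
      (C := C * |b - a|) h1 (fun x hx => ?_) left_mem_uIcc right_mem_uIcc
    · rw [Real.norm_eq_abs, Real.norm_eq_abs] at h2
      calc |G b - G a - deriv G a * (b - a)| = |G b - deriv G a * b - (G a - deriv G a * a)| := by
            congr 1; ring
        _ ≤ C * |b - a| * |b - a| := h2
        _ = C * (b - a) ^ 2 := by rw [← sq_abs]; ring
    · refine (hlip1 a (Ioo_subset_Icc_self ha) x (hsub hx)).trans ?_
      gcongr C * ?_
      exact abs_sub_left_of_mem_uIcc hx

theorem isCore_of_contDiff (hG : ContDiff ℝ 2 G) (hr : 0 < r)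
    (hz : ∀ u, u ∉ Icc (2 * r) (1 - 2 * r) → G u = 0)
    (b0 : ∀ u ∈ Icc (0 : ℝ) 1, |G u| ≤ C) (b1 : ∀ u ∈ Icc (0 : ℝ) 1, |deriv G u| ≤ C)
    (b2 : ∀ u ∈ Icc (0 : ℝ) 1, |deriv (deriv G) u| ≤ C) : IsCore r C G := by
  have hout : ∀ u, (u < 2 * r ∨ 1 - 2 * r < u) → u ∉ Icc (2 * r) (1 - 2 * r) := by
    rintro u (h | h) ⟨h1, h2⟩ <;> linarith
  refine ⟨isProfile_of_contDiff hG hr (fun u _ h => ?_) b0 b1 b2, fun u _ h => hz u (hout u h)⟩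
  have : G =ᶠ[𝓝 u] fun _ => 0 := by
    filter_upwards [isClosed_Icc.isOpen_compl.mem_nhds (hout u h)] with v hv
    exact hz v hv
  rw [this.deriv_eq, deriv_const]

/-- Smooth functions with compact support in `(0,1)`. -/
def coreSub : Submodule ℝ (ℝ → ℝ) where
  carrier := {G | ContDiff ℝ ∞ G ∧ ∃ r > 0, ∀ u, u ∉ Icc (2 * r) (1 - 2 * r) → G u = 0}
  add_mem' := by
    rintro F G ⟨hF, r, hr, hF0⟩ ⟨hG, s, hs, hG0⟩
    refine ⟨hF.add hG, min r s, lt_min hr hs, fun u hu => ?_⟩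
    have h1 : u ∉ Icc (2 * r) (1 - 2 * r) := fun h => hu
      ⟨by linarith [h.1, min_le_left r s], by linarith [h.2, min_le_left r s]⟩
    have h2 : u ∉ Icc (2 * s) (1 - 2 * s) := fun h => hu
      ⟨by linarith [h.1, min_le_right r s], by linarith [h.2, min_le_right r s]⟩
    rw [Pi.add_apply, hF0 u h1, hG0 u h2, add_zero]
  zero_mem' := ⟨contDiff_const, 1, one_pos, fun _ _ => rfl⟩
  smul_mem' := by
    rintro c G ⟨hG, r, hr, hG0⟩
    refine ⟨hG.const_smul c, r, hr, fun u hu => ?_⟩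
    rw [Pi.smul_apply, hG0 u hu, smul_zero]

theorem exists_isCore (hG : G ∈ coreSub) : ∃ r C, IsCore r C G := by
  obtain ⟨hG, r, hr, hG0⟩ := hG
  have hG2 : ContDiff ℝ 2 G := hG.of_le (by exact WithTop.coe_le_coe.2 le_top)
  have hG1 : ContDiff ℝ 1 (deriv G) := ((contDiff_succ_iff_deriv (n := 1)).1 hG2).2.2
  have hc2 : Continuous (deriv (deriv G)) := (contDiff_one_iff_deriv.1 hG1).2
  obtain ⟨C0, h0⟩ := isCompact_Icc.exists_bound_of_continuousOn (s := Icc (0 : ℝ) 1)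
    hG.continuous.continuousOn
  obtain ⟨C1, h1⟩ := isCompact_Icc.exists_bound_of_continuousOn (s := Icc (0 : ℝ) 1)
    hG1.continuous.continuousOn
  obtain ⟨C2, h2⟩ := isCompact_Icc.exists_bound_of_continuousOn (s := Icc (0 : ℝ) 1)
    hc2.continuousOn
  refine ⟨r, max C0 (max C1 C2), isCore_of_contDiff hG2 hr hG0 ?_ ?_ ?_⟩
  · exact fun u hu => (h0 u hu).trans (le_max_left _ _)
  · exact fun u hu => (h1 u hu).trans ((le_max_left _ _).trans (le_max_right _ _))
  · exact fun u hu => (h2 u hu).trans ((le_max_right _ _).trans (le_max_right _ _))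

/-- The space `L²((0,1)²)`. -/
abbrev HS2 : Type := Lp ℝ 2 (unitMeas.prod unitMeas)

/-- The ambient space of the graph of the form. -/
abbrev FormAmb : Type := WithLp 2 (HS × WithLp 2 (HS × HS2))

theorem measurable_V₁ : Measurable (V₁ γ) := by
  unfold V₁ rMinus rPlus
  exact (measurable_const.mul (measurable_id.pow_const _)).add
    (measurable_const.mul ((measurable_const.sub measurable_id).pow_const _))

theorem lowBd_le_V₁ (hγ : 1 < γ) (hκ : 0 ≤ κ) {u : ℝ} (hu : u ∈ Ioo (0 : ℝ) 1) :
    lowBd γ κ ≤ κ * V₁ γ u := by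
  have hc := cGamma_pos hγ
  have h0 : 0 ≤ cGamma γ * γ⁻¹ := by positivity
  have h1 : 1 ≤ u ^ (-γ) := Real.one_le_rpow_of_pos_of_le_one_of_nonpos hu.1 hu.2.le (by linarith)
  have h2 : 1 ≤ (1 - u) ^ (-γ) := Real.one_le_rpow_of_pos_of_le_one_of_nonpos
    (by linarith [hu.2]) (by linarith [hu.1]) (by linarith)
  unfold lowBd V₁ rMinus rPlus
  have h3 := mul_le_mul_of_nonneg_left h1 h0
  have h4 := mul_le_mul_of_nonneg_left h2 h0
  nlinarith

theorem IsCore.V₁_mul_abs_le (hγ : 1 < γ) (hG : IsCore r C G) {u : ℝ} (hu : u ∈ Ioo (0 : ℝ) 1)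
    (h : G u ≠ 0) : V₁ γ u ≤ 2 * (cGamma γ * γ⁻¹) * (2 * r) ^ (-γ) := by
  have hc := cGamma_pos hγ
  have hr := hG.pos
  have h0 : 0 ≤ cGamma γ * γ⁻¹ := by positivity
  have h1 : 2 * r ≤ u := by
    by_contra h'
    exact h (hG.eq_zero _ hu (Or.inl (not_le.1 h')))
  have h2 : 2 * r ≤ 1 - u := by
    by_contra h'
    exact h (hG.eq_zero _ hu (Or.inr (by linarith [not_le.1 h'])))
  have h3 := Real.rpow_le_rpow_of_nonpos (z := -γ) (by positivity) h1 (by linarith)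
  have h4 := Real.rpow_le_rpow_of_nonpos (z := -γ) (by positivity) h2 (by linarith)
  unfold V₁ rMinus rPlus
  nlinarith [mul_le_mul_of_nonneg_left h3 h0, mul_le_mul_of_nonneg_left h4 h0]

/-- The potential component of the form. -/
def potComp (γ κ : ℝ) (G : ℝ → ℝ) (u : ℝ) : ℝ := Real.sqrt (κ * V₁ γ u - lowBd γ κ) * G u

/-- The jump component of the form. -/
def jumpComp (γ e : ℝ) (G : ℝ → ℝ) (q : ℝ × ℝ) : ℝ :=
  Real.sqrt (e * cGamma γ / 2) * ((G q.1 - G q.2) / |q.1 - q.2| ^ ((1 + γ) / 2))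

theorem IsCore.memLp_potComp (hγ : 1 < γ) (hκ : 0 ≤ κ) (hG : IsCore r C G) :
    MemLp (potComp γ κ G) 2 unitMeas := by
  have hc := cGamma_pos hγ
  have hr := hG.pos
  have hC := hG.nonneg
  refine memLp_two_of_bound (C := Real.sqrt (κ * (2 * (cGamma γ * γ⁻¹) * (2 * r) ^ (-γ))) * C) ?_ ?_
  · exact (((measurable_const.mul measurable_V₁).sub measurable_const).sqrt.mul
      hG.cont.measurable).aestronglyMeasurable
  · filter_upwards [ae_restrict_mem measurableSet_Ioo] with u hu
    rw [potComp, abs_mul, abs_of_nonneg (Real.sqrt_nonneg _)]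
    by_cases h : G u = 0
    · rw [h, abs_zero, mul_zero]
      positivity
    · have h1 := mul_le_mul_of_nonneg_left (hG.V₁_mul_abs_le hγ hu h) hκ
      have h2 : 0 ≤ lowBd γ κ := by unfold lowBd; positivity
      refine mul_le_mul (Real.sqrt_le_sqrt (by linarith)) (hG.bound u hu) (abs_nonneg _)
        (Real.sqrt_nonneg _)

theorem jumpComp_mul (hγ : 1 < γ) (he : 0 ≤ e) (G₁ G₂ : ℝ → ℝ) (q : ℝ × ℝ) :
    jumpComp γ e G₁ q * jumpComp γ e G₂ q = e * cGamma γ / 2 * gagl γ G₁ G₂ q.1 q.2 := by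
  have hc := cGamma_pos hγ
  unfold jumpComp gagl
  have h1 : |q.1 - q.2| ^ (1 + γ) = |q.1 - q.2| ^ ((1 + γ) / 2) * |q.1 - q.2| ^ ((1 + γ) / 2) := by
    rcases (abs_nonneg (q.1 - q.2)).eq_or_lt with h | h
    · rw [← h, Real.zero_rpow (by linarith), Real.zero_rpow (by linarith), zero_mul]
    · rw [← Real.rpow_add h]
      congr 1
      ring
  rw [h1, mul_div_mul_comm, mul_mul_mul_comm, Real.mul_self_sqrt (by positivity)]

theorem measurable_jumpComp (hG : Measurable G) : Measurable (jumpComp γ e G) := by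
  have hm : Measurable fun q : ℝ × ℝ => |q.1 - q.2| := (measurable_fst.sub measurable_snd).abs
  exact measurable_const.mul (((hG.comp measurable_fst).sub (hG.comp measurable_snd)).div
    (hm.pow_const _))

theorem IsProfile.memLp_jumpComp (hγ : 1 < γ) (hγ2 : γ < 2) (he : 0 ≤ e) (hG : IsProfile r C G) :
    MemLp (jumpComp γ e G) 2 (unitMeas.prod unitMeas) := by
  rw [memLp_two_iff_integrable_sq (measurable_jumpComp hG.cont.measurable).aestronglyMeasurable]
  simp only [pow_two, jumpComp_mul hγ he]
  exact (integrable_gagl hγ2 hG hG).const_mul _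

theorem memLp_core (G : coreSub) : MemLp (G : ℝ → ℝ) 2 unitMeas := by
  obtain ⟨r, C, h⟩ := exists_isCore G.2
  exact h.memLp

theorem memLp_potComp_core (hγ : 1 < γ) (hκ : 0 ≤ κ) (G : coreSub) :
    MemLp (potComp γ κ G) 2 unitMeas := by
  obtain ⟨r, C, h⟩ := exists_isCore G.2
  exact h.memLp_potComp hγ hκ

theorem memLp_jumpComp_core (hγ : 1 < γ) (hγ2 : γ < 2) (he : 0 ≤ e) (G : coreSub) :
    MemLp (jumpComp γ e G) 2 (unitMeas.prod unitMeas) := by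
  obtain ⟨r, C, h⟩ := exists_isCore G.2
  exact h.memLp_jumpComp hγ hγ2 he

theorem memLp_coreOp_core (hγ : 1 < γ) (hγ2 : γ < 2) (hκ : 0 ≤ κ) (G : coreSub) :
    MemLp (coreOp γ κ e G) 2 unitMeas := by
  obtain ⟨r, C, h⟩ := exists_isCore G.2
  exact h.memLp_coreOp hγ hγ2 hκ

/-- The embedding of the core into the ambient space of the form. -/
def formMap (hγ : 1 < γ) (hγ2 : γ < 2) (hκ : 0 ≤ κ) (he : 0 ≤ e) : coreSub →ₗ[ℝ] FormAmb where
  -- The constant `lowBd` is taken out of the potential so that one component is a positive multiple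
  -- of `G` itself. The form domain then embeds continuously into `L²(0,1)` by reading off this
  -- component.
  toFun G := WithLp.toLp 2 (Real.sqrt (lowBd γ κ) • (memLp_core G).toLp _,
    WithLp.toLp 2 ((memLp_potComp_core hγ hκ G).toLp _, (memLp_jumpComp_core hγ hγ2 he G).toLp _))
  map_add' F G := by
    have h1 : (memLp_core (F + G)).toLp _ = (memLp_core F).toLp _ + (memLp_core G).toLp _ := by
      rw [← MemLp.toLp_add]
      rfl
    have h2 : (memLp_potComp_core hγ hκ (F + G)).toLp _ =
        (memLp_potComp_core hγ hκ F).toLp _ + (memLp_potComp_core hγ hκ G).toLp _ := by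
      rw [← MemLp.toLp_add]
      congr 1
      ext u
      simp only [potComp, Submodule.coe_add, Pi.add_apply]
      ring
    have h3 : (memLp_jumpComp_core hγ hγ2 he (F + G)).toLp _ =
        (memLp_jumpComp_core hγ hγ2 he F).toLp _ + (memLp_jumpComp_core hγ hγ2 he G).toLp _ := by
      rw [← MemLp.toLp_add]
      congr 1
      ext u
      simp only [jumpComp, Submodule.coe_add, Pi.add_apply]
      ring
    rw [h1, h2, h3, smul_add]
    rfl
  map_smul' c G := by
    have h1 : (memLp_core (c • G)).toLp _ = c • (memLp_core G).toLp _ := by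
      rw [← MemLp.toLp_const_smul]
      rfl
    have h2 : (memLp_potComp_core hγ hκ (c • G)).toLp _ =
        c • (memLp_potComp_core hγ hκ G).toLp _ := by
      rw [← MemLp.toLp_const_smul]
      congr 1
      ext u
      simp only [potComp, Submodule.coe_smul, Pi.smul_apply, smul_eq_mul]
      ring
    have h3 : (memLp_jumpComp_core hγ hγ2 he (c • G)).toLp _ =
        c • (memLp_jumpComp_core hγ hγ2 he G).toLp _ := by
      rw [← MemLp.toLp_const_smul]
      congr 1
      ext u
      simp only [jumpComp, Submodule.coe_smul, Pi.smul_apply, smul_eq_mul]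
      ring
    rw [h1, h2, h3, smul_comm]
    rfl

/-- The first two components add up to `κ V₁ F G`, and integration by parts turns the Gagliardo
component into `-e F 𝕃G`. -/
theorem inner_formMap (hγ : 1 < γ) (hγ2 : γ < 2) (hκ : 0 ≤ κ) (he : 0 ≤ e) (F G : coreSub) :
    ⟪formMap hγ hγ2 hκ he F, formMap hγ hγ2 hκ he G⟫ = ∫ u, (F : ℝ → ℝ) u * coreOp γ κ e G u
      ∂unitMeas := by
  obtain ⟨r₁, C₁, hF⟩ := exists_isCore F.2
  obtain ⟨r₂, C₂, hG⟩ := exists_isCore G.2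
  have hm : 0 ≤ lowBd γ κ := by
    have := cGamma_pos hγ
    unfold lowBd
    positivity
  rw [WithLp.prod_inner_apply, WithLp.prod_inner_apply]
  change ⟪Real.sqrt (lowBd γ κ) • (memLp_core F).toLp _, Real.sqrt (lowBd γ κ) •
    (memLp_core G).toLp _⟫ + (⟪(memLp_potComp_core hγ hκ F).toLp _,
      (memLp_potComp_core hγ hκ G).toLp _⟫ + ⟪(memLp_jumpComp_core hγ hγ2 he F).toLp _,
      (memLp_jumpComp_core hγ hγ2 he G).toLp _⟫) = _
  rw [inner_smul_left, inner_smul_right, inner_toLp, inner_toLp, inner_toLp, RCLike.conj_to_real,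
    ← mul_assoc, Real.mul_self_sqrt hm]
  simp only [jumpComp_mul hγ he]
  rw [integral_const_mul]
  have h1 := integral_gagl hγ hγ2 hG.toIsProfile hF.toIsProfile
  have h2 : ∀ a b, gagl γ (F : ℝ → ℝ) (G : ℝ → ℝ) a b = gagl γ (G : ℝ → ℝ) (F : ℝ → ℝ) a b := by
    intro a b
    unfold gagl
    rw [mul_comm (F.1 a - F.1 b)]
  simp only [h2]
  have i1 : Integrable (fun u => (F : ℝ → ℝ) u * (G : ℝ → ℝ) u) unitMeas :=
    hF.memLp.integrable_mul hG.memLp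
  have i2 : Integrable (fun u => potComp γ κ F u * potComp γ κ G u) unitMeas :=
    (hF.memLp_potComp hγ hκ).integrable_mul (hG.memLp_potComp hγ hκ)
  have i3 : Integrable (fun u => regionalLaplacian γ G u * (F : ℝ → ℝ) u) unitMeas :=
    (hG.memLp_regionalLaplacian hγ hγ2).integrable_mul hF.memLp
  have h3 : ∫ u, (F : ℝ → ℝ) u * coreOp γ κ e G u ∂unitMeas =
      ∫ u, (lowBd γ κ * ((F : ℝ → ℝ) u * (G : ℝ → ℝ) u) + potComp γ κ F u * potComp γ κ G u -
        e * (regionalLaplacian γ G u * (F : ℝ → ℝ) u)) ∂unitMeas := by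
    refine integral_congr_ae ?_
    filter_upwards [ae_restrict_mem measurableSet_Ioo] with u hu
    have h4 := Real.mul_self_sqrt (sub_nonneg.2 (lowBd_le_V₁ hγ hκ hu))
    unfold coreOp potComp
    calc (F : ℝ → ℝ) u * (κ * (V₁ γ u * (G : ℝ → ℝ) u) - e * regionalLaplacian γ G u)
        = lowBd γ κ * ((F : ℝ → ℝ) u * (G : ℝ → ℝ) u) + (κ * V₁ γ u - lowBd γ κ) *
          ((F : ℝ → ℝ) u * (G : ℝ → ℝ) u) - e * (regionalLaplacian γ G u * (F : ℝ → ℝ) u) := by ring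
      _ = lowBd γ κ * ((F : ℝ → ℝ) u * (G : ℝ → ℝ) u) + (Real.sqrt (κ * V₁ γ u - lowBd γ κ) *
          Real.sqrt (κ * V₁ γ u - lowBd γ κ)) * ((F : ℝ → ℝ) u * (G : ℝ → ℝ) u) -
          e * (regionalLaplacian γ G u * (F : ℝ → ℝ) u) := by rw [h4]
      _ = _ := by ring
  have h5 := integral_sub ((i1.const_mul (lowBd γ κ)).add i2) (i3.const_mul e)
  have h6 := integral_add (i1.const_mul (lowBd γ κ)) i2
  simp only [Pi.add_apply] at h5
  rw [h3, h5, h6, integral_const_mul, integral_const_mul, h1]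
  ring

/-- The form domain: the closure of the core for the form norm. -/
abbrev FormDom (hγ : 1 < γ) (hγ2 : γ < 2) (hκ : 0 ≤ κ) (he : 0 ≤ e) : Submodule ℝ FormAmb :=
  (LinearMap.range (formMap hγ hγ2 hκ he)).topologicalClosure

instance (hγ : 1 < γ) (hγ2 : γ < 2) (hκ : 0 ≤ κ) (he : 0 ≤ e) :
    CompleteSpace (FormDom hγ hγ2 hκ he) :=
  (Submodule.isClosed_topologicalClosure _).completeSpace_coe

/-- The core inside the form domain. -/
def coreEmb (hγ : 1 < γ) (hγ2 : γ < 2) (hκ : 0 ≤ κ) (he : 0 ≤ e) (G : coreSub) :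
    FormDom hγ hγ2 hκ he :=
  ⟨formMap hγ hγ2 hκ he G, Submodule.le_topologicalClosure _ ⟨G, rfl⟩⟩

/-- The embedding of the form domain into `L²(0,1)`. -/
def formEmb (hγ : 1 < γ) (hγ2 : γ < 2) (hκ : 0 ≤ κ) (he : 0 ≤ e) :
    FormDom hγ hγ2 hκ he →L[ℝ] HS :=
  (Real.sqrt (lowBd γ κ))⁻¹ • ((WithLp.fstL 2 ℝ HS (WithLp 2 (HS × HS2))).comp
    (FormDom hγ hγ2 hκ he).subtypeL)

variable (hγ : 1 < γ) (hγ2 : γ < 2) (hκ : 0 < κ) (he : 0 ≤ e)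

theorem formEmb_coreEmb (G : coreSub) :
    formEmb hγ hγ2 hκ.le he (coreEmb hγ hγ2 hκ.le he G) = (memLp_core G).toLp _ := by
  have h : Real.sqrt (lowBd γ κ) ≠ 0 := (Real.sqrt_pos.2 (lowBd_pos hγ hκ)).ne'
  change (Real.sqrt (lowBd γ κ))⁻¹ • (Real.sqrt (lowBd γ κ) • (memLp_core G).toLp _) = _
  rw [inv_smul_smul₀ h]

theorem denseRange_coreEmb : DenseRange (coreEmb hγ hγ2 hκ.le he) := by
  intro v
  rw [closure_subtype]
  have h : (Subtype.val '' range (coreEmb hγ hγ2 hκ.le he) : Set FormAmb) =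
      LinearMap.range (formMap hγ hγ2 hκ.le he) := by
    ext x
    constructor
    · rintro ⟨_, ⟨G, rfl⟩, rfl⟩
      exact ⟨G, rfl⟩
    · rintro ⟨G, rfl⟩
      exact ⟨_, ⟨G, rfl⟩, rfl⟩
  rw [h]
  exact v.2

/-- The identity on pairs of core elements extends to the form domain by density in `v`, since both
sides are continuous in the form norm. -/
theorem inner_coreEmb (v : FormDom hγ hγ2 hκ.le he) (G : coreSub) :
    ⟪v, coreEmb hγ hγ2 hκ.le he G⟫ =
      ⟪formEmb hγ hγ2 hκ.le he v, (memLp_coreOp_core (e := e) hγ hγ2 hκ.le G).toLp _⟫ := by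
  refine (denseRange_coreEmb hγ hγ2 hκ he).induction_on (p := fun v =>
    ⟪v, coreEmb hγ hγ2 hκ.le he G⟫ =
      ⟪formEmb hγ hγ2 hκ.le he v, (memLp_coreOp_core (e := e) hγ hγ2 hκ.le G).toLp _⟫) v
    (isClosed_eq (by fun_prop) (by fun_prop)) fun F => ?_
  rw [formEmb_coreEmb hγ hγ2 hκ he, inner_toLp, ← inner_formMap hγ hγ2 hκ.le he]
  rfl

theorem eq_zero_of_inner_core {w : HS} (h : ∀ G : coreSub, ⟪w, (memLp_core G).toLp _⟫ = 0) :
    w = 0 := by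
  have hInt : Integrable w unitMeas := (Lp.memLp w).integrable (by norm_num)
  have h0 : ∀ᵐ u, u ∈ Ioo (0 : ℝ) 1 → w u = 0 := by
    refine isOpen_Ioo.ae_eq_zero_of_integral_contDiff_smul_eq_zero
      (IntegrableOn.locallyIntegrableOn hInt) fun g hg1 hg2 hg3 => ?_
    have hmem : g ∈ coreSub := by
      refine ⟨hg1, ?_⟩
      obtain ⟨δ, hδ, hsub⟩ := hg2.isCompact.exists_cthickening_subset_open isOpen_Ioo hg3
      -- `δ/2` because `coreSub` asks for a margin `2r`: a closed `δ`-neighbourhood of the support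
      -- lies in `(0,1)`.
      refine ⟨δ / 2, by positivity, fun u hu => ?_⟩
      by_contra hgu
      have hut : u ∈ tsupport g := subset_tsupport g hgu
      have h1 := hsub (Metric.closedBall_subset_cthickening hut δ
        (show u - δ ∈ Metric.closedBall u δ by simp [abs_of_pos hδ]))
      have h2 := hsub (Metric.closedBall_subset_cthickening hut δ
        (show u + δ ∈ Metric.closedBall u δ by simp [abs_of_pos hδ]))
      exact hu ⟨by linarith [h1.1], by linarith [h2.2]⟩
    have h1 := h ⟨g, hmem⟩
    rw [inner_toLp_right] at h1
    have h2 : ∫ u, g u • w u = ∫ u, (Ioo (0 : ℝ) 1).indicator (fun u => w u * g u) u := by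
      refine integral_congr_ae (ae_of_all _ fun u => ?_)
      by_cases hu : u ∈ Ioo (0 : ℝ) 1
      · simp only [Set.indicator_of_mem hu, smul_eq_mul, mul_comm]
      · have : g u = 0 := by
          by_contra hgu
          exact hu (hg3 (subset_tsupport g hgu))
        simp only [Set.indicator_of_notMem hu, this, zero_smul]
    rw [h2, integral_indicator measurableSet_Ioo]
    exact h1
  rw [Lp.eq_zero_iff_ae_eq_zero]
  filter_upwards [ae_restrict_of_ae h0, ae_restrict_mem measurableSet_Ioo] with u h1 h2
  exact h1 h2

/-- The inverse `J J*` of the operator of a form with form domain `V`. -/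
def formInvOf {V H : Type*} [NormedAddCommGroup V] [InnerProductSpace ℝ V] [CompleteSpace V]
    [NormedAddCommGroup H] [InnerProductSpace ℝ H] [CompleteSpace H] (J : V →L[ℝ] H) : H →L[ℝ] H :=
  J.comp (ContinuousLinearMap.adjoint J)

theorem isSymmGe_formInvOf {V H : Type*} [NormedAddCommGroup V] [InnerProductSpace ℝ V]
    [CompleteSpace V] [NormedAddCommGroup H] [InnerProductSpace ℝ H] [CompleteSpace H]
    (J : V →L[ℝ] H) : IsSymmGe 0 (formInvOf J) := by
  refine ⟨fun x y => ?_, fun x => ?_⟩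
  · change ⟪J (ContinuousLinearMap.adjoint J x), y⟫ = ⟪x, J (ContinuousLinearMap.adjoint J y)⟫
    rw [← ContinuousLinearMap.adjoint_inner_right J, ← ContinuousLinearMap.adjoint_inner_left J]
  · change 0 * ‖x‖ ^ 2 ≤ ⟪J (ContinuousLinearMap.adjoint J x), x⟫
    rw [← ContinuousLinearMap.adjoint_inner_right, zero_mul]
    exact real_inner_self_nonneg

/-- `⟪J J* x, x⟫ = ‖J* x‖²`, so the kernel of `J J*` is orthogonal to the range of `J`. -/
theorem inner_eq_zero_of_formInvOf {V H : Type*} [NormedAddCommGroup V] [InnerProductSpace ℝ V]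
    [CompleteSpace V] [NormedAddCommGroup H] [InnerProductSpace ℝ H] [CompleteSpace H]
    (J : V →L[ℝ] H) {x : H} (hx : formInvOf J x = 0) (v : V) : ⟪x, J v⟫ = 0 := by
  have h1 : ContinuousLinearMap.adjoint J x = 0 := by
    rw [← inner_self_eq_zero (𝕜 := ℝ), ContinuousLinearMap.adjoint_inner_right]
    change ⟪formInvOf J x, x⟫ = 0
    rw [hx, inner_zero_left]
  rw [← ContinuousLinearMap.adjoint_inner_left, h1, inner_zero_left]

/-- The inverse of the form operator. -/
def formInv (hγ : 1 < γ) (hγ2 : γ < 2) (hκ : 0 ≤ κ) (he : 0 ≤ e) : HS →L[ℝ] HS :=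
  formInvOf (V := FormDom hγ hγ2 hκ he) (formEmb hγ hγ2 hκ he)

theorem isSymmGe_formInv (hκ : 0 ≤ κ) : IsSymmGe 0 (formInv hγ hγ2 hκ he) :=
  isSymmGe_formInvOf _

theorem formInv_injective (x : HS) (hx : formInv hγ hγ2 hκ.le he x = 0) : x = 0 := by
  refine eq_zero_of_inner_core fun G => ?_
  rw [← formEmb_coreEmb hγ hγ2 hκ he]
  exact inner_eq_zero_of_formInvOf _ hx _

end FormDomain

/-! ### Weak limits, multiplication operators and exhaustion of integrals. -/

section WeakLimits

local notation "⟪" x "," y "⟫" => inner ℝ x y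

/-- `‖S w‖²` is the limit of `⟪S x_i, S w⟫ ≤ (‖S x_i‖² + ‖S w‖²)/2`. -/
theorem norm_sq_le_of_weak {H H' : Type*} [NormedAddCommGroup H] [InnerProductSpace ℝ H]
    [CompleteSpace H] [NormedAddCommGroup H'] [InnerProductSpace ℝ H'] [CompleteSpace H']
    (S : H →L[ℝ] H') {ι : Type*} {l : Filter ι} [l.NeBot] {x : ι → H} {w : H}
    (hw : ∀ y, Tendsto (fun i => ⟪x i, y⟫) l (𝓝 ⟪w, y⟫)) {C : ℝ}
    (hC : ∀ᶠ i in l, ‖S (x i)‖ ^ 2 ≤ C) : ‖S w‖ ^ 2 ≤ C := by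
  have h1 : Tendsto (fun i => ⟪S (x i), S w⟫) l (𝓝 (‖S w‖ ^ 2)) := by
    have := hw (ContinuousLinearMap.adjoint S (S w))
    simp only [ContinuousLinearMap.adjoint_inner_right] at this
    rwa [real_inner_self_eq_norm_sq] at this
  have h2 : ‖S w‖ ^ 2 ≤ (C + ‖S w‖ ^ 2) / 2 := by
    refine le_of_tendsto h1 (hC.mono fun i hi => ?_)
    have := real_inner_le_norm (S (x i)) (S w)
    nlinarith [sq_nonneg (‖S (x i)‖ - ‖S w‖)]
  linarith

variable {Ω : Type*} [MeasurableSpace Ω] {ν : Measure Ω}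

theorem memLp_mul_of_bound {ψ : Ω → ℝ} (hψ : Measurable ψ) {C : ℝ} (hC : ∀ x, |ψ x| ≤ C)
    {f : Ω → ℝ} (hf : MemLp f 2 ν) : MemLp (fun x => ψ x * f x) 2 ν :=
  MemLp.of_le_mul (c := C) hf (hψ.aestronglyMeasurable.mul hf.1) (Eventually.of_forall fun x => by
    rw [norm_mul]
    exact mul_le_mul_of_nonneg_right (hC x) (norm_nonneg _))

/-- Multiplication by a bounded function on `L²`. -/
def mulL {ψ : Ω → ℝ} (hψ : Measurable ψ) {C : ℝ} (hC : ∀ x, |ψ x| ≤ C) :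
    Lp ℝ 2 ν →L[ℝ] Lp ℝ 2 ν :=
  LinearMap.mkContinuous
    { toFun := fun f => (memLp_mul_of_bound hψ hC (Lp.memLp f)).toLp _
      map_add' := fun f g => by
        rw [← MemLp.toLp_add]
        refine MemLp.toLp_congr _ _ ?_
        filter_upwards [Lp.coeFn_add f g] with x hx
        rw [hx]
        simp only [Pi.add_apply]
        ring
      map_smul' := fun c f => by
        rw [RingHom.id_apply, ← MemLp.toLp_const_smul]
        refine MemLp.toLp_congr _ _ ?_
        filter_upwards [Lp.coeFn_smul c f] with x hx
        rw [hx]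
        simp only [Pi.smul_apply, smul_eq_mul]
        ring }
    C (fun f => by
      refine Lp.norm_le_mul_norm_of_ae_le_mul ?_
      filter_upwards [MemLp.coeFn_toLp (memLp_mul_of_bound hψ hC (Lp.memLp f))] with x hx
      simp only [LinearMap.coe_mk, AddHom.coe_mk]
      rw [hx, norm_mul]
      exact mul_le_mul_of_nonneg_right (hC x) (norm_nonneg _))

theorem coeFn_mulL {ψ : Ω → ℝ} (hψ : Measurable ψ) {C : ℝ} (hC : ∀ x, |ψ x| ≤ C) (f : Lp ℝ 2 ν) :
    mulL hψ hC f =ᵐ[ν] fun x => ψ x * f x :=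
  MemLp.coeFn_toLp (memLp_mul_of_bound hψ hC (Lp.memLp f))

theorem lintegral_sq_eq (f : Lp ℝ 2 ν) :
    ∫⁻ x, ENNReal.ofReal (f x ^ 2) ∂ν = ENNReal.ofReal (‖f‖ ^ 2) := by
  have h := norm_sq_toLp (Lp.memLp f)
  rw [Lp.toLp_coeFn] at h
  rw [h, ofReal_integral_eq_lintegral_ofReal (Lp.memLp f).integrable_sq
    (Eventually.of_forall fun x => sq_nonneg _)]

/-- Increasing exhaustion of an integral. -/
theorem lintegral_le_of_exhaustion {F : Ω → ℝ≥0∞} {R : ℕ → Set Ω}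
    (hm : Monotone R) (hR : ∀ᵐ x ∂ν, x ∈ ⋃ n, R n) {C : ℝ≥0∞} (h : ∀ n, ∫⁻ x in R n, F x ∂ν ≤ C) :
    ∫⁻ x, F x ∂ν ≤ C := by
  have h1 : ∫⁻ x, F x ∂ν = ∫⁻ x in ⋃ n, R n, F x ∂ν := by
    rw [Measure.restrict_eq_self_of_ae_mem hR]
  rw [h1, setLIntegral_iUnion_of_directed _ (hm.directed_le)]
  exact iSup_le h

end WeakLimits

/-! ### Lower semicontinuity of truncated energies. -/

section LowerSemicontinuity

local notation "⟪" x "," y "⟫" => inner ℝ x y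

variable {γ κ e Q : ℝ} {l : Filter ℕ} [l.NeBot]

/-- The boundary part of the energy. -/
def potEnergy (γ : ℝ) (f : ℝ → ℝ) : ℝ≥0∞ :=
  ∫⁻ u in Ioo (0 : ℝ) 1, ENNReal.ofReal ((u ^ (-γ) + (1 - u) ^ (-γ)) * f u ^ 2)

/-- The Gagliardo part of the energy. -/
def gagEnergy (γ : ℝ) (f : ℝ → ℝ) : ℝ≥0∞ :=
  ∫⁻ u in Ioo (0 : ℝ) 1, ∫⁻ v in Ioo (0 : ℝ) 1, ENNReal.ofReal ((f u - f v) ^ 2 / |u - v| ^ (1 + γ))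

theorem gagEnergy_eq_prod {f : ℝ → ℝ} (hf : AEMeasurable f unitMeas) :
    gagEnergy γ f = ∫⁻ q, ENNReal.ofReal ((f q.1 - f q.2) ^ 2 / |q.1 - q.2| ^ (1 + γ))
      ∂(unitMeas.prod unitMeas) := by
  rw [lintegral_prod]
  · rfl
  · have h1 : AEMeasurable (fun q : ℝ × ℝ => f q.1) (unitMeas.prod unitMeas) := hf.comp_fst
    have h2 : AEMeasurable (fun q : ℝ × ℝ => f q.2) (unitMeas.prod unitMeas) := hf.comp_snd
    have h3 : Measurable fun q : ℝ × ℝ => |q.1 - q.2| ^ (1 + γ) :=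
      (measurable_fst.sub measurable_snd).abs.pow_const _
    exact (((h1.sub h2).pow_const 2).div h3.aemeasurable).ennreal_ofReal

/-- Away from the singularity the weight is bounded, so the truncated energy is the squared norm of
the image under a bounded multiplication operator. -/
theorem setLIntegral_weight_le_of_weak {φ : ℝ → ℝ} (hφ : Measurable φ) {R : Set ℝ}
    (hR : MeasurableSet R) {C : ℝ} (hφC : ∀ u ∈ R, 0 ≤ φ u ∧ φ u ≤ C) {x : ℕ → HS} {w : HS}
    (hw : ∀ y, Tendsto (fun i => ⟪x i, y⟫) l (𝓝 ⟪w, y⟫)) (hQ : 0 ≤ Q)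
    (h : ∀ᶠ i in l, ∫⁻ u in R, ENNReal.ofReal (φ u * x i u ^ 2) ∂unitMeas ≤ ENNReal.ofReal Q) :
    ∫⁻ u in R, ENNReal.ofReal (φ u * w u ^ 2) ∂unitMeas ≤ ENNReal.ofReal Q := by
  have hψ : Measurable (R.indicator fun u => Real.sqrt (φ u)) := hφ.sqrt.indicator hR
  have hψC : ∀ u, |R.indicator (fun u => Real.sqrt (φ u)) u| ≤ Real.sqrt C := by
    intro u
    by_cases hu : u ∈ R
    · rw [indicator_of_mem hu, abs_of_nonneg (Real.sqrt_nonneg _)]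
      exact Real.sqrt_le_sqrt (hφC u hu).2
    · rw [indicator_of_notMem hu, abs_zero]
      exact Real.sqrt_nonneg _
  have key : ∀ f : HS, ∫⁻ u in R, ENNReal.ofReal (φ u * f u ^ 2) ∂unitMeas =
      ENNReal.ofReal (‖mulL hψ hψC f‖ ^ 2) := by
    intro f
    rw [← lintegral_sq_eq, ← lintegral_indicator hR]
    refine lintegral_congr_ae ?_
    filter_upwards [coeFn_mulL hψ hψC f] with u hu
    rw [hu]
    by_cases hu : u ∈ R
    · rw [indicator_of_mem hu, indicator_of_mem hu, mul_pow, Real.sq_sqrt (hφC u hu).1]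
    · rw [indicator_of_notMem hu, indicator_of_notMem hu]
      simp
  rw [key]
  refine ENNReal.ofReal_le_ofReal (norm_sq_le_of_weak _ hw (h.mono fun i hi => ?_))
  rw [key] at hi
  exact (ENNReal.ofReal_le_ofReal_iff hQ).1 hi

/-- The same for `f(q₁) - f(q₂)`: the difference map into `L²` of the square is bounded because both
coordinate projections preserve measure. -/
theorem setLIntegral_diff_le_of_weak {φ : ℝ × ℝ → ℝ} (hφ : Measurable φ) {R : Set (ℝ × ℝ)}
    (hR : MeasurableSet R) {C : ℝ} (hφC : ∀ u ∈ R, 0 ≤ φ u ∧ φ u ≤ C) {x : ℕ → HS} {w : HS}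
    (hw : ∀ y, Tendsto (fun i => ⟪x i, y⟫) l (𝓝 ⟪w, y⟫)) (hQ : 0 ≤ Q)
    (h : ∀ᶠ i in l, ∫⁻ q in R, ENNReal.ofReal (φ q * (x i q.1 - x i q.2) ^ 2)
      ∂(unitMeas.prod unitMeas) ≤ ENNReal.ofReal Q) :
    ∫⁻ q in R, ENNReal.ofReal (φ q * (w q.1 - w q.2) ^ 2) ∂(unitMeas.prod unitMeas) ≤
      ENNReal.ofReal Q := by
  have hψ : Measurable (R.indicator fun u => Real.sqrt (φ u)) := hφ.sqrt.indicator hR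
  have hψC : ∀ u, |R.indicator (fun u => Real.sqrt (φ u)) u| ≤ Real.sqrt C := by
    intro u
    by_cases hu : u ∈ R
    · rw [indicator_of_mem hu, abs_of_nonneg (Real.sqrt_nonneg _)]
      exact Real.sqrt_le_sqrt (hφC u hu).2
    · rw [indicator_of_notMem hu, abs_zero]
      exact Real.sqrt_nonneg _
  have p1 : MeasurePreserving (Prod.fst : ℝ × ℝ → ℝ) (unitMeas.prod unitMeas) unitMeas :=
    measurePreserving_fst
  have p2 : MeasurePreserving (Prod.snd : ℝ × ℝ → ℝ) (unitMeas.prod unitMeas) unitMeas :=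
    measurePreserving_snd
  let D : HS →L[ℝ] HS2 := (Lp.compMeasurePreservingₗᵢ ℝ _ p1).toContinuousLinearMap -
    (Lp.compMeasurePreservingₗᵢ ℝ _ p2).toContinuousLinearMap
  have hD : ∀ f : HS, D f =ᵐ[unitMeas.prod unitMeas] fun q => f q.1 - f q.2 := by
    intro f
    filter_upwards [Lp.coeFn_sub (Lp.compMeasurePreserving _ p1 f) (Lp.compMeasurePreserving _ p2 f),
      Lp.coeFn_compMeasurePreserving f p1, Lp.coeFn_compMeasurePreserving f p2] with q h1 h2 h3
    change (Lp.compMeasurePreserving _ p1 f - Lp.compMeasurePreserving _ p2 f : HS2) q = _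
    rw [h1, Pi.sub_apply, h2, h3]
    rfl
  have key : ∀ f : HS, ∫⁻ q in R, ENNReal.ofReal (φ q * (f q.1 - f q.2) ^ 2)
      ∂(unitMeas.prod unitMeas) = ENNReal.ofReal (‖((mulL hψ hψC).comp D) f‖ ^ 2) := by
    intro f
    rw [← lintegral_sq_eq, ← lintegral_indicator hR]
    refine lintegral_congr_ae ?_
    filter_upwards [coeFn_mulL hψ hψC (D f), hD f] with u hu hu'
    rw [ContinuousLinearMap.comp_apply, hu, hu']
    by_cases hu : u ∈ R
    · rw [indicator_of_mem hu, indicator_of_mem hu, mul_pow, Real.sq_sqrt (hφC u hu).1]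
    · rw [indicator_of_notMem hu, indicator_of_notMem hu]
      simp
  rw [key]
  refine ENNReal.ofReal_le_ofReal (norm_sq_le_of_weak _ hw (h.mono fun i hi => ?_))
  rw [key] at hi
  exact (ENNReal.ofReal_le_ofReal_iff hQ).1 hi

end LowerSemicontinuity


/-! ### The discrete energy dominates the continuous one. -/

section DiscreteComparison

local notation "⟪" x "," y "⟫" => inner ℝ x y

variable {γ κ e Q : ℝ} {l : Filter ℕ} [l.NeBot]

/-- With `x = ⌊Nu⌋`, rounding down gives `x ≤ Nu`. On the right it costs one unit, absorbed by `N -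
x ≤ 2N(1-u)` since `N(1-u) ≥ 2`. The constant 4 bounds `2^γ`. -/
theorem weight_le_resRate (hγ : 1 < γ) (hγ2 : γ < 2) {N : ℕ} {δ u : ℝ} (hδ : 0 < δ)
    (hN : 2 ≤ N * δ) (hu : u ∈ Ioo δ (1 - δ)) :
    ⌊(N : ℝ) * u⌋ ∈ bulk N ∧ u ^ (-γ) + (1 - u) ^ (-γ) ≤
      4 * (cGamma γ * γ⁻¹)⁻¹ * (N : ℝ) ^ γ * resRate γ N ⌊(N : ℝ) * u⌋ := by
  have hc : 0 < cGamma γ * γ⁻¹ := mul_pos (cGamma_pos hγ) (inv_pos.2 (by linarith))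
  have hN0 : 0 < N := by
    rcases Nat.eq_zero_or_pos N with h | h
    · subst h; norm_num at hN
    · exact h
  have hN' : (0 : ℝ) < N := by exact_mod_cast hN0
  have hu0 : 0 < u := hδ.trans hu.1
  have hu1 : 0 < 1 - u := by linarith [hu.2]
  have hmem : ⌊(N : ℝ) * u⌋ ∈ bulk N := by
    refine floor_mem_bulk ⟨hu0, by linarith⟩ ?_
    rw [div_le_iff₀ hu0]
    nlinarith [hu.1]
  refine ⟨hmem, ?_⟩
  set x := ⌊(N : ℝ) * u⌋ with hx
  have h1 : (x : ℝ) ≤ N * u := Int.floor_le _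
  have h2 : (N : ℝ) * u < x + 1 := Int.lt_floor_add_one _
  have hx1 : (1 : ℝ) ≤ x := by exact_mod_cast (Finset.mem_Icc.1 hmem).1
  have hx2 : (x : ℝ) ≤ N - 1 := by exact_mod_cast (Finset.mem_Icc.1 hmem).2
  have h3 : 2 ≤ N * (1 - u) := by nlinarith [hu.2]
  have h4 : (N - x : ℝ) ≤ 2 * (N * (1 - u)) := by linarith
  have e1 : u ^ (-γ) ≤ N ^ γ * (x : ℝ) ^ (-γ) := by
    rw [mul_comm, mul_comm ((x : ℝ) ^ (-γ)), rpow_mul_rpow_neg hN0 (by linarith)]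
    exact Real.rpow_le_rpow_of_nonpos (by positivity) ((div_le_iff₀ hN').2 (by linarith))
      (by linarith)
  have e2 : (1 - u) ^ (-γ) ≤ 4 * (N ^ γ * (N - x : ℝ) ^ (-γ)) := by
    have ha : (0 : ℝ) < N - x := by linarith
    have e3 : ((N - x : ℝ) / N / 2) ^ (-γ) = 2 ^ γ * (N ^ γ * (N - x : ℝ) ^ (-γ)) := by
      rw [Real.div_rpow (by positivity) (by norm_num), Real.rpow_neg (by norm_num : (0:ℝ) ≤ 2),
        div_inv_eq_mul, rpow_mul_rpow_neg hN0 ha, mul_comm]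
    have e4 : (2 : ℝ) ^ γ ≤ 4 := by
      calc (2 : ℝ) ^ γ ≤ 2 ^ (2 : ℝ) := Real.rpow_le_rpow_of_exponent_le (by norm_num) hγ2.le
        _ = 4 := by norm_num
    calc (1 - u) ^ (-γ) ≤ ((N - x : ℝ) / N / 2) ^ (-γ) := by
          refine Real.rpow_le_rpow_of_nonpos (by positivity) ?_ (by linarith)
          rw [div_div, div_le_iff₀ (by positivity)]
          linarith
      _ = 2 ^ γ * (N ^ γ * (N - x : ℝ) ^ (-γ)) := e3
      _ ≤ _ := mul_le_mul_of_nonneg_right e4 (by positivity)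
  have t1 := le_tail hγ (n := x) (by linarith)
  have t2 := le_tail hγ (n := N - x) (by linarith)
  have hNγ : (0 : ℝ) ≤ N ^ γ := by positivity
  have s1 : (x : ℝ) ^ (-γ) ≤ (cGamma γ * γ⁻¹)⁻¹ * tail γ x := by
    rw [← div_eq_inv_mul, le_div_iff₀ hc]; linarith
  have s2 : (N - x : ℝ) ^ (-γ) ≤ (cGamma γ * γ⁻¹)⁻¹ * tail γ (N - x) := by
    rw [← div_eq_inv_mul, le_div_iff₀ hc]; linarith
  have p1 := mul_le_mul_of_nonneg_left s1 hNγ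
  have p2 := mul_le_mul_of_nonneg_left s2 hNγ
  have p3 : 0 ≤ (N : ℝ) ^ γ * ((cGamma γ * γ⁻¹)⁻¹ * tail γ x) :=
    le_trans (by positivity) p1
  unfold resRate
  nlinarith

theorem ofReal_mean {N : ℕ} (hN : 0 < N) {s : Finset ℤ} {f : ℤ → ℝ} (hf : ∀ x ∈ s, 0 ≤ f x) :
    (N : ℝ≥0∞)⁻¹ * ∑ x ∈ s, ENNReal.ofReal (f x) = ENNReal.ofReal ((N : ℝ)⁻¹ * ∑ x ∈ s, f x) := by
  rw [ENNReal.ofReal_mul (by positivity), ENNReal.ofReal_sum_of_nonneg hf,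
    ENNReal.ofReal_inv_of_pos (by exact_mod_cast hN), ENNReal.ofReal_natCast]

theorem resRate_nonneg (hγ : 1 < γ) {N : ℕ} {x : ℤ} (hx : x ∈ bulk N) : 0 ≤ resRate γ N x := by
  obtain ⟨h1, h2⟩ := one_le_of_mem_bulk hx
  exact add_nonneg (tail_nonneg hγ (by linarith)) (tail_nonneg hγ (by linarith))

theorem zero_notMem_bulk (N : ℕ) : (0 : ℤ) ∉ bulk N := by simp [bulk]

theorem setLIntegral_pot_stepL_le (hγ : 1 < γ) (hγ2 : γ < 2) {N : ℕ} {δ : ℝ} (hδ : 0 < δ)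
    (hN : 2 ≤ N * δ) (a : ℤ → ℝ) :
    ∫⁻ u in Ioo δ (1 - δ), ENNReal.ofReal ((u ^ (-γ) + (1 - u) ^ (-γ)) * stepL N a u ^ 2) ∂unitMeas ≤
      ENNReal.ofReal (4 * (cGamma γ * γ⁻¹)⁻¹ *
        ((N : ℝ)⁻¹ * ((N : ℝ) ^ γ * ∑ x ∈ bulk N, resRate γ N x * (a x * a x)))) := by
  have hc : 0 < cGamma γ * γ⁻¹ := mul_pos (cGamma_pos hγ) (inv_pos.2 (by linarith))
  have hN0 : 0 < N := by
    rcases Nat.eq_zero_or_pos N with h | h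
    · subst h; norm_num at hN
    · exact h
  let f : ℤ → ℝ := fun x => 4 * (cGamma γ * γ⁻¹)⁻¹ * (N : ℝ) ^ γ * (resRate γ N x * (a x * a x))
  let F : ℤ → ℝ≥0∞ := fun x => if x ∈ bulk N then ENNReal.ofReal (f x) else 0
  calc ∫⁻ u in Ioo δ (1 - δ), ENNReal.ofReal ((u ^ (-γ) + (1 - u) ^ (-γ)) * stepL N a u ^ 2) ∂unitMeas
      ≤ ∫⁻ u in Ioo δ (1 - δ), F ⌊(N : ℝ) * u⌋ ∂unitMeas := by
        refine lintegral_mono_ae ?_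
        filter_upwards [ae_restrict_mem measurableSet_Ioo, ae_restrict_of_ae (coeFn_stepL N a)]
          with u hu hau
        obtain ⟨hm, hle⟩ := weight_le_resRate hγ hγ2 hδ hN hu
        simp only [F, f]
        rw [if_pos hm, hau, stepFun, if_pos hm]
        refine ENNReal.ofReal_le_ofReal ?_
        calc _ ≤ _ := mul_le_mul_of_nonneg_right hle (sq_nonneg _)
          _ = _ := by ring
    _ ≤ ∫⁻ u, F ⌊(N : ℝ) * u⌋ ∂unitMeas := setLIntegral_le_lintegral _ _
    _ = (N : ℝ≥0∞)⁻¹ * ∑ x ∈ bulk N, F x :=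
        lintegral_floor hN0 F (by simp only [F]; rw [if_neg (zero_notMem_bulk N)])
    _ = (N : ℝ≥0∞)⁻¹ * ∑ x ∈ bulk N, ENNReal.ofReal (f x) := by
        congr 1
        exact Finset.sum_congr rfl fun x hx => by simp only [F]; rw [if_pos hx]
    _ = ENNReal.ofReal ((N : ℝ)⁻¹ * ∑ x ∈ bulk N, f x) := by
        refine ofReal_mean hN0 fun x hx => ?_
        have := resRate_nonneg hγ hx
        have := mul_self_nonneg (a x)
        positivity
    _ = _ := by
        congr 1
        simp only [f]
        rw [← Finset.mul_sum]
        ring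

/-- Since `N|u-v| ≥ 2`, rounding gives `|x-y| ≤ N|u-v| + 1 ≤ (3/2)N|u-v|`, and `(3/2)^(γ+1) ≤ 27/8 ≤
4`. -/
theorem inv_rpow_le_jump (hγ : 1 < γ) (hγ2 : γ < 2) {N : ℕ} {δ u v : ℝ}
    (hN : 2 ≤ N * δ) (huv : δ < |u - v|) :
    (|u - v| ^ (1 + γ))⁻¹ ≤ 4 * (cGamma γ)⁻¹ * ((N : ℝ) ^ γ * N) *
      jump γ (⌊(N : ℝ) * u⌋ - ⌊(N : ℝ) * v⌋) := by
  have hc := cGamma_pos hγ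
  have hN0 : (0 : ℝ) < N := by
    rcases Nat.eq_zero_or_pos N with h | h
    · subst h; norm_num at hN
    · exact_mod_cast h
  have hδ : 0 < δ := by
    by_contra h
    nlinarith
  set x := ⌊(N : ℝ) * u⌋
  set y := ⌊(N : ℝ) * v⌋
  have h1 : (x : ℝ) ≤ N * u := Int.floor_le _
  have h2 : (N : ℝ) * u < x + 1 := Int.lt_floor_add_one _
  have h3 : (y : ℝ) ≤ N * v := Int.floor_le _
  have h4 : (N : ℝ) * v < y + 1 := Int.lt_floor_add_one _
  have hab : |((x : ℝ) - y) - N * (u - v)| ≤ 1 := by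
    rw [abs_le]; constructor <;> linarith
  have hNuv : 2 ≤ N * |u - v| := by nlinarith
  have hNab : |(N : ℝ) * (u - v)| = N * |u - v| := by rw [abs_mul, abs_of_pos hN0]
  have h5 : |(x : ℝ) - y| ≤ 3 / 2 * (N * |u - v|) := by
    have := abs_sub_abs_le_abs_sub ((x : ℝ) - y) (N * (u - v))
    linarith
  have h6 : 1 ≤ |(x : ℝ) - y| := by
    have := abs_sub_abs_le_abs_sub (N * (u - v)) ((x : ℝ) - y)
    rw [abs_sub_comm (N * (u - v))] at this
    linarith
  have hne : x - y ≠ 0 := by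
    intro h
    have : (x : ℝ) - y = 0 := by exact_mod_cast h
    rw [this, abs_zero] at h6
    linarith
  unfold jump
  rw [if_neg hne]
  push_cast
  have hpos : 0 < |u - v| := hδ.trans huv
  have e1 : |(x : ℝ) - y| ^ (γ + 1) ≤ 4 * ((N : ℝ) ^ γ * N) * |u - v| ^ (1 + γ) := by
    have e2 : (3 / 2 : ℝ) ^ (γ + 1) ≤ 4 := by
      calc (3 / 2 : ℝ) ^ (γ + 1) ≤ (3 / 2 : ℝ) ^ (3 : ℝ) :=
            Real.rpow_le_rpow_of_exponent_le (by norm_num) (by linarith)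
        _ ≤ 4 := by
            rw [show (3 : ℝ) = ((3 : ℕ) : ℝ) by norm_num, Real.rpow_natCast]; norm_num
    calc |(x : ℝ) - y| ^ (γ + 1) ≤ (3 / 2 * (N * |u - v|)) ^ (γ + 1) :=
          Real.rpow_le_rpow (abs_nonneg _) h5 (by linarith)
      _ = (3 / 2) ^ (γ + 1) * (((N : ℝ) ^ γ * N) * |u - v| ^ (1 + γ)) := by
          rw [Real.mul_rpow (by norm_num) (by positivity), Real.mul_rpow hN0.le (abs_nonneg _),
            Real.rpow_add_one hN0.ne', add_comm 1 γ]
      _ ≤ 4 * (((N : ℝ) ^ γ * N) * |u - v| ^ (1 + γ)) :=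
          mul_le_mul_of_nonneg_right e2 (by positivity)
      _ = _ := by ring
  have hp1 : 0 < |(x : ℝ) - y| ^ (γ + 1) := Real.rpow_pos_of_pos (by linarith) _
  have hp2 : 0 < |u - v| ^ (1 + γ) := Real.rpow_pos_of_pos hpos _
  rw [show 4 * (cGamma γ)⁻¹ * ((N : ℝ) ^ γ * N) * (cGamma γ / |(x : ℝ) - y| ^ (γ + 1)) =
    4 * ((N : ℝ) ^ γ * N) / |(x : ℝ) - y| ^ (γ + 1) by field_simp, le_div_iff₀ hp1,
    inv_mul_le_iff₀ hp2]
  linarith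

theorem lintegral_prod_floor {N : ℕ} (hN : 0 < N) (F : ℤ → ℤ → ℝ≥0∞) (h1 : ∀ y, F 0 y = 0)
    (h2 : ∀ x, F x 0 = 0) :
    ∫⁻ q, F ⌊(N : ℝ) * q.1⌋ ⌊(N : ℝ) * q.2⌋ ∂(unitMeas.prod unitMeas) =
      (N : ℝ≥0∞)⁻¹ * ∑ x ∈ bulk N, (N : ℝ≥0∞)⁻¹ * ∑ y ∈ bulk N, F x y := by
  have hm : Measurable fun q : ℝ × ℝ => F ⌊(N : ℝ) * q.1⌋ ⌊(N : ℝ) * q.2⌋ := by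
    exact (measurable_of_countable fun z : ℤ × ℤ => F z.1 z.2).comp
      (((measurable_floor_mul N).comp measurable_fst).prodMk
        ((measurable_floor_mul N).comp measurable_snd))
  rw [lintegral_prod _ hm.aemeasurable]
  have : ∀ u : ℝ, ∫⁻ v, F ⌊(N : ℝ) * u⌋ ⌊(N : ℝ) * v⌋ ∂unitMeas =
      (fun x => (N : ℝ≥0∞)⁻¹ * ∑ y ∈ bulk N, F x y) ⌊(N : ℝ) * u⌋ := fun u =>
    lintegral_floor hN (F ⌊(N : ℝ) * u⌋) (h2 _)
  simp only [this]
  exact lintegral_floor hN (fun x => (N : ℝ≥0∞)⁻¹ * ∑ y ∈ bulk N, F x y) (by simp [h1])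

/-- The part of the unit square at distance more than `δ` from the diagonal and the lower sides. -/
def farSet (δ : ℝ) : Set (ℝ × ℝ) := {q | δ < q.1 ∧ δ < q.2 ∧ δ < |q.1 - q.2|}

theorem measurableSet_farSet (δ : ℝ) : MeasurableSet (farSet δ) :=
  (measurableSet_lt measurable_const measurable_fst).inter
    ((measurableSet_lt measurable_const measurable_snd).inter
      (measurableSet_lt measurable_const (measurable_fst.sub measurable_snd).abs))

theorem setLIntegral_gag_stepL_le (hγ : 1 < γ) (hγ2 : γ < 2) {N : ℕ} {δ : ℝ}
    (hN : 2 ≤ N * δ) (a : ℤ → ℝ) :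
    ∫⁻ q in farSet δ, ENNReal.ofReal ((|q.1 - q.2| ^ (1 + γ))⁻¹ *
      (stepL N a q.1 - stepL N a q.2) ^ 2) ∂(unitMeas.prod unitMeas) ≤
      ENNReal.ofReal (4 * (cGamma γ)⁻¹ * ((N : ℝ)⁻¹ * ((N : ℝ) ^ γ *
        ∑ x ∈ bulk N, ∑ y ∈ bulk N, jump γ (x - y) * ((a x - a y) * (a x - a y))))) := by
  have hc := cGamma_pos hγ
  have hN0 : 0 < N := by
    rcases Nat.eq_zero_or_pos N with h | h
    · subst h; norm_num at hN
    · exact h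
  have hN' : (0 : ℝ) < N := by exact_mod_cast hN0
  let f : ℤ → ℤ → ℝ := fun x y => 4 * (cGamma γ)⁻¹ * ((N : ℝ) ^ γ * N) *
    (jump γ (x - y) * ((a x - a y) * (a x - a y)))
  have hf : ∀ x y, 0 ≤ f x y := fun x y => by
    have := jump_nonneg hγ (x - y)
    have := mul_self_nonneg (a x - a y)
    positivity
  let F : ℤ → ℤ → ℝ≥0∞ := fun x y =>
    if x ∈ bulk N ∧ y ∈ bulk N then ENNReal.ofReal (f x y) else 0
  calc _ ≤ ∫⁻ q in farSet δ, F ⌊(N : ℝ) * q.1⌋ ⌊(N : ℝ) * q.2⌋ ∂(unitMeas.prod unitMeas) := by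
        refine lintegral_mono_ae ?_
        filter_upwards [ae_restrict_mem (measurableSet_farSet δ), ae_restrict_of_ae ae_mem_prod,
          ae_restrict_of_ae (Measure.quasiMeasurePreserving_fst.ae (coeFn_stepL N a)),
          ae_restrict_of_ae (Measure.quasiMeasurePreserving_snd.ae (coeFn_stepL N a))]
          with q hq hq' ha1 ha2
        obtain ⟨g1, g2, g3⟩ := hq
        -- Only the cell of `0` is missing from the bulk; points close to `1` fall in the cell of
        -- `N-1`. That is why `farSet` is truncated at the lower sides only.
        have hmem : ∀ u : ℝ, u ∈ Ioo (0 : ℝ) 1 → δ < u → ⌊(N : ℝ) * u⌋ ∈ bulk N := by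
          intro u hu hδu
          refine floor_mem_bulk hu ?_
          rw [div_le_iff₀ hu.1]
          nlinarith
        have m1 := hmem _ hq'.1 g1
        have m2 := hmem _ hq'.2 g2
        simp only [F, f]
        rw [if_pos ⟨m1, m2⟩, ha1, ha2, stepFun, stepFun, if_pos m1, if_pos m2]
        refine ENNReal.ofReal_le_ofReal ?_
        calc _ ≤ _ := mul_le_mul_of_nonneg_right (inv_rpow_le_jump hγ hγ2 hN g3) (sq_nonneg _)
          _ = _ := by ring
    _ ≤ ∫⁻ q, F ⌊(N : ℝ) * q.1⌋ ⌊(N : ℝ) * q.2⌋ ∂(unitMeas.prod unitMeas) :=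
        setLIntegral_le_lintegral _ _
    _ = (N : ℝ≥0∞)⁻¹ * ∑ x ∈ bulk N, (N : ℝ≥0∞)⁻¹ * ∑ y ∈ bulk N, F x y :=
        lintegral_prod_floor hN0 F
          (fun y => by simp only [F]; rw [if_neg fun h => zero_notMem_bulk N h.1])
          (fun y => by simp only [F]; rw [if_neg fun h => zero_notMem_bulk N h.2])
    _ = (N : ℝ≥0∞)⁻¹ * ∑ x ∈ bulk N, ENNReal.ofReal ((N : ℝ)⁻¹ * ∑ y ∈ bulk N, f x y) := by
        congr 1
        refine Finset.sum_congr rfl fun x hx => ?_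
        rw [← ofReal_mean hN0 fun y _ => hf x y]
        congr 1
        exact Finset.sum_congr rfl fun y hy => by simp only [F]; rw [if_pos ⟨hx, hy⟩]
    _ = _ := by
        rw [ofReal_mean hN0 fun x _ => mul_nonneg (by positivity)
          (Finset.sum_nonneg fun y _ => hf x y)]
        congr 1
        simp only [f, ← Finset.mul_sum]
        field_simp

theorem energy_parts_le (hγ : 1 < γ) (hκ : 0 < κ) (he : 0 ≤ e) (N : ℕ) (w : HS) :
    κ * ((N : ℝ)⁻¹ * ((N : ℝ) ^ γ * ∑ x ∈ bulk N,
      resRate γ N x * (cellAvg N x w * cellAvg N x w))) ≤ ⟪discGen γ κ e N w, w⟫ ∧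
    e / 2 * ((N : ℝ)⁻¹ * ((N : ℝ) ^ γ * ∑ x ∈ bulk N, ∑ y ∈ bulk N, jump γ (x - y) *
      ((cellAvg N x w - cellAvg N y w) * (cellAvg N x w - cellAvg N y w)))) ≤
      ⟪discGen γ κ e N w, w⟫ := by
  have h := sum_discOp_cellAvg_le (e := e) hγ hκ.le N w
  rw [sum_discOp_mul] at h
  set A := ∑ x ∈ bulk N, resRate γ N x * (cellAvg N x w * cellAvg N x w) with hA
  set D := ∑ x ∈ bulk N, ∑ y ∈ bulk N, jump γ (x - y) *
      ((cellAvg N x w - cellAvg N y w) * (cellAvg N x w - cellAvg N y w)) with hD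
  have hA0 : 0 ≤ A := Finset.sum_nonneg fun x hx =>
    mul_nonneg (resRate_nonneg hγ hx) (mul_self_nonneg _)
  have hD0 : 0 ≤ D := Finset.sum_nonneg fun x _ => Finset.sum_nonneg fun y _ =>
    mul_nonneg (jump_nonneg hγ _) (mul_self_nonneg _)
  have hN : (0 : ℝ) ≤ (N : ℝ)⁻¹ * (N : ℝ) ^ γ := by positivity
  have t1 := mul_nonneg (mul_nonneg hκ.le hN) hA0
  have t2 := mul_nonneg (mul_nonneg he hN) hD0
  constructor <;> nlinarith

variable {eN : ℕ → ℝ} {x : ℕ → HS} {w : HS}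

/-- The projection onto step functions is symmetric, so it can be moved to the fixed vector, where
it converges strongly to the identity. -/
theorem tendsto_inner_stepL_cellAvg (hl : l ≤ atTop)
    (hw : ∀ y, Tendsto (fun i => ⟪x i, y⟫) l (𝓝 ⟪w, y⟫)) {M : ℝ} (hM : ∀ᶠ i in l, ‖x i‖ ≤ M)
    (y : HS) : Tendsto (fun i => ⟪stepL i fun z => cellAvg i z (x i), y⟫) l (𝓝 ⟪w, y⟫) := by
  have h1 : ∀ i, ⟪stepL i fun z => cellAvg i z (x i), y⟫ =
      ⟪x i, y⟫ + ⟪x i, (stepL i fun z => cellAvg i z y) - y⟫ := by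
    intro i
    rw [← inner_add_right, add_sub_cancel, inner_stepL_left, real_inner_comm, inner_stepL_left]
    simp only [mul_comm]
  simp only [h1]
  have h2 : Tendsto (fun i => ⟪x i, (stepL i fun z => cellAvg i z y) - y⟫) l (𝓝 0) := by
    have h3 : Tendsto (fun i => M * ‖(stepL i fun z => cellAvg i z y) - y‖) l (𝓝 0) := by
      have := ((tendsto_stepL_cellAvg y).sub_const y).norm.const_mul M
      rw [sub_self, norm_zero, mul_zero] at this
      exact this.mono_left hl
    refine squeeze_zero_norm' (hM.mono fun i hi => ?_) h3
    exact (norm_inner_le_norm _ _).trans (mul_le_mul_of_nonneg_right hi (norm_nonneg _))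
  simpa using (hw y).add h2

theorem eventually_two_le_mul (hl : l ≤ atTop) {δ : ℝ} (hδ : 0 < δ) :
    ∀ᶠ N : ℕ in l, 2 ≤ (N : ℝ) * δ := by
  have := (tendsto_natCast_atTop_atTop (R := ℝ)).atTop_mul_const hδ
  exact (this.mono_left hl).eventually_ge_atTop 2

/-- On each compact part of `(0,1)` the reservoir part of the discrete energy dominates the weighted
square of the projected function. Lower semicontinuity passes to the limit there, and the compact
parts exhaust the interval. -/
theorem potEnergy_le_of_weak (hγ : 1 < γ) (hγ2 : γ < 2) (hκ : 0 < κ) (heN : ∀ N, 0 ≤ eN N)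
    (hl : l ≤ atTop) (hw : ∀ y, Tendsto (fun i => ⟪x i, y⟫) l (𝓝 ⟪w, y⟫)) {M : ℝ}
    (hM : ∀ᶠ i in l, ‖x i‖ ≤ M) (hQ : ∀ᶠ i in l, ⟪discGen γ κ (eN i) i (x i), x i⟫ ≤ Q) (hQ0 : 0 ≤ Q) :
    potEnergy γ w ≤ ENNReal.ofReal (4 * (κ * (cGamma γ * γ⁻¹))⁻¹ * Q) := by
  have hc : 0 < cGamma γ * γ⁻¹ := mul_pos (cGamma_pos hγ) (inv_pos.2 (by linarith))
  have hδ : ∀ n : ℕ, (0 : ℝ) < 1 / ((n : ℝ) + 1) := fun n => by positivity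
  have hmeas : Measurable fun u : ℝ => u ^ (-γ) + (1 - u) ^ (-γ) :=
    (measurable_id.pow_const _).add ((measurable_const.sub measurable_id).pow_const _)
  refine lintegral_le_of_exhaustion (R := fun n : ℕ =>
    Ioo (1 / ((n : ℝ) + 1)) (1 - 1 / ((n : ℝ) + 1))) ?_ ?_ fun n => ?_
  · intro m n hmn
    have : 1 / ((n : ℝ) + 1) ≤ 1 / ((m : ℝ) + 1) := one_div_le_one_div_of_le (by positivity)
      (by exact_mod_cast Nat.add_le_add_right hmn 1)
    exact Ioo_subset_Ioo this (by linarith)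
  · filter_upwards [ae_restrict_mem measurableSet_Ioo] with u hu
    obtain ⟨n, hn⟩ := exists_nat_one_div_lt (lt_min hu.1 (sub_pos.2 hu.2))
    exact mem_iUnion.2 ⟨n, hn.trans_le (min_le_left _ _), by
      linarith [hn.trans_le (min_le_right u (1 - u))]⟩
  · refine setLIntegral_weight_le_of_weak (C := 2 * (1 / ((n : ℝ) + 1)) ^ (-γ)) hmeas
      measurableSet_Ioo (fun u hu => ?_) (tendsto_inner_stepL_cellAvg hl hw hM) (by positivity) ?_
    · have hu0 : 0 < u := (hδ n).trans hu.1
      have hu1 : 0 < 1 - u := by linarith [hδ n, hu.2]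
      have h1 : u ^ (-γ) ≤ (1 / ((n : ℝ) + 1)) ^ (-γ) :=
        Real.rpow_le_rpow_of_nonpos (hδ n) hu.1.le (by linarith)
      have h2 : (1 - u) ^ (-γ) ≤ (1 / ((n : ℝ) + 1)) ^ (-γ) :=
        Real.rpow_le_rpow_of_nonpos (hδ n) (by linarith [hu.2]) (by linarith)
      exact ⟨by positivity, by linarith⟩
    · filter_upwards [hQ, eventually_two_le_mul hl (hδ n)] with N hN hN2
      refine (setLIntegral_pot_stepL_le hγ hγ2 (hδ n) hN2 _).trans (ENNReal.ofReal_le_ofReal ?_)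
      have h := (energy_parts_le hγ hκ (heN N) N (x N)).1.trans hN
      rw [mul_inv κ, show 4 * (κ⁻¹ * (cGamma γ * γ⁻¹)⁻¹) * Q =
        4 * (cGamma γ * γ⁻¹)⁻¹ * (κ⁻¹ * Q) by ring]
      refine mul_le_mul_of_nonneg_left ?_ (by positivity)
      rw [← div_eq_inv_mul Q, le_div_iff₀ hκ]
      linarith

/-- The same scheme away from the diagonal. Since `eN ≥ e`, the exchange part of the discrete energy
controls `e` times the Gagliardo energy; for `e = 0` nothing is claimed. -/
theorem gagEnergy_le_of_weak (hγ : 1 < γ) (hγ2 : γ < 2) (hκ : 0 < κ) (he : 0 ≤ e)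
    (heN : ∀ N, e ≤ eN N)
    (hl : l ≤ atTop) (hw : ∀ y, Tendsto (fun i => ⟪x i, y⟫) l (𝓝 ⟪w, y⟫)) {M : ℝ}
    (hM : ∀ᶠ i in l, ‖x i‖ ≤ M) (hQ : ∀ᶠ i in l, ⟪discGen γ κ (eN i) i (x i), x i⟫ ≤ Q) (hQ0 : 0 ≤ Q) :
    ENNReal.ofReal e * gagEnergy γ w ≤ ENNReal.ofReal (8 * (cGamma γ)⁻¹ * Q) := by
  have hc := cGamma_pos hγ
  rcases he.eq_or_lt with rfl | he
  · simp
  have hδ : ∀ n : ℕ, (0 : ℝ) < 1 / ((n : ℝ) + 1) := fun n => by positivity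
  have hmeas : Measurable fun q : ℝ × ℝ => (|q.1 - q.2| ^ (1 + γ))⁻¹ :=
    ((measurable_fst.sub measurable_snd).abs.pow_const _).inv
  have main : gagEnergy γ w ≤ ENNReal.ofReal (8 * (e * cGamma γ)⁻¹ * Q) := by
    rw [gagEnergy_eq_prod (Lp.aestronglyMeasurable w).aemeasurable]
    simp only [div_eq_inv_mul]
    refine lintegral_le_of_exhaustion (R := fun n : ℕ => farSet (1 / ((n : ℝ) + 1))) ?_ ?_
      fun n => ?_
    · intro m n hmn q hq
      have : 1 / ((n : ℝ) + 1) ≤ 1 / ((m : ℝ) + 1) := one_div_le_one_div_of_le (by positivity)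
        (by exact_mod_cast Nat.add_le_add_right hmn 1)
      exact ⟨this.trans_lt hq.1, this.trans_lt hq.2.1, this.trans_lt hq.2.2⟩
    · filter_upwards [ae_mem_prod, ae_ne_prod] with q hq hne
      obtain ⟨n, hn⟩ := exists_nat_one_div_lt (lt_min hq.1.1 (lt_min hq.2.1
        (abs_pos.2 (sub_ne_zero.2 hne))))
      rw [lt_min_iff, lt_min_iff] at hn
      exact mem_iUnion.2 ⟨n, hn⟩
    · refine setLIntegral_diff_le_of_weak (C := ((1 / ((n : ℝ) + 1)) ^ (1 + γ))⁻¹) hmeas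
        (measurableSet_farSet _) (fun q hq => ⟨by positivity, ?_⟩)
        (tendsto_inner_stepL_cellAvg hl hw hM) (by positivity) ?_
      · exact inv_anti₀ (Real.rpow_pos_of_pos (hδ n) _)
          (Real.rpow_le_rpow (hδ n).le hq.2.2.le (by linarith))
      · filter_upwards [hQ, eventually_two_le_mul hl (hδ n)] with N hN hN2
        refine (setLIntegral_gag_stepL_le hγ hγ2 hN2 _).trans (ENNReal.ofReal_le_ofReal ?_)
        have h := (energy_parts_le hγ hκ (he.le.trans (heN N)) N (x N)).2.trans hN
        have hD0 : 0 ≤ (N : ℝ)⁻¹ * ((N : ℝ) ^ γ * ∑ z ∈ bulk N, ∑ y ∈ bulk N, jump γ (z - y) *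
            ((cellAvg N z (x N) - cellAvg N y (x N)) * (cellAvg N z (x N) - cellAvg N y (x N)))) :=
          mul_nonneg (by positivity) (mul_nonneg (by positivity) (Finset.sum_nonneg fun x _ =>
            Finset.sum_nonneg fun y _ => mul_nonneg (jump_nonneg hγ _) (mul_self_nonneg _)))
        rw [mul_inv e, show 8 * (e⁻¹ * (cGamma γ)⁻¹) * Q =
          4 * (cGamma γ)⁻¹ * (e⁻¹ * (2 * Q)) by ring]
        refine mul_le_mul_of_nonneg_left ?_ (by positivity)
        rw [← div_eq_inv_mul (2 * Q), le_div_iff₀ he]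
        nlinarith [mul_le_mul_of_nonneg_right (heN N) hD0]
  calc _ ≤ ENNReal.ofReal e * ENNReal.ofReal (8 * (e * cGamma γ)⁻¹ * Q) := by gcongr
    _ = _ := by
      rw [← ENNReal.ofReal_mul he.le]
      congr 1
      field_simp

end DiscreteComparison

/-! ### Mollification after a dilation about the midpoint. -/

section Mollification

/-- The square of a mean is at most the mean of the square. -/
theorem ofReal_sq_integral_le {Ω : Type*} [MeasurableSpace Ω] {ν : Measure Ω}
    [IsProbabilityMeasure ν] {g : Ω → ℝ} (hg : AEMeasurable g ν) :
    ENNReal.ofReal ((∫ z, g z ∂ν) ^ 2) ≤ ∫⁻ z, ENNReal.ofReal (g z ^ 2) ∂ν := by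
  by_cases hg2 : Integrable (fun z => g z ^ 2) ν
  · have hmem : MemLp g 2 ν := (memLp_two_iff_integrable_sq hg.aestronglyMeasurable).2 hg2
    rw [← ofReal_integral_eq_lintegral_ofReal hg2 (Eventually.of_forall fun z => sq_nonneg _)]
    refine ENNReal.ofReal_le_ofReal ?_
    exact (even_two.convexOn_pow (𝕜 := ℝ)).map_integral_le (continuous_pow 2).continuousOn
      isClosed_univ (Eventually.of_forall fun _ => mem_univ _) (hmem.integrable (by norm_num)) hg2
  · have : ∫⁻ z, ENNReal.ofReal (g z ^ 2) ∂ν = ⊤ := by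
      by_contra h
      refine hg2 ⟨(hg.pow_const 2).aestronglyMeasurable, ?_⟩
      rw [hasFiniteIntegral_iff_ofReal (Eventually.of_forall fun z => sq_nonneg _)]
      exact lt_top_iff_ne_top.2 h
    rw [this]
    exact le_top

theorem lintegral_comp_affine {F : ℝ → ℝ≥0∞} (hF : Measurable F) {a : ℝ} (ha : 0 < a) (b : ℝ) :
    ∫⁻ u, F (a * u + b) = ENNReal.ofReal a⁻¹ * ∫⁻ u, F u := by
  have h1 : ∫⁻ u, F (a * u + b) = ∫⁻ v, F (v + b) ∂(Measure.map (fun x : ℝ => a * x) volume) :=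
    (lintegral_map (hF.comp (measurable_add_const b)) (measurable_const_mul a)).symm
  rw [h1, Real.map_volume_mul_left ha.ne', lintegral_smul_measure, lintegral_add_right_eq_self,
    abs_of_pos (inv_pos.2 ha), smul_eq_mul]

/-- The scale of the mollification. -/
def molRad (n : ℕ) : ℝ := 1 / ((n : ℝ) + 16)

theorem molRad_pos (n : ℕ) : 0 < molRad n := by unfold molRad; positivity

theorem molRad_le (n : ℕ) : molRad n ≤ 1 / 16 := by
  unfold molRad
  exact one_div_le_one_div_of_le (by norm_num) (by have : (0:ℝ) ≤ n := n.cast_nonneg; linarith)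

/-- The mollifier. -/
def molBump (n : ℕ) : ContDiffBump (0 : ℝ) :=
  ⟨molRad n / 2, molRad n, by linarith [molRad_pos n], by linarith [molRad_pos n]⟩

/-- The mollifier as a probability measure. -/
def molMeas (n : ℕ) : Measure ℝ :=
  volume.withDensity fun z => ENNReal.ofReal ((molBump n).normed volume z)

theorem continuous_molBump (n : ℕ) : Continuous ((molBump n).normed volume) :=
  ((molBump n).contDiff_normed (n := 0)).continuous

instance (n : ℕ) : IsProbabilityMeasure (molMeas n) := by
  constructor
  rw [molMeas, withDensity_apply _ MeasurableSet.univ, Measure.restrict_univ,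
    ← ofReal_integral_eq_lintegral_ofReal (molBump n).integrable_normed
    (Eventually.of_forall fun z => (molBump n).nonneg_normed z), (molBump n).integral_normed,
    ENNReal.ofReal_one]

theorem ae_molMeas (n : ℕ) : ∀ᵐ z ∂(molMeas n), |z| < molRad n := by
  rw [molMeas, ae_withDensity_iff (continuous_molBump n).measurable.ennreal_ofReal]
  refine Eventually.of_forall fun z hz => ?_
  have : z ∈ Function.support ((molBump n).normed volume) := by
    intro h
    exact hz (by rw [h, ENNReal.ofReal_zero])
  rw [(molBump n).support_normed_eq, Metric.mem_ball, dist_zero_right] at this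
  exact this

theorem integral_molMeas (n : ℕ) (g : ℝ → ℝ) :
    ∫ z, g z ∂(molMeas n) = ∫ z, (molBump n).normed volume z * g z := by
  rw [molMeas, integral_withDensity_eq_integral_toReal_smul
    (continuous_molBump n).measurable.ennreal_ofReal (Eventually.of_forall fun z => ENNReal.ofReal_lt_top)]
  refine integral_congr_ae (Eventually.of_forall fun z => ?_)
  simp only [smul_eq_mul]
  rw [ENNReal.toReal_ofReal ((molBump n).nonneg_normed z)]

theorem integrable_molMeas (n : ℕ) {g : ℝ → ℝ} (hg : Integrable g) : Integrable g (molMeas n) := by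
  rw [molMeas, integrable_withDensity_iff_integrable_smul'
    (continuous_molBump n).measurable.ennreal_ofReal (Eventually.of_forall fun z => ENNReal.ofReal_lt_top)]
  obtain ⟨C, hC⟩ := (continuous_molBump n).bounded_above_of_compact_support
    (molBump n).hasCompactSupport_normed
  refine Integrable.bdd_mul (c := C) hg ?_ (Eventually.of_forall fun z => ?_)
  · exact (continuous_molBump n).measurable.ennreal_ofReal.ennreal_toReal.aestronglyMeasurable
  · rw [ENNReal.toReal_ofReal ((molBump n).nonneg_normed z)]
    exact hC z

/-- The slope of the dilation. -/
def molSlope (n : ℕ) : ℝ := (1 - 8 * molRad n)⁻¹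

/-- The choice `molRad ≤ 1/16` keeps `1 - 8 molRad ≥ 1/2`, hence a slope at most 2 in all later
estimates. -/
theorem molSlope_bounds (n : ℕ) : 1 ≤ molSlope n ∧ molSlope n ≤ 2 ∧
    molSlope n * (1 - 8 * molRad n) = 1 := by
  have h1 := molRad_pos n
  have h2 := molRad_le n
  have h3 : 0 < 1 - 8 * molRad n := by linarith
  refine ⟨(one_le_inv₀ h3).2 (by linarith), ?_, inv_mul_cancel₀ h3.ne'⟩
  rw [molSlope, inv_le_comm₀ h3 (by norm_num)]
  linarith

/-- The dilated and translated point. -/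
def molPt (n : ℕ) (u z : ℝ) : ℝ := molSlope n * u + (1 / 2 - molSlope n / 2 - molSlope n * z)

theorem measurable_molPt (n : ℕ) : Measurable fun q : ℝ × ℝ => molPt n q.1 q.2 := by
  unfold molPt; fun_prop

theorem molPt_inv (n : ℕ) (u z : ℝ) :
    u = molPt n u z * (1 - 8 * molRad n) + 4 * molRad n + z := by
  have h := (molSlope_bounds n).2.2
  unfold molPt
  linear_combination (1 / 2 + z - u) * h

theorem abs_molPt_sub_le (n : ℕ) {u z : ℝ} (hu : u ∈ Ioo (0 : ℝ) 1) (hz : |z| < molRad n) :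
    |molPt n u z - u| ≤ 18 * molRad n := by
  obtain ⟨h1, h2, h3⟩ := molSlope_bounds n
  have h4 := molRad_pos n
  have e : molPt n u z - u = (molSlope n - 1) * (u - 1 / 2) - molSlope n * z := by
    unfold molPt; ring
  have h5 : molSlope n - 1 ≤ 16 * molRad n := by nlinarith
  have h6 : |u - 1 / 2| ≤ 1 := by rw [abs_le]; constructor <;> linarith [hu.1, hu.2]
  calc |molPt n u z - u| ≤ |(molSlope n - 1) * (u - 1 / 2)| + |molSlope n * z| := by
        rw [e]; exact abs_sub _ _
    _ = (molSlope n - 1) * |u - 1 / 2| + molSlope n * |z| := by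
        rw [abs_mul, abs_mul, abs_of_nonneg (by linarith : 0 ≤ molSlope n - 1),
          abs_of_nonneg (by linarith : 0 ≤ molSlope n)]
    _ ≤ 16 * molRad n * 1 + 2 * molRad n := by
        gcongr
    _ = 18 * molRad n := by ring

/-- The dilated mollification of a function on `(0,1)`. -/
def mol (n : ℕ) (f : ℝ → ℝ) (u : ℝ) : ℝ := ∫ z, f (molPt n u z) ∂(molMeas n)

variable {f : ℝ → ℝ}

theorem integrable_comp_molPt (n : ℕ) (hf : Integrable f) (u : ℝ) :
    Integrable (fun z => f (molPt n u z)) (molMeas n) := by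
  refine integrable_molMeas n ?_
  have hs : molSlope n ≠ 0 := by linarith [(molSlope_bounds n).1]
  have h1 : Integrable fun y => f (molSlope n * y + (1 / 2 - molSlope n / 2)) := by
    have := (hf.comp_add_right (1 / 2 - molSlope n / 2)).comp_mul_left' hs
    exact this
  refine (h1.comp_sub_left u).congr (Eventually.of_forall fun z => ?_)
  change f _ = f _
  congr 1
  unfold molPt
  ring

theorem mol_mem_coreSub (n : ℕ) (hf : Integrable f) (hf0 : ∀ u, u ∉ Ioo (0 : ℝ) 1 → f u = 0) :
    mol n f ∈ coreSub := by
  have hs : molSlope n ≠ 0 := by linarith [(molSlope_bounds n).1]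
  constructor
  · have h1 : Integrable fun y => f (molSlope n * y + (1 / 2 - molSlope n / 2)) :=
      (hf.comp_add_right (1 / 2 - molSlope n / 2)).comp_mul_left' hs
    have h2 : mol n f = MeasureTheory.convolution ((molBump n).normed volume)
        (fun y => f (molSlope n * y + (1 / 2 - molSlope n / 2)))
        (ContinuousLinearMap.lsmul ℝ ℝ) volume := by
      ext u
      rw [mol, integral_molMeas, MeasureTheory.convolution_def]
      refine integral_congr_ae (Eventually.of_forall fun z => ?_)
      simp only [ContinuousLinearMap.lsmul_apply, smul_eq_mul, molPt]
      congr 2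
      ring
    rw [h2]
    exact (molBump n).hasCompactSupport_normed.contDiff_convolution_left (n := ⊤) _
      (molBump n).contDiff_normed h1.locallyIntegrable
  -- The dilation shrinks `(0,1)` by a margin of four radii at each end and the convolution gives
  -- back at most one, so a margin of two radii survives.
  · refine ⟨molRad n, molRad_pos n, fun u hu => ?_⟩
    rw [mol]
    refine integral_eq_zero_of_ae ?_
    filter_upwards [ae_molMeas n] with z hz
    refine hf0 _ fun hmem => hu ?_
    have h := molPt_inv n u z
    have h1 := molRad_pos n
    have h2 := molRad_le n
    obtain ⟨h3, h4⟩ := abs_lt.1 hz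
    constructor
    · nlinarith [hmem.1]
    · nlinarith [hmem.2]

/-- Jensen in the mollification variable, then for fixed `z` the affine change of variable `u ↦
molPt n u z`, whose Jacobian factor is at most 1. Two weights are allowed because the point moves.
-/
theorem lintegral_mol_le (n : ℕ) (hf : Measurable f) (hf0 : ∀ u, u ∉ Ioo (0 : ℝ) 1 → f u = 0)
    {W W' : ℝ → ℝ≥0∞} (hW' : Measurable W')
    (hWW : ∀ u z, |z| < molRad n → molPt n u z ∈ Ioo (0 : ℝ) 1 → W u ≤ W' (molPt n u z)) :
    ∫⁻ u, W u * ENNReal.ofReal (mol n f u ^ 2) ≤ ∫⁻ u, W' u * ENNReal.ofReal (f u ^ 2) := by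
  obtain ⟨h1, h2, h3⟩ := molSlope_bounds n
  have hF : Measurable fun u => W' u * ENNReal.ofReal (f u ^ 2) :=
    hW'.mul (hf.pow_const 2).ennreal_ofReal
  calc ∫⁻ u, W u * ENNReal.ofReal (mol n f u ^ 2)
      ≤ ∫⁻ u, ∫⁻ z, W' (molPt n u z) * ENNReal.ofReal (f (molPt n u z) ^ 2) ∂(molMeas n) := by
        refine lintegral_mono fun u => ?_
        have hm : Measurable fun z => f (molPt n u z) :=
          hf.comp ((measurable_molPt n).comp measurable_prodMk_left)
        calc _ ≤ W u * ∫⁻ z, ENNReal.ofReal (f (molPt n u z) ^ 2) ∂(molMeas n) :=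
              mul_le_mul_right (ofReal_sq_integral_le hm.aemeasurable) _
          _ = ∫⁻ z, W u * ENNReal.ofReal (f (molPt n u z) ^ 2) ∂(molMeas n) :=
              (lintegral_const_mul _ (hm.pow_const 2).ennreal_ofReal).symm
          _ ≤ _ := by
              refine lintegral_mono_ae ?_
              filter_upwards [ae_molMeas n] with z hz
              by_cases hp : molPt n u z ∈ Ioo (0 : ℝ) 1
              · exact mul_le_mul_left (hWW u z hz hp) _
              · simp [hf0 _ hp]
    _ = ∫⁻ z, ∫⁻ u, W' (molPt n u z) * ENNReal.ofReal (f (molPt n u z) ^ 2) ∂volume ∂(molMeas n) :=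
        lintegral_lintegral_swap (hF.comp (measurable_molPt n)).aemeasurable
    _ = ∫⁻ _, ENNReal.ofReal (molSlope n)⁻¹ * (∫⁻ u, W' u * ENNReal.ofReal (f u ^ 2)) ∂(molMeas n) := by
        refine lintegral_congr fun z => ?_
        exact lintegral_comp_affine hF (by linarith) _
    _ = ENNReal.ofReal (molSlope n)⁻¹ * (∫⁻ u, W' u * ENNReal.ofReal (f u ^ 2)) := by
        rw [lintegral_const, measure_univ, mul_one]
    _ ≤ 1 * ∫⁻ u, W' u * ENNReal.ofReal (f u ^ 2) := by
        refine mul_le_mul_left ?_ _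
        rw [ENNReal.ofReal_le_one]
        exact inv_le_one_of_one_le₀ h1
    _ = _ := one_mul _

theorem lintegral_rotate {ν : Measure ℝ} [SFinite ν] {I : ℝ → ℝ → ℝ → ℝ≥0∞}
    (hI : Measurable fun q : (ℝ × ℝ) × ℝ => I q.1.1 q.1.2 q.2) :
    ∫⁻ u, ∫⁻ v, ∫⁻ z, I u v z ∂ν = ∫⁻ z, ∫⁻ u, ∫⁻ v, I u v z ∂volume ∂volume ∂ν := by
  have h1 : ∀ u, Measurable (Function.uncurry fun v z => I u v z) := by
    intro u
    have : Measurable fun q : ℝ × ℝ => ((u, q.1), q.2) :=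
      (measurable_const.prodMk measurable_fst).prodMk measurable_snd
    exact hI.comp this
  have h2 : Measurable (Function.uncurry fun u z => ∫⁻ v, I u v z) := by
    have h : Measurable fun q : (ℝ × ℝ) × ℝ => ((q.1.1, q.2), q.1.2) :=
      ((measurable_fst.comp measurable_fst).prodMk measurable_snd).prodMk
        (measurable_snd.comp measurable_fst)
    exact (hI.comp h).lintegral_prod_right'
  rw [← lintegral_lintegral_swap h2.aemeasurable]
  exact lintegral_congr fun u => lintegral_lintegral_swap (h1 u).aemeasurable

variable {γ : ℝ}

/-- The Gagliardo energy on the whole line. -/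
def gagLine (γ : ℝ) (f : ℝ → ℝ) : ℝ≥0∞ :=
  ∫⁻ u, ∫⁻ v, ENNReal.ofReal ((f u - f v) ^ 2 / |u - v| ^ (1 + γ))

theorem measurable_gagInt (hf : Measurable f) :
    Measurable fun q : ℝ × ℝ => ENNReal.ofReal ((f q.1 - f q.2) ^ 2 / |q.1 - q.2| ^ (1 + γ)) := by
  have h3 : Measurable fun q : ℝ × ℝ => |q.1 - q.2| ^ (1 + γ) :=
    (measurable_fst.sub measurable_snd).abs.pow_const _
  exact ((((hf.comp measurable_fst).sub (hf.comp measurable_snd)).pow_const 2).div h3).ennreal_ofReal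

/-- Jensen again. With slope `a`, the kernel contributes `a^(1+γ) ≤ a³` and the two changes of
variable `a⁻²`, in total at most `a ≤ 2`. The dilation leaves `(0,1)`, so the energy of the
extension to the line appears. -/
theorem gagEnergy_mol_le (hγ : 1 < γ) (hγ2 : γ < 2) (n : ℕ) (hf : Measurable f) (hfi : Integrable f) :
    gagEnergy γ (mol n f) ≤ 2 * gagLine γ f := by
  obtain ⟨h1, h2, h3⟩ := molSlope_bounds n
  have hs : 0 < molSlope n := by linarith
  set a := molSlope n with ha
  let H : ℝ × ℝ → ℝ≥0∞ := fun q => ENNReal.ofReal ((f q.1 - f q.2) ^ 2 / |q.1 - q.2| ^ (1 + γ))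
  have hH : Measurable H := measurable_gagInt hf
  let c : ℝ≥0∞ := ENNReal.ofReal (a ^ (1 + γ))
  let I : ℝ → ℝ → ℝ → ℝ≥0∞ := fun u v z => c * H (molPt n u z, molPt n v z)
  have hI : Measurable fun q : (ℝ × ℝ) × ℝ => I q.1.1 q.1.2 q.2 := by
    have m1 : Measurable fun q : (ℝ × ℝ) × ℝ => molPt n q.1.1 q.2 :=
      (measurable_molPt n).comp ((measurable_fst.comp measurable_fst).prodMk measurable_snd)
    have m2 : Measurable fun q : (ℝ × ℝ) × ℝ => molPt n q.1.2 q.2 :=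
      (measurable_molPt n).comp ((measurable_snd.comp measurable_fst).prodMk measurable_snd)
    exact (hH.comp (m1.prodMk m2)).const_mul c
  have step1 : ∀ u v, ENNReal.ofReal ((mol n f u - mol n f v) ^ 2 / |u - v| ^ (1 + γ)) ≤
      ∫⁻ z, I u v z ∂(molMeas n) := by
    intro u v
    have hm : ∀ u, Measurable fun z => f (molPt n u z) := fun u =>
      hf.comp ((measurable_molPt n).comp measurable_prodMk_left)
    have e1 : mol n f u - mol n f v = ∫ z, (f (molPt n u z) - f (molPt n v z)) ∂(molMeas n) :=
      (integral_sub (integrable_comp_molPt n hfi u) (integrable_comp_molPt n hfi v)).symm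
    rw [div_eq_inv_mul, ENNReal.ofReal_mul (by positivity), e1]
    calc _ ≤ ENNReal.ofReal (|u - v| ^ (1 + γ))⁻¹ *
          ∫⁻ z, ENNReal.ofReal ((f (molPt n u z) - f (molPt n v z)) ^ 2) ∂(molMeas n) :=
          mul_le_mul_right (ofReal_sq_integral_le ((hm u).sub (hm v)).aemeasurable) _
      _ = ∫⁻ z, ENNReal.ofReal (|u - v| ^ (1 + γ))⁻¹ *
          ENNReal.ofReal ((f (molPt n u z) - f (molPt n v z)) ^ 2) ∂(molMeas n) :=
          (lintegral_const_mul _ (((hm u).sub (hm v)).pow_const 2).ennreal_ofReal).symm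
      _ = _ := by
          refine lintegral_congr fun z => ?_
          simp only [I, H, c]
          rw [← ENNReal.ofReal_mul (by positivity), ← ENNReal.ofReal_mul (by positivity)]
          congr 1
          have e2 : molPt n u z - molPt n v z = a * (u - v) := by unfold molPt; ring
          rw [e2, abs_mul, abs_of_pos hs, Real.mul_rpow hs.le (abs_nonneg _)]
          have : a ^ (1 + γ) ≠ 0 := (Real.rpow_pos_of_pos hs _).ne'
          rw [mul_div_assoc', mul_div_mul_left _ _ this, div_eq_inv_mul]
  have hinner : ∀ z, ∫⁻ u, ∫⁻ v, I u v z = c * (ENNReal.ofReal a⁻¹ * ENNReal.ofReal a⁻¹) *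
      gagLine γ f := by
    intro z
    have e1 : ∀ u, ∫⁻ v, I u v z = c * (ENNReal.ofReal a⁻¹ * ∫⁻ q, H (molPt n u z, q)) := by
      intro u
      have hm : Measurable fun q => H (molPt n u z, q) := hH.comp measurable_prodMk_left
      simp only [I]
      rw [lintegral_const_mul]
      · congr 1
        exact lintegral_comp_affine hm hs _
      · exact hm.comp ((measurable_molPt n).comp measurable_prodMk_right)
    simp only [e1]
    have hm2 : Measurable fun p => ∫⁻ q, H (p, q) := hH.lintegral_prod_right'
    have hm3 : Measurable fun u => molPt n u z := (measurable_molPt n).comp measurable_prodMk_right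
    have hm4 : Measurable fun u => ∫⁻ q, H (molPt n u z, q) := hm2.comp hm3
    rw [lintegral_const_mul _ (hm4.const_mul _), lintegral_const_mul _ hm4]
    have := lintegral_comp_affine hm2 hs (1 / 2 - a / 2 - a * z)
    have h4 : ∫⁻ u, ∫⁻ q, H (molPt n u z, q) = ENNReal.ofReal a⁻¹ * gagLine γ f := this
    rw [h4]
    ring
  calc gagEnergy γ (mol n f) ≤ ∫⁻ u, ∫⁻ v, ENNReal.ofReal
        ((mol n f u - mol n f v) ^ 2 / |u - v| ^ (1 + γ)) :=
        (setLIntegral_le_lintegral _ _).trans (lintegral_mono fun u => setLIntegral_le_lintegral _ _)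
    _ ≤ ∫⁻ u, ∫⁻ v, ∫⁻ z, I u v z ∂(molMeas n) :=
        lintegral_mono fun u => lintegral_mono fun v => step1 u v
    _ = ∫⁻ z, ∫⁻ u, ∫⁻ v, I u v z ∂volume ∂volume ∂(molMeas n) := lintegral_rotate hI
    _ = c * (ENNReal.ofReal a⁻¹ * ENNReal.ofReal a⁻¹) * gagLine γ f := by
        simp only [hinner]
        rw [lintegral_const, measure_univ, mul_one]
    _ ≤ 2 * gagLine γ f := by
        refine mul_le_mul_left ?_ _
        simp only [c]
        rw [← ENNReal.ofReal_mul (by positivity), ← ENNReal.ofReal_mul (by positivity),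
          show (2 : ℝ≥0∞) = ENNReal.ofReal 2 by simp]
        refine ENNReal.ofReal_le_ofReal ?_
        have e1 : a ^ (1 + γ) ≤ a ^ (3 : ℝ) :=
          Real.rpow_le_rpow_of_exponent_le h1 (by linarith)
        have e2 : a ^ (3 : ℝ) = a * (a * a) := by
          rw [show (3 : ℝ) = ((3 : ℕ) : ℝ) by norm_num, Real.rpow_natCast]; ring
        rw [← mul_inv, ← div_eq_mul_inv, div_le_iff₀ (by positivity)]
        have e3 : a * (a * a) ≤ 2 * (a * a) := mul_le_mul_of_nonneg_right h2 (by positivity)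
        exact e1.trans (e2.le.trans e3)

end Mollification

/-! ### Functions of finite energy lie in the form domain. -/

section Density

local notation "⟪" x "," y "⟫" => inner ℝ x y

variable {γ κ e : ℝ} {f : ℝ → ℝ}

theorem lintegral_rpow_Ioi (hγ : 1 < γ) {c : ℝ} (hc : 0 < c) :
    ∫⁻ w in Ioi c, ENNReal.ofReal (1 / |w| ^ (1 + γ)) = ENNReal.ofReal (γ⁻¹ * c ^ (-γ)) := by
  have h1 : ∫⁻ w in Ioi c, ENNReal.ofReal (1 / |w| ^ (1 + γ)) =
      ∫⁻ w in Ioi c, ENNReal.ofReal (w ^ (-(1 + γ))) := by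
    refine setLIntegral_congr_fun measurableSet_Ioi fun w hw => ?_
    have hw0 : 0 < w := hc.trans hw
    rw [abs_of_pos hw0, Real.rpow_neg hw0.le, one_div]
  rw [h1, ← ofReal_integral_eq_lintegral_ofReal (integrableOn_Ioi_rpow_of_lt (by linarith) hc)
    (by
      filter_upwards [ae_restrict_mem measurableSet_Ioi] with w hw
      exact Real.rpow_nonneg (hc.trans hw).le _), integral_Ioi_rpow_of_lt (by linarith) hc]
  congr 1
  rw [show -(1 + γ) + 1 = -γ by ring, neg_div_neg_eq, div_eq_inv_mul]

/-- The kernel integrates explicitly over the two half-lines; the factor `γ⁻¹` is dropped as it is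
at most 1. -/
theorem lintegral_compl_kernel_le (hγ : 1 < γ) {u : ℝ} (hu : u ∈ Ioo (0 : ℝ) 1) :
    ∫⁻ v in (Ioo (0 : ℝ) 1)ᶜ, ENNReal.ofReal (1 / |u - v| ^ (1 + γ)) ≤
      ENNReal.ofReal (u ^ (-γ) + (1 - u) ^ (-γ)) := by
  have hu1 : 0 < 1 - u := by linarith [hu.2]
  have hsub : (Ioo (0 : ℝ) 1)ᶜ ⊆ Iic 0 ∪ Ici 1 := by
    intro v hv
    by_contra h
    simp only [mem_union, mem_Iic, mem_Ici, not_or, not_le] at h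
    exact hv h
  have hm : Measurable fun w : ℝ => ENNReal.ofReal (1 / |w| ^ (1 + γ)) :=
    (measurable_const.div (measurable_id.abs.pow_const _)).ennreal_ofReal
  have h1 : ∫⁻ v in Iic (0 : ℝ), ENNReal.ofReal (1 / |u - v| ^ (1 + γ)) =
      ENNReal.ofReal (γ⁻¹ * u ^ (-γ)) := by
    rw [← lintegral_rpow_Ioi hγ hu.1, setLIntegral_congr Iio_ae_eq_Iic.symm,
      ← lintegral_indicator measurableSet_Iio, ← lintegral_indicator measurableSet_Ioi,
      ← lintegral_sub_left_eq_self ((Ioi u).indicator _) u]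
    refine lintegral_congr fun v => ?_
    by_cases hv : v < 0
    · rw [indicator_of_mem (show v ∈ Iio (0:ℝ) from hv),
        indicator_of_mem (show u - v ∈ Ioi u by simp only [mem_Ioi]; linarith)]
    · rw [indicator_of_notMem (show v ∉ Iio (0:ℝ) from hv),
        indicator_of_notMem (show u - v ∉ Ioi u by simp only [mem_Ioi]; linarith)]
  have h2 : ∫⁻ v in Ici (1 : ℝ), ENNReal.ofReal (1 / |u - v| ^ (1 + γ)) =
      ENNReal.ofReal (γ⁻¹ * (1 - u) ^ (-γ)) := by
    rw [← lintegral_rpow_Ioi hγ hu1, setLIntegral_congr Ioi_ae_eq_Ici.symm,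
      ← lintegral_indicator measurableSet_Ioi, ← lintegral_indicator measurableSet_Ioi,
      ← lintegral_sub_right_eq_self ((Ioi (1 - u)).indicator _) u]
    refine lintegral_congr fun v => ?_
    by_cases hv : 1 < v
    · rw [indicator_of_mem (show v ∈ Ioi (1:ℝ) from hv),
        indicator_of_mem (show v - u ∈ Ioi (1 - u) by simp only [mem_Ioi]; linarith), abs_sub_comm]
    · rw [indicator_of_notMem (show v ∉ Ioi (1:ℝ) from hv),
        indicator_of_notMem (show v - u ∉ Ioi (1 - u) by simp only [mem_Ioi]; linarith)]
  calc _ ≤ ∫⁻ v in Iic (0 : ℝ) ∪ Ici 1, ENNReal.ofReal (1 / |u - v| ^ (1 + γ)) :=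
        lintegral_mono_set hsub
    _ ≤ _ := lintegral_union_le _ _ _
    _ = ENNReal.ofReal (γ⁻¹ * u ^ (-γ)) + ENNReal.ofReal (γ⁻¹ * (1 - u) ^ (-γ)) := by rw [h1, h2]
    _ = ENNReal.ofReal (γ⁻¹ * (u ^ (-γ) + (1 - u) ^ (-γ))) := by
        have := hu.1
        rw [← ENNReal.ofReal_add (by positivity) (by positivity)]
        congr 1
        ring
    _ ≤ _ := by
        have := hu.1
        refine ENNReal.ofReal_le_ofReal (mul_le_of_le_one_left (by positivity)
          (inv_le_one_of_one_le₀ hγ.le))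

/-- For a function vanishing outside `(0,1)` the interaction with the outside is `f(u)²` times the
outer kernel mass, which the boundary weight dominates; it occurs twice by symmetry. This is where
finite boundary energy encodes the Dirichlet condition. -/
theorem gagLine_le (hγ : 1 < γ) (hf : Measurable f) (hf0 : ∀ u, u ∉ Ioo (0 : ℝ) 1 → f u = 0) :
    gagLine γ f ≤ gagEnergy γ f + 2 * potEnergy γ f := by
  let H : ℝ → ℝ → ℝ≥0∞ := fun u v => ENNReal.ofReal ((f u - f v) ^ 2 / |u - v| ^ (1 + γ))
  have hH : Measurable (Function.uncurry H) := measurable_gagInt hf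
  have hcross : ∫⁻ u in Ioo (0 : ℝ) 1, ∫⁻ v in (Ioo (0 : ℝ) 1)ᶜ, H u v ≤ potEnergy γ f := by
    refine lintegral_mono_ae ?_
    filter_upwards [ae_restrict_mem measurableSet_Ioo] with u hu
    calc ∫⁻ v in (Ioo (0 : ℝ) 1)ᶜ, H u v = ∫⁻ v in (Ioo (0 : ℝ) 1)ᶜ,
          ENNReal.ofReal (f u ^ 2) * ENNReal.ofReal (1 / |u - v| ^ (1 + γ)) := by
          refine setLIntegral_congr_fun measurableSet_Ioo.compl fun v hv => ?_
          simp only [H]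
          rw [hf0 v hv, sub_zero, ← ENNReal.ofReal_mul (sq_nonneg _), mul_one_div]
      _ = ENNReal.ofReal (f u ^ 2) * ∫⁻ v in (Ioo (0 : ℝ) 1)ᶜ,
          ENNReal.ofReal (1 / |u - v| ^ (1 + γ)) := by
          refine lintegral_const_mul _ ?_
          exact (measurable_const.div
            ((measurable_const.sub measurable_id).abs.pow_const _)).ennreal_ofReal
      _ ≤ ENNReal.ofReal (f u ^ 2) * ENNReal.ofReal (u ^ (-γ) + (1 - u) ^ (-γ)) :=
          mul_le_mul_right (lintegral_compl_kernel_le hγ hu) _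
      _ = _ := by rw [← ENNReal.ofReal_mul (sq_nonneg _), mul_comm]
  have hzero : ∀ u ∈ (Ioo (0 : ℝ) 1)ᶜ, ∫⁻ v, H u v = ∫⁻ v in Ioo (0 : ℝ) 1, H u v := by
    intro u hu
    rw [← lintegral_indicator measurableSet_Ioo]
    refine lintegral_congr fun v => ?_
    by_cases hv : v ∈ Ioo (0 : ℝ) 1
    · rw [indicator_of_mem hv]
    · rw [indicator_of_notMem hv]
      simp [H, hf0 u hu, hf0 v hv]
  have hsymm : ∀ u v, H u v = H v u := by
    intro u v
    simp only [H]
    rw [abs_sub_comm, ← neg_sub (f v), neg_sq]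
  have h1 : gagLine γ f = (∫⁻ u in Ioo (0 : ℝ) 1, ∫⁻ v, H u v) +
      ∫⁻ u in (Ioo (0 : ℝ) 1)ᶜ, ∫⁻ v, H u v := (lintegral_add_compl _ measurableSet_Ioo).symm
  have h2 : ∫⁻ u in Ioo (0 : ℝ) 1, ∫⁻ v, H u v =
      gagEnergy γ f + ∫⁻ u in Ioo (0 : ℝ) 1, ∫⁻ v in (Ioo (0 : ℝ) 1)ᶜ, H u v := by
    have : ∀ u, ∫⁻ v, H u v = (∫⁻ v in Ioo (0 : ℝ) 1, H u v) + ∫⁻ v in (Ioo (0 : ℝ) 1)ᶜ, H u v :=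
      fun u => (lintegral_add_compl _ measurableSet_Ioo).symm
    simp only [this]
    rw [lintegral_add_left]
    · rfl
    · exact hH.lintegral_prod_right'
  have h3 : ∫⁻ u in (Ioo (0 : ℝ) 1)ᶜ, ∫⁻ v, H u v =
      ∫⁻ u in Ioo (0 : ℝ) 1, ∫⁻ v in (Ioo (0 : ℝ) 1)ᶜ, H u v := by
    rw [setLIntegral_congr_fun measurableSet_Ioo.compl hzero,
      lintegral_lintegral_swap hH.aemeasurable]
    simp only [hsymm]
  rw [h1, h2, h3, two_mul, ← add_assoc]
  gcongr

/-- The inversion formula gives `u ≥ p/2` and `1-u ≥ (1-p)/2` for `p = molPt n u z`, at a cost of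
`2^γ ≤ 4`. -/
theorem weight_mol_le (hγ : 1 < γ) (hγ2 : γ < 2) (n : ℕ) {u z : ℝ} (hz : |z| < molRad n)
    (hp : molPt n u z ∈ Ioo (0 : ℝ) 1) :
    u ^ (-γ) + (1 - u) ^ (-γ) ≤ 4 * (molPt n u z ^ (-γ) + (1 - molPt n u z) ^ (-γ)) := by
  have h := molPt_inv n u z
  set p := molPt n u z
  have h1 := molRad_pos n
  have h2 := molRad_le n
  obtain ⟨h3, h4⟩ := abs_lt.1 hz
  have key : ∀ a b : ℝ, 0 < b → b / 2 ≤ a → a ^ (-γ) ≤ 4 * b ^ (-γ) := by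
    intro a b hb hab
    calc a ^ (-γ) ≤ (b / 2) ^ (-γ) :=
          Real.rpow_le_rpow_of_nonpos (by positivity) hab (by linarith)
      _ = 2 ^ γ * b ^ (-γ) := by
          rw [Real.div_rpow hb.le (by norm_num), Real.rpow_neg (by norm_num : (0:ℝ) ≤ 2),
            div_inv_eq_mul, mul_comm]
      _ ≤ 4 * b ^ (-γ) := by
          refine mul_le_mul_of_nonneg_right ?_ (by positivity)
          calc (2 : ℝ) ^ γ ≤ 2 ^ (2 : ℝ) := Real.rpow_le_rpow_of_exponent_le (by norm_num) hγ2.le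
            _ = 4 := by norm_num
  have a1 := key u p hp.1 (by nlinarith [hp.1])
  have a2 := key (1 - u) (1 - p) (by linarith [hp.2]) (by nlinarith [hp.2])
  linarith

theorem potEnergy_mol_le (hγ : 1 < γ) (hγ2 : γ < 2) (n : ℕ) (hf : Measurable f)
    (hf0 : ∀ u, u ∉ Ioo (0 : ℝ) 1 → f u = 0) : potEnergy γ (mol n f) ≤ 4 * potEnergy γ f := by
  have hm : Measurable fun u : ℝ => u ^ (-γ) + (1 - u) ^ (-γ) :=
    (measurable_id.pow_const _).add ((measurable_const.sub measurable_id).pow_const _)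
  have hV : ∀ u ∈ Ioo (0 : ℝ) 1, 0 ≤ u ^ (-γ) + (1 - u) ^ (-γ) := fun u hu => by
    have := hu.1
    have : 0 < 1 - u := by linarith [hu.2]
    positivity
  have eq : ∀ g : ℝ → ℝ, potEnergy γ g = ∫⁻ u, (Ioo (0 : ℝ) 1).indicator
      (fun u => ENNReal.ofReal (u ^ (-γ) + (1 - u) ^ (-γ))) u * ENNReal.ofReal (g u ^ 2) := by
    intro g
    rw [potEnergy, ← lintegral_indicator measurableSet_Ioo]
    refine lintegral_congr fun u => ?_
    by_cases hu : u ∈ Ioo (0 : ℝ) 1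
    · rw [indicator_of_mem hu, indicator_of_mem hu, ENNReal.ofReal_mul (hV u hu)]
    · rw [indicator_of_notMem hu, indicator_of_notMem hu, zero_mul]
  have hW : Measurable ((Ioo (0 : ℝ) 1).indicator
      fun u => ENNReal.ofReal (u ^ (-γ) + (1 - u) ^ (-γ))) :=
    hm.ennreal_ofReal.indicator measurableSet_Ioo
  have hWf : Measurable fun u => (Ioo (0 : ℝ) 1).indicator
      (fun u => ENNReal.ofReal (u ^ (-γ) + (1 - u) ^ (-γ))) u * ENNReal.ofReal (f u ^ 2) :=
    hW.mul (hf.pow_const 2).ennreal_ofReal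
  rw [eq, eq, ← lintegral_const_mul _ hWf]
  simp only [← mul_assoc]
  refine lintegral_mol_le n hf hf0 (hW.const_mul 4) fun u z hz hp => ?_
  rw [indicator_of_mem hp]
  refine (indicator_le_self _ _ u).trans ?_
  rw [show (4 : ℝ≥0∞) = ENNReal.ofReal 4 by simp, ← ENNReal.ofReal_mul (by norm_num)]
  exact ENNReal.ofReal_le_ofReal (weight_mol_le hγ hγ2 n hz hp)

theorem lintegral_mol_sq_le (n : ℕ) (hf : Measurable f)
    (hf0 : ∀ u, u ∉ Ioo (0 : ℝ) 1 → f u = 0) :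
    ∫⁻ u in Ioo (0 : ℝ) 1, ENNReal.ofReal (mol n f u ^ 2) ≤
      ∫⁻ u in Ioo (0 : ℝ) 1, ENNReal.ofReal (f u ^ 2) := by
  have h := lintegral_mol_le n hf hf0 (W := fun _ => 1) (W' := fun _ => 1) measurable_const
    fun _ _ _ _ => le_rfl
  simp only [one_mul] at h
  refine (setLIntegral_le_lintegral _ _).trans (h.trans (le_of_eq ?_))
  rw [← lintegral_indicator measurableSet_Ioo]
  refine lintegral_congr fun u => ?_
  by_cases hu : u ∈ Ioo (0 : ℝ) 1
  · rw [indicator_of_mem hu]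
  · rw [indicator_of_notMem hu, hf0 u hu]; simp

theorem ofReal_norm_sq_toLp {Ω : Type*} [MeasurableSpace Ω] {ν : Measure Ω} {g : Ω → ℝ}
    (hg : MemLp g 2 ν) : ENNReal.ofReal (‖hg.toLp g‖ ^ 2) = ∫⁻ x, ENNReal.ofReal (g x ^ 2) ∂ν := by
  rw [norm_sq_toLp, ofReal_integral_eq_lintegral_ofReal hg.integrable_sq
    (Eventually.of_forall fun x => sq_nonneg _)]

theorem tendsto_mol {ψ : ℝ → ℝ} {u : ℝ} (hu : u ∈ Ioo (0 : ℝ) 1) (hψ : ContinuousAt ψ u)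
    (hψi : Integrable ψ) : Tendsto (fun n => mol n ψ u) atTop (𝓝 (ψ u)) := by
  rw [Metric.tendsto_atTop']
  intro ε hε
  obtain ⟨δ, hδ, h⟩ := Metric.continuousAt_iff.1 hψ (ε / 2) (half_pos hε)
  obtain ⟨M, hM⟩ := exists_nat_gt (18 / δ)
  refine ⟨M, fun n hn => ?_⟩
  have hr : 18 * molRad n < δ := by
    unfold molRad
    have h1 : (M : ℝ) ≤ n := by exact_mod_cast hn.le
    rw [mul_one_div, div_lt_iff₀ (by positivity)]
    rw [div_lt_iff₀ hδ] at hM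
    nlinarith
  have e1 : mol n ψ u - ψ u = ∫ z, (ψ (molPt n u z) - ψ u) ∂(molMeas n) := by
    rw [integral_sub (integrable_comp_molPt n hψi u) (integrable_const _), integral_const]
    simp [mol]
  rw [Real.dist_eq, e1]
  have := norm_integral_le_of_norm_le_const (μ := molMeas n) (C := ε / 2)
    (f := fun z => ψ (molPt n u z) - ψ u) (by
      filter_upwards [ae_molMeas n] with z hz
      have h2 := h (x := molPt n u z) (by
        rw [Real.dist_eq]
        exact (abs_molPt_sub_le n hu hz).trans_lt hr)
      rw [Real.dist_eq] at h2
      exact h2.le)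
  simp only [probReal_univ, mul_one, Real.norm_eq_abs] at this
  linarith

/-- The term split off in `formMap` recombines with the potential, so on the core the form norm is
exactly the energy with its constants. -/
theorem ofReal_norm_sq_coreEmb (hγ : 1 < γ) (hγ2 : γ < 2) (hκ : 0 < κ) (he : 0 ≤ e)
    (G : coreSub) : ENNReal.ofReal (‖coreEmb hγ hγ2 hκ.le he G‖ ^ 2) =
      ENNReal.ofReal (κ * (cGamma γ * γ⁻¹)) * potEnergy γ G +
        ENNReal.ofReal (e * cGamma γ / 2) * gagEnergy γ G := by
  have hc := cGamma_pos hγ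
  have hc' : 0 < cGamma γ * γ⁻¹ := mul_pos hc (inv_pos.2 (by linarith))
  have hm := lowBd_pos hγ hκ
  have hGm : Measurable (G : ℝ → ℝ) := G.2.1.continuous.measurable
  have h1 : ‖coreEmb hγ hγ2 hκ.le he G‖ ^ 2 = ‖Real.sqrt (lowBd γ κ) • (memLp_core G).toLp _‖ ^ 2 +
      (‖(memLp_potComp_core hγ hκ.le G).toLp _‖ ^ 2 +
        ‖(memLp_jumpComp_core hγ hγ2 he G).toLp _‖ ^ 2) := by
    change ‖formMap hγ hγ2 hκ.le he G‖ ^ 2 = _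
    rw [WithLp.prod_norm_sq_eq_of_L2, WithLp.prod_norm_sq_eq_of_L2]
    rfl
  rw [h1, norm_smul, mul_pow, Real.norm_eq_abs, sq_abs, Real.sq_sqrt hm.le,
    ENNReal.ofReal_add (by positivity) (by positivity),
    ENNReal.ofReal_add (by positivity) (by positivity), ENNReal.ofReal_mul hm.le,
    ofReal_norm_sq_toLp, ofReal_norm_sq_toLp, ofReal_norm_sq_toLp, ← add_assoc]
  congr 1
  · rw [← lintegral_const_mul _ (hGm.pow_const 2).ennreal_ofReal, ← lintegral_add_left
      ((hGm.pow_const 2).ennreal_ofReal.const_mul _), potEnergy, ← lintegral_const_mul']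
    · refine lintegral_congr_ae ?_
      filter_upwards [ae_restrict_mem measurableSet_Ioo] with u hu
      have hV := lowBd_le_V₁ hγ hκ.le hu
      unfold potComp
      rw [mul_pow, Real.sq_sqrt (by linarith), ← ENNReal.ofReal_mul hm.le,
        ← ENNReal.ofReal_add (by positivity) (mul_nonneg (by linarith) (sq_nonneg _)),
        ← ENNReal.ofReal_mul (by positivity)]
      congr 1
      unfold V₁ rMinus rPlus
      ring
    · exact ENNReal.ofReal_ne_top
  · rw [gagEnergy_eq_prod hGm.aemeasurable, ← lintegral_const_mul _ (measurable_gagInt hGm)]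
    refine lintegral_congr fun q => ?_
    rw [sq, jumpComp_mul hγ he, ← ENNReal.ofReal_mul (by positivity)]
    congr 1
    unfold gagl
    ring

/-- The constant comparing the norm of the form domain with the energy. -/
def formConst (γ κ e : ℝ) : ℝ := 4 * (κ * (cGamma γ * γ⁻¹)) + cGamma γ * (1 + 2 * e)

theorem formConst_nonneg (hγ : 1 < γ) (hκ : 0 ≤ κ) (he : 0 ≤ e) : 0 ≤ formConst γ κ e := by
  have := cGamma_pos hγ
  unfold formConst
  positivity

theorem norm_sq_coreEmb_mol_le (hγ : 1 < γ) (hγ2 : γ < 2) (hκ : 0 < κ) (he : 0 ≤ e) (n : ℕ)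
    (hf : Measurable f) (hfi : Integrable f) (hf0 : ∀ u, u ∉ Ioo (0 : ℝ) 1 → f u = 0) :
    ENNReal.ofReal (‖coreEmb hγ hγ2 hκ.le he ⟨mol n f, mol_mem_coreSub n hfi hf0⟩‖ ^ 2) ≤
      ENNReal.ofReal (formConst γ κ e) * (potEnergy γ f + ENNReal.ofReal e * gagEnergy γ f) := by
  have hc := cGamma_pos hγ
  rw [ofReal_norm_sq_coreEmb hγ hγ2 hκ he]
  have h1 := potEnergy_mol_le hγ hγ2 n hf hf0
  have h2 := (gagEnergy_mol_le hγ hγ2 n hf hfi).trans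
    (mul_le_mul_right (gagLine_le hγ hf hf0) 2)
  set p := potEnergy γ f
  set q := gagEnergy γ f
  have e1 : ENNReal.ofReal (formConst γ κ e) = ENNReal.ofReal (κ * (cGamma γ * γ⁻¹)) * 4 +
      (ENNReal.ofReal (cGamma γ) + ENNReal.ofReal (e * cGamma γ / 2) * 4) := by
    rw [show (4 : ℝ≥0∞) = ENNReal.ofReal 4 by simp, ← ENNReal.ofReal_mul (by positivity),
      ← ENNReal.ofReal_mul (by positivity), ← ENNReal.ofReal_add (by positivity) (by positivity),
      ← ENNReal.ofReal_add (by positivity) (by positivity)]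
    congr 1
    unfold formConst
    ring
  have e2 : ENNReal.ofReal (e * cGamma γ / 2) * 2 = ENNReal.ofReal (cGamma γ) * ENNReal.ofReal e := by
    rw [show (2 : ℝ≥0∞) = ENNReal.ofReal 2 by simp, ← ENNReal.ofReal_mul (by positivity),
      ← ENNReal.ofReal_mul (by positivity)]
    congr 1
    ring
  calc _ ≤ ENNReal.ofReal (κ * (cGamma γ * γ⁻¹)) * (4 * p) +
        ENNReal.ofReal (e * cGamma γ / 2) * (2 * (q + 2 * p)) := by gcongr
    _ = (ENNReal.ofReal (κ * (cGamma γ * γ⁻¹)) * 4 + ENNReal.ofReal (e * cGamma γ / 2) * 4) * p +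
        ENNReal.ofReal (cGamma γ) * (ENNReal.ofReal e * q) := by
        rw [← mul_assoc (ENNReal.ofReal (cGamma γ)), ← e2]
        ring
    _ ≤ ENNReal.ofReal (formConst γ κ e) * p + ENNReal.ofReal (formConst γ κ e) *
        (ENNReal.ofReal e * q) := by
        gcongr
        · rw [e1]
          gcongr
          exact le_add_self
        · unfold formConst
          have : 0 ≤ κ * (cGamma γ * γ⁻¹) := by positivity
          nlinarith [mul_nonneg hc.le he]
    _ = _ := (mul_add _ _ _).symm

theorem potEnergy_congr {f g : ℝ → ℝ} (h : f =ᵐ[unitMeas] g) : potEnergy γ f = potEnergy γ g := by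
  refine lintegral_congr_ae ?_
  filter_upwards [h] with u hu
  rw [hu]

theorem gagEnergy_congr {f g : ℝ → ℝ} (h : f =ᵐ[unitMeas] g) : gagEnergy γ f = gagEnergy γ g := by
  refine lintegral_congr_ae ?_
  filter_upwards [h] with u hu
  refine lintegral_congr_ae ?_
  filter_upwards [h] with v hv
  rw [hu, hv]

/-- The representative of an element of `L²(0,1)` that vanishes outside `(0,1)`. -/
def zeroExt (w : HS) : ℝ → ℝ := (Ioo (0 : ℝ) 1).indicator w

theorem measurable_zeroExt (w : HS) : Measurable (zeroExt w) :=
  (Lp.stronglyMeasurable w).measurable.indicator measurableSet_Ioo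

theorem integrable_zeroExt (w : HS) : Integrable (zeroExt w) := by
  rw [zeroExt, integrable_indicator_iff measurableSet_Ioo]
  exact (Lp.memLp w).integrable (by norm_num)

theorem zeroExt_eq_zero (w : HS) (u : ℝ) (hu : u ∉ Ioo (0 : ℝ) 1) : zeroExt w u = 0 :=
  indicator_of_notMem hu _

theorem zeroExt_ae (w : HS) : zeroExt w =ᵐ[unitMeas] w := by
  filter_upwards [ae_restrict_mem measurableSet_Ioo] with u hu
  exact indicator_of_mem hu _

/-- The dilated mollification of an element of `L²(0,1)`, in the core. -/
def molCore (n : ℕ) (w : HS) : coreSub :=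
  ⟨mol n (zeroExt w), mol_mem_coreSub n (integrable_zeroExt w) (zeroExt_eq_zero w)⟩

/-- This makes the mollification depend only on the almost-everywhere class of the function. -/
theorem quasiMeasurePreserving_molPt (n : ℕ) (u : ℝ) :
    Measure.QuasiMeasurePreserving (fun y => molPt n u y) (molMeas n) volume := by
  have hs : molSlope n ≠ 0 := by linarith [(molSlope_bounds n).1]
  have h : Measure.QuasiMeasurePreserving (fun y => molPt n u y) volume volume := by
    have e1 : (fun y => molPt n u y) = (fun y => y + (molSlope n * u + (1 / 2 - molSlope n / 2))) ∘
        fun y => (-molSlope n) * y := by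
      ext y
      simp only [Function.comp, molPt]
      ring
    rw [e1]
    refine (measurePreserving_add_right volume _).quasiMeasurePreserving.comp
      ⟨measurable_const_mul _, ?_⟩
    rw [Real.map_volume_mul_left (neg_ne_zero.2 hs)]
    exact Measure.smul_absolutelyContinuous
  exact h.mono_left (withDensity_absolutelyContinuous _ _)

theorem mol_congr (n : ℕ) {f g : ℝ → ℝ} (h : f =ᵐ[volume] g) (u : ℝ) : mol n f u = mol n g u :=
  integral_congr_ae ((quasiMeasurePreserving_molPt n u).ae h)

theorem zeroExt_sub_ae (w z : HS) :
    (fun x => zeroExt w x - zeroExt z x) =ᵐ[volume] zeroExt (w - z) := by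
  have h1 := (ae_restrict_iff' measurableSet_Ioo).1 (Lp.coeFn_sub w z)
  filter_upwards [h1] with x hx
  by_cases hm : x ∈ Ioo (0 : ℝ) 1
  · simp only [zeroExt, indicator_of_mem hm, hx hm, Pi.sub_apply]
  · simp only [zeroExt, indicator_of_notMem hm, sub_zero]

theorem norm_molCore_le (n : ℕ) (w : HS) : ‖(memLp_core (molCore n w)).toLp _‖ ≤ ‖w‖ := by
  have h1 : ENNReal.ofReal (‖(memLp_core (molCore n w)).toLp _‖ ^ 2) ≤
      ENNReal.ofReal (‖w‖ ^ 2) := by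
    rw [ofReal_norm_sq_toLp, ← lintegral_sq_eq]
    refine (lintegral_mol_sq_le n (measurable_zeroExt w) (zeroExt_eq_zero w)).trans (le_of_eq ?_)
    refine lintegral_congr_ae ?_
    filter_upwards [zeroExt_ae w] with u hu
    rw [hu]
  exact (sq_le_sq₀ (norm_nonneg _) (norm_nonneg _)).1
    ((ENNReal.ofReal_le_ofReal_iff (sq_nonneg _)).1 h1)

theorem norm_molCore_sub_le (n : ℕ) (w z : HS) :
    ‖(memLp_core (molCore n w)).toLp _ - (memLp_core (molCore n z)).toLp _‖ ≤ ‖w - z‖ := by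
  have h0 : (memLp_core (molCore n w)).toLp _ - (memLp_core (molCore n z)).toLp _ =
      (memLp_core (molCore n (w - z))).toLp _ := by
    rw [← MemLp.toLp_sub]
    refine MemLp.toLp_congr _ _ (Eventually.of_forall fun u => ?_)
    change mol n (zeroExt w) u - mol n (zeroExt z) u = mol n (zeroExt (w - z)) u
    rw [← mol_congr n (zeroExt_sub_ae w z)]
    exact (integral_sub (integrable_comp_molPt n (integrable_zeroExt w) u)
      (integrable_comp_molPt n (integrable_zeroExt z) u)).symm
  rw [h0]
  exact norm_molCore_le n _

/-- The mollifications are contractions of `L²`, so convergence on the dense set of continuous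
functions suffices. -/
theorem tendsto_molCore (w : HS) :
    Tendsto (fun n => (memLp_core (molCore n w)).toLp _) atTop (𝓝 w) := by
  rw [Metric.tendsto_atTop]
  intro ε hε
  obtain ⟨φ, hφ, hφw⟩ := exists_continuous_approx w (show 0 < ε / 3 by positivity)
  have hmem := memLp_of_continuousOn (hφ.continuousOn (s := Icc 0 1))
  obtain ⟨C, hC⟩ := isCompact_Icc.exists_bound_of_continuousOn (hφ.continuousOn (s := Icc (0 : ℝ) 1))
  have hC0 : 0 ≤ C := (norm_nonneg _).trans (hC 0 ⟨le_rfl, zero_le_one⟩)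
  set y : HS := hmem.toLp φ with hy
  have hφ0 : zeroExt y =ᵐ[volume] (Ioo (0 : ℝ) 1).indicator φ := by
    have h1 := (ae_restrict_iff' measurableSet_Ioo).1 hmem.coeFn_toLp
    filter_upwards [h1] with x hx
    by_cases hm : x ∈ Ioo (0 : ℝ) 1
    · simp only [zeroExt, indicator_of_mem hm]
      exact hx hm
    · simp only [zeroExt, indicator_of_notMem hm]
  have hconv : Tendsto (fun n => (memLp_core (molCore n y)).toLp _) atTop (𝓝 y) := by
    refine tendsto_toLp_of_dominated (C := C) _ hmem (Eventually.of_forall fun n =>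
      Eventually.of_forall fun u => ?_) ?_
    · change |mol n (zeroExt y) u| ≤ C
      rw [mol_congr n hφ0]
      have := norm_integral_le_of_norm_le_const (μ := molMeas n) (C := C)
        (f := fun z => (Ioo (0 : ℝ) 1).indicator φ (molPt n u z)) (Eventually.of_forall fun z => by
          by_cases hm : molPt n u z ∈ Ioo (0 : ℝ) 1
          · rw [indicator_of_mem hm]
            exact hC _ (Ioo_subset_Icc_self hm)
          · rw [indicator_of_notMem hm, norm_zero]
            exact hC0)
      rwa [probReal_univ, mul_one] at this
    · filter_upwards [ae_restrict_mem measurableSet_Ioo] with u hu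
      have hi : Integrable ((Ioo (0 : ℝ) 1).indicator φ) := (integrable_zeroExt y).congr hφ0
      have hc : ContinuousAt ((Ioo (0 : ℝ) 1).indicator φ) u := by
        refine hφ.continuousAt.congr ?_
        filter_upwards [isOpen_Ioo.mem_nhds hu] with v hv
        exact (indicator_of_mem hv _).symm
      have := tendsto_mol hu hc hi
      rw [indicator_of_mem hu] at this
      refine this.congr fun n => ?_
      exact (mol_congr n hφ0 u).symm
  obtain ⟨M, hM⟩ := Metric.tendsto_atTop.1 hconv (ε / 3) (by positivity)
  refine ⟨M, fun n hn => ?_⟩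
  have h1 := hM n hn
  have h2 := norm_molCore_sub_le n w y
  rw [dist_eq_norm] at h1 ⊢
  have h3 : (memLp_core (molCore n w)).toLp _ - w =
      ((memLp_core (molCore n w)).toLp _ - (memLp_core (molCore n y)).toLp _) +
      ((memLp_core (molCore n y)).toLp _ - y) - (w - y) := by abel
  have h4 : ‖w - y‖ < ε / 3 := hφw
  rw [h3]
  refine (norm_sub_le _ _).trans_lt ?_
  have := norm_add_le ((memLp_core (molCore n w)).toLp _ - (memLp_core (molCore n y)).toLp _)
    ((memLp_core (molCore n y)).toLp _ - y)
  linarith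

/-- Functions of finite energy belong to the form domain. -/
theorem exists_formEmb_eq (hγ : 1 < γ) (hγ2 : γ < 2) (hκ : 0 < κ) (he : 0 ≤ e) (w : HS)
    (hw : potEnergy γ w + ENNReal.ofReal e * gagEnergy γ w < ⊤) :
    ∃ v : FormDom hγ hγ2 hκ.le he, formEmb hγ hγ2 hκ.le he v = w ∧
      ‖v‖ ^ 2 ≤ formConst γ κ e *
        (potEnergy γ w + ENNReal.ofReal e * gagEnergy γ w).toReal := by
  set E := potEnergy γ w + ENNReal.ofReal e * gagEnergy γ w with hE
  have hE' : potEnergy γ (zeroExt w) + ENNReal.ofReal e * gagEnergy γ (zeroExt w) = E := by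
    rw [potEnergy_congr (zeroExt_ae w), gagEnergy_congr (zeroExt_ae w)]
  have hC := formConst_nonneg hγ hκ.le he
  have hb : ∀ n, ‖coreEmb hγ hγ2 hκ.le he (molCore n w)‖ ≤
      Real.sqrt (formConst γ κ e * E.toReal) := by
    intro n
    refine Real.le_sqrt_of_sq_le ?_
    have h := norm_sq_coreEmb_mol_le hγ hγ2 hκ he n (measurable_zeroExt w) (integrable_zeroExt w)
      (zeroExt_eq_zero w)
    rw [hE', ← ENNReal.ofReal_toReal hw.ne, ← ENNReal.ofReal_mul hC] at h
    exact (ENNReal.ofReal_le_ofReal_iff (by positivity)).1 h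
  -- Boundedness of the mollifications in form norm, rather than convergence, is enough: a weak
  -- limit stays in the closed form domain and is mapped to their `L²` limit `w`.
  obtain ⟨v, hv, hvw⟩ := exists_preimage_of_weak_limit (formEmb hγ hγ2 hκ.le he) (l := atTop)
    (Eventually.of_forall hb) (w := w) (by
      simp only [formEmb_coreEmb hγ hγ2 hκ he]
      exact tendsto_molCore w)
  refine ⟨v, hvw, ?_⟩
  have := pow_le_pow_left₀ (norm_nonneg _) hv 2
  rwa [Real.sq_sqrt (by positivity)] at this

end Density

/-! ### The limiting resolvent and semigroup. -/

section Semigroup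

local notation "⟪" x "," y "⟫" => inner ℝ x y

variable {γ κ e : ℝ} {eN : ℕ → ℝ}

/-- The standing assumptions: the exchange strength `eN` decreases to `e`. -/
structure Params (γ κ e : ℝ) (eN : ℕ → ℝ) : Prop where
  one_lt : 1 < γ
  lt_two : γ < 2
  pos : 0 < κ
  nonneg : 0 ≤ e
  le : ∀ N, e ≤ eN N
  le_one : ∀ N, eN N ≤ 1
  tendsto : Tendsto eN atTop (𝓝 e)

theorem Params.nonneg' (hp : Params γ κ e eN) (N : ℕ) : 0 ≤ eN N := hp.nonneg.trans (hp.le N)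

theorem Params.abs_le (hp : Params γ κ e eN) (N : ℕ) : |eN N| ≤ 1 := by
  rw [abs_of_nonneg (hp.nonneg' N)]
  exact hp.le_one N

theorem Params.isSymmGe (hp : Params γ κ e eN) (N : ℕ) :
    IsSymmGe (lowBd γ κ) (discGen γ κ (eN N) N) :=
  isSymmGe_discGen hp.one_lt hp.pos.le (hp.nonneg' N) N

theorem Params.lowBd_pos (hp : Params γ κ e eN) : 0 < lowBd γ κ :=
  LongJumpExclusion.lowBd_pos hp.one_lt hp.pos

theorem Params.isSymmGe_zero (hp : Params γ κ e eN) (N : ℕ) :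
    IsSymmGe 0 (discGen γ κ (eN N) N) :=
  le_of_isSymmGe hp.lowBd_pos.le (hp.isSymmGe N)

/-- The inverse of the discrete operator. -/
def Params.inv (hp : Params γ κ e eN) (N : ℕ) : HS →L[ℝ] HS :=
  ((hp.isSymmGe N).exists_inverse hp.lowBd_pos).choose

theorem Params.discGen_inv (hp : Params γ κ e eN) (N : ℕ) (x : HS) :
    discGen γ κ (eN N) N (hp.inv N x) = x :=
  ((hp.isSymmGe N).exists_inverse hp.lowBd_pos).choose_spec.1 x

theorem Params.inv_discGen (hp : Params γ κ e eN) (N : ℕ) (x : HS) :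
    hp.inv N (discGen γ κ (eN N) N x) = x :=
  ((hp.isSymmGe N).exists_inverse hp.lowBd_pos).choose_spec.2 x

/-- The constant in the lower semicontinuity of the energy. -/
def lscConst (γ κ : ℝ) : ℝ := 4 * (κ * (cGamma γ * γ⁻¹))⁻¹ + 8 * (cGamma γ)⁻¹

theorem Params.lscConst_nonneg (hp : Params γ κ e eN) : 0 ≤ lscConst γ κ := by
  have := cGamma_pos hp.one_lt
  have := hp.one_lt
  have := hp.pos
  unfold lscConst
  positivity

/-- The energy of a function. -/
def energy (γ e : ℝ) (f : ℝ → ℝ) : ℝ≥0∞ := potEnergy γ f + ENNReal.ofReal e * gagEnergy γ f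

theorem Params.energy_le_of_weak (hp : Params γ κ e eN) {l : Filter ℕ} [l.NeBot] (hl : l ≤ atTop)
    {x : ℕ → HS} {w : HS} {Q : ℝ} (hw : ∀ y, Tendsto (fun i => ⟪x i, y⟫) l (𝓝 ⟪w, y⟫)) {M : ℝ}
    (hM : ∀ᶠ i in l, ‖x i‖ ≤ M) (hQ : ∀ᶠ i in l, ⟪discGen γ κ (eN i) i (x i), x i⟫ ≤ Q) (hQ0 : 0 ≤ Q) :
    energy γ e w ≤ ENNReal.ofReal (lscConst γ κ * Q) := by
  have hc := cGamma_pos hp.one_lt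
  have h1 := hp.one_lt
  have h2 := hp.pos
  unfold lscConst
  rw [add_mul, ENNReal.ofReal_add (by positivity) (by positivity)]
  exact add_le_add
    (potEnergy_le_of_weak hp.one_lt hp.lt_two hp.pos hp.nonneg' hl hw hM hQ hQ0)
    (gagEnergy_le_of_weak hp.one_lt hp.lt_two hp.pos hp.nonneg hp.le hl hw hM hQ hQ0)

/-- The limiting resolvent at zero. -/
def Params.green (hp : Params γ κ e eN) : HS →L[ℝ] HS :=
  formInv hp.one_lt hp.lt_two hp.pos.le hp.nonneg

/-- The abstract criterion with sampled test functions as approximants: consistency comes from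
`IsCore.tendsto_discGen`, and the compactness hypothesis from lower semicontinuity of the energy
followed by `exists_formEmb_eq`. -/
theorem Params.tendsto_inv (hp : Params γ κ e eN) (f : HS) :
    Tendsto (fun N => hp.inv N f) atTop (𝓝 (hp.green f)) := by
  refine tendsto_inverse_of_consistent
    (formEmb hp.one_lt hp.lt_two hp.pos.le hp.nonneg)
    (coreEmb hp.one_lt hp.lt_two hp.pos.le hp.nonneg)
    (denseRange_coreEmb hp.one_lt hp.lt_two hp.pos hp.nonneg)
    (fun G => (memLp_coreOp_core (e := e) hp.one_lt hp.lt_two hp.pos.le G).toLp _)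
    (inner_coreEmb hp.one_lt hp.lt_two hp.pos hp.nonneg) hp.lowBd_pos hp.isSymmGe
    hp.discGen_inv (fun N G => stepL N fun x => (G : ℝ → ℝ) ((x : ℝ) / N)) (fun G => ?_) (fun G => ?_)
    (fun U hU w z Q hw hwQ hQ => ?_) f
  · rw [formEmb_coreEmb hp.one_lt hp.lt_two hp.pos hp.nonneg]
    exact tendsto_stepL_sample (G.2.1.continuous.continuousOn)
  · obtain ⟨r, C, hG⟩ := exists_isCore G.2
    exact hG.tendsto_discGen hp.one_lt hp.lt_two hp.pos.le hp.tendsto hp.abs_le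
  · have hQ0 : 0 ≤ Q := (norm_nonneg _).trans (hwQ 0)
    have h := hp.energy_le_of_weak hU hw (Eventually.of_forall hwQ) (Eventually.of_forall hQ) hQ0
    obtain ⟨v, hv, -⟩ := exists_formEmb_eq hp.one_lt hp.lt_two hp.pos hp.nonneg z
      (h.trans_lt ENNReal.ofReal_lt_top)
    exact ⟨v, hv⟩

theorem Params.tendsto_inv_of_tendsto (hp : Params γ κ e eN) {b : ℕ → HS} {f : HS}
    (hb : Tendsto b atTop (𝓝 f)) : Tendsto (fun N => hp.inv N (b N)) atTop (𝓝 (hp.green f)) := by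
  have h1 : Tendsto (fun N => hp.inv N (b N - f)) atTop (𝓝 0) := by
    refine squeeze_zero_norm (a := fun N => (lowBd γ κ)⁻¹ * ‖b N - f‖) (fun N =>
      (hp.isSymmGe N).norm_inverse_le hp.lowBd_pos (hp.discGen_inv N) _) ?_
    have := ((hb.sub_const f).norm).const_mul (lowBd γ κ)⁻¹
    simpa using this
  have h2 := h1.add (hp.tendsto_inv f)
  simp only [map_sub, sub_add_cancel, zero_add] at h2
  exact h2

theorem Params.exists_tendsto (hp : Params γ κ e eN) {t : ℝ} (ht : 0 ≤ t) (x : HS) :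
    ∃ y, Tendsto (fun N => expSg (discGen γ κ (eN N) N) t x) atTop (𝓝 y) :=
  exists_tendsto_expSg hp.lowBd_pos hp.isSymmGe hp.discGen_inv hp.inv_discGen
    (isSymmGe_formInv hp.one_lt hp.lt_two hp.nonneg hp.pos.le)
    (formInv_injective hp.one_lt hp.lt_two hp.pos hp.nonneg) hp.tendsto_inv ht x

/-- The limiting semigroup. -/
def Params.semigroup (hp : Params γ κ e eN) (t : ℝ) (x : HS) : HS :=
  if ht : 0 ≤ t then (hp.exists_tendsto ht x).choose else 0

theorem Params.tendsto_semigroup (hp : Params γ κ e eN) {t : ℝ} (ht : 0 ≤ t) (x : HS) :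
    Tendsto (fun N => expSg (discGen γ κ (eN N) N) t x) atTop (𝓝 (hp.semigroup t x)) := by
  rw [Params.semigroup, dif_pos ht]
  exact (hp.exists_tendsto ht x).choose_spec

theorem Params.tendsto_semigroup_of_tendsto (hp : Params γ κ e eN) {t : ℝ} (ht : 0 ≤ t)
    {z : ℕ → HS} {x : HS} (hz : Tendsto z atTop (𝓝 x)) :
    Tendsto (fun N => expSg (discGen γ κ (eN N) N) t (z N)) atTop (𝓝 (hp.semigroup t x)) := by
  have h1 : Tendsto (fun N => expSg (discGen γ κ (eN N) N) t (z N - x)) atTop (𝓝 0) := by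
    refine squeeze_zero_norm (a := fun N => ‖z N - x‖) (fun N =>
      (hp.isSymmGe_zero N).norm_expSg_le ht _) ?_
    have := (hz.sub_const x).norm
    simpa using this
  have h2 := h1.add (hp.tendsto_semigroup ht x)
  simp only [map_sub, sub_add_cancel, zero_add] at h2
  exact h2

theorem Params.semigroup_symm (hp : Params γ κ e eN) {t : ℝ} (ht : 0 ≤ t) (x y : HS) :
    ⟪hp.semigroup t x, y⟫ = ⟪x, hp.semigroup t y⟫ := by
  have h1 := (hp.tendsto_semigroup ht x).inner (𝕜 := ℝ) (tendsto_const_nhds (x := y))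
  have h2 := (tendsto_const_nhds (x := x)).inner (𝕜 := ℝ) (hp.tendsto_semigroup ht y)
  simp only [(hp.isSymmGe_zero _).expSg_symm] at h1
  exact tendsto_nhds_unique h1 h2

end Semigroup

/-! ### The boundary profile, the limit curve and its energy. -/

section Profile

local notation "⟪" x "," y "⟫" => inner ℝ x y

variable {γ κ e α β : ℝ} {eN : ℕ → ℝ}

/-- A smooth profile equal to `α` on `[0,1/4]` and to `β` on `[3/4,1]`. -/
def bdProfile (α β u : ℝ) : ℝ := α + (β - α) * Real.smoothTransition (2 * u - 1 / 2)

theorem bdProfile_left (α β : ℝ) {u : ℝ} (hu : u ≤ 1 / 4) : bdProfile α β u = α := by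
  rw [bdProfile, Real.smoothTransition.zero_of_nonpos (by linarith), mul_zero, add_zero]

theorem bdProfile_right (α β : ℝ) {u : ℝ} (hu : 3 / 4 ≤ u) : bdProfile α β u = β := by
  rw [bdProfile, Real.smoothTransition.one_of_one_le (by linarith)]
  ring

theorem contDiff_bdProfile (α β : ℝ) : ContDiff ℝ ∞ (bdProfile α β) := by
  unfold bdProfile
  exact contDiff_const.add (contDiff_const.mul (Real.smoothTransition.contDiff.comp (by fun_prop)))

theorem continuous_bdProfile (α β : ℝ) : Continuous (bdProfile α β) :=
  (contDiff_bdProfile α β).continuous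

theorem exists_isProfile_bdProfile (α β : ℝ) : ∃ C, IsProfile (1 / 8) C (bdProfile α β) := by
  have hG := contDiff_bdProfile α β
  have hG2 : ContDiff ℝ 2 (bdProfile α β) := hG.of_le (by exact WithTop.coe_le_coe.2 le_top)
  have hG1 : ContDiff ℝ 1 (deriv (bdProfile α β)) :=
    ((contDiff_succ_iff_deriv (n := 1)).1 hG2).2.2
  have hc2 : Continuous (deriv (deriv (bdProfile α β))) := (contDiff_one_iff_deriv.1 hG1).2
  obtain ⟨C0, h0⟩ := isCompact_Icc.exists_bound_of_continuousOn (s := Icc (0 : ℝ) 1)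
    hG.continuous.continuousOn
  obtain ⟨C1, h1⟩ := isCompact_Icc.exists_bound_of_continuousOn (s := Icc (0 : ℝ) 1)
    hG1.continuous.continuousOn
  obtain ⟨C2, h2⟩ := isCompact_Icc.exists_bound_of_continuousOn (s := Icc (0 : ℝ) 1)
    hc2.continuousOn
  refine ⟨max C0 (max C1 C2), isProfile_of_contDiff hG2 (by norm_num) (fun u hu h => ?_)
    (fun u hu => (h0 u hu).trans (le_max_left _ _))
    (fun u hu => (h1 u hu).trans ((le_max_left _ _).trans (le_max_right _ _)))
    (fun u hu => (h2 u hu).trans ((le_max_right _ _).trans (le_max_right _ _)))⟩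
  rcases h with h | h
  · have : bdProfile α β =ᶠ[𝓝 u] fun _ => α := by
      filter_upwards [Iio_mem_nhds (show u < 1 / 4 by linarith)] with v hv
      exact bdProfile_left α β (le_of_lt hv)
    rw [this.deriv_eq, deriv_const]
  · have : bdProfile α β =ᶠ[𝓝 u] fun _ => β := by
      filter_upwards [Ioi_mem_nhds (show 3 / 4 < u by linarith)] with v hv
      exact bdProfile_right α β (le_of_lt hv)
    rw [this.deriv_eq, deriv_const]

/-- The discrete reservoir source. -/
def resSource (γ κ α β : ℝ) (N : ℕ) (x : ℤ) : ℝ :=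
  (N : ℝ) ^ γ * (κ * (α * tail γ x + β * tail γ (N - x)))

/-- The discrete source seen by the deviation from the boundary profile. -/
def devSource (γ κ α β e : ℝ) (N : ℕ) (x : ℤ) : ℝ :=
  resSource γ κ α β N x - discOp γ κ e N (fun x => bdProfile α β ((x : ℝ) / N)) x

/-- Each singular rate now multiplies a factor that vanishes near its own end point, so this source
is bounded uniformly in `N`, unlike `resSource`. -/
theorem devSource_eq (N : ℕ) (x : ℤ) : devSource γ κ α β e N x =
    e * discLap γ N (bdProfile α β) x +
      κ * (((N : ℝ) ^ γ * tail γ x) * (α - bdProfile α β ((x : ℝ) / N)) +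
        ((N : ℝ) ^ γ * tail γ (N - x)) * (β - bdProfile α β ((x : ℝ) / N))) := by
  rw [devSource, discOp_sample, resSource]
  ring

/-- The limiting source. -/
def limSource (γ κ α β e u : ℝ) : ℝ :=
  e * regionalLaplacian γ (bdProfile α β) u +
    κ * (rMinus γ u * (α - bdProfile α β u) + rPlus γ u * (β - bdProfile α β u))

theorem exists_abs_devSource_le (hp : Params γ κ e eN) (α β : ℝ) :
    ∃ C, ∀ N, ∀ x ∈ bulk N, |devSource γ κ α β (eN N) N x| ≤ C := by
  obtain ⟨C, hC⟩ := exists_isProfile_bdProfile α β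
  have hc := cGamma_pos hp.one_lt
  have hC0 := hC.nonneg
  set T := 2 * cGamma γ * (1 / 4 : ℝ) ^ (-γ) with hT
  have hT0 : 0 ≤ T := by positivity
  refine ⟨1 * lapBound γ (1 / 8) C + κ * (T * (|α| + C) + T * (|β| + C)), fun N x hx => ?_⟩
  have hN := pos_of_mem_bulk hx
  have hN' : (N : ℝ) ≠ 0 := by exact_mod_cast hN.ne'
  have hu := div_mem_of_mem_bulk hx
  obtain ⟨h1, h2⟩ := one_le_of_mem_bulk hx
  have hb : ∀ a : ℝ, |a - bdProfile α β ((x : ℝ) / N)| ≤ |a| + C := fun a =>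
    (abs_sub _ _).trans (add_le_add le_rfl (hC.bound _ hu))
  have hbn : ∀ a : ℝ, 0 ≤ |a| + C := fun a => by positivity
  have t1 : |(N : ℝ) ^ γ * tail γ x * (α - bdProfile α β ((x : ℝ) / N))| ≤ T * (|α| + C) := by
    rcases le_total ((x : ℝ) / N) (1 / 4) with h | h
    · rw [bdProfile_left α β h, sub_self, mul_zero, abs_zero]
      exact mul_nonneg hT0 (hbn α)
    · rw [abs_mul, abs_of_nonneg (mul_nonneg (by positivity)
        (tail_nonneg hp.one_lt (by linarith)))]
      exact mul_le_mul (rpow_mul_tail_le hp.one_lt hN h1 (by norm_num) h) (hb α)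
        (abs_nonneg _) hT0
  have t2 : |(N : ℝ) ^ γ * tail γ (N - x) * (β - bdProfile α β ((x : ℝ) / N))| ≤
      T * (|β| + C) := by
    rcases le_total (3 / 4) ((x : ℝ) / N) with h | h
    · rw [bdProfile_right α β h, sub_self, mul_zero, abs_zero]
      exact mul_nonneg hT0 (hbn β)
    · rw [abs_mul, abs_of_nonneg (mul_nonneg (by positivity)
        (tail_nonneg hp.one_lt (by linarith)))]
      refine mul_le_mul (rpow_mul_tail_le hp.one_lt hN h2 (by norm_num) ?_) (hb β)
        (abs_nonneg _) hT0
      rw [sub_div, div_self hN']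
      linarith
  rw [devSource_eq]
  refine (abs_add_le _ _).trans (add_le_add ?_ ?_)
  · rw [abs_mul]
    exact mul_le_mul (hp.abs_le N) (hC.abs_discLap_le hp.one_lt hp.lt_two hx) (abs_nonneg _)
      zero_le_one
  · rw [abs_mul, abs_of_pos hp.pos]
    exact mul_le_mul_of_nonneg_left ((abs_add_le _ _).trans (add_le_add t1 t2)) hp.pos.le

theorem tendsto_devSource (hp : Params γ κ e eN) (α β : ℝ) {u : ℝ} (hu : u ∈ Ioo (0 : ℝ) 1) :
    Tendsto (fun N : ℕ => devSource γ κ α β (eN N) N ⌊(N : ℝ) * u⌋) atTop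
      (𝓝 (limSource γ κ α β e u)) := by
  obtain ⟨C, hC⟩ := exists_isProfile_bdProfile α β
  simp only [devSource_eq]
  have hcont : Tendsto (fun N : ℕ => bdProfile α β ((⌊(N : ℝ) * u⌋ : ℝ) / N)) atTop
      (𝓝 (bdProfile α β u)) :=
    ((continuous_bdProfile α β).tendsto u).comp (tendsto_floor_div u)
  refine Tendsto.add (hp.tendsto.mul (hC.tendsto_discLap hp.one_lt hp.lt_two hu))
    (Tendsto.const_mul _ (Tendsto.add ?_ ?_))
  · exact (tendsto_tail_left hp.one_lt hu).mul (tendsto_const_nhds.sub hcont)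
  · exact (tendsto_tail_right hp.one_lt hu).mul (tendsto_const_nhds.sub hcont)

theorem Params.memLp_limSource (hp : Params γ κ e eN) (α β : ℝ) :
    MemLp (limSource γ κ α β e) 2 unitMeas := by
  obtain ⟨C, hC⟩ := exists_abs_devSource_le hp α β
  exact memLp_of_tendsto_stepFun (fun u hu => tendsto_devSource hp α β hu) hC

theorem Params.tendsto_stepL_devSource (hp : Params γ κ e eN) (α β : ℝ) :
    Tendsto (fun N => stepL N (devSource γ κ α β (eN N) N)) atTop
      (𝓝 ((hp.memLp_limSource α β).toLp _)) := by
  obtain ⟨C, hC⟩ := exists_abs_devSource_le hp α β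
  refine tendsto_stepL _ (Eventually.of_forall hC) ?_
  filter_upwards [ae_restrict_mem measurableSet_Ioo] with u hu
  exact tendsto_devSource hp α β hu

theorem memLp_bdProfile (α β : ℝ) : MemLp (bdProfile α β) 2 unitMeas :=
  memLp_of_continuousOn (continuous_bdProfile α β).continuousOn

/-- The discrete boundary profile. -/
def bdL (α β : ℝ) (N : ℕ) : HS := stepL N fun x => bdProfile α β ((x : ℝ) / N)

theorem tendsto_bdL (α β : ℝ) : Tendsto (bdL α β) atTop (𝓝 ((memLp_bdProfile α β).toLp _)) :=
  tendsto_stepL_sample (continuous_bdProfile α β).continuousOn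

/-- The discrete stationary deviation. -/
def Params.devL (hp : Params γ κ e eN) (α β : ℝ) (N : ℕ) : HS :=
  hp.inv N (stepL N (devSource γ κ α β (eN N) N))

/-- The limiting stationary deviation. -/
def Params.devLim (hp : Params γ κ e eN) (α β : ℝ) : HS :=
  hp.green ((hp.memLp_limSource α β).toLp _)

theorem Params.tendsto_devL (hp : Params γ κ e eN) (α β : ℝ) :
    Tendsto (hp.devL α β) atTop (𝓝 (hp.devLim α β)) :=
  hp.tendsto_inv_of_tendsto (hp.tendsto_stepL_devSource α β)

/-- Boundary profile plus deviation is stationary for the discrete equation, which reduces the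
inhomogeneous problem to the semigroup. -/
theorem Params.discGen_devL (hp : Params γ κ e eN) (α β : ℝ) (N : ℕ) :
    discGen γ κ (eN N) N (bdL α β N + hp.devL α β N) = stepL N (resSource γ κ α β N) := by
  rw [map_add, Params.devL, hp.discGen_inv, bdL, discGen_stepL, ← map_add]
  congr 1
  ext x
  simp only [Pi.add_apply, devSource]
  ring

/-- The deviation from the boundary profile, at the discrete level. -/
def Params.devSol (hp : Params γ κ e eN) (α β : ℝ) (g : HS) (N : ℕ) (t : ℝ) : HS :=
  hp.devL α β N + expSg (discGen γ κ (eN N) N) t (g - bdL α β N - hp.devL α β N)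

/-- The solution of the discrete equation. -/
def Params.discSol (hp : Params γ κ e eN) (α β : ℝ) (g : HS) (N : ℕ) (t : ℝ) : HS :=
  bdL α β N + hp.devSol α β g N t

/-- The solution of the limiting equation. -/
def Params.sol (hp : Params γ κ e eN) (α β : ℝ) (g : HS) (t : ℝ) : HS :=
  (memLp_bdProfile α β).toLp _ + (hp.devLim α β +
    hp.semigroup t (g - (memLp_bdProfile α β).toLp _ - hp.devLim α β))

variable {g : HS}

theorem Params.tendsto_devSol (hp : Params γ κ e eN) (α β : ℝ) (g : HS) {t : ℝ} (ht : 0 ≤ t) :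
    Tendsto (fun N => hp.devSol α β g N t) atTop
      (𝓝 (hp.sol α β g t - (memLp_bdProfile α β).toLp _)) := by
  rw [Params.sol, add_sub_cancel_left]
  exact (hp.tendsto_devL α β).add (hp.tendsto_semigroup_of_tendsto ht
    ((tendsto_const_nhds.sub (tendsto_bdL α β)).sub (hp.tendsto_devL α β)))

theorem Params.tendsto_discSol (hp : Params γ κ e eN) (α β : ℝ) (g : HS) {t : ℝ} (ht : 0 ≤ t) :
    Tendsto (fun N => hp.discSol α β g N t) atTop (𝓝 (hp.sol α β g t)) := by
  have := (tendsto_bdL α β).add (hp.tendsto_devSol α β g ht)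
  rwa [add_sub_cancel] at this

theorem Params.sol_zero (hp : Params γ κ e eN) (α β : ℝ) (g : HS) : hp.sol α β g 0 = g := by
  refine tendsto_nhds_unique (hp.tendsto_discSol α β g le_rfl) ?_
  have : ∀ N, hp.discSol α β g N 0 = g := by
    intro N
    rw [Params.discSol, Params.devSol, expSg_zero]
    abel
  simp only [this]
  exact tendsto_const_nhds

theorem exists_bound_of_tendsto {x : ℕ → HS} {y : HS} (h : Tendsto x atTop (𝓝 y)) :
    ∃ C, 0 ≤ C ∧ ∀ N, ‖x N‖ ≤ C := by
  obtain ⟨C, hC⟩ := h.norm.bddAbove_range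
  exact ⟨C, (norm_nonneg _).trans (hC ⟨0, rfl⟩), fun N => hC ⟨N, rfl⟩⟩

theorem Params.exists_bound_init (hp : Params γ κ e eN) (α β : ℝ) (g : HS) :
    ∃ C, 0 ≤ C ∧ ∀ N, ‖g - bdL α β N - hp.devL α β N‖ ≤ C :=
  exists_bound_of_tendsto ((tendsto_const_nhds.sub (tendsto_bdL α β)).sub (hp.tendsto_devL α β))

theorem Params.exists_bound_devSol (hp : Params γ κ e eN) (α β : ℝ) (g : HS) :
    ∃ C, 0 ≤ C ∧ ∀ N t, 0 ≤ t → ‖hp.devSol α β g N t‖ ≤ C := by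
  obtain ⟨C1, h1, h1'⟩ := exists_bound_of_tendsto (hp.tendsto_devL α β)
  obtain ⟨C2, h2, h2'⟩ := hp.exists_bound_init α β g
  refine ⟨C1 + C2, by positivity, fun N t ht => (norm_add_le _ _).trans (add_le_add (h1' N) ?_)⟩
  exact ((hp.isSymmGe_zero N).norm_expSg_le ht _).trans (h2' N)

theorem Params.exists_bound_discSol (hp : Params γ κ e eN) (α β : ℝ) (g : HS) :
    ∃ C, 0 ≤ C ∧ ∀ N t, 0 ≤ t → ‖hp.discSol α β g N t‖ ≤ C := by
  obtain ⟨C1, h1, h1'⟩ := exists_bound_of_tendsto (tendsto_bdL α β)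
  obtain ⟨C2, h2, h2'⟩ := hp.exists_bound_devSol α β g
  exact ⟨C1 + C2, by positivity, fun N t ht =>
    (norm_add_le _ _).trans (add_le_add (h1' N) (h2' N t ht))⟩

theorem Params.hasDerivAt_discSol (hp : Params γ κ e eN) (α β : ℝ) (g : HS) (N : ℕ) (t : ℝ) :
    HasDerivAt (hp.discSol α β g N) (stepL N (resSource γ κ α β N) -
      discGen γ κ (eN N) N (hp.discSol α β g N t)) t := by
  have h1 := (hasDerivAt_expSg (discGen γ κ (eN N) N) (g - bdL α β N - hp.devL α β N) t).const_add
    (bdL α β N + hp.devL α β N)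
  have e1 : hp.discSol α β g N = fun t => bdL α β N + hp.devL α β N +
      expSg (discGen γ κ (eN N) N) t (g - bdL α β N - hp.devL α β N) := by
    ext1 s
    rw [Params.discSol, Params.devSol, add_assoc]
  have e2 : stepL N (resSource γ κ α β N) - discGen γ κ (eN N) N (hp.discSol α β g N t) =
      -(discGen γ κ (eN N) N) (expSg (discGen γ κ (eN N) N) t (g - bdL α β N - hp.devL α β N)) := by
    rw [e1, map_add, hp.discGen_devL]
    abel
  rw [e2, e1]
  exact h1

/-- The total energy of the deviation on a time interval is bounded uniformly. -/
theorem Params.lintegral_energy_lt_top (hp : Params γ κ e eN) (α β : ℝ) (g : HS) {T : ℝ}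
    (hT : 0 ≤ T) : ∫⁻ t in Icc 0 T,
      energy γ e (hp.sol α β g t - (memLp_bdProfile α β).toLp _ : HS) < ⊤ := by
  obtain ⟨C1, h1, h1'⟩ := exists_bound_of_tendsto (hp.tendsto_devL α β)
  obtain ⟨C2, h2, h2'⟩ := hp.exists_bound_init α β g
  obtain ⟨C3, h3, h3'⟩ := exists_bound_of_tendsto (hp.tendsto_stepL_devSource α β)
  obtain ⟨C4, h4, h4'⟩ := hp.exists_bound_devSol α β g
  set B := fun N => discGen γ κ (eN N) N with hB
  set z := fun N => g - bdL α β N - hp.devL α β N with hz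
  let p : ℕ → ℝ → ℝ := fun N t => ⟪B N (expSg (B N) t (z N)), expSg (B N) t (z N)⟫
  have hp0 : ∀ N x, 0 ≤ ⟪B N x, x⟫ := fun N x => by
    have := (hp.isSymmGe_zero N).lower x
    linarith [mul_comm 0 (‖x‖ ^ 2)]
  -- Majorant of the energy of the deviation, by `⟪B(a+b), a+b⟫ ≤ 2⟪Ba,a⟫ + 2⟪Bb,b⟫`: `a` is the
  -- stationary part and `b` the part moved by the semigroup, whose energy is integrable in time.
  let q : ℕ → ℝ → ℝ := fun N t => 2 * (C3 * C1) + 2 * p N t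
  have hq0 : ∀ N t, 0 ≤ q N t := fun N t => by
    have := hp0 N (expSg (B N) t (z N))
    simp only [q, p]
    positivity
  have hqE : ∀ N t, ⟪B N (hp.devSol α β g N t), hp.devSol α β g N t⟫ ≤ q N t := by
    intro N t
    set a := hp.devL α β N
    set b := expSg (B N) t (z N)
    have e1 : hp.devSol α β g N t = a + b := rfl
    have e2 : ⟪B N a, a⟫ ≤ C3 * C1 := by
      have : B N a = stepL N (devSource γ κ α β (eN N) N) := hp.discGen_inv N _
      rw [this]
      exact (real_inner_le_norm _ _).trans (mul_le_mul (h3' N) (h1' N) (norm_nonneg _) h3)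
    have e3 := hp0 N (a - b)
    rw [map_sub, inner_sub_left, inner_sub_right, inner_sub_right] at e3
    rw [e1, map_add, inner_add_left, inner_add_right, inner_add_right]
    simp only [q, p]
    linarith
  have hpc : ∀ N, Continuous (p N) := fun N =>
    ((B N).continuous.comp (continuous_expSg _ _)).inner (continuous_expSg _ _)
  have hqc : ∀ N, Continuous (q N) := fun N => continuous_const.add (continuous_const.mul (hpc N))
  have hqint : ∀ N, ∫⁻ t in Icc 0 T, ENNReal.ofReal (q N t) ≤
      ENNReal.ofReal (2 * (C3 * C1) * T + C2 ^ 2) := by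
    intro N
    rw [← ofReal_integral_eq_lintegral_ofReal (hqc N).continuousOn.integrableOn_Icc
      (Eventually.of_forall (hq0 N)), integral_Icc_eq_integral_Ioc,
      ← intervalIntegral.integral_of_le hT]
    refine ENNReal.ofReal_le_ofReal ?_
    simp only [q]
    rw [intervalIntegral.integral_add (by simp) (((hpc N).const_mul 2).intervalIntegrable _ _),
      intervalIntegral.integral_const, intervalIntegral.integral_const_mul]
    have e1 := IsSymmGe.integral_energy_le (B := B N) (z N) (T := T)
    have e2 : ‖z N‖ ^ 2 ≤ C2 ^ 2 := pow_le_pow_left₀ (norm_nonneg _) (h2' N) 2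
    simp only [sub_zero, smul_eq_mul]
    linarith
  -- Lower semicontinuity at each fixed time bounds the limit energy by the lower limit of the
  -- majorants; Fatou's lemma then integrates in time.
  have hpt : ∀ t ∈ Icc 0 T, energy γ e (hp.sol α β g t - (memLp_bdProfile α β).toLp _ : HS) ≤
      ENNReal.ofReal (lscConst γ κ) * liminf (fun N => ENNReal.ofReal (q N t)) atTop := by
    intro t ht
    rcases eq_or_ne (liminf (fun N => ENNReal.ofReal (q N t)) atTop) ⊤ with hL | hL
    · rw [hL, ENNReal.mul_top]
      · exact le_top
      · have := cGamma_pos hp.one_lt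
        have := hp.one_lt
        have := hp.pos
        rw [Ne, ENNReal.ofReal_eq_zero, not_le]
        unfold lscConst
        positivity
    · set L := liminf (fun N => ENNReal.ofReal (q N t)) atTop with hLdef
      have hlim : Tendsto (fun δ : ℝ => ENNReal.ofReal (lscConst γ κ * (L.toReal + δ))) (𝓝[>] 0)
          (𝓝 (ENNReal.ofReal (lscConst γ κ * (L.toReal + 0)))) :=
        tendsto_nhdsWithin_of_tendsto_nhds ((ENNReal.continuous_ofReal.comp (by fun_prop :
          Continuous fun δ : ℝ => lscConst γ κ * (L.toReal + δ))).tendsto 0)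
      rw [add_zero, ENNReal.ofReal_mul hp.lscConst_nonneg, ENNReal.ofReal_toReal hL] at hlim
      refine ge_of_tendsto hlim ?_
      filter_upwards [self_mem_nhdsWithin] with δ hδ
      have hδ : 0 < δ := hδ
      have hlt : L < ENNReal.ofReal (L.toReal + δ) := by
        rw [ENNReal.ofReal_add ENNReal.toReal_nonneg hδ.le, ENNReal.ofReal_toReal hL]
        exact ENNReal.lt_add_right hL (by simpa using hδ)
      have hfreq : ∃ᶠ N in atTop, ENNReal.ofReal (q N t) < ENNReal.ofReal (L.toReal + δ) :=
        frequently_lt_of_liminf_lt (by isBoundedDefault) hlt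
      -- `atTop ⊓ 𝓟 S` plays the role of a subsequence along which the majorant stays below its
      -- lower limit plus `δ`.
      set S := {N | ENNReal.ofReal (q N t) < ENNReal.ofReal (L.toReal + δ)} with hS
      have : (atTop ⊓ 𝓟 S : Filter ℕ).NeBot := frequently_mem_iff_neBot.1 hfreq
      have htd := hp.tendsto_devSol α β g ht.1
      refine hp.energy_le_of_weak (l := atTop ⊓ 𝓟 S) inf_le_left
        (x := fun N => hp.devSol α β g N t) (fun y => ?_)
        (Eventually.of_forall fun N => h4' N t ht.1) ?_ (by positivity)
      · exact (htd.inner (𝕜 := ℝ) tendsto_const_nhds).mono_left inf_le_left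
      · filter_upwards [mem_inf_of_right (mem_principal_self S)] with N hN
        refine (hqE N t).trans ?_
        exact (ENNReal.ofReal_le_ofReal_iff (by positivity)).1 (le_of_lt hN)
  calc _ ≤ ∫⁻ t in Icc 0 T, ENNReal.ofReal (lscConst γ κ) *
        liminf (fun N => ENNReal.ofReal (q N t)) atTop :=
        setLIntegral_mono' measurableSet_Icc hpt
    _ = ENNReal.ofReal (lscConst γ κ) *
        ∫⁻ t in Icc 0 T, liminf (fun N => ENNReal.ofReal (q N t)) atTop :=
        lintegral_const_mul' _ _ ENNReal.ofReal_ne_top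
    _ ≤ ENNReal.ofReal (lscConst γ κ) *
        liminf (fun N => ∫⁻ t in Icc 0 T, ENNReal.ofReal (q N t)) atTop := by
        gcongr
        exact lintegral_liminf_le fun N => (hqc N).measurable.ennreal_ofReal
    _ ≤ ENNReal.ofReal (lscConst γ κ) * ENNReal.ofReal (2 * (C3 * C1) * T + C2 ^ 2) := by
        gcongr
        exact (liminf_le_liminf (Eventually.of_forall hqint)).trans (by simp)
    _ < ⊤ := ENNReal.mul_lt_top ENNReal.ofReal_lt_top ENNReal.ofReal_lt_top

end Profile

/-! ### Dynkin's formula for the martingale problem. -/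

section Dynkin

variable {T : ℝ} {N : ℕ}

theorem measurable_at (t : Icc (0 : ℝ) T) : Measurable fun w : SkorohodPath T N => w.at t := by
  intro s hs
  exact le_iSup (fun t : Icc (0 : ℝ) T =>
    MeasurableSpace.comap (fun w : SkorohodPath T N => w.at t) inferInstance) t _ ⟨s, hs, rfl⟩

theorem measurable_comp_at (f : Config N → ℝ) (t : Icc (0 : ℝ) T) :
    Measurable fun w : SkorohodPath T N => f (w.at t) :=
  (measurable_of_countable f).comp (measurable_at t)

theorem exists_config_bound (f : Config N → ℝ) : ∃ C, 0 ≤ C ∧ ∀ η, |f η| ≤ C := by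
  obtain ⟨C, hC⟩ := (Set.finite_range fun η => |f η|).bddAbove
  exact ⟨max C 0, le_max_right _ _, fun η => (hC ⟨η, rfl⟩).trans (le_max_left _ _)⟩

/-- The state space is discrete, so a right-continuous path is constant on a short interval to the
right of each time. -/
theorem eventually_at_eq (w : SkorohodPath T N) (t : Icc (0 : ℝ) T) :
    ∃ ε > 0, ∀ s : Icc (0 : ℝ) T, t ≤ s → (s : ℝ) < t + ε → w.at s = w.at t := by
  have h := (w.2 t).1.eventually (show {w.1 t} ∈ 𝓝 (w.1 t) from
    (isOpen_discrete _).mem_nhds rfl)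
  rw [Metric.nhdsWithin_basis_ball.eventually_iff] at h
  obtain ⟨ε, hε, h⟩ := h
  refine ⟨ε, hε, fun s hts hs => h ⟨?_, hts⟩⟩
  have hts' : (t : ℝ) ≤ s := hts
  rw [Metric.mem_ball, Subtype.dist_eq, Real.dist_eq, abs_of_nonneg (sub_nonneg.2 hts')]
  linarith

theorem measurable_path (hT : 0 ≤ T) (w : SkorohodPath T N) (f : Config N → ℝ) :
    Measurable fun s : Icc (0 : ℝ) T => f (w.at s) := by
  -- The next grid time to the right of `s`, clipped at `T`: only right continuity is available, so
  -- the approximation must come from the right.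
  let τ : ℕ → ℤ → Icc (0 : ℝ) T := fun n k => projIcc 0 T hT (((k : ℝ) + 1) / ((n : ℝ) + 1))
  refine measurable_of_tendsto_metrizable
    (f := fun (n : ℕ) (s : Icc (0 : ℝ) T) => f (w.at (τ n ⌊((n : ℝ) + 1) * (s : ℝ)⌋))) (fun n => ?_) ?_
  · have hm : Measurable fun s : Icc (0 : ℝ) T => ⌊((n : ℝ) + 1) * (s : ℝ)⌋ :=
      Int.measurable_floor.comp (measurable_subtype_coe.const_mul _)
    exact (measurable_of_countable fun k : ℤ => f (w.at (τ n k))).comp hm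
  · rw [tendsto_pi_nhds]
    intro s
    obtain ⟨ε, hε, h⟩ := eventually_at_eq w s
    refine tendsto_const_nhds.congr' ?_
    obtain ⟨M, hM⟩ := exists_nat_gt (1 / ε)
    filter_upwards [eventually_ge_atTop M] with n hn
    have hn1 : (0 : ℝ) < (n : ℝ) + 1 := by positivity
    have h1 := Int.floor_le (((n : ℝ) + 1) * (s : ℝ))
    have h2 := Int.lt_floor_add_one (((n : ℝ) + 1) * (s : ℝ))
    have hMn : (M : ℝ) ≤ n := by exact_mod_cast hn
    set v : ℝ := ((⌊((n : ℝ) + 1) * (s : ℝ)⌋ : ℝ) + 1) / ((n : ℝ) + 1) with hv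
    have h3 : (s : ℝ) ≤ v := by
      rw [hv, le_div_iff₀ hn1]; linarith
    have h4 : v < s + ε := by
      rw [hv, div_lt_iff₀ hn1]
      rw [div_lt_iff₀ hε] at hM
      nlinarith
    have h5 : ((τ n ⌊((n : ℝ) + 1) * (s : ℝ)⌋ : Icc (0 : ℝ) T) : ℝ) = min T v := by
      simp only [τ]
      rw [coe_projIcc, max_eq_right]
      exact le_min hT (s.2.1.trans h3)
    congr 1
    symm
    refine h _ ?_ ?_
    · rw [← Subtype.coe_le_coe, h5]
      exact le_min s.2.2 h3
    · rw [h5]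
      exact (min_le_right _ _).trans_lt h4

/-- Lebesgue measure on `[0,T]`. -/
abbrev timeMeas (T : ℝ) : Measure (Icc (0 : ℝ) T) := Measure.comap Subtype.val (volume : Measure ℝ)

theorem timeMeas_Ioc (s t : Icc (0 : ℝ) T) :
    timeMeas T (Ioc s t) = ENNReal.ofReal ((t : ℝ) - s) := by
  rw [timeMeas, (MeasurableEmbedding.subtype_coe measurableSet_Icc).comap_apply]
  have : Subtype.val '' Ioc s t = Ioc (s : ℝ) t := by
    ext x
    constructor
    · rintro ⟨y, hy, rfl⟩
      exact hy
    · intro hx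
      exact ⟨⟨x, s.2.1.trans hx.1.le, hx.2.trans t.2.2⟩, hx, rfl⟩
  rw [this, Real.volume_Ioc]

theorem isFiniteMeasure_timeMeas : IsFiniteMeasure (timeMeas T) := by
  constructor
  rw [timeMeas, (MeasurableEmbedding.subtype_coe measurableSet_Icc).comap_apply, image_univ,
    Subtype.range_coe, Real.volume_Icc]
  exact ENNReal.ofReal_lt_top

theorem integrable_path (hT : 0 ≤ T) (w : SkorohodPath T N) (f : Config N → ℝ) :
    Integrable (fun s : Icc (0 : ℝ) T => f (w.at s)) (timeMeas T) := by
  have := isFiniteMeasure_timeMeas (T := T)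
  obtain ⟨C, -, hC⟩ := exists_config_bound f
  exact Integrable.of_bound (measurable_path hT w f).aestronglyMeasurable C
    (Eventually.of_forall fun s => hC _)

theorem integral_Iic_sub (hT : 0 ≤ T) (w : SkorohodPath T N) (f : Config N → ℝ)
    {s t : Icc (0 : ℝ) T} (hst : s ≤ t) :
    (∫ r in Iic t, f (w.at r) ∂(timeMeas T)) - ∫ r in Iic s, f (w.at r) ∂(timeMeas T) =
      ∫ r in Ioc s t, f (w.at r) ∂(timeMeas T) := by
  rw [← Iic_union_Ioc_eq_Iic hst, setIntegral_union (Iic_disjoint_Ioc le_rfl) measurableSet_Ioc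
    (integrable_path hT w f).integrableOn (integrable_path hT w f).integrableOn]
  ring

theorem abs_integral_Ioc_le (w : SkorohodPath T N) {f : Config N → ℝ} {C : ℝ}
    (hC : ∀ η, |f η| ≤ C) {s t : Icc (0 : ℝ) T} (hst : s ≤ t) :
    |∫ r in Ioc s t, f (w.at r) ∂(timeMeas T)| ≤ C * ((t : ℝ) - s) := by
  have h := norm_setIntegral_le_of_norm_le_const (μ := timeMeas T) (s := Ioc s t)
    (f := fun r => f (w.at r)) (C := C) (by rw [timeMeas_Ioc]; exact ENNReal.ofReal_lt_top)
    (fun r _ => hC _)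
  rw [measureReal_def, timeMeas_Ioc, ENNReal.toReal_ofReal (sub_nonneg.2 hst)] at h
  exact h

variable {γ α β κ θ : ℝ} {μ : Measure (Config N)} {P : Measure (SkorohodPath T N)}

/-- The accelerated generator. -/
def accGen (γ α β κ θ : ℝ) (N : ℕ) (f : Config N → ℝ) (η : Config N) : ℝ :=
  timeScale γ θ N * gen γ α β κ θ N f η

/-- The expectation of an observable at time `t`. -/
def expect (hT : 0 ≤ T) (P : Measure (SkorohodPath T N)) (f : Config N → ℝ) (t : ℝ) : ℝ :=
  ∫ w, f (w.at (projIcc 0 T hT t)) ∂P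

theorem integrable_comp_at [IsFiniteMeasure P] (f : Config N → ℝ) (t : Icc (0 : ℝ) T) :
    Integrable (fun w : SkorohodPath T N => f (w.at t)) P := by
  obtain ⟨C, -, hC⟩ := exists_config_bound f
  exact Integrable.of_bound (measurable_comp_at f t).aestronglyMeasurable C
    (Eventually.of_forall fun s => hC _)

/-- Measurability in the path is read off from the martingale: the time integral is the observable
minus an integrable process. -/
theorem IsProcessLaw.integrable_Ioc (hT : 0 ≤ T) (hP : IsProcessLaw γ α β κ θ T N μ P)
    (f : Config N → ℝ) {s t : Icc (0 : ℝ) T} (hst : s ≤ t) :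
    Integrable (fun w => ∫ r in Ioc s t, accGen γ α β κ θ N f (w.at r) ∂(timeMeas T)) P := by
  have := hP.isProbabilityMeasure
  have h := fun t : Icc (0 : ℝ) T => (integrable_comp_at (P := P) f t).sub
    ((hP.martingale f).integrable t)
  refine ((h t).sub (h s)).congr (Eventually.of_forall fun w => ?_)
  have := integral_Iic_sub hT w (accGen γ α β κ θ N f) hst
  simp only [accGen] at this
  simp only [Pi.sub_apply, accGen]
  linarith

theorem IsProcessLaw.expect_sub (hT : 0 ≤ T) (hP : IsProcessLaw γ α β κ θ T N μ P)
    (f : Config N → ℝ) {s t : Icc (0 : ℝ) T} (hst : s ≤ t) :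
    (∫ w, f (w.at t) ∂P) - ∫ w, f (w.at s) ∂P =
      ∫ w, ∫ r in Ioc s t, accGen γ α β κ θ N f (w.at r) ∂(timeMeas T) ∂P := by
  have := hP.isProbabilityMeasure
  have h1 := (hP.martingale f).setIntegral_eq hst (s := univ) MeasurableSet.univ
  rw [setIntegral_univ, setIntegral_univ] at h1
  have h2 := fun t : Icc (0 : ℝ) T => (hP.martingale f).integrable t
  rw [← integral_sub (integrable_comp_at f t) (integrable_comp_at f s)]
  rw [← sub_eq_zero, ← integral_sub (h2 s) (h2 t)] at h1
  have hi : Integrable (fun w : SkorohodPath T N => f (w.at t) - f (w.at s)) P :=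
    (integrable_comp_at f t).sub (integrable_comp_at f s)
  rw [← sub_eq_zero, ← integral_sub hi (hP.integrable_Ioc hT f hst)]
  refine neg_injective ?_
  rw [neg_zero, ← integral_neg]
  refine Eq.trans (integral_congr_ae (Eventually.of_forall fun w => ?_)) h1
  have := integral_Iic_sub hT w (accGen γ α β κ θ N f) hst
  simp only [accGen] at this
  simp only [accGen]
  linarith

theorem IsProcessLaw.abs_expect_sub_le (hT : 0 ≤ T) (hP : IsProcessLaw γ α β κ θ T N μ P)
    (f : Config N → ℝ) {C : ℝ} (hC : ∀ η, |accGen γ α β κ θ N f η| ≤ C) {s t : Icc (0 : ℝ) T}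
    (hst : s ≤ t) : |(∫ w, f (w.at t) ∂P) - ∫ w, f (w.at s) ∂P| ≤ C * ((t : ℝ) - s) := by
  have := hP.isProbabilityMeasure
  rw [hP.expect_sub hT f hst]
  have := norm_integral_le_of_norm_le_const (μ := P) (C := C * ((t : ℝ) - s))
    (f := fun w => ∫ r in Ioc s t, accGen γ α β κ θ N f (w.at r) ∂(timeMeas T))
    (Eventually.of_forall fun w => abs_integral_Ioc_le w hC hst)
  rwa [probReal_univ, mul_one] at this

theorem IsProcessLaw.continuousOn_expect (hT : 0 ≤ T) (hP : IsProcessLaw γ α β κ θ T N μ P)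
    (f : Config N → ℝ) : ContinuousOn (expect hT P f) (Icc 0 T) := by
  obtain ⟨C, hC0, hC⟩ := exists_config_bound (accGen γ α β κ θ N f)
  have hL : LipschitzOnWith ⟨C, hC0⟩ (expect hT P f) (Icc 0 T) := by
    refine LipschitzOnWith.of_dist_le_mul fun s hs t ht => ?_
    wlog hst : s ≤ t generalizing s t
    · rw [dist_comm, dist_comm s]
      exact this t ht s hs (le_of_not_ge hst)
    have := hP.abs_expect_sub_le hT f hC (s := ⟨s, hs⟩) (t := ⟨t, ht⟩) hst
    rw [dist_comm, dist_comm s, Real.dist_eq, Real.dist_eq, abs_of_nonneg (sub_nonneg.2 hst)]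
    unfold expect
    rw [projIcc_of_mem hT hs, projIcc_of_mem hT ht]
    exact this
  exact hL.continuousOn

/-- Paths are locally constant to the right, so the difference quotients converge pathwise and
boundedly. A right derivative is all that the fundamental theorem of calculus will require. -/
theorem IsProcessLaw.hasDerivWithinAt_expect (hT : 0 ≤ T)
    (hP : IsProcessLaw γ α β κ θ T N μ P) (f : Config N → ℝ) {t : ℝ} (ht : t ∈ Ico 0 T) :
    HasDerivWithinAt (expect hT P f) (expect hT P (accGen γ α β κ θ N f) t) (Ioi t) t := by
  have := hP.isProbabilityMeasure
  obtain ⟨C, hC0, hC⟩ := exists_config_bound (accGen γ α β κ θ N f)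
  rw [hasDerivWithinAt_iff_tendsto_slope' (by simp)]
  have ht' : t ∈ Icc 0 T := ⟨ht.1, ht.2.le⟩
  let τ : ℝ → Icc (0 : ℝ) T := projIcc 0 T hT
  have hτ : ∀ s ∈ Ioc t T, τ t ≤ τ s ∧ ((τ s : Icc (0 : ℝ) T) : ℝ) = s := fun s hs =>
    ⟨monotone_projIcc hT hs.1.le, by
      simp only [τ]; rw [projIcc_of_mem hT ⟨ht.1.trans hs.1.le, hs.2⟩]⟩
  have hτt : ((τ t : Icc (0 : ℝ) T) : ℝ) = t := by
    simp only [τ]; rw [projIcc_of_mem hT ht']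
  have hmem : ∀ᶠ s in 𝓝[>] t, s ∈ Ioc t T := Ioc_mem_nhdsGT ht.2
  have hD : ∀ᶠ s in 𝓝[>] t, ∫ w, (s - t)⁻¹ * ∫ r in Ioc (τ t) (τ s),
      accGen γ α β κ θ N f (w.at r) ∂(timeMeas T) ∂P = slope (expect hT P f) t s := by
    filter_upwards [hmem] with s hs
    rw [slope_def_field, expect, expect, hP.expect_sub hT f (hτ s hs).1, integral_const_mul,
      div_eq_inv_mul]
  refine Tendsto.congr' hD ?_
  refine tendsto_integral_filter_of_dominated_convergence (fun _ => C) ?_ ?_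
    (integrable_const C) ?_
  · filter_upwards [hmem] with s hs
    exact ((hP.integrable_Ioc hT f (hτ s hs).1).const_mul _).aestronglyMeasurable
  · filter_upwards [hmem] with s hs
    refine Eventually.of_forall fun w => ?_
    have h1 := abs_integral_Ioc_le w hC (hτ s hs).1
    rw [(hτ s hs).2, hτt] at h1
    have h2 : 0 < s - t := sub_pos.2 hs.1
    rw [norm_mul, norm_inv, Real.norm_eq_abs, Real.norm_eq_abs, abs_of_pos h2, inv_mul_le_iff₀ h2]
    linarith
  · refine Eventually.of_forall fun w => ?_
    obtain ⟨ε, hε, h⟩ := eventually_at_eq w (τ t)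
    refine tendsto_const_nhds.congr' ?_
    filter_upwards [hmem, Ioo_mem_nhdsGT (show t < t + ε by linarith)] with s hs hsε
    have h2 : 0 < s - t := sub_pos.2 hs.1
    have h1 : ∫ r in Ioc (τ t) (τ s), accGen γ α β κ θ N f (w.at r) ∂(timeMeas T) =
        ∫ r in Ioc (τ t) (τ s), accGen γ α β κ θ N f (w.at (τ t)) ∂(timeMeas T) := by
      refine setIntegral_congr_fun measurableSet_Ioc fun r hr => ?_
      rw [h r hr.1.le]
      have : (r : ℝ) ≤ τ s := hr.2
      rw [(hτ s hs).2] at this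
      rw [hτt]
      linarith [hsε.2]
    rw [h1, setIntegral_const, measureReal_def, timeMeas_Ioc, (hτ s hs).2, hτt,
      ENNReal.toReal_ofReal h2.le, smul_eq_mul, inv_mul_cancel_left₀ h2.ne']

/-- Expanding over the finitely many configurations separates time dependence of the observable from
that of the law. -/
theorem expect_eq_sum (hT : 0 ≤ T) [IsProbabilityMeasure P] (f : Config N → ℝ) (t : ℝ) :
    expect hT P f t = ∑ ξ, f ξ * expect hT P (Pi.single ξ 1) t := by
  unfold expect
  simp only [← integral_const_mul]
  rw [← integral_finsetSum _ fun ξ _ => (integrable_comp_at _ _).const_mul _]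
  refine integral_congr_ae (Eventually.of_forall fun w => ?_)
  simp [Pi.single_apply]

end Dynkin

/-! ### The accelerated generator and its square field. -/

section Generator

variable {T : ℝ} {N : ℕ} {γ α β κ θ : ℝ} {μ : Measure (Config N)} {P : Measure (SkorohodPath T N)}

/-- The accelerated exchange rate. -/
def exRate (γ θ : ℝ) (N : ℕ) (x y : Site N) : ℝ :=
  1 / 2 * ((N : ℝ) ^ γ * (N : ℝ) ^ θ * jump γ ((x : ℤ) - (y : ℤ)))

/-- The accelerated flip rate. -/
def flRate (γ α β κ : ℝ) (N : ℕ) (x : Site N) (η : Config N) : ℝ :=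
  (N : ℝ) ^ γ * (κ * (tail γ ((x : ℤ) : ℝ) * flipRate α x η +
    tail γ (N - ((x : ℤ) : ℝ)) * flipRate β x η))

theorem site_bounds (x : Site N) : (1 : ℤ) ≤ x ∧ (x : ℤ) ≤ N - 1 := Finset.mem_Icc.1 x.2

/-- The factor `N^(-θ)` of the reservoirs cancels against the time scale: flips occur at speed
`N^γ`, exchanges at speed `N^γ N^θ`. -/
theorem accGen_eq (hN : 0 < N) (f : Config N → ℝ) (η : Config N) :
    accGen γ α β κ θ N f η = (∑ x, ∑ y, exRate γ θ N x y * (f (exchange x y η) - f η)) +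
      ∑ x, flRate γ α β κ N x η * (f (flipSite x η) - f η) := by
  have hN' : (0 : ℝ) < N := by exact_mod_cast hN
  have h1 : timeScale γ θ N = (N : ℝ) ^ γ * (N : ℝ) ^ θ := Real.rpow_add hN' _ _
  have h2 : timeScale γ θ N * (N : ℝ) ^ (-θ) = (N : ℝ) ^ γ := by
    rw [timeScale, ← Real.rpow_add hN']
    congr 1
    ring
  have hl : genLeft γ α N f η = ∑ x : Site N, tail γ ((x : ℤ) : ℝ) * flipRate α x η *
      (f (flipSite x η) - f η) := by
    unfold genLeft
    refine Finset.sum_congr rfl fun x _ => ?_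
    rw [tsum_mul_right, tsum_mul_right, tsum_jump_left (site_bounds x).1]
  have hr : genRight γ β N f η = ∑ x : Site N, tail γ (N - ((x : ℤ) : ℝ)) * flipRate β x η *
      (f (flipSite x η) - f η) := by
    unfold genRight
    refine Finset.sum_congr rfl fun x _ => ?_
    rw [tsum_mul_right, tsum_mul_right, tsum_jump_right (site_bounds x).2]
  rw [accGen, gen, hl, hr, genBulk, mul_add, mul_add, add_assoc]
  congr 1
  · rw [h1]
    simp only [Finset.mul_sum, exRate]
    refine Finset.sum_congr rfl fun x _ => Finset.sum_congr rfl fun y _ => ?_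
    ring
  · rw [show ∀ a b : ℝ, timeScale γ θ N * (κ * (N : ℝ) ^ (-θ) * a) +
      timeScale γ θ N * (κ * (N : ℝ) ^ (-θ) * b) =
      (timeScale γ θ N * (N : ℝ) ^ (-θ)) * (κ * (a + b)) by intros; ring, h2,
      ← Finset.sum_add_distrib, Finset.mul_sum, Finset.mul_sum]
    refine Finset.sum_congr rfl fun x _ => ?_
    unfold flRate
    ring

theorem sum_accGen_single (hN : 0 < N) (F : Config N → ℝ) (η : Config N) :
    ∑ ξ, F ξ * accGen γ α β κ θ N (Pi.single ξ 1) η = accGen γ α β κ θ N F η := by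
  have key : ∀ a : Config N, ∑ ξ, F ξ * (Pi.single ξ (1 : ℝ) : Config N → ℝ) a = F a := by
    intro a
    simp [Pi.single_apply]
  simp only [accGen_eq hN, mul_add, Finset.sum_add_distrib]
  congr 1
  · simp only [Finset.mul_sum]
    rw [Finset.sum_comm]
    refine Finset.sum_congr rfl fun x _ => ?_
    rw [Finset.sum_comm]
    refine Finset.sum_congr rfl fun y _ => ?_
    rw [← key (exchange x y η), ← key η, ← Finset.sum_sub_distrib, Finset.mul_sum]
    refine Finset.sum_congr rfl fun ξ _ => ?_
    ring
  · simp only [Finset.mul_sum]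
    rw [Finset.sum_comm]
    refine Finset.sum_congr rfl fun x _ => ?_
    rw [← key (flipSite x η), ← key η, ← Finset.sum_sub_distrib, Finset.mul_sum]
    refine Finset.sum_congr rfl fun ξ _ => ?_
    ring

/-- The square field of the accelerated generator. -/
def squareField (γ α β κ θ : ℝ) (N : ℕ) (f : Config N → ℝ) (η : Config N) : ℝ :=
  (∑ x, ∑ y, exRate γ θ N x y * (f (exchange x y η) - f η) ^ 2) +
    ∑ x, flRate γ α β κ N x η * (f (flipSite x η) - f η) ^ 2

theorem accGen_sq (hN : 0 < N) (f : Config N → ℝ) (η : Config N) :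
    accGen γ α β κ θ N (fun ξ => f ξ ^ 2) η =
      2 * f η * accGen γ α β κ θ N f η + squareField γ α β κ θ N f η := by
  have h1 : ∑ x, ∑ y, exRate γ θ N x y * (f (exchange x y η) ^ 2 - f η ^ 2) =
      2 * f η * (∑ x, ∑ y, exRate γ θ N x y * (f (exchange x y η) - f η)) +
        ∑ x, ∑ y, exRate γ θ N x y * (f (exchange x y η) - f η) ^ 2 := by
    simp only [Finset.mul_sum, ← Finset.sum_add_distrib]
    exact Finset.sum_congr rfl fun x _ => Finset.sum_congr rfl fun y _ => by ring
  have h2 : ∑ x, flRate γ α β κ N x η * (f (flipSite x η) ^ 2 - f η ^ 2) =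
      2 * f η * (∑ x, flRate γ α β κ N x η * (f (flipSite x η) - f η)) +
        ∑ x, flRate γ α β κ N x η * (f (flipSite x η) - f η) ^ 2 := by
    simp only [Finset.mul_sum, ← Finset.sum_add_distrib]
    exact Finset.sum_congr rfl fun x _ => by ring
  rw [accGen_eq hN, accGen_eq hN, squareField, h1, h2]
  ring

/-- Dynkin's inequality for time-dependent observables. -/
theorem IsProcessLaw.expect_le (hT : 0 ≤ T) (hN : 0 < N) (hP : IsProcessLaw γ α β κ θ T N μ P)
    {F F' : ℝ → Config N → ℝ} (hF : ∀ ξ s, HasDerivAt (fun s => F s ξ) (F' s ξ) s)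
    (hF' : ∀ ξ, Continuous fun s => F' s ξ) {c : ℝ → ℝ} (hc : Continuous c)
    {t : ℝ} (ht : t ∈ Icc 0 T)
    (hle : ∀ s ∈ Icc 0 t, ∀ η, F' s η + accGen γ α β κ θ N (F s) η ≤ c s) :
    expect hT P (F t) t ≤ expect hT P (F 0) 0 + ∫ s in (0 : ℝ)..t, c s := by
  have := hP.isProbabilityMeasure
  have hFc : ∀ ξ, Continuous fun s => F s ξ := fun ξ =>
    continuous_iff_continuousAt.2 fun s => (hF ξ s).continuousAt
  have hsub : Icc 0 t ⊆ Icc 0 T := Icc_subset_Icc le_rfl ht.2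
  -- The probability of each configuration as a function of time, with right derivative `p'`; the
  -- expectation of `F s` is then a finite sum to which the product rule applies.
  let p : Config N → ℝ → ℝ := fun ξ => expect hT P (Pi.single ξ 1)
  let p' : Config N → ℝ → ℝ := fun ξ => expect hT P (accGen γ α β κ θ N (Pi.single ξ 1))
  have hpc : ∀ ξ, ContinuousOn (p ξ) (Icc 0 t) := fun ξ =>
    (hP.continuousOn_expect hT _).mono hsub
  have hpc' : ∀ ξ, ContinuousOn (p' ξ) (Icc 0 t) := fun ξ =>
    (hP.continuousOn_expect hT _).mono hsub
  let D : ℝ → ℝ := fun s => ∑ ξ, (F' s ξ * p ξ s + F s ξ * p' ξ s)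
  have hDc : ContinuousOn D (Icc 0 t) := continuousOn_finsetSum _ fun ξ _ =>
    ((hF' ξ).continuousOn.mul (hpc ξ)).add ((hFc ξ).continuousOn.mul (hpc' ξ))
  have hDi : IntervalIntegrable D volume 0 t := by
    rw [← uIcc_of_le ht.1] at hDc
    exact hDc.intervalIntegrable
  have hΦ : ∀ s, expect hT P (F s) s = ∑ ξ, F s ξ * p ξ s := fun s => expect_eq_sum hT _ s
  have hDle : ∀ s ∈ Icc 0 t, D s ≤ c s := by
    intro s hs
    have e1 : D s = expect hT P (fun η => F' s η + accGen γ α β κ θ N (F s) η) s := by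
      have e2 : ∑ ξ, F s ξ * p' ξ s = expect hT P (accGen γ α β κ θ N (F s)) s := by
        simp only [p', expect, ← integral_const_mul]
        rw [← integral_finsetSum _ fun ξ _ => (integrable_comp_at _ _).const_mul _]
        refine integral_congr_ae (Eventually.of_forall fun w => ?_)
        exact sum_accGen_single hN (F s) _
      simp only [D]
      rw [Finset.sum_add_distrib, e2, ← expect_eq_sum hT (F' s) s]
      exact (integral_add (integrable_comp_at _ _) (integrable_comp_at _ _)).symm
    rw [e1]
    have := integral_mono (μ := P) (integrable_comp_at (fun η => F' s η +
      accGen γ α β κ θ N (F s) η) (projIcc 0 T hT s)) (integrable_const (c s))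
      fun w => hle s hs _
    simpa [expect] using this
  -- The version of the fundamental theorem for a continuous function with an integrable right
  -- derivative.
  have hftc := intervalIntegral.integral_eq_sub_of_hasDeriv_right_of_le ht.1
    (f := fun s => expect hT P (F s) s) (f' := D) (by
      simp only [hΦ]
      exact continuousOn_finsetSum _ fun ξ _ => (hFc ξ).continuousOn.mul (hpc ξ))
    (fun s hs => by
      simp only [hΦ]
      refine HasDerivWithinAt.fun_sum fun ξ _ => ?_
      exact ((hF ξ s).hasDerivWithinAt).mul
        (hP.hasDerivWithinAt_expect hT _ ⟨hs.1.le, hs.2.trans_le ht.2⟩)) hDi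
  have := intervalIntegral.integral_mono_on ht.1 hDi (hc.intervalIntegrable _ _) hDle
  linarith

end Generator

/-! ### Linear observables. -/

section Linear

local notation "⟪" x "," y "⟫" => inner ℝ x y

variable {N : ℕ} {γ α β κ θ : ℝ}

/-- The occupation variables as a function on the integers. -/
def occZ (η : Config N) (x : ℤ) : ℝ := if h : x ∈ bulk N then occ η ⟨x, h⟩ else 0

theorem occZ_coe (η : Config N) (x : Site N) : occZ η (x : ℤ) = occ η x := by
  rw [occZ, dif_pos x.2]

theorem occ_mem (η : Config N) (x : Site N) : occ η x = 0 ∨ occ η x = 1 := by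
  unfold occ
  split_ifs
  · exact Or.inr rfl
  · exact Or.inl rfl

theorem occZ_mem (η : Config N) (x : ℤ) : 0 ≤ occZ η x ∧ occZ η x ≤ 1 := by
  unfold occZ
  split_ifs with h
  · rcases occ_mem η ⟨x, h⟩ with h | h <;> rw [h] <;> norm_num
  · norm_num

/-- The linear observable `(1/N) ∑ a_x η_x`. -/
def linObs (N : ℕ) (a : ℤ → ℝ) (η : Config N) : ℝ := (N : ℝ)⁻¹ * ∑ x ∈ bulk N, a x * occZ η x

theorem linObs_eq (a : ℤ → ℝ) (η : Config N) :
    linObs N a η = (N : ℝ)⁻¹ * ∑ x : Site N, a x * occ η x := by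
  rw [linObs, ← Finset.sum_coe_sort (bulk N)]
  congr 1
  exact Finset.sum_congr rfl fun x _ => by rw [occZ_coe]

theorem empirical_eq (G : ℝ → ℝ) (η : Config N) :
    empirical G η = linObs N (fun x => G ((x : ℝ) / N)) η := by
  rw [linObs_eq, empirical, one_div]

theorem linObs_exchange (a : ℤ → ℝ) (x y : Site N) (η : Config N) :
    linObs N a (exchange x y η) - linObs N a η =
      -((N : ℝ)⁻¹ * ((a x - a y) * (occ η x - occ η y))) := by
  have key : ∀ z : Site N, a z * occ (exchange x y η) z - a z * occ η z =
      (if z = x then a x * (occ η y - occ η x) else 0) +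
        if z = y then a y * (occ η x - occ η y) else 0 := by
    intro z
    unfold occ exchange
    by_cases hx : z = x
    · subst hx
      by_cases hy : z = y
      · subst hy; simp
      · simp [hy, mul_sub]
    · by_cases hy : z = y
      · subst hy; simp [hx, mul_sub]
      · simp [hx, hy]
  rw [linObs_eq, linObs_eq, ← mul_sub, ← Finset.sum_sub_distrib]
  simp only [key, Finset.sum_add_distrib, Finset.sum_ite_eq', Finset.mem_univ, if_true]
  ring

theorem linObs_flip (a : ℤ → ℝ) (x : Site N) (η : Config N) :
    linObs N a (flipSite x η) - linObs N a η = (N : ℝ)⁻¹ * (a x * (1 - 2 * occ η x)) := by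
  have key : ∀ z : Site N, a z * occ (flipSite x η) z - a z * occ η z =
      if z = x then a x * (1 - 2 * occ η x) else 0 := by
    intro z
    unfold occ flipSite
    by_cases hx : z = x
    · subst hx
      cases h : η z
      · simp
      · simp; ring
    · simp [hx]
  rw [linObs_eq, linObs_eq, ← mul_sub, ← Finset.sum_sub_distrib]
  simp only [key, Finset.sum_ite_eq', Finset.mem_univ, if_true]

/-- The closure of the equations. An exchange changes the observable linearly in the occupations,
and for a flip `c_x(η;r)(1-2η_x) = r - η_x` because `η_x ∈ {0,1}`. No correlations appear, and the
exchange strength of the discrete operator is `N^θ`. -/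
theorem accGen_linObs (hN : 0 < N) (a : ℤ → ℝ) (k : ℝ) (η : Config N) :
    accGen γ α β κ θ N (fun η => linObs N a η - k) η =
      (N : ℝ)⁻¹ * (∑ x ∈ bulk N, resSource γ κ α β N x * a x -
        ∑ x ∈ bulk N, discOp γ κ ((N : ℝ) ^ θ) N a x * occZ η x) := by
  rw [accGen_eq hN, sum_discOp_mul]
  simp only [sub_sub_sub_cancel_right, linObs_exchange, linObs_flip]
  have h1 : ∑ x : Site N, ∑ y : Site N, exRate γ θ N x y *
      -((N : ℝ)⁻¹ * ((a x - a y) * (occ η x - occ η y))) =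
      -((N : ℝ)⁻¹ * ((N : ℝ) ^ γ * ((N : ℝ) ^ θ / 2 * ∑ x ∈ bulk N, ∑ y ∈ bulk N,
        jump γ (x - y) * ((a x - a y) * (occZ η x - occZ η y))))) := by
    rw [← Finset.sum_coe_sort (bulk N)]
    simp only [← Finset.sum_coe_sort (bulk N) (fun y => jump γ (_ - y) * _), Finset.mul_sum,
      ← Finset.sum_neg_distrib, occZ_coe, exRate]
    refine Finset.sum_congr rfl fun x _ => Finset.sum_congr rfl fun y _ => ?_
    ring
  have h2 : ∑ x : Site N, flRate γ α β κ N x η * ((N : ℝ)⁻¹ * (a x * (1 - 2 * occ η x))) =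
      (N : ℝ)⁻¹ * (∑ x ∈ bulk N, resSource γ κ α β N x * a x -
        (N : ℝ) ^ γ * (κ * ∑ x ∈ bulk N, resRate γ N x * (a x * occZ η x))) := by
    rw [← Finset.sum_coe_sort (bulk N), ← Finset.sum_coe_sort (bulk N)]
    simp only [Finset.mul_sum, ← Finset.sum_sub_distrib, occZ_coe]
    refine Finset.sum_congr rfl fun x _ => ?_
    unfold flRate flipRate resSource resRate
    rcases occ_mem η x with h | h <;> rw [h] <;> ring
  rw [h1, h2]
  ring

theorem flipRate_mem (hα : 0 ≤ α) (hα1 : α ≤ 1) (x : Site N) (η : Config N) :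
    0 ≤ flipRate α x η ∧ flipRate α x η ≤ 1 := by
  unfold flipRate
  rcases occ_mem η x with h | h <;> rw [h] <;> constructor <;> linarith

/-- Each jump moves the observable by order `1/N`, so squaring gives `N⁻²`; one factor `N⁻¹`
normalises the energy of `a`, the other remains as the decay. Occupation differences and flip rates
are bounded by 1. -/
theorem squareField_linObs_le (hγ : 1 < γ) (hκ : 0 ≤ κ) (hα : 0 ≤ α) (hα1 : α ≤ 1) (hβ : 0 ≤ β)
    (hβ1 : β ≤ 1) (a : ℤ → ℝ) (k : ℝ) (η : Config N) :
    squareField γ α β κ θ N (fun η => linObs N a η - k) η ≤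
      (N : ℝ)⁻¹ * ((N : ℝ)⁻¹ * ∑ x ∈ bulk N, discOp γ κ ((N : ℝ) ^ θ) N a x * a x) := by
  rw [squareField, sum_discOp_mul]
  simp only [sub_sub_sub_cancel_right, linObs_exchange, linObs_flip]
  have h1 : ∑ x : Site N, ∑ y : Site N, exRate γ θ N x y *
      (-((N : ℝ)⁻¹ * ((a x - a y) * (occ η x - occ η y)))) ^ 2 ≤
      (N : ℝ)⁻¹ * ((N : ℝ)⁻¹ * ((N : ℝ) ^ γ * ((N : ℝ) ^ θ / 2 * ∑ x ∈ bulk N, ∑ y ∈ bulk N,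
        jump γ (x - y) * ((a x - a y) * (a x - a y))))) := by
    rw [← Finset.sum_coe_sort (bulk N)]
    simp only [← Finset.sum_coe_sort (bulk N) (fun y => jump γ (_ - y) * _), Finset.mul_sum, exRate]
    refine Finset.sum_le_sum fun x _ => Finset.sum_le_sum fun y _ => ?_
    have hj := jump_nonneg hγ ((x : ℤ) - y)
    have ho : (occ η x - occ η y) ^ 2 ≤ 1 := by
      rcases occ_mem η x with h | h <;> rcases occ_mem η y with h' | h' <;> rw [h, h'] <;> norm_num
    have hpos : 0 ≤ (N : ℝ)⁻¹ * ((N : ℝ)⁻¹ * ((N : ℝ) ^ γ * ((N : ℝ) ^ θ / 2 *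
        (jump γ ((x : ℤ) - y) * ((a x - a y) * (a x - a y)))))) := by
      have := mul_self_nonneg (a x - a y)
      positivity
    calc _ = (N : ℝ)⁻¹ * ((N : ℝ)⁻¹ * ((N : ℝ) ^ γ * ((N : ℝ) ^ θ / 2 *
        (jump γ ((x : ℤ) - y) * ((a x - a y) * (a x - a y)))))) * (occ η x - occ η y) ^ 2 := by ring
      _ ≤ _ := mul_le_of_le_one_right hpos ho
  have h2 : ∑ x : Site N, flRate γ α β κ N x η * ((N : ℝ)⁻¹ * (a x * (1 - 2 * occ η x))) ^ 2 ≤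
      (N : ℝ)⁻¹ * ((N : ℝ)⁻¹ * ((N : ℝ) ^ γ *
        (κ * ∑ x ∈ bulk N, resRate γ N x * (a x * a x)))) := by
    rw [← Finset.sum_coe_sort (bulk N)]
    simp only [Finset.mul_sum]
    refine Finset.sum_le_sum fun x _ => ?_
    obtain ⟨hx1, hx2⟩ := one_le_of_mem_bulk x.2
    have t1 := tail_nonneg hγ (n := ((x : ℤ) : ℝ)) (by linarith)
    have t2 := tail_nonneg hγ (n := (N : ℝ) - ((x : ℤ) : ℝ)) (by linarith)
    have f1 := flipRate_mem hα hα1 x η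
    have f2 := flipRate_mem hβ hβ1 x η
    have ho : (1 - 2 * occ η x) ^ 2 = 1 := by
      rcases occ_mem η x with h | h <;> rw [h] <;> norm_num
    have hr : tail γ ((x : ℤ) : ℝ) * flipRate α x η +
        tail γ (N - ((x : ℤ) : ℝ)) * flipRate β x η ≤ resRate γ N x := by
      unfold resRate
      exact add_le_add (mul_le_of_le_one_right t1 f1.2) (mul_le_of_le_one_right t2 f2.2)
    have hpos : 0 ≤ (N : ℝ)⁻¹ * ((N : ℝ)⁻¹ * ((N : ℝ) ^ γ * (κ * (a x * a x)))) := by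
      have := mul_self_nonneg (a x)
      positivity
    calc _ = (N : ℝ)⁻¹ * ((N : ℝ)⁻¹ * ((N : ℝ) ^ γ * (κ * (a x * a x)))) *
          (tail γ ((x : ℤ) : ℝ) * flipRate α x η +
            tail γ (N - ((x : ℤ) : ℝ)) * flipRate β x η) * (1 - 2 * occ η x) ^ 2 := by
          unfold flRate; ring
      _ ≤ (N : ℝ)⁻¹ * ((N : ℝ)⁻¹ * ((N : ℝ) ^ γ * (κ * (a x * a x)))) * resRate γ N x := by
          rw [ho, mul_one]
          exact mul_le_mul_of_nonneg_left hr hpos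
      _ = _ := by ring
  calc _ ≤ _ := add_le_add h1 h2
    _ = _ := by ring

end Linear

/-! ### The variance bound. -/

section Fluctuations

local notation "⟪" x "," y "⟫" => inner ℝ x y

variable {T : ℝ} {N : ℕ} {γ α β κ θ e : ℝ} {eN : ℕ → ℝ} {μ : Measure (Config N)}
  {P : Measure (SkorohodPath T N)}

/-- The configuration as an element of `L²(0,1)`. -/
def occL (η : Config N) : HS := stepL N (occZ η)

theorem inner_occL (η : Config N) (v : HS) :
    ⟪occL η, v⟫ = linObs N (fun x => cellAvg N x v) η := by
  rw [occL, inner_stepL_left, linObs]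
  congr 1
  exact Finset.sum_congr rfl fun x _ => mul_comm _ _

theorem inner_occL_stepL (η : Config N) (a : ℤ → ℝ) : ⟪occL η, stepL N a⟫ = linObs N a η := by
  rw [occL, inner_stepL, linObs]
  congr 1
  exact Finset.sum_congr rfl fun x _ => mul_comm _ _

theorem norm_stepL_le {a : ℤ → ℝ} {C : ℝ} (hC : 0 ≤ C) (ha : ∀ x ∈ bulk N, |a x| ≤ C) :
    ‖stepL N a‖ ≤ C := by
  have h : ‖stepL N a‖ ^ 2 ≤ C ^ 2 := by
    rw [stepL_apply, norm_sq_toLp]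
    calc ∫ u, stepFun N a u ^ 2 ∂unitMeas ≤ ∫ _, C ^ 2 ∂unitMeas := by
          refine integral_mono (memLp_stepFun N a).integrable_sq (integrable_const _) fun u => ?_
          have := abs_stepFun_le hC ha u
          rw [← sq_abs]
          exact pow_le_pow_left₀ (abs_nonneg _) this 2
      _ = C ^ 2 := by simp
  exact (sq_le_sq₀ (norm_nonneg _) hC).1 h

theorem norm_occL_le (η : Config N) : ‖occL η‖ ≤ 1 := by
  refine norm_stepL_le zero_le_one fun x _ => ?_
  rw [abs_of_nonneg (occZ_mem η x).1]
  exact (occZ_mem η x).2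

/-- The projection of the discrete stationary profile. -/
def Params.statL (hp : Params γ κ e eN) (α β : ℝ) (N : ℕ) : HS :=
  stepL N fun x => cellAvg N x (bdL α β N + hp.devL α β N)

theorem tendsto_stepL_cellAvg_of_tendsto {x : ℕ → HS} {y : HS} (h : Tendsto x atTop (𝓝 y)) :
    Tendsto (fun N => stepL N fun z => cellAvg N z (x N)) atTop (𝓝 y) := by
  have h1 : Tendsto (fun N => stepL N fun z => cellAvg N z (x N - y)) atTop (𝓝 0) := by
    refine squeeze_zero_norm (fun N => norm_stepL_cellAvg_le N (x N - y)) ?_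
    have := (h.sub_const y).norm
    simpa using this
  have h2 := h1.add (tendsto_stepL_cellAvg y)
  rw [zero_add] at h2
  refine h2.congr fun N => ?_
  rw [← map_add]
  congr 1
  ext z
  simp

theorem Params.tendsto_statL (hp : Params γ κ e eN) (α β : ℝ) :
    Tendsto (hp.statL α β) atTop (𝓝 ((memLp_bdProfile α β).toLp _ + hp.devLim α β)) :=
  tendsto_stepL_cellAvg_of_tendsto ((tendsto_bdL α β).add (hp.tendsto_devL α β))

/-- Stationarity in weak form: centring by `statL` cancels the reservoir source in the drift. -/
theorem Params.inner_statL_discGen (hp : Params γ κ e eN) (α β : ℝ) (N : ℕ) (v : HS) :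
    ⟪hp.statL α β N, discGen γ κ (eN N) N v⟫ =
      (N : ℝ)⁻¹ * ∑ x ∈ bulk N, resSource γ κ α β N x * cellAvg N x v := by
  rw [Params.statL, inner_stepL_left]
  congr 1
  have h1 : ∑ x ∈ bulk N, cellAvg N x (bdL α β N + hp.devL α β N) *
      cellAvg N x (discGen γ κ (eN N) N v) = ∑ x ∈ bulk N,
      cellAvg N x (bdL α β N + hp.devL α β N) *
        discOp γ κ (eN N) N (fun z => cellAvg N z v) x :=
    Finset.sum_congr rfl fun x hx => by rw [cellAvg_discGen hx]
  rw [h1, ← sum_discOp_mul_comm]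
  refine Finset.sum_congr rfl fun x hx => ?_
  rw [← cellAvg_discGen hx, hp.discGen_devL, cellAvg_stepL hx]

/-- Duality: the test vector solves the backward equation, so the centred observable has no drift.
Its square grows only through the square field, whose total over `[0,t]` is `N⁻¹` times dissipated
energy, at most `‖v‖²/2`. -/
theorem Params.expect_sq_le (hp : Params γ κ e eN) (hT : 0 ≤ T) (hN : 0 < N)
    (heN : eN N = (N : ℝ) ^ θ) (hα : 0 ≤ α) (hα1 : α ≤ 1) (hβ : 0 ≤ β) (hβ1 : β ≤ 1)
    (hP : IsProcessLaw γ α β κ θ T N μ P) {t : ℝ} (ht : t ∈ Icc 0 T) (v : HS) (c : ℝ) :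
    expect hT P (fun η => (⟪occL η - hp.statL α β N, v⟫ - c) ^ 2) t ≤
      expect hT P (fun η => (⟪occL η - hp.statL α β N,
        expSg (discGen γ κ (eN N) N) t v⟫ - c) ^ 2) 0 + (N : ℝ)⁻¹ * (‖v‖ ^ 2 / 2) := by
  set B := discGen γ κ (eN N) N with hB
  -- Backward evolution, with derivative `+B (S s)` and final value `v` at `s = t`.
  let S : ℝ → HS := fun s => expSg B (t - s) v
  have hS : ∀ s, HasDerivAt S (B (S s)) s := by
    intro s
    have h := (hasDerivAt_expSg B v (t - s)).scomp s ((hasDerivAt_id s).const_sub t)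
    have e : (-1 : ℝ) • -B (expSg B (t - s) v) = B (S s) := by simp [S]
    rw [e] at h
    exact h
  have hSc : Continuous S := continuous_iff_continuousAt.2 fun s => (hS s).continuousAt
  let F : ℝ → Config N → ℝ := fun s η => (⟪occL η - hp.statL α β N, S s⟫ - c) ^ 2
  let F' : ℝ → Config N → ℝ := fun s η =>
    2 * (⟪occL η - hp.statL α β N, S s⟫ - c) * ⟪occL η - hp.statL α β N, B (S s)⟫
  have hF : ∀ ξ s, HasDerivAt (fun s => F s ξ) (F' s ξ) s := by
    intro ξ s
    have h1 : HasDerivAt (fun s => ⟪occL ξ - hp.statL α β N, S s⟫)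
        ⟪occL ξ - hp.statL α β N, B (S s)⟫ s :=
      (innerSL ℝ (occL ξ - hp.statL α β N)).hasFDerivAt.comp_hasDerivAt s (hS s)
    have h2 := (h1.sub_const c).fun_pow 2
    have e : F' s ξ = ((2 : ℕ) : ℝ) * (⟪occL ξ - hp.statL α β N, S s⟫ - c) ^ (2 - 1) *
        ⟪occL ξ - hp.statL α β N, B (S s)⟫ := by simp [F']
    rw [e]
    exact h2
  have hF' : ∀ ξ, Continuous fun s => F' s ξ := fun ξ => by
    have h1 : Continuous fun s => ⟪occL ξ - hp.statL α β N, S s⟫ := continuous_const.inner hSc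
    have h2 : Continuous fun s => ⟪occL ξ - hp.statL α β N, B (S s)⟫ :=
      continuous_const.inner (B.continuous.comp hSc)
    exact ((continuous_const.mul (h1.sub continuous_const)).mul h2)
  have hle : ∀ s ∈ Icc 0 t, ∀ η, F' s η + accGen γ α β κ θ N (F s) η ≤
      (N : ℝ)⁻¹ * ⟪B (S s), S s⟫ := by
    intro s _ η
    set a : ℤ → ℝ := fun x => cellAvg N x (S s) with ha
    set k : ℝ := ⟪hp.statL α β N, S s⟫ + c with hk
    have e1 : ∀ η : Config N, ⟪occL η - hp.statL α β N, S s⟫ - c = linObs N a η - k := by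
      intro η
      rw [inner_sub_left, inner_occL, hk]
      ring
    have e2 : F s = fun η => (fun ξ => linObs N a ξ - k) η ^ 2 := by
      ext ξ
      simp only [F]
      rw [e1]
    -- The time derivative of the test vector compensates the generator exactly; the source is
    -- cancelled by `statL`.
    have e3 : ⟪occL η - hp.statL α β N, B (S s)⟫ +
        accGen γ α β κ θ N (fun ξ => linObs N a ξ - k) η = 0 := by
      rw [accGen_linObs hN, inner_sub_left, hp.inner_statL_discGen, ← heN, inner_occL, linObs]
      have : ∑ x ∈ bulk N, cellAvg N x (B (S s)) * occZ η x =
          ∑ x ∈ bulk N, discOp γ κ (eN N) N a x * occZ η x :=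
        Finset.sum_congr rfl fun x hx => by rw [hB, cellAvg_discGen hx]
      rw [this]
      ring
    have e4 : F' s η + accGen γ α β κ θ N (F s) η =
        squareField γ α β κ θ N (fun ξ => linObs N a ξ - k) η := by
      rw [e2, accGen_sq hN]
      simp only [F']
      rw [e1]
      linear_combination 2 * (linObs N a η - k) * e3
    rw [e4]
    refine (squareField_linObs_le hp.one_lt hp.pos.le hα hα1 hβ hβ1 a k η).trans ?_
    rw [← heN]
    exact mul_le_mul_of_nonneg_left (sum_discOp_cellAvg_le hp.one_lt hp.pos.le N (S s))
      (by positivity)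
  have hc : Continuous fun s => (N : ℝ)⁻¹ * ⟪B (S s), S s⟫ :=
    continuous_const.mul ((B.continuous.comp hSc).inner hSc)
  have main := hP.expect_le hT hN hF hF' hc ht hle
  have h1 : F t = fun η => (⟪occL η - hp.statL α β N, v⟫ - c) ^ 2 := by
    ext η
    simp only [F, S, sub_self, expSg_zero]
  have h0 : F 0 = fun η => (⟪occL η - hp.statL α β N, expSg B t v⟫ - c) ^ 2 := by
    ext η
    simp only [F, S, sub_zero]
  rw [h1, h0] at main
  refine main.trans (add_le_add le_rfl ?_)
  rw [intervalIntegral.integral_const_mul]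
  refine mul_le_mul_of_nonneg_left ?_ (by positivity)
  have h2 := intervalIntegral.integral_comp_sub_left
    (fun r => ⟪B (expSg B r v), expSg B r v⟫) t (a := 0) (b := t)
  rw [sub_self, sub_zero] at h2
  simp only [S]
  rw [h2]
  exact IsSymmGe.integral_energy_le v

end Fluctuations

/-! ### Mean square convergence of linear observables. -/

section Convergence

local notation "⟪" x "," y "⟫" => inner ℝ x y

variable {T γ α β κ θ e : ℝ} {eN : ℕ → ℝ} {μ : ∀ N : ℕ, Measure (Config N)} {g : ℝ → ℝ}

theorem integral_interval_eq (f : ℝ → ℝ) : ∫ u in (0 : ℝ)..1, f u = ∫ u, f u ∂unitMeas := by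
  rw [intervalIntegral.integral_of_le zero_le_one, integral_Ioc_eq_integral_Ioo]

theorem memLp_profile (hg : Measurable g) (hg01 : ∀ u ∈ Icc (0 : ℝ) 1, g u ∈ Icc (0 : ℝ) 1) :
    MemLp g 2 unitMeas := by
  refine memLp_two_of_bound (C := 1) hg.aestronglyMeasurable ?_
  filter_upwards [ae_restrict_mem measurableSet_Ioo] with u hu
  obtain ⟨h1, h2⟩ := hg01 u (Ioo_subset_Icc_self hu)
  rw [abs_of_nonneg h1]
  exact h2

theorem integrable_config {N : ℕ} {ν : Measure (Config N)} [IsFiniteMeasure ν] (f : Config N → ℝ) :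
    Integrable f ν := by
  obtain ⟨C, -, hC⟩ := exists_config_bound f
  exact Integrable.of_bound (measurable_of_countable f).aestronglyMeasurable C
    (Eventually.of_forall hC)

theorem integral_sq_le {Ω : Type*} [MeasurableSpace Ω] {ν : Measure Ω} [IsProbabilityMeasure ν]
    {X : Ω → ℝ} (hX : Measurable X) {K δ : ℝ} (hK : ∀ z, |X z| ≤ K) :
    ∫ z, X z ^ 2 ∂ν ≤ δ ^ 2 + K ^ 2 * (ν {z | δ < |X z|}).toReal := by
  have hm : MeasurableSet {z | δ < |X z|} := measurableSet_lt measurable_const hX.abs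
  calc ∫ z, X z ^ 2 ∂ν ≤ ∫ z, (δ ^ 2 + {z | δ < |X z|}.indicator (fun _ => K ^ 2) z) ∂ν := by
        refine integral_mono_of_nonneg (Eventually.of_forall fun z => sq_nonneg _)
          ((integrable_const _).add ((integrable_const _).indicator hm))
          (Eventually.of_forall fun z => ?_)
        simp only
        by_cases h : z ∈ {z | δ < |X z|}
        · rw [indicator_of_mem h, ← sq_abs]
          have := pow_le_pow_left₀ (abs_nonneg _) (hK z) 2
          nlinarith [sq_nonneg δ]
        · rw [indicator_of_notMem h, ← sq_abs, add_zero]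
          exact pow_le_pow_left₀ (abs_nonneg _) (not_lt.1 h) 2
    _ = δ ^ 2 + K ^ 2 * (ν {z | δ < |X z|}).toReal := by
        rw [integral_add (integrable_const _) ((integrable_const _).indicator hm),
          integral_indicator_const _ hm, integral_const, probReal_univ, measureReal_def]
        simp only [smul_eq_mul]
        ring

/-- Convergence in probability of uniformly bounded variables implies convergence in mean square. -/
theorem tendsto_integral_sq_empirical (hμ : ∀ N, 2 ≤ N → IsProbabilityMeasure (μ N))
    (hμg : AssociatedTo μ g) {φ : ℝ → ℝ} (hφ : Continuous φ) :
    Tendsto (fun N => ∫ η, (empirical φ η - ∫ u in (0 : ℝ)..1, φ u * g u) ^ 2 ∂(μ N)) atTop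
      (𝓝 0) := by
  set c := ∫ u in (0 : ℝ)..1, φ u * g u with hc
  obtain ⟨C, hC⟩ := isCompact_Icc.exists_bound_of_continuousOn (hφ.continuousOn (s := Icc (0 : ℝ) 1))
  have hC0 : 0 ≤ C := (norm_nonneg _).trans (hC 0 ⟨le_rfl, zero_le_one⟩)
  have hbd : ∀ N, ∀ η : Config N, |empirical φ η - c| ≤ C + |c| := by
    intro N η
    refine (abs_sub _ _).trans (add_le_add ?_ le_rfl)
    rw [empirical_eq, linObs, abs_mul, abs_of_nonneg (by positivity)]
    rcases Nat.eq_zero_or_pos N with h | h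
    · subst h; simpa using hC0
    rw [inv_mul_le_iff₀ (by exact_mod_cast h)]
    calc |∑ x ∈ bulk N, φ ((x : ℝ) / N) * occZ η x| ≤ ∑ x ∈ bulk N, |φ ((x : ℝ) / N) * occZ η x| :=
          Finset.abs_sum_le_sum_abs _ _
      _ ≤ ∑ x ∈ bulk N, C := by
          refine Finset.sum_le_sum fun x hx => ?_
          rw [abs_mul, abs_of_nonneg (occZ_mem η x).1]
          exact (mul_le_of_le_one_right (abs_nonneg _) (occZ_mem η x).2).trans
            (hC _ (Ioo_subset_Icc_self (div_mem_of_mem_bulk hx)))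
      _ ≤ N * C := by
          rw [Finset.sum_const, nsmul_eq_mul]
          refine mul_le_mul_of_nonneg_right ?_ hC0
          rw [Int.card_Icc]
          have : ((N : ℤ) - 1 + 1 - 1).toNat ≤ N := by omega
          exact_mod_cast this
  rw [Metric.tendsto_atTop]
  intro ε hε
  set δ := Real.sqrt (ε / 2) with hδ
  have hδ0 : 0 < δ := Real.sqrt_pos.2 (by linarith)
  have hδ2 : δ ^ 2 = ε / 2 := Real.sq_sqrt (by linarith)
  have h1 : Tendsto (fun N => (C + |c|) ^ 2 * (μ N {η | δ < |empirical φ η - c|}).toReal) atTop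
      (𝓝 0) := by
    have := ((ENNReal.tendsto_toReal ENNReal.zero_ne_top).comp
      (hμg φ hφ.continuousOn δ hδ0)).const_mul ((C + |c|) ^ 2)
    simpa using this
  obtain ⟨M, hM⟩ := Metric.tendsto_atTop.1 h1 (ε / 2) (by linarith)
  refine ⟨max M 2, fun N hN => ?_⟩
  have := hμ N ((le_max_right _ _).trans hN)
  have h2 := hM N ((le_max_left _ _).trans hN)
  rw [Real.dist_eq, sub_zero] at h2 ⊢
  have h3 := le_abs_self ((C + |c|) ^ 2 * (μ N {η | δ < |empirical φ η - c|}).toReal)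
  rw [abs_of_nonneg (integral_nonneg fun η => sq_nonneg _)]
  have h4 := integral_sq_le (ν := μ N) (δ := δ) (X := fun η => empirical φ η - c)
    (measurable_of_countable _) (hbd N)
  linarith

theorem integral_sq_add_le {N : ℕ} {ν : Measure (Config N)} [IsProbabilityMeasure ν]
    (X : Config N → ℝ) {Y : Config N → ℝ} {b : ℝ} (hY : ∀ η, |Y η| ≤ b) :
    ∫ η, (X η + Y η) ^ 2 ∂ν ≤ 2 * ∫ η, X η ^ 2 ∂ν + 2 * b ^ 2 := by
  calc ∫ η, (X η + Y η) ^ 2 ∂ν ≤ ∫ η, (2 * X η ^ 2 + 2 * b ^ 2) ∂ν := by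
        refine integral_mono (integrable_config _) (integrable_config _) fun η => ?_
        have h1 : Y η ^ 2 ≤ b ^ 2 := by
          rw [← sq_abs]
          exact pow_le_pow_left₀ (abs_nonneg _) (hY η) 2
        simp only
        nlinarith [sq_nonneg (X η - Y η)]
    _ = _ := by
        rw [integral_add (integrable_config _) (integrable_config _), integral_const_mul]
        simp

/-- The hypothesis on the initial laws concerns continuous test functions, whereas the evolved
vectors `v N` and their limit are only in `L²`. As `‖occL η‖ ≤ 1`, replacing them by a continuous
function costs an error uniform in `η`. -/
theorem tendsto_integral_sq_occL (hg : MemLp g 2 unitMeas)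
    (hμ : ∀ N, 2 ≤ N → IsProbabilityMeasure (μ N)) (hμg : AssociatedTo μ g) {v : ℕ → HS} {w : HS}
    (hv : Tendsto v atTop (𝓝 w)) :
    Tendsto (fun N => ∫ η, (⟪occL η, v N⟫ - ⟪hg.toLp g, w⟫) ^ 2 ∂(μ N)) atTop (𝓝 0) := by
  rw [Metric.tendsto_atTop]
  intro ε hε
  set K := 2 + ‖hg.toLp g‖ with hK
  have hK0 : 0 < K := by positivity
  -- Chosen so that the replacement error is at most `K δ = √(ε/4)`; doubled and squared it uses
  -- half of `ε`.
  set δ := Real.sqrt (ε / 4) / K with hδ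
  have hδ0 : 0 < δ := div_pos (Real.sqrt_pos.2 (by linarith)) hK0
  obtain ⟨φ, hφ, hφw⟩ := exists_continuous_approx w hδ0
  have hmem := memLp_of_continuousOn (hφ.continuousOn (s := Icc 0 1))
  set y : HS := hmem.toLp φ with hy
  have hyN := tendsto_stepL_sample (hφ.continuousOn (s := Icc 0 1))
  have h1 : Tendsto (fun N => ‖v N - stepL N fun x => φ ((x : ℝ) / N)‖) atTop (𝓝 ‖w - y‖) :=
    (hv.sub hyN).norm
  have h2 := (tendsto_integral_sq_empirical hμ hμg hφ).const_mul 2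
  rw [mul_zero] at h2
  obtain ⟨M1, hM1⟩ := eventually_atTop.1 (h1.eventually (gt_mem_nhds hφw))
  obtain ⟨M2, hM2⟩ := eventually_atTop.1 (h2.eventually (gt_mem_nhds (show (0 : ℝ) < ε / 2 by linarith)))
  refine ⟨max (max M1 M2) 2, fun N hN => ?_⟩
  have := hμ N ((le_max_right _ _).trans hN)
  have a1 := hM1 N ((le_max_left _ _).trans ((le_max_left _ _).trans hN))
  have a2 := hM2 N ((le_max_right _ _).trans ((le_max_left _ _).trans hN))
  rw [Real.dist_eq, sub_zero, abs_of_nonneg (integral_nonneg fun η => sq_nonneg _)]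
  have e1 : ∀ η : Config N, ⟪occL η, v N⟫ - ⟪hg.toLp g, w⟫ =
      (empirical φ η - ∫ u in (0 : ℝ)..1, φ u * g u) +
        (⟪occL η, v N - stepL N fun x => φ ((x : ℝ) / N)⟫ - ⟪hg.toLp g, w - y⟫) := by
    intro η
    rw [empirical_eq, ← inner_occL_stepL, inner_sub_right, inner_sub_right, integral_interval_eq,
      real_inner_comm y, hy, inner_toLp]
    ring
  have e2 : ∀ η : Config N,
      |⟪occL η, v N - stepL N fun x => φ ((x : ℝ) / N)⟫ - ⟪hg.toLp g, w - y⟫| ≤ K * δ := by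
    intro η
    refine (abs_sub _ _).trans ?_
    have b1 := (abs_real_inner_le_norm (occL η) (v N - stepL N fun x => φ ((x : ℝ) / N))).trans
      (mul_le_mul (norm_occL_le η) a1.le (norm_nonneg _) zero_le_one)
    have b2 := (abs_real_inner_le_norm (hg.toLp g) (w - y)).trans
      (mul_le_mul_of_nonneg_left hφw.le (norm_nonneg _))
    rw [hK]
    nlinarith
  simp only [e1]
  refine (integral_sq_add_le _ e2).trans_lt ?_
  have e3 : (K * δ) ^ 2 = ε / 4 := by
    rw [hδ, mul_div_cancel₀ _ hK0.ne', Real.sq_sqrt (by linarith)]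
  rw [e3]
  linarith

theorem IsProcessLaw.expect_zero {N : ℕ} {ν : Measure (Config N)} {P : Measure (SkorohodPath T N)}
    (hT : 0 ≤ T) (hP : IsProcessLaw γ α β κ θ T N ν P) (f : Config N → ℝ) :
    expect hT P f 0 = ∫ η, f η ∂ν := by
  have h0 : ((projIcc 0 T hT 0 : Icc (0 : ℝ) T) : ℝ) = 0 := by
    rw [projIcc_of_mem hT ⟨le_rfl, hT⟩]
  rw [← hP.initial _ h0, integral_map (measurable_at _).aemeasurable
    (measurable_of_countable f).aestronglyMeasurable]
  rfl

theorem expect_sq_add_le {N : ℕ} {P : Measure (SkorohodPath T N)} [IsProbabilityMeasure P]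
    (hT : 0 ≤ T) (X : Config N → ℝ) (b t : ℝ) :
    expect hT P (fun η => (X η + b) ^ 2) t ≤ 2 * expect hT P (fun η => X η ^ 2) t + 2 * b ^ 2 := by
  unfold expect
  calc _ ≤ ∫ w, (2 * X (w.at (projIcc 0 T hT t)) ^ 2 + 2 * b ^ 2) ∂P := by
        refine integral_mono (integrable_comp_at (fun η => (X η + b) ^ 2) _)
          (integrable_comp_at (fun η => 2 * X η ^ 2 + 2 * b ^ 2) _) fun w => ?_
        simp only
        nlinarith [sq_nonneg (X (w.at (projIcc 0 T hT t)) - b)]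
    _ = _ := by
        rw [integral_add (integrable_comp_at (fun η => 2 * X η ^ 2) _) (integrable_const _),
          integral_const_mul]
        simp

/-- Convergence in mean square of the linear observables at a fixed time. -/
theorem Params.tendsto_expect_sq (hp : Params γ κ e eN) (hT : 0 ≤ T)
    (heN : ∀ N, eN N = (N : ℝ) ^ θ) (hα : 0 ≤ α) (hα1 : α ≤ 1) (hβ : 0 ≤ β) (hβ1 : β ≤ 1)
    (hg : MemLp g 2 unitMeas) (hμ : ∀ N, 2 ≤ N → IsProbabilityMeasure (μ N))
    (hμg : AssociatedTo μ g) {P : ∀ N : ℕ, Measure (SkorohodPath T N)}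
    (hP : ∀ N, 2 ≤ N → IsProcessLaw γ α β κ θ T N (μ N) (P N)) {t : ℝ} (ht : t ∈ Icc 0 T)
    {v : ℕ → HS} {w : HS} (hv : Tendsto v atTop (𝓝 w)) :
    Tendsto (fun N => expect hT (P N) (fun η => (⟪occL η, v N⟫ -
      ⟪hp.sol α β (hg.toLp g) t, w⟫) ^ 2) t) atTop (𝓝 0) := by
  set gL := hg.toLp g with hgL
  set R := (memLp_bdProfile α β).toLp _ + hp.devLim α β with hR
  set c := ⟪gL - R, hp.semigroup t w⟫ with hc
  have hsol : ⟪hp.sol α β gL t, w⟫ = ⟪R, w⟫ + c := by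
    rw [Params.sol, ← add_assoc, ← hR, inner_add_left, sub_sub, ← hR, hp.semigroup_symm ht.1]
  have hS := hp.tendsto_semigroup_of_tendsto ht.1 hv
  have hRN : Tendsto (hp.statL α β) atTop (𝓝 R) := hp.tendsto_statL α β
  have h0 := tendsto_integral_sq_occL hg hμ hμg hS
  have hb0 : Tendsto (fun N => 2 * (⟪R, hp.semigroup t w⟫ -
      ⟪hp.statL α β N, expSg (discGen γ κ (eN N) N) t (v N)⟫) ^ 2) atTop (𝓝 0) := by
    have h1 := ((tendsto_const_nhds (x := ⟪R, hp.semigroup t w⟫)).sub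
      (hRN.inner (𝕜 := ℝ) hS)).pow 2 |>.const_mul 2
    simpa using h1
  have hb1 : Tendsto (fun N => 2 * (⟪hp.statL α β N, v N⟫ - ⟪R, w⟫) ^ 2) atTop (𝓝 0) := by
    have h1 := ((hRN.inner (𝕜 := ℝ) hv).sub
      (tendsto_const_nhds (x := ⟪R, w⟫))).pow 2 |>.const_mul 2
    simpa using h1
  have hv2 : Tendsto (fun N : ℕ => (N : ℝ)⁻¹ * (‖v N‖ ^ 2 / 2)) atTop (𝓝 0) := by
    have h1 := (tendsto_inv_atTop_nhds_zero_nat (𝕜 := ℝ)).mul ((hv.norm.pow 2).div_const 2)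
    simpa using h1
  have htot := ((((h0.const_mul 2).add hb0).add hv2).const_mul 2).add hb1
  simp only [mul_zero, add_zero] at htot
  refine tendsto_of_tendsto_of_tendsto_of_le_of_le' tendsto_const_nhds htot
    (Eventually.of_forall fun N => integral_nonneg fun w => sq_nonneg _) ?_
  filter_upwards [eventually_ge_atTop 2] with N hN
  have := hμ N hN
  have hPN := hP N hN
  have := hPN.isProbabilityMeasure
  have e1 : ∀ η : Config N, ⟪occL η, v N⟫ - ⟪hp.sol α β gL t, w⟫ =
      (⟪occL η - hp.statL α β N, v N⟫ - c) + (⟪hp.statL α β N, v N⟫ - ⟪R, w⟫) := by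
    intro η
    rw [hsol, inner_sub_left]
    ring
  simp only [e1]
  refine (expect_sq_add_le hT _ _ _).trans ?_
  refine add_le_add (mul_le_mul_of_nonneg_left ?_ (by norm_num)) le_rfl
  refine (hp.expect_sq_le hT (by omega) (heN N) hα hα1 hβ hβ1 hPN ht (v N) c).trans ?_
  refine add_le_add ?_ le_rfl
  rw [hPN.expect_zero hT]
  have e2 : ∀ η : Config N, ⟪occL η - hp.statL α β N, expSg (discGen γ κ (eN N) N) t (v N)⟫ - c =
      (⟪occL η, expSg (discGen γ κ (eN N) N) t (v N)⟫ - ⟪gL, hp.semigroup t w⟫) +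
        (⟪R, hp.semigroup t w⟫ - ⟪hp.statL α β N, expSg (discGen γ κ (eN N) N) t (v N)⟫) := by
    intro η
    rw [hc, inner_sub_left, inner_sub_left]
    ring
  simp only [e2]
  have := integral_sq_add_le (ν := μ N) (fun η => ⟪occL η, expSg (discGen γ κ (eN N) N) t (v N)⟫ -
    ⟪gL, hp.semigroup t w⟫) (Y := fun _ => ⟪R, hp.semigroup t w⟫ -
      ⟪hp.statL α β N, expSg (discGen γ κ (eN N) N) t (v N)⟫) (fun _ => le_rfl)
  rwa [sq_abs] at this

end Convergence

/-! ### Bounds on the limit density and convergence in probability. -/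

section Bounds

local notation "⟪" x "," y "⟫" => inner ℝ x y

variable {T γ α β κ θ e : ℝ} {eN : ℕ → ℝ} {μ : ∀ N : ℕ, Measure (Config N)} {g : ℝ → ℝ}

theorem setIntegral_occL_mem {N : ℕ} (η : Config N) (s : Set ℝ) :
    ∫ u in s, occL η u ∂unitMeas ∈ Icc 0 (unitMeas.real s) := by
  have h : occL η =ᵐ[unitMeas.restrict s] stepFun N (occZ η) :=
    ae_restrict_of_ae (coeFn_stepL N (occZ η))
  rw [integral_congr_ae h]
  have hm : ∀ u, stepFun N (occZ η) u ∈ Icc (0 : ℝ) 1 := by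
    intro u
    unfold stepFun
    split_ifs
    · exact occZ_mem η _
    · exact ⟨le_rfl, zero_le_one⟩
  refine ⟨integral_nonneg fun u => (hm u).1, ?_⟩
  calc ∫ u in s, stepFun N (occZ η) u ∂unitMeas ≤ ∫ _ in s, (1 : ℝ) ∂unitMeas :=
        integral_mono (((memLp_stepFun N _).integrable one_le_two).restrict)
          (integrable_const _) fun u => (hm u).2
    _ = unitMeas.real s := by simp

/-- If `c` were outside `[0,m]`, the mean square would stay above the squared distance from `c` to
the interval. -/
theorem mem_Icc_of_tendsto_expect_sq (hT : 0 ≤ T) {P : ∀ N : ℕ, Measure (SkorohodPath T N)}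
    (hP : ∀ N, 2 ≤ N → IsProbabilityMeasure (P N)) {t m c : ℝ} {X : ∀ N, Config N → ℝ}
    (hX : ∀ N η, X N η ∈ Icc 0 m)
    (h : Tendsto (fun N => expect hT (P N) (fun η => (X N η - c) ^ 2) t) atTop (𝓝 0)) :
    c ∈ Icc 0 m := by
  have key : ∀ d : ℝ, (∀ N η, d ≤ (X N η - c) ^ 2) → d ≤ 0 := by
    intro d hd
    refine ge_of_tendsto h ?_
    filter_upwards [eventually_ge_atTop 2] with N hN
    have := hP N hN
    calc d = ∫ _, d ∂(P N) := by simp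
      _ ≤ _ := integral_mono (integrable_const _)
          (integrable_comp_at (fun η => (X N η - c) ^ 2) _) fun w => hd N _
  constructor
  · by_contra! hc
    have := key (c ^ 2) fun N η => by nlinarith [(hX N η).1]
    nlinarith
  · by_contra! hc
    have := key ((c - m) ^ 2) fun N η => by nlinarith [(hX N η).2]
    nlinarith

/-- A maximum principle inherited from the particles: the integral of the limit over a set `s` is a
mean square limit of integrals of occupation densities, all in `[0, |s|]`. -/
theorem Params.sol_mem_Icc
    (hp : Params γ κ e eN) (hT : 0 ≤ T)
    (heN : ∀ N, eN N = (N : ℝ) ^ θ) (hα : 0 ≤ α) (hα1 : α ≤ 1) (hβ : 0 ≤ β) (hβ1 : β ≤ 1)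
    (hg : MemLp g 2 unitMeas) (hμ : ∀ N, 2 ≤ N → IsProbabilityMeasure (μ N))
    (hμg : AssociatedTo μ g) {P : ∀ N : ℕ, Measure (SkorohodPath T N)}
    (hP : ∀ N, 2 ≤ N → IsProcessLaw γ α β κ θ T N (μ N) (P N)) {t : ℝ} (ht : t ∈ Icc 0 T) :
    ∀ᵐ u ∂unitMeas, hp.sol α β (hg.toLp g) t u ∈ Icc (0 : ℝ) 1 := by
  set x := hp.sol α β (hg.toLp g) t with hx
  have hi : Integrable x unitMeas := (Lp.memLp x).integrable one_le_two
  have key : ∀ s, MeasurableSet s → ∫ u in s, x u ∂unitMeas ∈ Icc 0 (unitMeas.real s) := by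
    intro s hs
    have hms : unitMeas s ≠ ⊤ := measure_ne_top _ _
    have h := hp.tendsto_expect_sq hT heN hα hα1 hβ hβ1 hg hμ hμg hP ht
      (tendsto_const_nhds (x := indicatorConstLp 2 hs hms (1 : ℝ)))
    rw [← L2.inner_indicatorConstLp_one (𝕜 := ℝ) hs hms, real_inner_comm]
    refine mem_Icc_of_tendsto_expect_sq hT (fun N hN => (hP N hN).isProbabilityMeasure)
      (X := fun N η => ⟪occL η, indicatorConstLp 2 hs hms (1 : ℝ)⟫) (fun N η => ?_) h
    rw [real_inner_comm, L2.inner_indicatorConstLp_one (𝕜 := ℝ) hs hms]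
    exact setIntegral_occL_mem η s
  have h0 := ae_nonneg_of_forall_setIntegral_nonneg hi fun s hs _ => (key s hs).1
  have h1 := ae_le_of_forall_setIntegral_le hi (integrable_const (1 : ℝ)) fun s hs _ => by
    simpa using (key s hs).2
  filter_upwards [h0, h1] with u h0 h1 using ⟨h0, h1⟩

/-- Chebyshev's inequality applied to the mean square convergence, with the sampled test function as
vector. -/
theorem Params.convergesTo
    (hp : Params γ κ e eN) (hT : 0 ≤ T)
    (heN : ∀ N, eN N = (N : ℝ) ^ θ) (hα : 0 ≤ α) (hα1 : α ≤ 1) (hβ : 0 ≤ β) (hβ1 : β ≤ 1)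
    (hg : MemLp g 2 unitMeas) (hμ : ∀ N, 2 ≤ N → IsProbabilityMeasure (μ N))
    (hμg : AssociatedTo μ g) {P : ∀ N : ℕ, Measure (SkorohodPath T N)}
    (hP : ∀ N, 2 ≤ N → IsProcessLaw γ α β κ θ T N (μ N) (P N)) {ρ : ℝ → ℝ → ℝ}
    (hρ : ∀ t ∈ Icc 0 T, ρ t =ᵐ[unitMeas] hp.sol α β (hg.toLp g) t) : ConvergesTo T P ρ := by
  intro t G hG δ hδ
  have h := hp.tendsto_expect_sq hT heN hα hα1 hβ hβ1 hg hμ hμg hP t.2 (tendsto_stepL_sample hG)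
  have hc : ⟪hp.sol α β (hg.toLp g) t, (memLp_of_continuousOn hG).toLp G⟫ =
      ∫ u in (0 : ℝ)..1, G u * ρ t u := by
    rw [integral_interval_eq, real_inner_comm, inner_toLp_left]
    refine integral_congr_ae ?_
    filter_upwards [hρ t t.2] with u hu
    rw [hu]
  simp only [hc, inner_occL_stepL] at h
  set c := ∫ u in (0 : ℝ)..1, G u * ρ t u
  have h2 : Tendsto (fun N => ENNReal.ofReal ((δ ^ 2)⁻¹ * expect hT (P N) (fun η =>
      (linObs N (fun x => G ((x : ℝ) / N)) η - c) ^ 2) t)) atTop (𝓝 0) := by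
    have := ENNReal.tendsto_ofReal (h.const_mul (δ ^ 2)⁻¹)
    rwa [mul_zero, ENNReal.ofReal_zero] at this
  refine tendsto_of_tendsto_of_tendsto_of_le_of_le' tendsto_const_nhds h2
    (Eventually.of_forall fun N => zero_le) ?_
  filter_upwards [eventually_ge_atTop 2] with N hN
  have := (hP N hN).isProbabilityMeasure
  have hproj : projIcc 0 T hT t = t := projIcc_val hT t
  have h3 := mul_meas_ge_le_integral_of_nonneg (μ := P N)
    (f := fun w => (linObs N (fun x => G ((x : ℝ) / N)) (w.at t) - c) ^ 2)
    (Eventually.of_forall fun w => sq_nonneg _)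
    (integrable_comp_at (fun η => (linObs N (fun x => G ((x : ℝ) / N)) η - c) ^ 2) t) (δ ^ 2)
  rw [expect, hproj]
  refine ENNReal.le_ofReal_iff_toReal_le (measure_ne_top _ _) ?_ |>.2 ?_
  · exact mul_nonneg (by positivity) (integral_nonneg fun w => sq_nonneg _)
  rw [le_inv_mul_iff₀ (by positivity)]
  refine le_trans (mul_le_mul_of_nonneg_left ?_ (by positivity)) h3
  refine ENNReal.toReal_mono (measure_ne_top _ _) (measure_mono fun w hw => ?_)
  rw [Set.mem_ofPred_eq, empirical_eq] at hw
  rw [Set.mem_ofPred_eq, ← sq_abs (linObs _ _ _ - c)]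
  exact pow_le_pow_left₀ hδ.le hw.le 2

end Bounds

/-! ### Time continuity and a jointly measurable version of the limit. -/

section Version

local notation "⟪" x "," y "⟫" => inner ℝ x y

variable {γ κ e : ℝ} {eN : ℕ → ℝ}

theorem Params.denseRange_green (hp : Params γ κ e eN) : DenseRange hp.green := by
  have h : (LinearMap.range hp.green.toLinearMap).topologicalClosure = ⊤ := by
    rw [Submodule.topologicalClosure_eq_top_iff, Submodule.eq_bot_iff]
    intro x hx
    refine formInv_injective hp.one_lt hp.lt_two hp.pos hp.nonneg x ?_
    refine ext_inner_left ℝ fun y => ?_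
    rw [inner_zero_right, ← (isSymmGe_formInv hp.one_lt hp.lt_two hp.nonneg hp.pos.le).symm]
    exact (Submodule.mem_orthogonal _ _).1 hx _ ⟨y, rfl⟩
  intro x
  have hx : x ∈ (LinearMap.range hp.green.toLinearMap).topologicalClosure := h ▸ Submodule.mem_top
  exact hx

theorem Params.norm_semigroup_sub_le (hp : Params γ κ e eN) {t : ℝ} (ht : 0 ≤ t) (x z : HS) :
    ‖hp.semigroup t x - hp.semigroup t z‖ ≤ ‖x - z‖ := by
  refine le_of_tendsto ((hp.tendsto_semigroup ht x).sub (hp.tendsto_semigroup ht z)).norm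
    (Eventually.of_forall fun N => ?_)
  rw [← map_sub]
  exact (hp.isSymmGe_zero N).norm_expSg_le ht _

/-- On `K_N y` the discrete semigroup has time derivative `-exp(-rB_N) y`, bounded by `‖y‖`
uniformly in `N`. -/
theorem Params.norm_semigroup_green_sub_le (hp : Params γ κ e eN) {s t : ℝ} (hs : 0 ≤ s)
    (ht : 0 ≤ t) (y : HS) :
    ‖hp.semigroup t (hp.green y) - hp.semigroup s (hp.green y)‖ ≤ ‖y‖ * ‖t - s‖ := by
  refine le_of_tendsto ((hp.tendsto_semigroup_of_tendsto ht (hp.tendsto_inv y)).sub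
    (hp.tendsto_semigroup_of_tendsto hs (hp.tendsto_inv y))).norm (Eventually.of_forall fun N => ?_)
  refine Convex.norm_image_sub_le_of_norm_hasDerivWithin_le (s := Ici 0)
    (f := fun r => expSg (discGen γ κ (eN N) N) r (hp.inv N y))
    (fun r _ => (hasDerivAt_expSg' _ _ r).hasDerivWithinAt) (fun r hr => ?_) (convex_Ici 0) hs ht
  rw [norm_neg, hp.discGen_inv]
  exact (hp.isSymmGe_zero N).norm_expSg_le hr _

/-- The range of `green` is dense and the semigroup is contractive, so the curve is a uniform limit
of Lipschitz curves. The truncation `max t 0` extends it to all real times. -/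
theorem Params.continuous_semigroup (hp : Params γ κ e eN) (x : HS) :
    Continuous fun t : ℝ => hp.semigroup (max t 0) x := by
  refine continuous_of_uniform_approx_of_continuous fun u hu => ?_
  obtain ⟨ε, hε, hu⟩ := Metric.mem_uniformity_dist.1 hu
  obtain ⟨y, hy⟩ := hp.denseRange_green.exists_dist_lt x hε
  refine ⟨fun t => hp.semigroup (max t 0) (hp.green y), ?_, fun t => hu ?_⟩
  · refine (LipschitzWith.of_dist_le_mul (K := ‖y‖₊) fun t s => ?_).continuous
    rw [dist_eq_norm]
    refine (hp.norm_semigroup_green_sub_le (le_max_right _ _) (le_max_right _ _) y).trans ?_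
    exact mul_le_mul_of_nonneg_left (abs_max_sub_max_le_abs t s 0) (norm_nonneg _)
  · rw [dist_eq_norm]
    refine (hp.norm_semigroup_sub_le (le_max_right _ _) _ _).trans_lt ?_
    rwa [← dist_eq_norm]

theorem Params.continuous_sol (hp : Params γ κ e eN) (α β : ℝ) (g : HS) :
    Continuous fun t : ℝ => hp.sol α β g (max t 0) :=
  continuous_const.add (continuous_const.add (hp.continuous_semigroup _))

/-- The primitive of an element of `L²(0,1)`, extended by zero. -/
def primitive (w : HS) (u : ℝ) : ℝ := ∫ v in (0 : ℝ)..u, zeroExt w v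

theorem continuous_primitive (w : HS) : Continuous (primitive w) :=
  intervalIntegral.continuous_primitive (fun _ _ => (integrable_zeroExt w).intervalIntegrable) 0

theorem primitive_eq (w : HS) (u : ℝ) : primitive w u =
    ⟪indicatorConstLp 2 (measurableSet_Ioc (a := 0) (b := u)) (measure_ne_top unitMeas _) (1 : ℝ), w⟫ := by
  rw [L2.inner_indicatorConstLp_one (𝕜 := ℝ), primitive]
  have h : ∀ s, MeasurableSet s → ∫ v in s, zeroExt w v = ∫ v in s, w v ∂unitMeas := by
    intro s hs
    unfold zeroExt
    rw [integral_indicator measurableSet_Ioo, Measure.restrict_restrict measurableSet_Ioo,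
      Measure.restrict_restrict hs, inter_comm]
  rcases le_total 0 u with hu | hu
  · rw [intervalIntegral.integral_of_le hu, h _ measurableSet_Ioc]
  · rw [intervalIntegral.integral_of_ge hu, h _ measurableSet_Ioc, Ioc_eq_empty (not_lt.2 hu),
      Measure.restrict_empty, integral_zero_measure, Measure.restrict_restrict measurableSet_Ioc]
    have : Ioc u 0 ∩ Ioo 0 1 = (∅ : Set ℝ) := by
      ext v
      simp only [mem_inter_iff, mem_Ioc, mem_Ioo, mem_empty_iff_false, iff_false]
      rintro ⟨⟨-, h1⟩, h2, -⟩
      exact absurd h1 (not_le.2 h2)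
    simp [this]

/-- A jointly measurable version of a curve in `L²(0,1)`, truncated to `[0,1]`. -/
def version (x : ℝ → HS) (t u : ℝ) : ℝ :=
  max 0 (min 1 (limsup (fun n : ℕ => (1 / ((n : ℝ) + 1))⁻¹ *
    (primitive (x t) (u + 1 / ((n : ℝ) + 1)) - primitive (x t) u)) atTop))

theorem version_mem_Icc (x : ℝ → HS) (t u : ℝ) : version x t u ∈ Icc (0 : ℝ) 1 :=
  ⟨le_max_left _ _, max_le zero_le_one (min_le_left _ _)⟩

theorem measurable_version {x : ℝ → HS} (hx : Continuous x) :
    Measurable (Function.uncurry (version x)) := by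
  have h : Measurable (Function.uncurry fun u t => primitive (x t) u) := by
    -- The primitive is continuous in `u` and, as a scalar product with an indicator, measurable in
    -- `t`: a Carathéodory function. Difference quotients then recover the density by Lebesgue
    -- differentiation.
    refine measurable_uncurry_of_continuous_of_measurable (fun t => continuous_primitive _)
      fun u => ?_
    simp_rw [primitive_eq]
    exact (continuous_const.inner hx).measurable
  refine measurable_const.max (measurable_const.min (Measurable.limsup fun n => ?_))
  have h1 : Measurable fun q : ℝ × ℝ => primitive (x q.1) (q.2 + 1 / ((n : ℝ) + 1)) :=
    h.comp ((measurable_snd.add_const _).prodMk measurable_fst)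
  have h2 : Measurable fun q : ℝ × ℝ => primitive (x q.1) q.2 :=
    h.comp (measurable_snd.prodMk measurable_fst)
  exact (h1.sub h2).const_mul _

theorem version_ae_eq {x : ℝ → HS} {t : ℝ} (h : ∀ᵐ u ∂unitMeas, x t u ∈ Icc (0 : ℝ) 1) :
    version x t =ᵐ[unitMeas] x t := by
  have h1 := ae_restrict_of_ae (s := Ioo (0 : ℝ) 1)
    (LocallyIntegrable.ae_hasDerivAt_integral (integrable_zeroExt (x t)).locallyIntegrable)
  filter_upwards [h, h1, zeroExt_ae (x t)] with u hu h1 h2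
  have h3 := (h1 0).tendsto_slope_zero_right.comp
    (tendsto_nhdsWithin_iff.2 ⟨tendsto_one_div_add_atTop_nhds_zero_nat (𝕜 := ℝ),
      Eventually.of_forall fun n : ℕ => (by positivity : (0 : ℝ) < 1 / ((n : ℝ) + 1))⟩)
  have h4 := h3.limsup_eq
  rw [h2] at h4
  unfold version
  have : limsup (fun n : ℕ => (1 / ((n : ℝ) + 1))⁻¹ *
    (primitive (x t) (u + 1 / ((n : ℝ) + 1)) - primitive (x t) u)) atTop = x t u := h4
  rw [this, min_eq_right hu.2, max_eq_right hu.1]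

end Version

/-! ### The weak formulation. -/

section WeakForm

local notation "⟪" x "," y "⟫" => inner ℝ x y

variable {T γ κ e α β : ℝ} {eN : ℕ → ℝ}

theorem exists_subset_Icc_of_isCompact {K : Set ℝ} (hK : IsCompact K) (h : K ⊆ Ioo 0 1) :
    ∃ r > 0, K ⊆ Icc (2 * r) (1 - 2 * r) := by
  obtain ⟨a, ha, hKa⟩ := hK.exists_forall_le' (f := fun u : ℝ => min u (1 - u))
    (by fun_prop) (a := 0) fun u hu => lt_min (h hu).1 (sub_pos.2 (h hu).2)
  refine ⟨a / 2, by linarith, fun u hu => ?_⟩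
  have := le_min_iff.1 (hKa u hu)
  constructor <;> linarith [this.1, this.2]

/-- Compactness of `[0,T] × [0,1]` makes the bounds uniform in time, as needed for domination under
the time integral. -/
theorem IsTestFunction.exists_isCore {G : ℝ → ℝ → ℝ} (hG : IsTestFunction T G) :
    ∃ r C, ∀ s ∈ Icc 0 T, IsCore r C (G s) := by
  obtain ⟨K, hK, hK1, hK0⟩ := hG.compactSupport
  obtain ⟨r, hr, hKr⟩ := exists_subset_Icc_of_isCompact hK hK1
  have hb : ∀ n, ∃ C, ∀ s ∈ Icc 0 T, ∀ u ∈ Icc (0 : ℝ) 1, |iteratedDeriv n (G s) u| ≤ C := by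
    intro n
    obtain ⟨C, hC⟩ := (isCompact_Icc.prod isCompact_Icc).exists_bound_of_continuousOn
      ((hG.continuousOn_iteratedDeriv n).mono
        (prod_mono_right (subset_univ (Icc (0 : ℝ) 1))))
    exact ⟨C, fun s hs u hu => hC (s, u) ⟨hs, hu⟩⟩
  obtain ⟨C0, h0⟩ := hb 0
  obtain ⟨C1, h1⟩ := hb 1
  obtain ⟨C2, h2⟩ := hb 2
  simp only [iteratedDeriv_zero] at h0
  simp only [iteratedDeriv_one] at h1
  simp only [iteratedDeriv_succ, iteratedDeriv_zero] at h2
  refine ⟨r, max C0 (max C1 C2), fun s hs => isCore_of_contDiff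
    ((hG.smooth s hs).of_le (by exact WithTop.coe_le_coe.2 le_top)) hr
    (fun u hu => hK0 s hs u fun h => hu (hKr h)) (fun u hu => (h0 s hs u hu).trans ?_)
    (fun u hu => (h1 s hs u hu).trans ?_) fun u hu => (h2 s hs u hu).trans ?_⟩
  · exact le_max_left _ _
  · exact (le_max_left _ _).trans (le_max_right _ _)
  · exact (le_max_right _ _).trans (le_max_right _ _)

theorem IsTestFunction.continuous_timeDeriv {G : ℝ → ℝ → ℝ} (hG : IsTestFunction T G) {s : ℝ}
    (hs : s ∈ Icc 0 T) : Continuous (timeDeriv T G s) := by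
  have := hG.continuousOn_timeDeriv.comp
    (continuousOn_const.prodMk continuousOn_id : ContinuousOn (fun u : ℝ => (s, u)) univ)
    fun u _ => ⟨hs, mem_univ _⟩
  exact continuousOn_univ.1 this

theorem continuousOn_stepL {a : ℝ → ℤ → ℝ} {S : Set ℝ} {N : ℕ}
    (h : ∀ x ∈ bulk N, ContinuousOn (fun s => a s x) S) : ContinuousOn (fun s => stepL N (a s)) S := by
  simp_rw [stepL_eq_sum]
  exact continuousOn_finsetSum _ fun x hx => (h x hx).smul continuousOn_const

theorem hasDerivWithinAt_stepL {a : ℝ → ℤ → ℝ} {a' : ℤ → ℝ} {S : Set ℝ} {N : ℕ} {s : ℝ}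
    (h : ∀ x ∈ bulk N, HasDerivWithinAt (fun s => a s x) (a' x) S s) :
    HasDerivWithinAt (fun s => stepL N (a s)) (stepL N a') S s := by
  simp_rw [stepL_eq_sum]
  exact HasDerivWithinAt.fun_sum fun x hx => (h x hx).smul_const _

/-- Bounded convergence on `[0,t]`, with integrability of the limit. -/
theorem tendsto_integral_of_bounded {f : ℕ → ℝ → ℝ} {g : ℝ → ℝ} {C t : ℝ} (ht : t ∈ Icc 0 T)
    (hf : ∀ N, ContinuousOn (f N) (Icc 0 T)) (hC : ∀ N, ∀ s ∈ Icc 0 T, |f N s| ≤ C)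
    (h : ∀ s ∈ Icc 0 T, Tendsto (fun N => f N s) atTop (𝓝 (g s))) :
    IntervalIntegrable g volume 0 t ∧
      Tendsto (fun N => ∫ s in (0 : ℝ)..t, f N s) atTop (𝓝 (∫ s in (0 : ℝ)..t, g s)) := by
  have hsub : uIoc 0 t ⊆ Icc 0 T := by
    rw [uIoc_of_le ht.1]
    exact fun s hs => ⟨hs.1.le, hs.2.trans ht.2⟩
  have hm : ∀ N, AEStronglyMeasurable (f N) (volume.restrict (uIoc 0 t)) := fun N =>
    ((hf N).mono hsub).aestronglyMeasurable measurableSet_uIoc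
  have hlim : ∀ᵐ s ∂(volume.restrict (uIoc 0 t)), Tendsto (fun N => f N s) atTop (𝓝 (g s)) := by
    filter_upwards [ae_restrict_mem measurableSet_uIoc] with s hs using h s (hsub hs)
  refine ⟨?_, intervalIntegral.tendsto_integral_filter_of_dominated_convergence (fun _ => C)
    (Eventually.of_forall hm) (Eventually.of_forall fun N => Eventually.of_forall fun s hs =>
      hC N s (hsub hs)) (by simp) (Eventually.of_forall fun s hs => h s (hsub hs))⟩
  rw [intervalIntegrable_iff]
  have : IsFiniteMeasure (volume.restrict (uIoc 0 t)) := ⟨by simp⟩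
  refine Integrable.of_bound (aestronglyMeasurable_of_tendsto_ae _ hm hlim) C ?_
  filter_upwards [ae_restrict_mem measurableSet_uIoc] with s hs
  exact le_of_tendsto (h s (hsub hs)).abs (Eventually.of_forall fun N => hC N s (hsub hs))

theorem abs_resSource_mul_le (hp : Params γ κ e eN) (hα : 0 ≤ α) (hα1 : α ≤ 1) (hβ : 0 ≤ β)
    (hβ1 : β ≤ 1) {r C : ℝ} {G : ℝ → ℝ} (hG : IsCore r C G) {N : ℕ} {x : ℤ} (hx : x ∈ bulk N) :
    |resSource γ κ α β N x * G ((x : ℝ) / N)| ≤ opBound γ κ 0 r C := by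
  refine le_trans ?_ (hG.abs_discOp_le hp.one_lt hp.lt_two hp.pos.le (e := 0) (by simp) hx)
  obtain ⟨h1, h2⟩ := one_le_of_mem_bulk hx
  have t1 := tail_nonneg hp.one_lt (n := (x : ℝ)) (by linarith)
  have t2 := tail_nonneg hp.one_lt (n := (N : ℝ) - x) (by linarith)
  rw [discOp_sample, zero_mul, sub_zero, ← mul_assoc, abs_mul, abs_mul (κ * _), resSource]
  have hN : (0 : ℝ) ≤ (N : ℝ) ^ γ := by positivity
  have hκ := hp.pos
  refine mul_le_mul_of_nonneg_right ?_ (abs_nonneg _)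
  rw [abs_of_nonneg (by positivity), abs_of_nonneg (by positivity)]
  have : α * tail γ x + β * tail γ (N - x) ≤ tail γ x + tail γ (N - x) := by nlinarith
  calc (N : ℝ) ^ γ * (κ * (α * tail γ x + β * tail γ (N - x)))
      ≤ (N : ℝ) ^ γ * (κ * (tail γ x + tail γ (N - x))) := by gcongr
    _ = _ := by ring

/-- `resSource` alone is not bounded near the boundary. Its product with a test function is, so the
pairing is rewritten as the integral of that product. -/
theorem inner_resSource (N : ℕ) (a b : ℤ → ℝ) :
    ⟪stepL N a, stepL N b⟫ = ⟪stepL N fun x => a x * b x, stepL N fun _ => 1⟫ := by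
  rw [inner_stepL, inner_stepL]
  simp

theorem tendsto_inner_resSource (hp : Params γ κ e eN) (hα : 0 ≤ α) (hα1 : α ≤ 1) (hβ : 0 ≤ β)
    (hβ1 : β ≤ 1) {r C : ℝ} {G : ℝ → ℝ} (hG : IsCore r C G) :
    Tendsto (fun N => ⟪stepL N (resSource γ κ α β N), stepL N fun x => G ((x : ℝ) / N)⟫) atTop
      (𝓝 (κ * ∫ u in (0 : ℝ)..1, G u * V₀ γ α β u)) := by
  have hlim : ∀ u ∈ Ioo (0 : ℝ) 1, Tendsto (fun N : ℕ => resSource γ κ α β N ⌊(N : ℝ) * u⌋ *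
      G ((⌊(N : ℝ) * u⌋ : ℝ) / N)) atTop (𝓝 (κ * (G u * V₀ γ α β u))) := by
    intro u hu
    have h := ((((tendsto_tail_left hp.one_lt hu).const_mul α).add
      ((tendsto_tail_right hp.one_lt hu).const_mul β)).const_mul κ).mul
      ((hG.cont.tendsto u).comp (tendsto_floor_div u))
    have e1 : κ * (α * rMinus γ u + β * rPlus γ u) * G u = κ * (G u * V₀ γ α β u) := by
      rw [V₀]; ring
    rw [e1] at h
    refine h.congr fun N => ?_
    simp only [resSource, Function.comp]
    ring
  have hb := fun N x (hx : x ∈ bulk N) => abs_resSource_mul_le hp hα hα1 hβ hβ1 hG hx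
  have hm := memLp_of_tendsto_stepFun hlim hb
  have h1 := tendsto_stepL hm (Eventually.of_forall hb)
    ((ae_restrict_mem measurableSet_Ioo).mono hlim)
  have h2 := h1.inner (𝕜 := ℝ) (tendsto_stepL_sample (φ := fun _ => 1) continuousOn_const)
  rw [inner_toLp] at h2
  simp only [mul_one, integral_const_mul] at h2
  rw [integral_interval_eq]
  exact h2.congr fun N => (inner_resSource N _ _).symm

/-- The weak formulation satisfied by the limiting curve. -/
theorem Params.weak_identity (hp : Params γ κ e eN) (hα : 0 ≤ α) (hα1 : α ≤ 1) (hβ : 0 ≤ β)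
    (hβ1 : β ≤ 1) {g : ℝ → ℝ} (hg : MemLp g 2 unitMeas) {ρ : ℝ → ℝ → ℝ}
    (hρ : ∀ t ∈ Icc 0 T, ρ t =ᵐ[unitMeas] hp.sol α β (hg.toLp g) t) {t : ℝ} (ht : t ∈ Icc 0 T)
    {G : ℝ → ℝ → ℝ} (hG : IsTestFunction T G) :
    IntervalIntegrable (fun s => ∫ u in (0 : ℝ)..1, ρ s u * timeDeriv T G s u) volume 0 t ∧
    IntervalIntegrable (fun s => ∫ u in (0 : ℝ)..1, ρ s u * coreOp γ κ e (G s) u) volume 0 t ∧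
    (∫ u in (0 : ℝ)..1, ρ t u * G t u) - (∫ u in (0 : ℝ)..1, g u * G 0 u) =
      (∫ s in (0 : ℝ)..t, ∫ u in (0 : ℝ)..1, ρ s u * timeDeriv T G s u)
      - (∫ s in (0 : ℝ)..t, ∫ u in (0 : ℝ)..1, ρ s u * coreOp γ κ e (G s) u)
      + κ * ∫ s in (0 : ℝ)..t, ∫ u in (0 : ℝ)..1, G s u * V₀ γ α β u := by
  obtain ⟨r, C, hcore⟩ := hG.exists_isCore
  obtain ⟨D, hD⟩ := (isCompact_Icc.prod isCompact_Icc).exists_bound_of_continuousOn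
    (hG.continuousOn_timeDeriv.mono (prod_mono_right (subset_univ (Icc (0 : ℝ) 1))))
  have h0 : (0 : ℝ) ∈ Icc 0 T := ⟨le_rfl, ht.1.trans ht.2⟩
  have hD0 : 0 ≤ D := (norm_nonneg _).trans (hD (0, 0) ⟨h0, le_rfl, zero_le_one⟩)
  -- Only the sign of the constant is wanted; `N = 2`, `x = 1` is the smallest case with a bulk
  -- site.
  have hop0 : 0 ≤ opBound γ κ 1 r C := (abs_nonneg _).trans
    ((hcore 0 h0).abs_discOp_le hp.one_lt hp.lt_two hp.pos.le (e := 1) (by simp)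
      (N := 2) (x := 1) (by simp [bulk]))
  have hop1 : 0 ≤ opBound γ κ 0 r C := (abs_nonneg _).trans
    ((hcore 0 h0).abs_discOp_le hp.one_lt hp.lt_two hp.pos.le (e := 0) (by simp)
      (N := 2) (x := 1) (by simp [bulk]))
  obtain ⟨M, hM0, hM⟩ := hp.exists_bound_discSol α β (hg.toLp g)
  set X := hp.discSol α β (hg.toLp g) with hX
  let B : ∀ N : ℕ, HS →L[ℝ] HS := fun N => discGen γ κ (eN N) N
  let Y : ℕ → ℝ → HS := fun N s => stepL N fun x => G s ((x : ℝ) / N)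
  let Z : ℕ → ℝ → HS := fun N s => stepL N fun x => timeDeriv T G s ((x : ℝ) / N)
  let S : ℕ → HS := fun N => stepL N (resSource γ κ α β N)
  have hXc : ∀ N, Continuous (X N) := fun N => continuous_iff_continuousAt.2 fun s =>
    (hp.hasDerivAt_discSol α β _ N s).continuousAt
  have hYd : ∀ N, ∀ s ∈ Icc 0 T, HasDerivWithinAt (Y N) (Z N s) (Icc 0 T) s := fun N s hs =>
    hasDerivWithinAt_stepL fun x _ => (hG.differentiableOn _ s hs).hasDerivWithinAt
  have hYc : ∀ N, ContinuousOn (Y N) (Icc 0 T) := fun N s hs => (hYd N s hs).continuousWithinAt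
  have hZc : ∀ N, ContinuousOn (Z N) (Icc 0 T) := fun N => continuousOn_stepL fun x _ =>
    hG.continuousOn_timeDeriv.comp (continuousOn_id.prodMk continuousOn_const)
      fun s hs => ⟨hs, mem_univ _⟩
  have hBY : ∀ N s, B N (Y N s) = stepL N (discOp γ κ (eN N) N fun x => G s ((x : ℝ) / N)) :=
    fun N s => discGen_stepL N _
  have htd := fun s (hs : s ∈ Icc 0 T) => hG.continuous_timeDeriv hs
  have hlX := fun s (hs : s ∈ Icc 0 T) => hp.tendsto_discSol α β (hg.toLp g) hs.1
  have eint : ∀ s ∈ Icc 0 T, ∀ {φ : ℝ → ℝ} (hφ : MemLp φ 2 unitMeas),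
      ⟪hp.sol α β (hg.toLp g) s, hφ.toLp φ⟫ = ∫ u in (0 : ℝ)..1, ρ s u * φ u := by
    intro s hs φ hφ
    rw [integral_interval_eq, inner_toLp_right]
    refine integral_congr_ae ?_
    filter_upwards [hρ s hs] with u hu
    rw [hu]
  -- the three terms of the derivative
  have c1 : ∀ N, ContinuousOn (fun s => ⟪X N s, Z N s⟫) (Icc 0 T) := fun N =>
    (hXc N).continuousOn.inner (hZc N)
  have c2 : ∀ N, ContinuousOn (fun s => ⟪X N s, B N (Y N s)⟫) (Icc 0 T) := fun N =>
    (hXc N).continuousOn.inner ((B N).continuous.comp_continuousOn (hYc N))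
  have c3 : ∀ N, ContinuousOn (fun s => ⟪S N, Y N s⟫) (Icc 0 T) := fun N =>
    continuousOn_const.inner (hYc N)
  obtain ⟨i1, l1⟩ := tendsto_integral_of_bounded (C := M * D) ht c1 (fun N s hs => by
      refine (abs_real_inner_le_norm _ _).trans (mul_le_mul (hM N s hs.1) ?_ (norm_nonneg _) hM0)
      exact norm_stepL_le hD0 fun x hx =>
        hD (s, _) ⟨hs, Ioo_subset_Icc_self (div_mem_of_mem_bulk hx)⟩)
    (g := fun s => ∫ u in (0 : ℝ)..1, ρ s u * timeDeriv T G s u) fun s hs => by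
      rw [← eint s hs (memLp_of_continuousOn (htd s hs).continuousOn)]
      exact (hlX s hs).inner (𝕜 := ℝ) (tendsto_stepL_sample (htd s hs).continuousOn)
  obtain ⟨i2, l2⟩ := tendsto_integral_of_bounded (C := M * opBound γ κ 1 r C) ht c2
    (fun N s hs => by
      refine (abs_real_inner_le_norm _ _).trans (mul_le_mul (hM N s hs.1) ?_ (norm_nonneg _) hM0)
      rw [hBY]
      exact norm_stepL_le hop0 fun x hx =>
        (hcore s hs).abs_discOp_le hp.one_lt hp.lt_two hp.pos.le (hp.abs_le N) hx)
    (g := fun s => ∫ u in (0 : ℝ)..1, ρ s u * coreOp γ κ e (G s) u) fun s hs => by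
      rw [← eint s hs ((hcore s hs).memLp_coreOp hp.one_lt hp.lt_two hp.pos.le)]
      exact (hlX s hs).inner (𝕜 := ℝ) ((hcore s hs).tendsto_discGen hp.one_lt hp.lt_two hp.pos.le
        hp.tendsto hp.abs_le)
  obtain ⟨i3, l3⟩ := tendsto_integral_of_bounded (C := opBound γ κ 0 r C * 1) ht c3
    (fun N s hs => by
      simp only [S, Y]
      rw [inner_resSource]
      refine (abs_real_inner_le_norm _ _).trans (mul_le_mul ?_ ?_ (norm_nonneg _) hop1)
      · exact norm_stepL_le hop1 fun x hx => abs_resSource_mul_le hp hα hα1 hβ hβ1 (hcore s hs) hx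
      · exact norm_stepL_le zero_le_one fun x _ => by simp)
    (g := fun s => κ * ∫ u in (0 : ℝ)..1, G s u * V₀ γ α β u) fun s hs =>
      tendsto_inner_resSource hp hα hα1 hβ hβ1 (hcore s hs)
  refine ⟨i1, i2, ?_⟩
  have hsub : Icc 0 t ⊆ Icc 0 T := Icc_subset_Icc_right ht.2
  -- The weak identity at the discrete level: `X' = S - B X`, with `B` moved to the sampled test
  -- function by symmetry. Each term then converges by bounded convergence in `s`.
  have hFTC : ∀ N, ⟪X N t, Y N t⟫ - ⟪X N 0, Y N 0⟫ = (∫ s in (0 : ℝ)..t, ⟪X N s, Z N s⟫) -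
      (∫ s in (0 : ℝ)..t, ⟪X N s, B N (Y N s)⟫) + ∫ s in (0 : ℝ)..t, ⟪S N, Y N s⟫ := by
    intro N
    have j1 := ((c1 N).mono hsub).intervalIntegrable_of_Icc (μ := volume) ht.1
    have j2 := ((c2 N).mono hsub).intervalIntegrable_of_Icc (μ := volume) ht.1
    have j3 := ((c3 N).mono hsub).intervalIntegrable_of_Icc (μ := volume) ht.1
    rw [← intervalIntegral.integral_sub j1 j2, ← intervalIntegral.integral_add (j1.sub j2) j3]
    refine (intervalIntegral.integral_eq_sub_of_hasDerivAt_of_le ht.1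
      (f := fun s => ⟪X N s, Y N s⟫) ((hXc N).continuousOn.inner ((hYc N).mono hsub))
      (fun s hs => ?_) ((j1.sub j2).add j3)).symm
    have hs' : s ∈ Icc 0 T := hsub (Ioo_subset_Icc_self hs)
    have d1 := hp.hasDerivAt_discSol α β (hg.toLp g) N s
    have d2 : HasDerivAt (Y N) (Z N s) s := (hYd N s hs').hasDerivAt
      (Icc_mem_nhds hs.1 (hs.2.trans_le ht.2))
    have d3 := d1.inner ℝ d2
    have e1 : ⟪X N s, Z N s⟫ - ⟪X N s, B N (Y N s)⟫ + ⟪S N, Y N s⟫ =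
        ⟪hp.discSol α β (hg.toLp g) N s, Z N s⟫ + ⟪stepL N (resSource γ κ α β N) -
          discGen γ κ (eN N) N (hp.discSol α β (hg.toLp g) N s), Y N s⟫ := by
      rw [inner_sub_left, (hp.isSymmGe N).symm]
      simp only [S, B, hX]
      ring
    rw [e1]
    exact d3
  have hlim := (l1.sub l2).add l3
  have hl : ∀ s ∈ Icc 0 T, Tendsto (fun N => ⟪X N s, Y N s⟫) atTop
      (𝓝 (∫ u in (0 : ℝ)..1, ρ s u * G s u)) := by
    intro s hs
    have hc := (hcore s hs).cont.continuousOn (s := Icc 0 1)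
    rw [← eint s hs (memLp_of_continuousOn hc)]
    exact (hlX s hs).inner (𝕜 := ℝ) (tendsto_stepL_sample hc)
  have huniq := tendsto_nhds_unique (hlim.congr fun N => (hFTC N).symm)
    ((hl t ht).sub (hl 0 h0))
  rw [intervalIntegral.integral_const_mul] at huniq
  rw [huniq]
  congr 1
  rw [integral_interval_eq, integral_interval_eq]
  refine integral_congr_ae ?_
  have h3 := hρ 0 h0
  rw [hp.sol_zero] at h3
  filter_upwards [h3, hg.coeFn_toLp] with u h1 h2
  rw [h1, h2]

end WeakForm

/-! ### Finite energy of the limit density. -/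

section Energies

local notation "⟪" x "," y "⟫" => inner ℝ x y

variable {T γ κ e α β : ℝ} {eN : ℕ → ℝ}

theorem gagEnergy_sub_le {f g : ℝ → ℝ} (hf : Measurable f) (hg : Measurable g) :
    gagEnergy γ (fun u => f u - g u) ≤ 2 * gagEnergy γ f + 2 * gagEnergy γ g := by
  rw [gagEnergy_eq_prod (f := fun u => f u - g u) (hf.sub hg).aemeasurable, gagEnergy_eq_prod hf.aemeasurable,
    gagEnergy_eq_prod hg.aemeasurable, ← lintegral_const_mul _ (measurable_gagInt hf),
    ← lintegral_const_mul _ (measurable_gagInt hg),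
    ← lintegral_add_left ((measurable_gagInt hf).const_mul 2)]
  refine lintegral_mono fun q => ?_
  have h2 : (2 : ℝ≥0∞) = ENNReal.ofReal 2 := by simp
  rw [h2, ← ENNReal.ofReal_mul zero_le_two, ← ENNReal.ofReal_mul zero_le_two,
    ← ENNReal.ofReal_add (by positivity) (by positivity), ← mul_div_assoc, ← mul_div_assoc, ← add_div]
  refine ENNReal.ofReal_le_ofReal (div_le_div_of_nonneg_right ?_ (by positivity))
  nlinarith [sq_nonneg ((f q.1 - f q.2) + (g q.1 - g q.2))]

theorem gagEnergy_neg (f : ℝ → ℝ) : gagEnergy γ (fun u => -f u) = gagEnergy γ f := by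
  unfold gagEnergy
  refine lintegral_congr fun u => lintegral_congr fun v => ?_
  rw [neg_sub_neg, ← neg_sub, neg_sq]

theorem IsProfile.gagEnergy_lt_top (hγ2 : γ < 2) {r C : ℝ} {G : ℝ → ℝ} (hG : IsProfile r C G) :
    gagEnergy γ G < ⊤ := by
  rw [gagEnergy_eq_prod hG.cont.aemeasurable]
  refine lt_of_le_of_lt (lintegral_mono fun q => ?_) (integrable_gagl hγ2 hG hG).hasFiniteIntegral
  rw [← ofReal_norm]
  refine ENNReal.ofReal_le_ofReal (le_trans (le_of_eq ?_) (le_abs_self _))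
  change _ = (G q.1 - G q.2) * (G q.1 - G q.2) / |q.1 - q.2| ^ (1 + γ)
  rw [sq]

/-- The boundary energy of a profile. -/
def bdEnergy (γ α β : ℝ) (f : ℝ → ℝ) : ℝ≥0∞ :=
  ∫⁻ u in Ioo (0 : ℝ) 1, ENNReal.ofReal ((α - f u) ^ 2 / u ^ γ + (β - f u) ^ 2 / (1 - u) ^ γ)

/-- Within distance `1/4` of an end point the matching numerator vanishes, and elsewhere the
denominator is bounded below. -/
theorem exists_bdProfile_bound (hγ : 0 ≤ γ) (α β : ℝ) : ∃ C, 0 ≤ C ∧ ∀ u ∈ Ioo (0 : ℝ) 1,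
    (α - bdProfile α β u) ^ 2 / u ^ γ + (β - bdProfile α β u) ^ 2 / (1 - u) ^ γ ≤ C := by
  obtain ⟨D, hD⟩ := isCompact_Icc.exists_bound_of_continuousOn
    ((continuous_bdProfile α β).continuousOn (s := Icc (0 : ℝ) 1))
  have key : ∀ a h v : ℝ, |h| ≤ D → 0 < v → (v ≤ 1 / 4 → h = a) →
      (a - h) ^ 2 / v ^ γ ≤ (|a| + D) ^ 2 / (1 / 4) ^ γ := by
    intro a h v hh hv hz
    rcases le_total v (1 / 4) with h1 | h1
    · rw [hz h1]
      simp only [sub_self, ne_eq, OfNat.ofNat_ne_zero, not_false_eq_true, zero_pow, zero_div]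
      positivity
    · refine div_le_div₀ (sq_nonneg _) ?_ (by positivity)
        (Real.rpow_le_rpow (by norm_num) h1 hγ)
      rw [← sq_abs]
      exact pow_le_pow_left₀ (abs_nonneg _) ((abs_sub _ _).trans (by linarith)) 2
  refine ⟨(|α| + D) ^ 2 / (1 / 4) ^ γ + (|β| + D) ^ 2 / (1 / 4) ^ γ, by positivity,
    fun u hu => add_le_add ?_ ?_⟩
  · exact key _ _ _ (hD u (Ioo_subset_Icc_self hu)) hu.1 (bdProfile_left α β)
  · exact key _ _ _ (hD u (Ioo_subset_Icc_self hu)) (by linarith [hu.2])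
      fun h => bdProfile_right α β (by linarith)

theorem exists_bdEnergy_le (hγ : 0 ≤ γ) (α β : ℝ) : ∃ C : ℝ≥0∞, C ≠ ⊤ ∧ ∀ f : ℝ → ℝ,
    bdEnergy γ α β f ≤ C + 2 * potEnergy γ (fun u => f u - bdProfile α β u) := by
  obtain ⟨C, hC0, hC⟩ := exists_bdProfile_bound hγ α β
  refine ⟨ENNReal.ofReal (2 * C), ENNReal.ofReal_ne_top, fun f => ?_⟩
  have e1 : ENNReal.ofReal (2 * C) = ∫⁻ _ in Ioo (0 : ℝ) 1, ENNReal.ofReal (2 * C) := by simp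
  rw [e1, potEnergy, ← lintegral_const_mul' _ _ (by simp), ← lintegral_add_left measurable_const]
  refine setLIntegral_mono' measurableSet_Ioo fun u hu => ?_
  have h2 : (2 : ℝ≥0∞) = ENNReal.ofReal 2 := by simp
  have hu0 := hu.1
  have hu1 : 0 < 1 - u := by linarith [hu.2]
  rw [h2, ← ENNReal.ofReal_mul zero_le_two, ← ENNReal.ofReal_add (by positivity) (by positivity),
    Real.rpow_neg hu0.le, Real.rpow_neg hu1.le]
  refine ENNReal.ofReal_le_ofReal ?_
  have := hC u hu
  rw [div_eq_mul_inv, div_eq_mul_inv] at this ⊢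
  have p1 : 0 < (u ^ γ)⁻¹ := by positivity
  have p2 : 0 < ((1 - u) ^ γ)⁻¹ := by positivity
  have q1 : (α - f u) ^ 2 ≤ 2 * (α - bdProfile α β u) ^ 2 + 2 * (f u - bdProfile α β u) ^ 2 := by
    nlinarith [sq_nonneg ((α - bdProfile α β u) + (f u - bdProfile α β u))]
  have q2 : (β - f u) ^ 2 ≤ 2 * (β - bdProfile α β u) ^ 2 + 2 * (f u - bdProfile α β u) ^ 2 := by
    nlinarith [sq_nonneg ((β - bdProfile α β u) + (f u - bdProfile α β u))]
  nlinarith [mul_le_mul_of_nonneg_right q1 p1.le, mul_le_mul_of_nonneg_right q2 p2.le]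

theorem sub_bdProfile_ae {f : ℝ → ℝ} {x : HS} (h : f =ᵐ[unitMeas] x) (α β : ℝ) :
    (fun u => f u - bdProfile α β u) =ᵐ[unitMeas] (x - (memLp_bdProfile α β).toLp _ : HS) := by
  filter_upwards [h, Lp.coeFn_sub x ((memLp_bdProfile α β).toLp _),
    (memLp_bdProfile α β).coeFn_toLp] with u h1 h2 h3
  rw [h2, Pi.sub_apply, h1, h3]

theorem lintegral_lt_top_of_le {E F : ℝ → ℝ≥0∞} {C K : ℝ≥0∞} (hC : C ≠ ⊤) (hK : K ≠ ⊤)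
    (hE : ∫⁻ t in Icc 0 T, E t < ⊤) (h : ∀ t ∈ Icc 0 T, F t ≤ C + K * E t) :
    ∫⁻ t in Icc 0 T, F t < ⊤ := by
  refine (setLIntegral_mono' measurableSet_Icc h).trans_lt ?_
  rw [lintegral_add_left measurable_const, lintegral_const_mul' _ _ hK]
  refine ENNReal.add_lt_top.2 ⟨?_, ENNReal.mul_lt_top hK.lt_top hE⟩
  simpa using ENNReal.mul_lt_top hC.lt_top ENNReal.ofReal_lt_top

theorem Params.boundaryEnergyFinite (hp : Params γ κ e eN) (hT : 0 ≤ T) {g : HS} {ρ : ℝ → ℝ → ℝ}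
    (hρ : ∀ t ∈ Icc 0 T, ρ t =ᵐ[unitMeas] hp.sol α β g t) : BoundaryEnergyFinite γ α β T ρ := by
  obtain ⟨C, hC, h⟩ := exists_bdEnergy_le (γ := γ) (by linarith [hp.one_lt]) α β
  refine lintegral_lt_top_of_le hC (by simp) (hp.lintegral_energy_lt_top α β g hT)
    (K := 2) fun t ht => (h (ρ t)).trans ?_
  rw [potEnergy_congr (sub_bdProfile_ae (hρ t ht) α β), energy]
  gcongr
  exact le_self_add

theorem Params.lintegral_sobolev_lt_top (hp : Params γ κ 1 eN) (hT : 0 ≤ T) {g : HS}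
    {ρ : ℝ → ℝ → ℝ} (hd : IsDensity T ρ)
    (hρ : ∀ t ∈ Icc 0 T, ρ t =ᵐ[unitMeas] hp.sol α β g t) :
    ∫⁻ t in Icc 0 T, sobolevNormSq γ (ρ t) < ⊤ := by
  obtain ⟨Cb, hb⟩ := exists_isProfile_bdProfile α β
  have hbt := hb.gagEnergy_lt_top hp.lt_two
  refine lintegral_lt_top_of_le
    (C := 1 + ENNReal.ofReal (cGamma γ / 2) * (2 * gagEnergy γ (bdProfile α β)))
    (K := ENNReal.ofReal (cGamma γ / 2) * 2) ?_ ?_ (hp.lintegral_energy_lt_top α β g hT)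
    fun t ht => ?_
  · exact ENNReal.add_ne_top.2 ⟨ENNReal.one_ne_top, ENNReal.mul_ne_top ENNReal.ofReal_ne_top
      (ENNReal.mul_ne_top (by simp) hbt.ne)⟩
  · exact ENNReal.mul_ne_top ENNReal.ofReal_ne_top (by simp)
  have hm : Measurable (ρ t) := hd.measurable.of_uncurry_left
  have hbm := (continuous_bdProfile α β).measurable
  have h1 : ∫⁻ u in Ioo (0 : ℝ) 1, ENNReal.ofReal (ρ t u ^ 2) ≤ 1 := by
    calc _ ≤ ∫⁻ _ in Ioo (0 : ℝ) 1, (1 : ℝ≥0∞) := by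
          refine setLIntegral_mono' measurableSet_Ioo fun u hu => ?_
          obtain ⟨a, b⟩ := hd.mem_Icc t ht u (Ioo_subset_Icc_self hu)
          exact ENNReal.ofReal_le_one.2 (pow_le_one₀ a b)
      _ = 1 := by simp
  have h2 : gagEnergy γ (ρ t) ≤ 2 * gagEnergy γ (bdProfile α β) +
      2 * energy γ 1 (hp.sol α β g t - (memLp_bdProfile α β).toLp _ : HS) := by
    -- The density is written as its deviation from the profile minus the opposite of the profile.
    have h3 := gagEnergy_sub_le (γ := γ) (hm.sub hbm) hbm.neg
    simp only [Pi.neg_apply, Pi.sub_apply, sub_neg_eq_add, sub_add_cancel] at h3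
    have e1 : gagEnergy γ (-bdProfile α β) = gagEnergy γ (bdProfile α β) := gagEnergy_neg _
    have e2 : gagEnergy γ (ρ t - bdProfile α β) = _ :=
      gagEnergy_congr (sub_bdProfile_ae (hρ t ht) α β)
    rw [e1, e2, add_comm] at h3
    refine h3.trans (add_le_add le_rfl ?_)
    gcongr
    rw [energy, ENNReal.ofReal_one, one_mul]
    exact le_add_self
  calc sobolevNormSq γ (ρ t) ≤ 1 + ENNReal.ofReal (cGamma γ / 2) * (2 * gagEnergy γ (bdProfile α β) +
      2 * energy γ 1 (hp.sol α β g t - (memLp_bdProfile α β).toLp _ : HS)) :=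
        add_le_add h1 (by gcongr; exact h2)
    _ = _ := by rw [mul_add, ← add_assoc, mul_assoc _ 2]

end Energies

/-! ### Uniqueness of weak solutions. -/

section Uniqueness

local notation "⟪" x "," y "⟫" => inner ℝ x y

variable {T γ κ e α β : ℝ} {eN : ℕ → ℝ} {g : ℝ → ℝ}

theorem isTestFunction_core (T : ℝ) (G : coreSub) : IsTestFunction T fun _ => (G : ℝ → ℝ) := by
  obtain ⟨hG, r, hr, hG0⟩ := G.2
  have htd : timeDeriv T (fun _ => (G : ℝ → ℝ)) = fun _ _ => 0 := by
    ext t u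
    simp [timeDeriv]
  refine ⟨fun _ _ => hG, fun n => ?_, fun u => differentiableOn_const _, ?_, Icc (2 * r) (1 - 2 * r),
    isCompact_Icc, fun u hu => ⟨by linarith [hu.1], by linarith [hu.2]⟩, fun _ _ u hu => hG0 u hu⟩
  · exact ((hG.continuous_iteratedDeriv n (by exact_mod_cast le_top)).comp continuous_snd).continuousOn
  · rw [htd]
    exact continuousOn_const

/-- The weak formulation with time-independent test functions. -/
structure IsCoreSolution (γ α β κ e T : ℝ) (g : ℝ → ℝ) (ρ : ℝ → ℝ → ℝ) : Prop where
  isDensity : IsDensity T ρ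
  boundary : BoundaryEnergyFinite γ α β T ρ
  gag : ∫⁻ t in Icc 0 T, ENNReal.ofReal e * gagEnergy γ (ρ t) < ⊤
  weak : ∀ t ∈ Icc 0 T, ∀ G : coreSub,
    (∫ u, ρ t u * (G : ℝ → ℝ) u ∂unitMeas) = (∫ u in (0 : ℝ)..1, g u * (G : ℝ → ℝ) u)
      - (∫ s in (0 : ℝ)..t, ∫ u, ρ s u * coreOp γ κ e G u ∂unitMeas)
      + κ * ∫ _ in (0 : ℝ)..t, ∫ u in (0 : ℝ)..1, (G : ℝ → ℝ) u * V₀ γ α β u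

theorem IsWeakSolutionDir.isCoreSolution (hγ : 1 < γ) {ρ : ℝ → ℝ → ℝ}
    (h : IsWeakSolutionDir γ α β κ T g ρ) : IsCoreSolution γ α β κ 1 T g ρ := by
  refine ⟨h.isDensity, h.boundary, ?_, fun t ht G => ?_⟩
  · have hc := cGamma_pos hγ
    refine lintegral_lt_top_of_le (C := 0) (K := (ENNReal.ofReal (cGamma γ / 2))⁻¹) (by simp)
      (by simpa using hc) h.sobolev fun t _ => ?_
    rw [zero_add, ENNReal.ofReal_one, one_mul, sobolevNormSq, mul_add, ← mul_assoc,
      ENNReal.inv_mul_cancel (by simpa using hc) ENNReal.ofReal_ne_top, one_mul]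
    exact le_add_self
  · have hw := h.weak t ht _ (isTestFunction_core T G)
    have e1 : ∀ s u, ρ s u * (timeDeriv T (fun _ => (G : ℝ → ℝ)) s u +
        (regionalLaplacian γ G u - κ * V₁ γ u * (G : ℝ → ℝ) u)) = -(ρ s u * coreOp γ κ 1 G u) := by
      intro s u
      simp only [timeDeriv, derivWithin_fun_const, coreOp, Pi.zero_apply]
      ring
    simp only [e1, intervalIntegral.integral_neg, integral_interval_eq] at hw ⊢
    linarith

theorem IsWeakSolutionReac.isCoreSolution {ρ : ℝ → ℝ → ℝ}
    (h : IsWeakSolutionReac γ α β κ T g ρ) : IsCoreSolution γ α β κ 0 T g ρ := by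
  refine ⟨h.isDensity, h.boundary, by simp, fun t ht G => ?_⟩
  have hw := h.weak t ht _ (isTestFunction_core T G)
  have e1 : ∀ s u, ρ s u * coreOp γ κ 0 G u = κ * (ρ s u * (G : ℝ → ℝ) u * V₁ γ u) := by
    intro s u
    simp only [coreOp]
    ring
  have e2 : ∀ s u, ρ s u * timeDeriv T (fun _ => (G : ℝ → ℝ)) s u = 0 := by
    intro s u
    simp [timeDeriv]
  simp only [e2, intervalIntegral.integral_zero, integral_interval_eq] at hw ⊢
  simp only [e1, integral_const_mul, intervalIntegral.integral_const_mul]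
  linarith

theorem IsDensity.memLp {ρ : ℝ → ℝ → ℝ} (h : IsDensity T ρ) {t : ℝ} (ht : t ∈ Icc 0 T) :
    MemLp (ρ t) 2 unitMeas :=
  memLp_profile h.measurable.of_uncurry_left (h.mem_Icc t ht)

theorem IsDensity.intervalIntegrable {ρ : ℝ → ℝ → ℝ} (h : IsDensity T ρ) {t : ℝ} (ht : t ∈ Icc 0 T)
    {φ : ℝ → ℝ} (hφ : MemLp φ 2 unitMeas) :
    IntervalIntegrable (fun s => ∫ u, ρ s u * φ u ∂unitMeas) volume 0 t := by
  rw [intervalIntegrable_iff_integrableOn_Ioc_of_le ht.1]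
  refine Integrable.of_bound ?_ (∫ u, |φ u| ∂unitMeas) ?_
  · have h1 : AEStronglyMeasurable (fun q : ℝ × ℝ => ρ q.1 q.2 * φ q.2)
        ((volume.restrict (Ioc 0 t)).prod unitMeas) :=
      h.measurable.aestronglyMeasurable.mul hφ.1.comp_snd
    exact h1.integral_prod_right'
  · filter_upwards [ae_restrict_mem measurableSet_Ioc] with s hs
    refine norm_integral_le_of_norm_le (hφ.integrable one_le_two).abs ?_
    filter_upwards [ae_restrict_mem measurableSet_Ioo] with u hu
    obtain ⟨a, b⟩ := h.mem_Icc s ⟨hs.1.le, hs.2.trans ht.2⟩ u (Ioo_subset_Icc_self hu)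
    rw [norm_mul, Real.norm_eq_abs, Real.norm_eq_abs, abs_of_nonneg a]
    exact mul_le_of_le_one_left (abs_nonneg _) b

theorem potEnergy_sub_le {f k : ℝ → ℝ} (hf : Measurable f) :
    potEnergy γ (fun u => f u - k u) ≤ 2 * bdEnergy γ α β f + 2 * bdEnergy γ α β k := by
  have hm : Measurable fun u => ENNReal.ofReal ((α - f u) ^ 2 / u ^ γ + (β - f u) ^ 2 / (1 - u) ^ γ) := by
    fun_prop
  unfold potEnergy bdEnergy
  rw [← lintegral_const_mul' _ _ (by simp), ← lintegral_const_mul' _ _ (by simp),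
    ← lintegral_add_left (hm.const_mul 2)]
  refine setLIntegral_mono' measurableSet_Ioo fun u hu => ?_
  have h2 : (2 : ℝ≥0∞) = ENNReal.ofReal 2 := by simp
  have hu0 := hu.1
  have hu1 : 0 < 1 - u := by linarith [hu.2]
  rw [h2, ← ENNReal.ofReal_mul zero_le_two, ← ENNReal.ofReal_mul zero_le_two,
    ← ENNReal.ofReal_add (by positivity) (by positivity), Real.rpow_neg hu0.le, Real.rpow_neg hu1.le]
  refine ENNReal.ofReal_le_ofReal ?_
  simp only [div_eq_mul_inv]
  have p1 : 0 < (u ^ γ)⁻¹ := by positivity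
  have p2 : 0 < ((1 - u) ^ γ)⁻¹ := by positivity
  have q : ∀ a : ℝ, (f u - k u) ^ 2 ≤ 2 * (a - f u) ^ 2 + 2 * (a - k u) ^ 2 := fun a => by
    nlinarith [sq_nonneg ((a - f u) + (a - k u))]
  nlinarith [mul_le_mul_of_nonneg_right (q α) p1.le, mul_le_mul_of_nonneg_right (q β) p2.le]

theorem measurable_gagEnergy {ρ : ℝ → ℝ → ℝ} (h : Measurable (Function.uncurry ρ)) :
    Measurable fun t => gagEnergy γ (ρ t) := by
  have h1 : Measurable fun q : ℝ × ℝ × ℝ => ENNReal.ofReal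
      ((ρ q.1 q.2.1 - ρ q.1 q.2.2) ^ 2 / |q.2.1 - q.2.2| ^ (1 + γ)) := by
    have a1 : Measurable fun q : ℝ × ℝ × ℝ => ρ q.1 q.2.1 :=
      h.comp (measurable_fst.prodMk measurable_snd.fst)
    have a2 : Measurable fun q : ℝ × ℝ × ℝ => ρ q.1 q.2.2 :=
      h.comp (measurable_fst.prodMk measurable_snd.snd)
    fun_prop
  have h2 : (fun t => gagEnergy γ (ρ t)) = fun t => ∫⁻ p, ENNReal.ofReal
      ((ρ t p.1 - ρ t p.2) ^ 2 / |p.1 - p.2| ^ (1 + γ)) ∂(unitMeas.prod unitMeas) := by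
    ext t
    exact gagEnergy_eq_prod (h.of_uncurry_left (x := t)).aemeasurable
  rw [h2]
  exact h1.lintegral_prod_right'

theorem measurable_bdEnergy {ρ : ℝ → ℝ → ℝ} (h : Measurable (Function.uncurry ρ)) :
    Measurable fun t => bdEnergy γ α β (ρ t) := by
  have h1 : Measurable fun q : ℝ × ℝ => ENNReal.ofReal
      ((α - ρ q.1 q.2) ^ 2 / q.2 ^ γ + (β - ρ q.1 q.2) ^ 2 / (1 - q.2) ^ γ) := by
    have a1 : Measurable fun q : ℝ × ℝ => ρ q.1 q.2 := h
    fun_prop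
  exact h1.lintegral_prod_right'

theorem measurable_energy {ρ : ℝ → ℝ → ℝ} (h : Measurable (Function.uncurry ρ)) :
    Measurable fun t => energy γ e (ρ t) := by
  have h1 : Measurable fun q : ℝ × ℝ => ENNReal.ofReal
      ((q.2 ^ (-γ) + (1 - q.2) ^ (-γ)) * ρ q.1 q.2 ^ 2) := by
    have a1 : Measurable fun q : ℝ × ℝ => ρ q.1 q.2 := h
    fun_prop
  have h2 : Measurable fun t => potEnergy γ (ρ t) := h1.lintegral_prod_right'
  exact h2.add ((measurable_gagEnergy h).const_mul _)

theorem IsCoreSolution.lintegral_energy_sub_lt_top {ρ ρ' : ℝ → ℝ → ℝ}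
    (h : IsCoreSolution γ α β κ e T g ρ) (h' : IsCoreSolution γ α β κ e T g ρ') :
    ∫⁻ t in Icc 0 T, energy γ e (fun u => ρ t u - ρ' t u) < ⊤ := by
  have key : ∀ {σ : ℝ → ℝ → ℝ}, IsCoreSolution γ α β κ e T g σ →
      ∫⁻ t in Icc 0 T, (bdEnergy γ α β (σ t) + ENNReal.ofReal e * gagEnergy γ (σ t)) < ⊤ := by
    intro σ hσ
    rw [lintegral_add_left (measurable_bdEnergy hσ.isDensity.measurable)]
    exact ENNReal.add_lt_top.2 ⟨hσ.boundary, hσ.gag⟩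
  have hm : Measurable fun t => bdEnergy γ α β (ρ t) + ENNReal.ofReal e * gagEnergy γ (ρ t) :=
    (measurable_bdEnergy h.isDensity.measurable).add
      ((measurable_gagEnergy h.isDensity.measurable).const_mul _)
  have hs : ∫⁻ t in Icc 0 T, ((bdEnergy γ α β (ρ t) + ENNReal.ofReal e * gagEnergy γ (ρ t)) +
      (bdEnergy γ α β (ρ' t) + ENNReal.ofReal e * gagEnergy γ (ρ' t))) < ⊤ := by
    rw [lintegral_add_left hm]
    exact ENNReal.add_lt_top.2 ⟨key h, key h'⟩
  refine lintegral_lt_top_of_le (C := 0) (K := 2) (by simp) (by simp) hs fun t _ => ?_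
  have m1 : Measurable (ρ t) := h.isDensity.measurable.of_uncurry_left
  have m2 : Measurable (ρ' t) := h'.isDensity.measurable.of_uncurry_left
  calc energy γ e (fun u => ρ t u - ρ' t u)
      ≤ (2 * bdEnergy γ α β (ρ t) + 2 * bdEnergy γ α β (ρ' t)) +
        ENNReal.ofReal e * (2 * gagEnergy γ (ρ t) + 2 * gagEnergy γ (ρ' t)) :=
        add_le_add (potEnergy_sub_le m1) (by gcongr; exact gagEnergy_sub_le m1 m2)
    _ = _ := by ring

theorem exists_formInvOf_eq {V H : Type*} [NormedAddCommGroup V] [InnerProductSpace ℝ V]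
    [CompleteSpace V] [NormedAddCommGroup H] [InnerProductSpace ℝ H] [CompleteSpace H]
    (J : V →L[ℝ] H) (φ : H) : ∃ ξ : V, J ξ = formInvOf J φ ∧ ∀ v, ⟪v, ξ⟫ = ⟪J v, φ⟫ :=
  ⟨ContinuousLinearMap.adjoint J φ, rfl, fun _ => ContinuousLinearMap.adjoint_inner_right _ _ _⟩

/-- Uniqueness of weak solutions. -/
theorem IsCoreSolution.ae_eq (hγ : 1 < γ) (hγ2 : γ < 2) (hκ : 0 < κ) (he : 0 ≤ e)
    {ρ ρ' : ℝ → ℝ → ℝ} (h : IsCoreSolution γ α β κ e T g ρ) (h' : IsCoreSolution γ α β κ e T g ρ') :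
    ∀ t ∈ Icc 0 T, ρ t =ᵐ[unitMeas] ρ' t := by
  classical
  let w : ℝ → HS := fun s => if hs : s ∈ Icc 0 T then
    (h.isDensity.memLp hs).toLp _ - (h'.isDensity.memLp hs).toLp _ else 0
  have hw : ∀ s (hs : s ∈ Icc 0 T), w s =
      (h.isDensity.memLp hs).toLp _ - (h'.isDensity.memLp hs).toLp _ := fun s hs => dif_pos hs
  have hwae : ∀ s ∈ Icc 0 T, w s =ᵐ[unitMeas] fun u => ρ s u - ρ' s u := by
    intro s hs
    rw [hw s hs]
    filter_upwards [Lp.coeFn_sub ((h.isDensity.memLp hs).toLp _) ((h'.isDensity.memLp hs).toLp _),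
      (h.isDensity.memLp hs).coeFn_toLp, (h'.isDensity.memLp hs).coeFn_toLp] with u h1 h2 h3
    rw [h1, Pi.sub_apply, h2, h3]
  have hin : ∀ s ∈ Icc 0 T, ∀ {φ : ℝ → ℝ} (hφ : MemLp φ 2 unitMeas), ⟪w s, hφ.toLp φ⟫ =
      (∫ u, ρ s u * φ u ∂unitMeas) - ∫ u, ρ' s u * φ u ∂unitMeas := by
    intro s hs φ hφ
    rw [hw s hs, inner_sub_left, inner_toLp, inner_toLp]
  have hInt : ∀ t ∈ Icc 0 T, ∀ φ : HS, IntervalIntegrable (fun s => ⟪w s, φ⟫) volume 0 t := by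
    intro t ht φ
    refine ((h.isDensity.intervalIntegrable ht (Lp.memLp φ)).sub
      (h'.isDensity.intervalIntegrable ht (Lp.memLp φ))).congr fun s hs => ?_
    rw [uIoc_of_le ht.1] at hs
    have := hin s ⟨hs.1.le, hs.2.trans ht.2⟩ (Lp.memLp φ)
    rw [Lp.toLp_coeFn] at this
    exact this.symm
  -- In the difference of the two weak formulations the initial datum and the source cancel.
  have hcore : ∀ t ∈ Icc 0 T, ∀ G : coreSub, ⟪w t, (memLp_core G).toLp _⟫ =
      -∫ s in (0 : ℝ)..t, ⟪w s, (memLp_coreOp_core (e := e) hγ hγ2 hκ.le G).toLp _⟫ := by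
    intro t ht G
    have hm := memLp_coreOp_core (e := e) hγ hγ2 hκ.le G
    have e1 : ∫ s in (0 : ℝ)..t, ⟪w s, hm.toLp _⟫ = ∫ s in (0 : ℝ)..t,
        ((∫ u, ρ s u * coreOp γ κ e G u ∂unitMeas) - ∫ u, ρ' s u * coreOp γ κ e G u ∂unitMeas) := by
      refine intervalIntegral.integral_congr fun s hs => ?_
      rw [uIcc_of_le ht.1] at hs
      exact hin s ⟨hs.1, hs.2.trans ht.2⟩ hm
    rw [e1, intervalIntegral.integral_sub (h.isDensity.intervalIntegrable ht hm)
      (h'.isDensity.intervalIntegrable ht hm), hin t ht, h.weak t ht, h'.weak t ht]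
    ring
  have heq : ∀ s ∈ Icc 0 T, energy γ e (w s) = energy γ e fun u => ρ s u - ρ' s u := by
    intro s hs
    rw [energy, energy, potEnergy_congr (hwae s hs), gagEnergy_congr (hwae s hs)]
  have hE : ∫⁻ s in Icc 0 T, energy γ e (w s) < ⊤ :=
    lt_of_eq_of_lt (setLIntegral_congr_fun measurableSet_Icc heq) (h.lintegral_energy_sub_lt_top h')
  have hfin : ∀ᵐ s ∂(volume.restrict (Icc 0 T)), energy γ e (w s) < ⊤ := by
    filter_upwards [ae_lt_top (measurable_energy (ρ := fun s u => ρ s u - ρ' s u) (h.isDensity.measurable.sub h'.isDensity.measurable))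
      (h.lintegral_energy_sub_lt_top h').ne, ae_restrict_mem measurableSet_Icc] with s h1 h2
    rw [heq s h2]
    exact h1
  set K := formConst γ κ e with hK
  have hK0 : 0 ≤ K := formConst_nonneg hγ hκ.le he
  set M := ∫⁻ s in Icc 0 T, (1 + ENNReal.ofReal K * energy γ e (w s)) with hM
  have hMtop : M < ⊤ := lintegral_lt_top_of_le ENNReal.one_ne_top ENNReal.ofReal_ne_top hE
    fun _ _ => le_rfl
  -- It remains to replace core functions `G` by `R φ` with `R = J J*`, for which the operator
  -- applied to the test function is simply `φ`.
  have hz := eq_zero_of_inner_eq_neg_integral (R := formInv hγ hγ2 hκ.le he)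
    (isSymmGe_formInv hγ hγ2 he hκ.le).symm (formInv_injective hγ hγ2 hκ he) (T := T) (w := w)
    (fun s hs => Lp.norm_le_of_ae_bound zero_le_one (by
      filter_upwards [hwae s hs, ae_restrict_mem measurableSet_Ioo] with u h1 hu
      obtain ⟨a, b⟩ := h.isDensity.mem_Icc s hs u (Ioo_subset_Icc_self hu)
      obtain ⟨c, d⟩ := h'.isDensity.mem_Icc s hs u (Ioo_subset_Icc_self hu)
      rw [h1, Real.norm_eq_abs, abs_le]
      constructor <;> linarith)) fun t ht φ => ?_
  · intro t ht
    have h1 := hwae t ht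
    rw [hz t ht] at h1
    filter_upwards [h1, Lp.coeFn_zero ℝ 2 unitMeas] with u h1 h2
    rw [h2] at h1
    exact (sub_eq_zero.1 h1.symm)
  let J := formEmb hγ hγ2 hκ.le he
  obtain ⟨ξ, hξ, hξv⟩ := exists_formInvOf_eq (V := FormDom hγ hγ2 hκ.le he) J φ
  -- Core functions converge to `J* φ` in form norm only. The limit under the time integral is
  -- therefore taken through `⟪v, x n - ξ⟫`, where `v` represents `w s` in the form domain. This is
  -- where finite energy for almost every time is used.
  obtain ⟨x, hx, hlim⟩ := mem_closure_iff_seq_limit.1 (denseRange_coreEmb hγ hγ2 hκ he ξ)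
  choose G hG using hx
  have l1 : Tendsto (fun n => ⟪w t, J (x n)⟫) atTop (𝓝 ⟪w t, formInv hγ hγ2 hκ.le he φ⟫) :=
    tendsto_const_nhds.inner (𝕜 := ℝ) (hξ ▸ (J.continuous.tendsto ξ).comp hlim)
  let ψ : ℕ → HS := fun n => (memLp_coreOp_core (e := e) hγ hγ2 hκ.le (G n)).toLp _
  have l2 : Tendsto (fun n => ∫ s in (0 : ℝ)..t, ⟪w s, ψ n⟫) atTop
      (𝓝 (∫ s in (0 : ℝ)..t, ⟪w s, φ⟫)) := by
    rw [tendsto_iff_norm_sub_tendsto_zero]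
    have hd : Tendsto (fun n => ‖x n - ξ‖ * M.toReal) atTop (𝓝 0) := by
      have := (tendsto_iff_norm_sub_tendsto_zero.1 hlim).mul_const M.toReal
      rwa [zero_mul] at this
    refine squeeze_zero (fun n => norm_nonneg _) (fun n => ?_) hd
    rw [← intervalIntegral.integral_sub (hInt t ht _) (hInt t ht _),
      intervalIntegral.integral_of_le ht.1]
    have hle : ‖∫ s in Ioc 0 t, (⟪w s, ψ n⟫ - ⟪w s, φ⟫)‖ₑ ≤ ENNReal.ofReal ‖x n - ξ‖ * M := by
      rw [hM, ← lintegral_const_mul' _ _ ENNReal.ofReal_ne_top]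
      refine (enorm_integral_le_lintegral_enorm _).trans ((lintegral_mono_set (t := Icc 0 T)
        fun s hs => ⟨hs.1.le, hs.2.trans ht.2⟩).trans (lintegral_mono_ae ?_))
      filter_upwards [hfin] with s hs
      obtain ⟨v, hv, hvn⟩ := exists_formEmb_eq hγ hγ2 hκ he (w s) hs
      have e1 : ⟪w s, ψ n⟫ - ⟪w s, φ⟫ = ⟪v, x n - ξ⟫ := by
        rw [inner_sub_right, ← hG n, inner_coreEmb hγ hγ2 hκ, hv, hξv]
        change _ = _ - ⟪formEmb hγ hγ2 hκ.le he v, φ⟫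
        rw [hv]
      have e2 : (1 : ℝ≥0∞) + ENNReal.ofReal K * energy γ e (w s) =
          ENNReal.ofReal (1 + K * (energy γ e (w s)).toReal) := by
        rw [ENNReal.ofReal_add zero_le_one (by positivity), ENNReal.ofReal_one,
          ENNReal.ofReal_mul hK0, ENNReal.ofReal_toReal hs.ne]
      rw [e1, e2, ← ofReal_norm, ← ENNReal.ofReal_mul (norm_nonneg _)]
      refine ENNReal.ofReal_le_ofReal ((abs_real_inner_le_norm _ _).trans ?_)
      rw [mul_comm]
      refine mul_le_mul_of_nonneg_left ?_ (norm_nonneg _)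
      have h3 : ‖v‖ ^ 2 ≤ K * (energy γ e (w s)).toReal := hvn
      -- `‖v‖ ≤ 1 + ‖v‖²` replaces the norm by the energy, whose time integral is finite; no
      -- measurable choice of `v` in `s` is required.
      nlinarith [sq_nonneg (‖v‖ - 1 / 2)]
    have h4 := ENNReal.toReal_mono (ENNReal.mul_ne_top ENNReal.ofReal_ne_top hMtop.ne) hle
    rwa [toReal_enorm, ENNReal.toReal_mul, ENNReal.toReal_ofReal (norm_nonneg _)] at h4
  refine tendsto_nhds_unique l1 (l2.neg.congr fun n => ?_)
  rw [← hcore t ht (G n), ← hG n]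
  exact congrArg _ (formEmb_coreEmb hγ hγ2 hκ he (G n)).symm

end Uniqueness

/-! ### Existence and conclusion. -/

section Existence

variable {T γ κ e α β θ : ℝ} {eN : ℕ → ℝ} {g : ℝ → ℝ} {μ : ∀ N : ℕ, Measure (Config N)}

theorem Params.isWeakSolutionDir (hp : Params γ κ 1 eN) (hT : 0 ≤ T) (hα : 0 ≤ α) (hα1 : α ≤ 1)
    (hβ : 0 ≤ β) (hβ1 : β ≤ 1) (hg : MemLp g 2 unitMeas) {ρ : ℝ → ℝ → ℝ} (hd : IsDensity T ρ)
    (hρ : ∀ t ∈ Icc 0 T, ρ t =ᵐ[unitMeas] hp.sol α β (hg.toLp g) t) :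
    IsWeakSolutionDir γ α β κ T g ρ := by
  refine ⟨hd, hp.lintegral_sobolev_lt_top hT hd hρ, hp.boundaryEnergyFinite hT hρ,
    fun t ht G hG => ?_⟩
  obtain ⟨i1, i2, h⟩ := hp.weak_identity hα hα1 hβ hβ1 hg hρ ht hG
  obtain ⟨r, C, hcore⟩ := hG.exists_isCore
  have e1 : ∫ s in (0 : ℝ)..t, ∫ u in (0 : ℝ)..1, ρ s u * (timeDeriv T G s u +
        (regionalLaplacian γ (G s) u - κ * V₁ γ u * G s u)) =
      ∫ s in (0 : ℝ)..t, ((∫ u in (0 : ℝ)..1, ρ s u * timeDeriv T G s u) -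
        ∫ u in (0 : ℝ)..1, ρ s u * coreOp γ κ 1 (G s) u) := by
    refine intervalIntegral.integral_congr fun s hs => ?_
    rw [uIcc_of_le ht.1] at hs
    have hs' : s ∈ Icc 0 T := ⟨hs.1, hs.2.trans ht.2⟩
    simp only [integral_interval_eq]
    have j1 : Integrable (fun u => ρ s u * timeDeriv T G s u) unitMeas := (hd.memLp hs').integrable_mul
      (memLp_of_continuousOn (hG.continuous_timeDeriv hs').continuousOn)
    have j2 : Integrable (fun u => ρ s u * coreOp γ κ 1 (G s) u) unitMeas :=
      (hd.memLp hs').integrable_mul ((hcore s hs').memLp_coreOp hp.one_lt hp.lt_two hp.pos.le)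
    rw [← integral_sub j1 j2]
    refine integral_congr_ae (Eventually.of_forall fun u => ?_)
    simp only [coreOp]
    ring
  rw [e1, intervalIntegral.integral_sub i1 i2]
  linarith

theorem Params.isWeakSolutionReac (hp : Params γ κ 0 eN) (hT : 0 ≤ T) (hα : 0 ≤ α) (hα1 : α ≤ 1)
    (hβ : 0 ≤ β) (hβ1 : β ≤ 1) (hg : MemLp g 2 unitMeas) {ρ : ℝ → ℝ → ℝ} (hd : IsDensity T ρ)
    (hρ : ∀ t ∈ Icc 0 T, ρ t =ᵐ[unitMeas] hp.sol α β (hg.toLp g) t) :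
    IsWeakSolutionReac γ α β κ T g ρ := by
  refine ⟨hd, hp.boundaryEnergyFinite hT hρ, fun t ht G hG => ?_⟩
  obtain ⟨-, -, h⟩ := hp.weak_identity hα hα1 hβ hβ1 hg hρ ht hG
  have e1 : ∀ s u, ρ s u * coreOp γ κ 0 (G s) u = κ * (ρ s u * G s u * V₁ γ u) := by
    intro s u
    simp only [coreOp]
    ring
  simp only [e1, intervalIntegral.integral_const_mul] at h
  linarith

theorem Params.exists_density (hp : Params γ κ e eN) (hT : 0 ≤ T)
    (heN : ∀ N, eN N = (N : ℝ) ^ θ) (hα : 0 ≤ α) (hα1 : α ≤ 1) (hβ : 0 ≤ β) (hβ1 : β ≤ 1)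
    (hg : MemLp g 2 unitMeas) (hμ : ∀ N, 2 ≤ N → IsProbabilityMeasure (μ N))
    (hμg : AssociatedTo μ g) {P : ∀ N : ℕ, Measure (SkorohodPath T N)}
    (hP : ∀ N, 2 ≤ N → IsProcessLaw γ α β κ θ T N (μ N) (P N)) :
    ∃ ρ, IsDensity T ρ ∧ ∀ t ∈ Icc 0 T, ρ t =ᵐ[unitMeas] hp.sol α β (hg.toLp g) t := by
  have hmax : ∀ t ∈ Icc 0 T, max t 0 = t := fun t ht => max_eq_left ht.1
  refine ⟨version fun t => hp.sol α β (hg.toLp g) (max t 0),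
    ⟨measurable_version (hp.continuous_sol α β _), fun t _ u _ => version_mem_Icc _ t u⟩,
    fun t ht => ?_⟩
  have h := version_ae_eq (x := fun t => hp.sol α β (hg.toLp g) (max t 0)) (t := t) (by
    rw [hmax t ht]
    exact hp.sol_mem_Icc hT heN hα hα1 hβ hβ1 hg hμ hμg hP ht)
  simp only [hmax t ht] at h
  exact h

theorem params_one (hγ : γ ∈ Ioo (1 : ℝ) 2) (hκ : 0 < κ) : Params γ κ 1 fun _ => 1 :=
  ⟨hγ.1, hγ.2, hκ, zero_le_one, fun _ => le_rfl, fun _ => le_rfl, tendsto_const_nhds⟩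

theorem params_zero (hγ : γ ∈ Ioo (1 : ℝ) 2) (hκ : 0 < κ) (hθ : θ < 0) :
    Params γ κ 0 fun N => (N : ℝ) ^ θ := by
  refine ⟨hγ.1, hγ.2, hκ, le_rfl, fun N => by positivity, fun N => ?_, ?_⟩
  · rcases Nat.eq_zero_or_pos N with h | h
    · subst h
      -- At `N = 0` the convention `0^θ = 0` for `θ ≠ 0` gives the bound.
      simp [Real.zero_rpow hθ.ne]
    · exact Real.rpow_le_one_of_one_le_of_nonpos (by exact_mod_cast h) hθ.le
  · have h := (tendsto_rpow_neg_atTop (neg_pos.2 hθ)).comp tendsto_natCast_atTop_atTop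
    simpa [Function.comp_def] using h

theorem IsCoreSolution.isUniqueSolution (hγ : γ ∈ Ioo (1 : ℝ) 2) (hκ : 0 < κ) (he : 0 ≤ e)
    {S : (ℝ → ℝ → ℝ) → Prop} (hS : ∀ σ, S σ → IsCoreSolution γ α β κ e T g σ) {ρ : ℝ → ℝ → ℝ}
    (hρ : S ρ) : IsUniqueSolution T S ρ := by
  refine ⟨hρ, fun ρ' h' t ht => ?_⟩
  rw [← restrict_Ioo_eq_restrict_Icc]
  exact (hS ρ' h').ae_eq hγ.1 hγ.2 hκ he (hS ρ hρ) t ht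

end Existence

end LongJumpExclusion

end

theorem mainTheorem1
    (γ : ℝ) (hγ : γ ∈ Set.Ioo (1 : ℝ) 2)
    (α β : ℝ) (hα : 0 < α) (hαβ : α ≤ β) (hβ : β < 1)
    (κ : ℝ) (hκ : 0 < κ) (θ : ℝ)
    (T : ℝ) (hT : 0 < T)
    (g : ℝ → ℝ) (hg : Measurable g) (hg01 : ∀ u ∈ Set.Icc (0 : ℝ) 1, g u ∈ Set.Icc (0 : ℝ) 1)
    (μ : ∀ N : ℕ, Measure (Config N)) (hμ : ∀ N, 2 ≤ N → IsProbabilityMeasure (μ N))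
    (hμg : AssociatedTo μ g)
    (P : ∀ N : ℕ, Measure (SkorohodPath T N))
    (hP : ∀ N, 2 ≤ N → IsProcessLaw γ α β κ θ T N (μ N) (P N)) :
    (θ < 0 → ∃ ρ : ℝ → ℝ → ℝ,
      IsUniqueSolution T (IsWeakSolutionReac γ α β κ T g) ρ ∧ ConvergesTo T P ρ) ∧
    (θ = 0 → ∃ ρ : ℝ → ℝ → ℝ,
      IsUniqueSolution T (IsWeakSolutionDir γ α β κ T g) ρ ∧ ConvergesTo T P ρ) := by
  have hgL := memLp_profile hg hg01
  have hα1 : α ≤ 1 := hαβ.trans hβ.le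
  have hβ0 : 0 ≤ β := hα.le.trans hαβ
  constructor
  · intro hθ
    -- Here `e_N = N^θ → 0`: the exchanges vanish in the limit and only the reaction survives.
    have hp := params_zero hγ hκ hθ
    obtain ⟨ρ, hd, hρ⟩ := hp.exists_density hT.le (fun _ => rfl) hα.le hα1 hβ0 hβ.le hgL hμ hμg hP
    exact ⟨ρ, IsCoreSolution.isUniqueSolution hγ hκ le_rfl (fun _ h => h.isCoreSolution)
      (hp.isWeakSolutionReac hT.le hα.le hα1 hβ0 hβ.le hgL hd hρ),
      hp.convergesTo hT.le (fun _ => rfl) hα.le hα1 hβ0 hβ.le hgL hμ hμg hP hρ⟩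
  · intro hθ
    -- Here `N^θ = 1`, so exchanges and reservoirs act on the same scale.
    have hp := params_one hγ hκ
    have heN : ∀ N : ℕ, (1 : ℝ) = (N : ℝ) ^ θ := fun N => by rw [hθ, Real.rpow_zero]
    obtain ⟨ρ, hd, hρ⟩ := hp.exists_density hT.le heN hα.le hα1 hβ0 hβ.le hgL hμ hμg hP
    exact ⟨ρ, IsCoreSolution.isUniqueSolution hγ hκ zero_le_one (fun _ h => h.isCoreSolution hγ.1)
      (hp.isWeakSolutionDir hT.le hα.le hα1 hβ0 hβ.le hgL hd hρ),
      hp.convergesTo hT.le heN hα.le hα1 hβ0 hβ.le hgL hμ hμg hP hρ⟩
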